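/- **Theorem 3.1.** Let $n\ge 1$. Let $\Sigma_n$ be the set of pairs $(y,\eta)\in\mathbb R^{n+1}\times\mathbb R^{n+1}$ with $\langle y,\eta\rangle=0$, $y\neq 0$, $\eta\neq 0$, and let $\Sigma_n^\bullet$ be its quotient by the action $(y,\eta)\mapsto(ty,t^{-1}\eta)$ of $\mathbb R^\times$. Writing $y=(y_*,y_{n+1})$, use on $\Sigma_n^\bullet$ the (almost everywhere defined) coordinates $(y_*,\eta_*)\in\mathbb R^n\times\mathbb R^n$ of the orbit of $(y_*,1;\eta_*,-\langle y_*,\eta_*\rangle)$ and the invariant measure $dy_*\,d\eta_*$, which defines $L^2(\Sigma_n^\bullet)$. On $\Sigma_n$ use the measure $dm=|y_{n+1}|^{-1}dy\,d\eta_*$. A function $\Phi$ on $\Sigma_n^\bullet$ extends to the $\mathbb R^\times$-invariant function $\widetilde\Phi(y,\eta)=\Phi(y_*/y_{n+1},\,y_{n+1}\eta_*)$ on $\Sigma_n$. For a tempered distribution $\mathfrak S$ on $\mathbb R^{n+1}\times\mathbb R^{n+1}$ put $$(\mathcal F_{\rm symp}\mathfrak S)(x,\xi)=\langle \mathfrak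 S,\,(y,\eta)\mapsto e^{2i\pi(\langle x,\eta\rangle-\langle y,\xi\rangle)}\rangle .$$ Then: 1. For every $\Phi\in L^2(\Sigma_n^\bullet)$, $\widetilde\Phi\,dm$ is a tempered distribution. For every $\Phi\in C^\infty(\Sigma_n^\bullet)$ with compact support, $\Phi\in L^2(\Sigma_n^\bullet)$ and $\mathcal F_{\rm symp}(\widetilde\Phi\,dm)$ is a continuous function on the open set $\{x\ne 0,\ \xi\neq 0\}$, so that its restriction to $\Sigma_n$ defines a function $\mathcal H\Phi$ on $\Sigma_n^\bullet$. The set of those $\Phi\in C^\infty(\Sigma_n^\bullet)$ with compact support for which $\mathcal H\Phi\in L^2(\Sigma_n^\bullet)$ is dense in $L^2(\Sigma_n^\bullet)$. 2. The operator $r$ on $L^2(\Sigma_n^\bullet)$ defined, with its maximal domain and in the sense of distributions, by the equation $\langle\xi_*,\partial/\partial\xi_*\rangle=-\frac n2-ir$ is self-adjoint. 3. There is an unbounded self-adjoint operator on $L^2(\Sigma_n^\bullet)$, again denoted by $\mathcal H$ and not defined on the whole space, that extends $\mathcal H$ in the following sense: a function $\Phi\in C^\infty(\Sigma_n^\bullet)$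 with compact support lies in its domain if and only if the function $\mathcal H\Phi$ of part 1 lies in $L^2(\Sigma_n^\bullet)$, and the two meanings of $\mathcal H\Phi$ then agree. It satisfies, with equality of domains and in the sense of the functional calculus of $r$, $$\mathcal H^2=\mathcal H^*\mathcal H=\pi\,\frac{\Gamma(ir)\Gamma(-ir)}{\Gamma(\frac12+ir)\Gamma(\frac12-ir)} .$$ 4. There is a unitary involution $\mathcal K$ of $L^2(\Sigma_n^\bullet)$ such that for $\delta\in\{0,1\}$ and every $\Phi$ in the domain of the operator $\mathcal H$ of part 3 with $\Phi(y_*,-\eta_*)=(-1)^\delta\Phi(y_*,\eta_*)$, the function $\mathcal H\Phi$ lies in the domain of the function of $r$ on the right-hand side below and $$\mathcal K\Phi=(-1)^\delta\,\pi^{-\frac12-2ir}\,\frac{\Gamma(\frac12+ir)}{\Gamma(-ir)}\,\mathcal H\Phi .$$ For every $\Phi\in C^\infty(\Sigma_n^\bullet)$ with compact support, one has, on the open set $\{\langle x,\xi\rangle\neq 0\}$, $$\mathcal F_{\rm symp}(\widetilde{\mathcal K\Phi}\,dm)=\mathrm{Inv}\,(\mathcal F_{\rm symp}(\widetilde\Phi\,dm)),\qquad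 (\mathrm{Inv}\,H)(x,\xi)=|\langle x,\xi\rangle|^{-n}\,H\Big(\frac{x}{\langle x,\xi\rangle},\frac{\xi}{\langle x,\xi\rangle}\Big).$$ -/

import Mathlib

open MeasureTheory
open scoped SchwartzMap ContDiff InnerProductSpace

noncomputable section

/-- `ℝᵏ` with its Euclidean structure and Lebesgue measure. -/
abbrev Eu (k : ℕ) : Type := EuclideanSpace ℝ (Fin k)

/-- The first `n` coordinates `y_*` of `y = (y_*, y_{n+1})`. -/
def starPart {n : ℕ} (y : Eu (n + 1)) : Eu n := WithLp.toLp 2 fun i => y i.castSucc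

/-- The last coordinate `y_{n+1}` of `y = (y_*, y_{n+1})`. -/
def lastCoord {n : ℕ} (y : Eu (n + 1)) : ℝ := y (Fin.last n)

/-- The vector `(v, c)` with first `n` coordinates `v` and last coordinate `c`. -/
def joinLast {n : ℕ} (v : Eu n) (c : ℝ) : Eu (n + 1) :=
  WithLp.toLp 2 (Fin.snoc (α := fun _ => ℝ) (fun i => v i) c)

/-! ### The cone, its quotient, test functions -/

/-- The cone `Σ_n`: pairs `(y, η)` with `⟨y, η⟩ = 0`, `y ≠ 0`, `η ≠ 0`. -/
def SigmaCone (n : ℕ) : Set (Eu (n + 1) × Eu (n + 1)) :=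
  {z | ⟪z.1, z.2⟫_ℝ = 0 ∧ z.1 ≠ 0 ∧ z.2 ≠ 0}

/-- The action `t.(y, η) = (t y, t⁻¹ η)` of `ℝˣ`, by which the quotient `Σ_n^•` is taken. -/
def scaleAct {n : ℕ} (t : ℝ) (z : Eu (n + 1) × Eu (n + 1)) : Eu (n + 1) × Eu (n + 1) :=
  (t • z.1, t⁻¹ • z.2)

/-- `Φ` represents a `C^∞` function with compact support on `Σ_n^• = Σ_n / ℝˣ`: it is a smooth
`ℝˣ`-invariant function on the submanifold `Σ_n`, and it vanishes on `Σ_n` outside the orbits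
of the points of a compact subset of `Σ_n`.  The values of `Φ` off `Σ_n` are irrelevant. -/
structure IsTestFunction {n : ℕ} (Φ : Eu (n + 1) × Eu (n + 1) → ℂ) : Prop where
  smooth : ContDiffOn ℝ ∞ Φ (SigmaCone n)
  invariant : ∀ t : ℝ, t ≠ 0 → ∀ z ∈ SigmaCone n, Φ (scaleAct t z) = Φ z
  compact_support : ∃ C : Set (Eu (n + 1) × Eu (n + 1)), IsCompact C ∧ C ⊆ SigmaCone n ∧
    ∀ z ∈ SigmaCone n, Φ z ≠ 0 → ∃ t : ℝ, t ≠ 0 ∧ scaleAct t z ∈ C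

/-- The point `(y_*, 1; η_*, -⟨y_*, η_*⟩)` whose orbit has the coordinates `(y_*, η_*)` on
`Σ_n^•`.  The coordinates miss only a set of measure zero. -/
def sigmaPoint {n : ℕ} (p : Eu n × Eu n) : Eu (n + 1) × Eu (n + 1) :=
  (joinLast p.1 1, joinLast p.2 (-⟪p.1, p.2⟫_ℝ))

/-- The expression in the coordinates `(y_*, η_*)` of an invariant function on `Σ_n`. -/
def inCoords {n : ℕ} (Φ : Eu (n + 1) × Eu (n + 1) → ℂ) (p : Eu n × Eu n) : ℂ := Φ (sigmaPoint p)

/-- `L²(Σ_n^•)`, for the invariant measure `dm^• = dy_* dη_*`. -/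
abbrev L2Sigma (n : ℕ) : Type := Lp ℂ 2 (volume : Measure (Eu n × Eu n))

/-- The point of the cone with coordinates `(y, η_*)`:
its last coordinate is `η_{n+1} = -⟨y_*, η_*⟩ / y_{n+1}`. -/
def conePoint {n : ℕ} (p : Eu (n + 1) × Eu n) : Eu (n + 1) × Eu (n + 1) :=
  (p.1, joinLast p.2 (-⟪starPart p.1, p.2⟫_ℝ / lastCoord p.1))

lemma measurable_conePoint {n : ℕ} : Measurable (conePoint (n := n)) := by
  have m1 : Measurable fun p : Eu (n + 1) × Eu n => ⟪starPart p.1, p.2⟫_ℝ := by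
    simp only [starPart, PiLp.inner_apply, RCLike.inner_apply, conj_trivial]
    fun_prop
  have m2 : Measurable fun p : Eu (n + 1) × Eu n =>
      -⟪starPart p.1, p.2⟫_ℝ / lastCoord p.1 := by
    unfold lastCoord; fun_prop
  refine measurable_fst.prodMk ?_
  refine (WithLp.measurable_toLp 2 _).comp (measurable_pi_iff.2 fun i => ?_)
  refine Fin.lastCases ?_ (fun j => ?_) i
  · simpa using m2
  · simp; fun_prop

/-- The measure `dm = |y_{n+1}|⁻¹ dy dη_*` on `Σ_n`, as a measure on `ℝ^{n+1} × ℝ^{n+1}`. -/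
def coneMeasure (n : ℕ) : Measure (Eu (n + 1) × Eu (n + 1)) :=
  ((volume : Measure (Eu (n + 1) × Eu n)).withDensity
    fun p => ENNReal.ofReal |lastCoord p.1|⁻¹).map conePoint

/-- The invariant extension `Φ̃(y, η) = Φ(y_* / y_{n+1}, y_{n+1} η_*)`. -/
def tilde {n : ℕ} (u : Eu n × Eu n → ℂ) (z : Eu (n + 1) × Eu (n + 1)) : ℂ :=
  u ((lastCoord z.1)⁻¹ • starPart z.1, lastCoord z.1 • starPart z.2)

/-- The pairing `⟨Φ̃ dm, φ⟩`. -/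
def conePairing {n : ℕ} (u : Eu n × Eu n → ℂ) (φ : Eu (n + 1) × Eu (n + 1) → ℂ) : ℂ :=
  ∫ z, tilde u z * φ z ∂(coneMeasure n)

/-! ### The symplectic Fourier transformation and the operator `𝓗` -/

/-- The kernel `e^{2iπ (⟨x, η⟩ - ⟨y, ξ⟩)}`, at `p = (x, ξ)` and `z = (y, η)`. -/
def sympKernel {n : ℕ} (p z : Eu (n + 1) × Eu (n + 1)) : ℂ :=
  Complex.exp (2 * Complex.I * Real.pi * ((⟪p.1, z.2⟫_ℝ - ⟪z.1, p.2⟫_ℝ : ℝ) : ℂ))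

/-- The distribution `𝓕_symp (Φ̃ dm)`, that is
`(x, ξ) ↦ ⟨Φ̃ dm, (y, η) ↦ e^{2iπ (⟨x, η⟩ - ⟨y, ξ⟩)}⟩`, evaluated on a test function `ψ` of
`(x, ξ)`. -/
def thetaDist {n : ℕ} (u : Eu n × Eu n → ℂ) (ψ : 𝓢(Eu (n + 1) × Eu (n + 1), ℂ)) : ℂ :=
  conePairing u fun z => ∫ p, sympKernel p z * ψ p

/-- The open set `x ≠ 0`, `ξ ≠ 0`, which contains `Σ_n` and the set `⟨x, ξ⟩ ≠ 0`. -/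
def regularSet (n : ℕ) : Set (Eu (n + 1) × Eu (n + 1)) := {z | z.1 ≠ 0 ∧ z.2 ≠ 0}

/-- On the open set `U`, the distribution `𝓕_symp (Φ̃ dm)` is the function `g`. -/
def ThetaEqOn {n : ℕ} (u : Eu n × Eu n → ℂ) (U : Set (Eu (n + 1) × Eu (n + 1)))
    (g : Eu (n + 1) × Eu (n + 1) → ℂ) : Prop :=
  ∀ ψ : 𝓢(Eu (n + 1) × Eu (n + 1), ℂ), HasCompactSupport ψ → tsupport ψ ⊆ U →
    thetaDist u ψ = ∫ z, g z * ψ z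

/-- `g` is the continuous function that `𝓕_symp (Φ̃ dm)` is where `x ≠ 0` and `ξ ≠ 0`. -/
def IsThetaFun {n : ℕ} (u : Eu n × Eu n → ℂ) (g : Eu (n + 1) × Eu (n + 1) → ℂ) : Prop :=
  ContinuousOn g (regularSet n) ∧ ThetaEqOn u (regularSet n) g

/-- `𝓕_symp (Φ̃ dm)` as a function on the set `x ≠ 0`, `ξ ≠ 0` (there, a continuous function is
determined by the distribution).  Its existence is part of the theorem. -/
def thetaFun {n : ℕ} (u : Eu n × Eu n → ℂ) : Eu (n + 1) × Eu (n + 1) → ℂ :=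
  Classical.epsilon (IsThetaFun u)

/-- `𝓗 Φ`: the restriction of `𝓕_symp (Φ̃ dm)` to `Σ_n`, in the coordinates `(x_*, ξ_*)`. -/
def hFun {n : ℕ} (u : Eu n × Eu n → ℂ) : Eu n × Eu n → ℂ := inCoords (thetaFun u)

/-- The inversion `(Inv H)(x, ξ) = |⟨x, ξ⟩|^{-n} H(x / ⟨x, ξ⟩, ξ / ⟨x, ξ⟩)`. -/
def inversion {n : ℕ} (H : Eu (n + 1) × Eu (n + 1) → ℂ) (z : Eu (n + 1) × Eu (n + 1)) : ℂ :=
  (((|⟪z.1, z.2⟫_ℝ| ^ n)⁻¹ : ℝ) : ℂ) * H ((⟪z.1, z.2⟫_ℝ)⁻¹ • z.1, (⟪z.1, z.2⟫_ℝ)⁻¹ • z.2)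

/-! ### The Euler operator and functions of it -/

/-- The Euler operator `⟨ξ_*, ∂/∂ξ_*⟩` on smooth functions. -/
def eulerDeriv {n : ℕ} (χ : Eu n × Eu n → ℂ) (p : Eu n × Eu n) : ℂ := fderiv ℝ χ p (0, p.2)

/-- In the sense of distributions, `⟨ξ_*, ∂/∂ξ_*⟩ Φ = -(n/2) Φ - i Ψ`; the transpose of the
Euler operator is `χ ↦ -(n χ + ⟨ξ_*, ∂/∂ξ_*⟩ χ)`. -/
def WeakEuler {n : ℕ} (Φ Ψ : L2Sigma n) : Prop :=
  ∀ χ : Eu n × Eu n → ℂ, ContDiff ℝ ∞ χ → HasCompactSupport χ →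
    ∫ p, Φ p * (-((n : ℂ) * χ p + eulerDeriv χ p)) =
      ∫ p, (-((n : ℂ) / 2) * Φ p - Complex.I * Ψ p) * χ p

lemma integrable_L2_mul {n : ℕ} (Φ : L2Sigma n) {χ : Eu n × Eu n → ℂ} (hc : Continuous χ)
    (hs : HasCompactSupport χ) : Integrable (fun p => Φ p * χ p) :=
  (Lp.memLp Φ).integrable_mul (hc.memLp_of_hasCompactSupport (p := 2) hs)

lemma continuous_eulerTranspose {n : ℕ} {χ : Eu n × Eu n → ℂ} (h : ContDiff ℝ ∞ χ) :
    Continuous fun p => -((n : ℂ) * χ p + eulerDeriv χ p) := by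
  have h1 : Continuous (fderiv ℝ χ) := h.continuous_fderiv (by simp)
  have h2 := h.continuous
  unfold eulerDeriv
  fun_prop

lemma hasCompactSupport_eulerTranspose {n : ℕ} {χ : Eu n × Eu n → ℂ} (h : HasCompactSupport χ) :
    HasCompactSupport fun p => -((n : ℂ) * χ p + eulerDeriv χ p) := by
  have h1 : HasCompactSupport (fderiv ℝ χ) := h.fderiv ℝ
  refine HasCompactSupport.intro (h.isCompact.union h1.isCompact) fun p hp => ?_
  have a : χ p = 0 := image_eq_zero_of_notMem_tsupport fun hh => hp (Or.inl hh)
  have b : fderiv ℝ χ p = 0 := image_eq_zero_of_notMem_tsupport fun hh => hp (Or.inr hh)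
  simp [eulerDeriv, a, b]

/-- The weak equation, with the two unknown functions separated. -/
lemma weakEuler_iff {n : ℕ} (Φ Ψ : L2Sigma n) : WeakEuler Φ Ψ ↔
    ∀ χ : Eu n × Eu n → ℂ, ContDiff ℝ ∞ χ → HasCompactSupport χ →
      ∫ p, Φ p * (-((n : ℂ) * χ p + eulerDeriv χ p)) =
        -((n : ℂ) / 2) * (∫ p, Φ p * χ p) - Complex.I * (∫ p, Ψ p * χ p) := by
  have key : ∀ χ : Eu n × Eu n → ℂ, ContDiff ℝ ∞ χ → HasCompactSupport χ →
      ∫ p, (-((n : ℂ) / 2) * Φ p - Complex.I * Ψ p) * χ p =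
        -((n : ℂ) / 2) * (∫ p, Φ p * χ p) - Complex.I * (∫ p, Ψ p * χ p) := by
    intro χ h hs
    rw [← integral_const_mul, ← integral_const_mul, ← integral_sub
      ((integrable_L2_mul Φ h.continuous hs).const_mul _)
      ((integrable_L2_mul Ψ h.continuous hs).const_mul _)]
    exact integral_congr_ae (.of_forall fun p => by ring)
  constructor <;> intro H χ h hs
  · rw [H χ h hs, key χ h hs]
  · rw [H χ h hs, key χ h hs]

lemma integral_L2_add {n : ℕ} (Φ Φ' : L2Sigma n) {χ : Eu n × Eu n → ℂ} (hc : Continuous χ)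
    (hs : HasCompactSupport χ) :
    ∫ p, (Φ + Φ' : L2Sigma n) p * χ p = (∫ p, Φ p * χ p) + ∫ p, Φ' p * χ p := by
  rw [← integral_add (integrable_L2_mul Φ hc hs) (integrable_L2_mul Φ' hc hs)]
  refine integral_congr_ae ?_
  filter_upwards [Lp.coeFn_add Φ Φ'] with p hp
  rw [hp, Pi.add_apply]; ring

lemma integral_L2_smul {n : ℕ} (c : ℂ) (Φ : L2Sigma n) (χ : Eu n × Eu n → ℂ) :
    ∫ p, (c • Φ : L2Sigma n) p * χ p = c * ∫ p, Φ p * χ p := by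
  rw [← integral_const_mul]
  refine integral_congr_ae ?_
  filter_upwards [Lp.coeFn_smul c Φ] with p hp
  rw [hp, Pi.smul_apply, smul_eq_mul]; ring

/-- The graph of the operator `r` on `L²(Σ_n^•)` defined by the equation
`⟨ξ_*, ∂/∂ξ_*⟩ = -n/2 - i r`. -/
def eulerGraph (n : ℕ) : Submodule ℂ (L2Sigma n × L2Sigma n) where
  carrier := {q | WeakEuler q.1 q.2}
  add_mem' := by
    rintro ⟨a, b⟩ ⟨a', b'⟩ h h'
    simp only [Set.mem_ofPred_eq, weakEuler_iff, Prod.mk_add_mk] at h h' ⊢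
    intro χ hχ hs
    rw [integral_L2_add _ _ (continuous_eulerTranspose hχ) (hasCompactSupport_eulerTranspose hs),
      integral_L2_add _ _ hχ.continuous hs, integral_L2_add _ _ hχ.continuous hs,
      h χ hχ hs, h' χ hχ hs]
    ring
  zero_mem' := by
    have h0 : ∀ χ : Eu n × Eu n → ℂ, ∫ p, (0 : L2Sigma n) p * χ p = 0 := fun χ => by
      have := integral_L2_smul (n := n) 0 0 χ
      rwa [zero_smul, zero_mul] at this
    simp only [Set.mem_ofPred_eq, weakEuler_iff, Prod.fst_zero, Prod.snd_zero]
    intro χ _ _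
    rw [h0, h0]; ring
  smul_mem' := by
    rintro c ⟨a, b⟩ h
    simp only [Set.mem_ofPred_eq, weakEuler_iff, Prod.smul_mk] at h ⊢
    intro χ hχ hs
    rw [integral_L2_smul, integral_L2_smul, integral_L2_smul, h χ hχ hs]
    ring

/-- The operator `r` on `L²(Σ_n^•)` defined by `⟨ξ_*, ∂/∂ξ_*⟩ = -n/2 - i r`, with its maximal
domain: the `Φ ∈ L²` for which `⟨ξ_*, ∂/∂ξ_*⟩ Φ`, a distribution, lies in `L²`. -/
def eulerOp (n : ℕ) : L2Sigma n →ₗ.[ℂ] L2Sigma n := (eulerGraph n).toLinearPMap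

/-- `r Φ = Ψ` means exactly that the weak equation holds. -/
lemma mem_eulerOp_graph {n : ℕ} (Φ Ψ : L2Sigma n) :
    (Φ, Ψ) ∈ (eulerOp n).graph ↔ WeakEuler Φ Ψ := by
  rw [eulerOp, Submodule.toLinearPMap_graph_eq]
  · rfl
  rintro ⟨a, b⟩ h (h0 : a = 0)
  subst h0
  have h' := (weakEuler_iff 0 b).1 h
  have z : ∀ χ : Eu n × Eu n → ℂ, ∫ p, (0 : L2Sigma n) p * χ p = 0 := fun χ => by
    have := integral_L2_smul (n := n) 0 0 χ
    rwa [zero_smul, zero_mul] at this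
  refine (Lp.eq_zero_iff_ae_eq_zero).2 ?_
  refine ae_eq_zero_of_integral_contDiff_smul_eq_zero
    ((Lp.memLp b).locallyIntegrable (by norm_num)) fun g hg hgs => ?_
  have hc : ContDiff ℝ ∞ fun p => (g p : ℂ) := Complex.ofRealCLM.contDiff.comp hg
  have hs : HasCompactSupport fun p => (g p : ℂ) := hgs.comp_left Complex.ofReal_zero
  have e := h' _ hc hs
  rw [z, z] at e
  have e' : ∫ p, b p * (g p : ℂ) = 0 := by simpa using e.symm
  rw [← e']
  exact integral_congr_ae (.of_forall fun p => by simp [mul_comm])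

/-- `T = f(A)`, for a self-adjoint operator `A` and a Borel function `f` on the real line, in the
sense of the spectral theorem: some unitary map onto an `L²` space transforms `A` into the
multiplication by a real function `a` (with its maximal domain), and `T` into the multiplication
by `f ∘ a` (with its maximal domain). -/
def IsFunctionOf {𝓗 : Type*} [NormedAddCommGroup 𝓗] [InnerProductSpace ℂ 𝓗]
    (A : 𝓗 →ₗ.[ℂ] 𝓗) (f : ℝ → ℂ) (T : 𝓗 →ₗ.[ℂ] 𝓗) : Prop :=
  ∃ (X : Type) (_ : MeasurableSpace X) (μ : Measure X) (a : X → ℝ) (V : 𝓗 ≃ₗᵢ[ℂ] Lp ℂ 2 μ),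
    SigmaFinite μ ∧ Measurable a ∧
    (∀ u v, (u, v) ∈ A.graph ↔ V v =ᵐ[μ] fun x => (a x : ℂ) * V u x) ∧
    (∀ u v, (u, v) ∈ T.graph ↔ V v =ᵐ[μ] fun x => f (a x) * V u x)

/-- The composition `S T` of unbounded operators, with domain `{u ∈ D(T) : T u ∈ D(S)}`. -/
def opComp {𝓗 : Type*} [AddCommGroup 𝓗] [Module ℂ 𝓗] (S T : 𝓗 →ₗ.[ℂ] 𝓗) : 𝓗 →ₗ.[ℂ] 𝓗 where
  domain := (S.domain.comap T.toFun).map T.domain.subtype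
  toFun :=
    { toFun := fun u => S ⟨T ⟨u, by
          obtain ⟨w, -, hw⟩ := u.2; rw [← hw]; exact w.2⟩, by
          obtain ⟨_, w, hw, rfl⟩ := u; exact hw⟩
      map_add' := fun u v => by
        rw [← LinearPMap.map_add]; congr 1; ext1
        simp only [Submodule.coe_add]; rw [← LinearPMap.map_add]; rfl
      map_smul' := fun c u => by
        rw [RingHom.id_apply, ← LinearPMap.map_smul]; congr 1; ext1
        simp only [Submodule.coe_smul]; rw [← LinearPMap.map_smul]; rfl }

lemma mem_opComp_graph {𝓗 : Type*} [AddCommGroup 𝓗] [Module ℂ 𝓗] (S T : 𝓗 →ₗ.[ℂ] 𝓗) (u w : 𝓗) :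
    (u, w) ∈ (opComp S T).graph ↔ ∃ v, (u, v) ∈ T.graph ∧ (v, w) ∈ S.graph := by
  simp only [LinearPMap.mem_graph_iff]
  constructor
  · rintro ⟨⟨_, x, hx, rfl⟩, rfl, rfl⟩
    exact ⟨T x, ⟨x, rfl, rfl⟩, ⟨T x, hx⟩, rfl, rfl⟩
  · rintro ⟨_, ⟨x, rfl, rfl⟩, y, hy, rfl⟩
    refine ⟨⟨x, x, ?_, rfl⟩, rfl, ?_⟩
    · change T x ∈ S.domain
      rw [← hy]; exact y.2
    · change S ⟨T ⟨x, _⟩, _⟩ = S y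
      congr 1; ext1; exact hy.symm

/-- The function `π Γ(iλ) Γ(-iλ) / (Γ(1/2 + iλ) Γ(1/2 - iλ))` (for `λ ≠ 0`). -/
def squareSymbol (l : ℝ) : ℂ :=
  Real.pi * (Complex.Gamma (Complex.I * l) * Complex.Gamma (-(Complex.I * l))) /
    (Complex.Gamma (1 / 2 + Complex.I * l) * Complex.Gamma (1 / 2 - Complex.I * l))

/-- The function `π^{-1/2 - 2iλ} Γ(1/2 + iλ) / Γ(-iλ)`, which vanishes at `λ = 0`. -/
def normalizingSymbol (l : ℝ) : ℂ :=
  (Real.pi : ℂ) ^ (-(1 / 2 : ℂ) - 2 * Complex.I * l) *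
    (Complex.Gamma (1 / 2 + Complex.I * l) / Complex.Gamma (-(Complex.I * l)))

/-- `Φ` has, with respect to `η_*`, the parity associated with `δ`. -/
def HasParity {n : ℕ} (δ : Fin 2) (Φ : L2Sigma n) : Prop :=
  ∀ᵐ p : Eu n × Eu n, Φ (p.1, -p.2) = (-1 : ℂ) ^ (δ : ℕ) * Φ p

end

/-!
The generator `r` of the dilations `(y_*, η_*) ↦ (y_*, e^s η_*)` can be diagonalized: the
symplectic Fourier transformation on the chart, which turns these dilations into their inverses,
then coordinates adapted to the rays through the origin, then a one-dimensional Fourier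
transformation along the rays, make up a unitary map `spectralU` under which `r` is multiplication
by `freq` (`eulerOp_eq_mulOp`). There `𝓗` and `𝓚` can be written down. With `oppo` the map that
changes the sign of `freq` and passes to the opposite ray, `hOp` is multiplication by
`gammaSymbol freq` after composition with `oppo`, and `kOp` is composition with the change of sign
of `freq` alone. Self-adjointness, the formula for `𝓗²` and the relation between `𝓗` and `𝓚` are
then statements on functions of one variable (`isSelfAdjoint_mulOp`, `opComp_hOp`,
`isFunctionOf_hOp_sq`, `exists_normOp_of_parity`).

The other half identifies `hOp` with the operator given by the geometry. On the cone,
`𝓕_symp (Φ̃ dm)` is an integral over the scale `t = ± e^s` and over the chart. The integral over `s`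
converges only conditionally, but it is bounded by a singular kernel (`kerBound`) which is integrable
against rapidly decaying functions; so the truncations converge locally uniformly, to the continuous
function `thetaLim` that represents the distribution (`thetaEqOn_thetaLim`). Testing its restriction
to a slice `⟨x, ξ⟩ = h` against `a ⊗ b` and applying Fubini's theorem gives an absolutely
convergent integral over scales and chart (`integral_thetaLim_offCone`). On the cone, `h = 0`, this is
in ray coordinates a convolution along the rays, whose multiplier is a Gamma factor
(`integral_chr_mul_charFun`). The multiplier has a pole at `freq = 0`, which is cancelled for the
vectors `(U - 1) (a ⊗ b)`, with `U` a dilation: there `thetaLim` and `hOp` agree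
(`thetaLim_ae_eq_hOp`). No nonzero locally square integrable function is orthogonal to all these
vectors (`ae_eq_zero_of_stepDilate_test`), and the kernel of the integral operator is symmetric.
So the two operators agree on all test functions, domains included
(`IsTestFunction.mem_hOp_domain_iff`), and the test functions in the domain are dense.

For the inversion formula let the transform of `Φ` have compact support in `⟨ζ, z⟩ ≠ 0`; such `Φ`
are total. On transforms, `𝓚` is `rayInvert`, so that in the integral over scales the substitution
`s ↦ log |⟨ζ, z⟩| - s` carries the slice `h` to the slice `h⁻¹` (`thetaLim_offCone_eq`). As
`thetaLim` is invariant under `ℝˣ`, this is the inversion (`thetaLim_rayInvert`), and both sides are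
continuous in `Φ` (`exists_thetaCLM`).
-/

open Filter Topology
open scoped FourierTransform Real ComplexConjugate
open Real (abs_exp cosh enorm_eq_ofReal_abs exp exp_add exp_le_exp exp_log exp_mul exp_nat_mul
  exp_ne_zero exp_neg exp_pos fourier_eq' log norm_eq_abs norm_of_nonneg pi_ne_zero pi_pos rpow_add
  rpow_natCast rpow_neg sinh sq_sqrt sqrt)
open ENNReal (add_lt_top add_ne_top mul_eq_top mul_lt_top mul_ne_top mul_rpow_of_ne_top
  mul_rpow_of_nonneg mul_top ofReal ofReal_eq_zero ofReal_le_ofReal ofReal_lt_top ofReal_mul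
  ofReal_ne_top ofReal_one ofReal_pow ofReal_rpow_of_pos one_le_ofReal one_rpow rpow_le_rpow
  rpow_mul rpow_ne_top_of_nonneg rpow_two tendsto_ofReal zero_rpow_of_neg)
open Complex (Gamma I I_ne_zero I_sq add_re arg conj_I conj_conj conj_ofReal continuous_conj cos
  cpow_add cpow_def_of_ne_zero exp_conj im measurable_ofReal norm_I norm_exp norm_real ofRealCLM
  ofReal_inj ofReal_ne_zero ofReal_zero real_smul sin sub_re)
open MeasureTheory.Measure (quasiMeasurePreserving_fst quasiMeasurePreserving_snd volume_eq_prod)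
open Set (indicator_of_mem indicator_of_notMem)
open RCLike (inner_apply norm_conj)
set_option linter.unusedSectionVars false

noncomputable section

local notation "cexp" => Complex.exp
local notation "⟪" x "," y "⟫" => inner ℝ x y
local notation:max "Eu²" k:max => Eu k × Eu k
local notation:max "Chart" k:max => Eu (k + 1) × Eu (k + 1)
local notation:max "Phase" k:max => Eu (k + 2) × Eu (k + 2)
local notation "ε₀" => (1 / 16 : ℝ)


/-! ### Unitary maps, tensor products and multiplication operators on `L²` -/

section Integrals

variable {X : Type*} [MeasurableSpace X] {μ : Measure X}

lemma integral_ext {E : Type*} [NormedAddCommGroup E] [NormedSpace ℝ E] {f g : X → E}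
    (h : ∀ x, f x = g x) : ∫ x, f x ∂μ = ∫ x, g x ∂μ := congrArg (integral μ) (funext h)

lemma integral_ext_ae {E : Type*} [NormedAddCommGroup E] [NormedSpace ℝ E] {f g : X → E}
    {p : X → Prop} (hp : ∀ᵐ x ∂μ, p x) (h : ∀ x, p x → f x = g x) :
    ∫ x, f x ∂μ = ∫ x, g x ∂μ := integral_congr_ae (hp.mono h)

lemma inner_eq_integral {F G : Lp ℂ 2 μ} {f g : X → ℂ} (hf : F =ᵐ[μ] f) (hg : G =ᵐ[μ] g) :
    ⟪F, G⟫_ℂ = ∫ x, g x * conj (f x) ∂μ := by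
  rw [L2.inner_def]
  exact integral_ext_ae (hf.and hg) fun x h => by rw [h.1, h.2, inner_apply]

lemma integrable_mul_conj_of_ae_eq {F G : Lp ℂ 2 μ} {f g : X → ℂ} (hf : F =ᵐ[μ] f)
    (hg : G =ᵐ[μ] g) : Integrable (fun x => g x * conj (f x)) μ :=
  (L2.integrable_inner (𝕜 := ℂ) F G).congr ((hf.and hg).mono fun x h => by
    simp only [h.1, h.2, inner_apply])

end Integrals

section Hilbert

variable {E E' : Type*} [NormedAddCommGroup E] [InnerProductSpace ℂ E] [CompleteSpace E]
  [NormedAddCommGroup E'] [InnerProductSpace ℂ E'] [CompleteSpace E']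

/-- The family `v` is total: only the zero vector is orthogonal to all its members. -/
def TotalFam {ι E : Type*} [NormedAddCommGroup E] [InnerProductSpace ℂ E] (v : ι → E) : Prop :=
  ∀ G, (∀ i, ⟪v i, G⟫_ℂ = 0) → G = 0

lemma TotalFam.dense {ι : Type*} {v : ι → E} (hv : TotalFam v) :
    Dense (Submodule.span ℂ (Set.range v) : Set E) := by
  rw [Submodule.dense_iff_topologicalClosure_eq_top, Submodule.topologicalClosure_eq_top_iff,
    Submodule.eq_bot_iff]
  exact fun G hG => hv G fun i => (Submodule.mem_orthogonal _ _).1 hG _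
    (Submodule.subset_span ⟨i, rfl⟩)

/-- A continuous linear functional that vanishes on a total family vanishes. -/
lemma TotalFam.eq_zero {ι : Type*} {v : ι → E} (hv : TotalFam v) (L : E →L[ℂ] ℂ)
    (hL : ∀ i, L (v i) = 0) (x : E) : L x = 0 := by
  have h2 : L = 0 := ContinuousLinearMap.ext_on hv.dense
    fun y hy => by obtain ⟨i, rfl⟩ := hy; simpa using hL i
  simp [h2]

lemma TotalFam.denseRange {ι : Type*} {v : ι → E} (hv : TotalFam v) :
    DenseRange (Finsupp.linearCombination ℂ v) := by
  have := hv.dense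
  rwa [← Finsupp.range_linearCombination] at this

/-- Two total families with the same Gram matrix are exchanged by a unitary map. -/
theorem exists_unitary_of_inner_eq {ι : Type*} (v : ι → E) (w : ι → E') (hv : TotalFam v)
    (hw : TotalFam w) (h : ∀ i j, ⟪v i, v j⟫_ℂ = ⟪w i, w j⟫_ℂ) :
    ∃ U : E ≃ₗᵢ[ℂ] E', ∀ i, U (v i) = w i := by
  have hn : ∀ x : ι →₀ ℂ, ‖Finsupp.linearCombination ℂ w x‖ = ‖Finsupp.linearCombination ℂ v x‖ := by
    intro x
    rw [norm_eq_sqrt_re_inner (𝕜 := ℂ), norm_eq_sqrt_re_inner (𝕜 := ℂ)]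
    simp only [Finsupp.linearCombination_apply, Finsupp.sum_inner, Finsupp.inner_sum,
      inner_smul_left, inner_smul_right, h]
  refine ⟨(LinearEquiv.refl ℂ (ι →₀ ℂ)).extendOfIsometry (Finsupp.linearCombination ℂ v)
    (Finsupp.linearCombination ℂ w) hv.denseRange hw.denseRange hn, fun i => ?_⟩
  simpa using LinearEquiv.extendOfIsometry_eq (LinearEquiv.refl ℂ (ι →₀ ℂ)) _ _ hv.denseRange
    hw.denseRange hn (Finsupp.single i 1)

end Hilbert

section Tensor

variable {α β : Type*} [MeasurableSpace α] [MeasurableSpace β] {μ : Measure α} {ν : Measure β}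

lemma ae_prod_fst {p : α → Prop} (h : ∀ᵐ x ∂μ, p x) : ∀ᵐ z ∂(μ.prod ν), p z.1 :=
  quasiMeasurePreserving_fst.ae h

lemma ae_prod_snd {p : β → Prop} (h : ∀ᵐ y ∂ν, p y) : ∀ᵐ z ∂(μ.prod ν), p z.2 :=
  quasiMeasurePreserving_snd.ae h

lemma memLp_tensor {f : α → ℂ} {g : β → ℂ} (hf : MemLp f 2 μ) (hg : MemLp g 2 ν) :
    MemLp (fun p : α × β => f p.1 * g p.2) 2 (μ.prod ν) := by
  refine (memLp_two_iff_integrable_sq_norm ((hf.1.comp_fst (ν := ν)).mul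
    (hg.1.comp_snd (μ := μ)))).2 ((((memLp_two_iff_integrable_sq_norm hf.1).1 hf).mul_prod
      ((memLp_two_iff_integrable_sq_norm hg.1).1 hg)).congr (.of_forall fun p => ?_))
  simp [mul_pow]

/-- The function `f(a) g(b)` in `L²` of a product space. -/
def tensor (f : Lp ℂ 2 μ) (g : Lp ℂ 2 ν) : Lp ℂ 2 (μ.prod ν) :=
  (memLp_tensor (Lp.memLp f) (Lp.memLp g)).toLp

lemma coeFn_tensor (f : Lp ℂ 2 μ) (g : Lp ℂ 2 ν) :
    tensor f g =ᵐ[μ.prod ν] fun p => f p.1 * g p.2 := MemLp.coeFn_toLp _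

lemma tensor_ae_eq {F : Lp ℂ 2 μ} {G : Lp ℂ 2 ν} {f : α → ℂ} {g : β → ℂ} (hf : F =ᵐ[μ] f)
    (hg : G =ᵐ[ν] g) : tensor F G =ᵐ[μ.prod ν] fun p => f p.1 * g p.2 := by
  filter_upwards [coeFn_tensor F G, ae_prod_fst hf, ae_prod_snd hg] with p a b c
  rw [a, b, c]

variable [SigmaFinite μ] [SigmaFinite ν]

lemma inner_tensor (f f' : Lp ℂ 2 μ) (g g' : Lp ℂ 2 ν) :
    ⟪tensor f g, tensor f' g'⟫_ℂ = ⟪f, f'⟫_ℂ * ⟪g, g'⟫_ℂ := by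
  rw [inner_eq_integral (coeFn_tensor f g) (coeFn_tensor f' g'), L2.inner_def, L2.inner_def,
    ← integral_prod_mul]
  refine integral_ext fun p => ?_
  simp only [inner_apply, map_mul]; ring

/-- `tensor` as a continuous bilinear map. -/
def tensorL : Lp ℂ 2 μ →L[ℂ] Lp ℂ 2 ν →L[ℂ] Lp ℂ 2 (μ.prod ν) := by
  refine LinearMap.mkContinuous₂ (LinearMap.mk₂ ℂ tensor ?_ ?_ ?_ ?_) 1 fun f g => ?_
  iterate 4
    intros
    refine sub_eq_zero.1 ((inner_self_eq_zero (𝕜 := ℂ)).1 ?_)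
    simp only [inner_sub_left, inner_sub_right, inner_add_left, inner_add_right, inner_smul_left,
      inner_smul_right, inner_tensor]
    ring
  rw [one_mul, LinearMap.mk₂_apply, norm_eq_sqrt_re_inner (𝕜 := ℂ), inner_tensor,
    inner_self_eq_norm_sq_to_K, inner_self_eq_norm_sq_to_K, ← mul_pow]
  refine le_of_eq ?_
  norm_cast
  exact Real.sqrt_sq (by positivity)

lemma tensor_total : TotalFam fun f : Lp ℂ 2 μ × Lp ℂ 2 ν => tensor f.1 f.2 := by
  intro G h
  have key : ∀ k : ℕ, G =ᵐ[(μ.prod ν).restrict (spanningSets μ k ×ˢ spanningSets ν k)] 0 := by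
    intro k
    set A := spanningSets μ k
    set B := spanningSets ν k
    have : IsFiniteMeasure ((μ.prod ν).restrict (A ×ˢ B)) := ⟨by
      rw [Measure.restrict_apply_univ, Measure.prod_prod]
      exact mul_lt_top (measure_spanningSets_lt_top μ k) (measure_spanningSets_lt_top ν k)⟩
    have iS : Integrable G ((μ.prod ν).restrict (A ×ˢ B)) :=
      ((Lp.memLp G).restrict _).integrable (by norm_num)
    have rect : ∀ a b, MeasurableSet a → MeasurableSet b →
        ∫ x in a ×ˢ b, G x ∂((μ.prod ν).restrict (A ×ˢ B)) = 0 := by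
      intro a b ha hb
      have fa := (measure_mono Set.inter_subset_right |>.trans_lt (measure_spanningSets_lt_top μ k) :
        μ (a ∩ A) < _).ne
      have fb := (measure_mono Set.inter_subset_right |>.trans_lt (measure_spanningSets_lt_top ν k) :
        ν (b ∩ B) < _).ne
      have ma : MeasurableSet (a ∩ A) := ha.inter (measurableSet_spanningSets μ k)
      have mb : MeasurableSet (b ∩ B) := hb.inter (measurableSet_spanningSets ν k)
      rw [Measure.restrict_restrict (ha.prod hb), Set.prod_inter_prod,
        ← integral_indicator (ma.prod mb), ← h (indicatorConstLp 2 ma fa 1, indicatorConstLp 2 mb fb 1),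
        inner_eq_integral (tensor_ae_eq indicatorConstLp_coeFn indicatorConstLp_coeFn) .rfl]
      refine integral_ext fun p => ?_
      by_cases ha : p.1 ∈ a ∩ A <;> by_cases hb : p.2 ∈ b ∩ B <;>
        simp [Set.indicator, ha, hb, Set.mem_prod]
    refine iS.ae_eq_of_withDensityᵥ_eq (integrable_zero _ _ _) (VectorMeasure.ext_of_generateFrom _
      ?_ generateFrom_prod.symm isPiSystem_prod ?_)
    · rintro _ ⟨a, ha, b, hb, rfl⟩
      simp [withDensityᵥ_apply iS (MeasurableSet.prod ha hb), rect a b ha hb]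
    · have := rect Set.univ Set.univ .univ .univ
      rw [Set.univ_prod_univ] at this
      rw [withDensityᵥ_apply iS .univ, this, withDensityᵥ_zero]; rfl
  have hU : (⋃ k, spanningSets μ k ×ˢ spanningSets ν k) = Set.univ :=
    Set.eq_univ_of_forall fun p => Set.mem_iUnion.2
      ⟨max (spanningSetsIndex μ p.1) (spanningSetsIndex ν p.2),
        monotone_spanningSets μ (le_max_left _ _) (mem_spanningSetsIndex μ p.1),
        monotone_spanningSets ν (le_max_right _ _) (mem_spanningSetsIndex ν p.2)⟩
  have := (ae_restrict_iUnion_iff _ fun p => G p = 0).2 key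
  rw [hU, Measure.restrict_univ] at this
  exact Lp.eq_zero_iff_ae_eq_zero.2 this

/-- Tensors of vectors taken from two total families are total. -/
lemma tensor_total_of_total {ι κ : Type*} {v : ι → Lp ℂ 2 μ} {w : κ → Lp ℂ 2 ν} (hv : TotalFam v)
    (hw : TotalFam w) : TotalFam fun i : ι × κ => tensor (v i.1) (w i.2) := by
  refine fun G h => tensor_total G fun f => ?_
  have s1 : ∀ i g, ⟪G, tensor (v i) g⟫_ℂ = 0 := fun i g =>
    hw.eq_zero ((innerSL ℂ G).comp (tensorL (v i))) (fun j =>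
      inner_eq_zero_symm.1 (h (i, j))) g
  exact inner_eq_zero_symm.1 (hv.eq_zero ((innerSL ℂ G).comp (tensorL.flip f.2))
    (fun i => s1 i f.2) f.1)

end Tensor

section BoundedMul

variable {X : Type*} [MeasurableSpace X] {μ : Measure X}

lemma memLp_bounded_mul {k : X → ℂ} (hk : Measurable k) {C : ℝ} (hC : ∀ x, ‖k x‖ ≤ C)
    (f : Lp ℂ 2 μ) : MemLp (fun x => k x * f x) 2 μ :=
  (Lp.memLp f).of_le_mul (hk.aestronglyMeasurable.mul (Lp.aestronglyMeasurable f))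
    (.of_forall fun x => by rw [norm_mul]; gcongr; exact hC x)

variable {E : Type*} [NormedAddCommGroup E] [InnerProductSpace ℂ E]

/-- The graph of the operator that two unitary maps `V`, `V'` onto an `L²` space transform into
the multiplication by `m`, with its maximal domain. -/
def mulGraph (V V' : E ≃ₗᵢ[ℂ] Lp ℂ 2 μ) (m : X → ℂ) : Submodule ℂ (E × E) where
  carrier := {q | V q.2 =ᵐ[μ] fun x => m x * V' q.1 x}
  add_mem' := by
    rintro ⟨a, b⟩ ⟨a', b'⟩ h h'
    simp only [Set.mem_ofPred_eq, Prod.mk_add_mk, map_add] at h h' ⊢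
    filter_upwards [h, h', Lp.coeFn_add (V b) (V b'), Lp.coeFn_add (V' a) (V' a')] with x h1 h2 h3 h4
    rw [h3, h4, Pi.add_apply, Pi.add_apply, h1, h2]; ring
  zero_mem' := by
    simp only [Set.mem_ofPred_eq, Prod.fst_zero, Prod.snd_zero, map_zero]
    filter_upwards [Lp.coeFn_zero ℂ 2 μ] with x h
    rw [h]; simp
  smul_mem' := by
    rintro c ⟨a, b⟩ h
    simp only [Set.mem_ofPred_eq, Prod.smul_mk, map_smul] at h ⊢
    filter_upwards [h, Lp.coeFn_smul c (V b), Lp.coeFn_smul c (V' a)] with x h1 h3 h4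
    rw [h3, h4, Pi.smul_apply, Pi.smul_apply, h1, smul_eq_mul, smul_eq_mul]; ring

/-- The operator with graph `mulGraph V V' m`. -/
def mulOp (V V' : E ≃ₗᵢ[ℂ] Lp ℂ 2 μ) (m : X → ℂ) : E →ₗ.[ℂ] E := (mulGraph V V' m).toLinearPMap

lemma mem_mulOp_graph (V V' : E ≃ₗᵢ[ℂ] Lp ℂ 2 μ) (m : X → ℂ) (u v : E) :
    (u, v) ∈ (mulOp V V' m).graph ↔ V v =ᵐ[μ] fun x => m x * V' u x := by
  rw [mulOp, Submodule.toLinearPMap_graph_eq]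
  · rfl
  rintro ⟨_, b⟩ (h : V b =ᵐ[μ] _) rfl
  refine V.map_eq_zero_iff.1 (Lp.eq_zero_iff_ae_eq_zero.2 ?_)
  filter_upwards [h, Lp.coeFn_zero ℂ 2 μ] with x h1 h2
  rw [h1, map_zero, h2]; simp

lemma mem_mulOp_domain {V V' : E ≃ₗᵢ[ℂ] Lp ℂ 2 μ} {m : X → ℂ} {u : E} :
    u ∈ (mulOp V V' m).domain ↔ MemLp (fun x => m x * V' u x) 2 μ := by
  rw [LinearPMap.mem_domain_iff]
  refine ⟨fun ⟨v, hv⟩ => (memLp_congr_ae ((mem_mulOp_graph _ _ _ _ _).1 hv)).1 (Lp.memLp _),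
    fun h => ⟨V.symm h.toLp, (mem_mulOp_graph _ _ _ _ _).2 ?_⟩⟩
  rw [V.apply_symm_apply]; exact h.coeFn_toLp

variable [CompleteSpace E]

/-- A bounded factor without zeros which makes the multiplier `m` bounded. -/
def damp (m : X → ℂ) (x : X) : ℂ := ((1 + ‖m x‖)⁻¹ : ℝ)

lemma damp_ne_zero (m : X → ℂ) (x : X) : damp m x ≠ 0 :=
  ofReal_ne_zero.2 (inv_ne_zero (by positivity))

lemma memLp_damp {m : X → ℂ} (hm : Measurable m) (f : Lp ℂ 2 μ) :
    MemLp (fun x => damp m x * f x) 2 μ := by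
  refine memLp_bounded_mul (by unfold damp; fun_prop) (C := 1) (fun x => ?_) f
  rw [damp, norm_real, norm_of_nonneg (by positivity)]
  exact inv_le_one_of_one_le₀ (by simp)

lemma memLp_mul_damp {m : X → ℂ} (hm : Measurable m) (f : Lp ℂ 2 μ) :
    MemLp (fun x => m x * damp m x * f x) 2 μ := by
  refine memLp_bounded_mul (by unfold damp; fun_prop) (C := 1) (fun x => ?_) f
  rw [damp, norm_mul, norm_real, norm_of_nonneg (by positivity), ← div_eq_mul_inv]
  exact div_le_one_of_le₀ (by simp) (by positivity)

lemma damp_mem_graph (V V' : E ≃ₗᵢ[ℂ] Lp ℂ 2 μ) {m : X → ℂ} (hm : Measurable m) (f : Lp ℂ 2 μ) :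
    (V'.symm (memLp_damp hm f).toLp, V.symm (memLp_mul_damp hm f).toLp) ∈ (mulOp V V' m).graph := by
  rw [mem_mulOp_graph, V.apply_symm_apply, V'.apply_symm_apply]
  filter_upwards [(memLp_damp hm f).coeFn_toLp, (memLp_mul_damp hm f).coeFn_toLp] with x h1 h2
  rw [h1, h2, mul_assoc]

lemma dense_mulOp_domain (V V' : E ≃ₗᵢ[ℂ] Lp ℂ 2 μ) {m : X → ℂ} (hm : Measurable m) :
    Dense ((mulOp V V' m).domain : Set E) := by
  rw [Submodule.dense_iff_topologicalClosure_eq_top, Submodule.topologicalClosure_eq_top_iff,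
    Submodule.eq_bot_iff]
  intro z hz
  have key : (memLp_damp hm (V' z)).toLp = 0 := ext_inner_left ℂ fun t => by
    have h0 := (Submodule.mem_orthogonal _ _).1 hz _ (LinearPMap.mem_domain_of_mem_graph
      (damp_mem_graph V V' hm t))
    rw [← V'.inner_map_map, V'.apply_symm_apply] at h0
    rw [inner_zero_right, ← h0, inner_eq_integral .rfl (MemLp.coeFn_toLp _),
      inner_eq_integral (MemLp.coeFn_toLp _) .rfl]
    refine integral_ext fun x => ?_
    simp only [damp, map_mul, conj_ofReal]; ring
  refine V'.map_eq_zero_iff.1 (Lp.eq_zero_iff_ae_eq_zero.2 ?_)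
  filter_upwards [(memLp_damp hm (V' z)).coeFn_toLp, Lp.eq_zero_iff_ae_eq_zero.1 key] with x h1 h2
  exact (mul_eq_zero.1 (h1.symm.trans h2)).resolve_left (damp_ne_zero m x)

/-- The operator with graph `V v = m V' u` is self-adjoint, provided that its graph is also
described by the adjoint relation `V' v = m̄ V u`. -/
theorem isSelfAdjoint_mulOp (V V' : E ≃ₗᵢ[ℂ] Lp ℂ 2 μ) {m : X → ℂ} (hm : Measurable m)
    (hsym : ∀ u v : E, (V v =ᵐ[μ] fun x => m x * V' u x) ↔
      V' v =ᵐ[μ] fun x => conj (m x) * V u x) : IsSelfAdjoint (mulOp V V' m) := by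
  rw [LinearPMap.isSelfAdjoint_def]
  refine LinearPMap.eq_of_eq_graph ?_
  rw [LinearPMap.adjoint_graph_eq_graph_adjoint (dense_mulOp_domain V V' hm)]
  ext ⟨u, v⟩
  rw [Submodule.mem_adjoint_iff, mem_mulOp_graph, hsym]
  constructor
  · intro h
    have hc : Measurable fun x => conj (m x) := continuous_conj.measurable.comp hm
    have i2 := memLp_mul_damp hc (V u)
    have key : (memLp_damp hm (V' v)).toLp = i2.toLp := ext_inner_left ℂ fun t => by
      have h0 := h _ _ (damp_mem_graph V V' hm t)
      rw [sub_eq_zero, ← V.inner_map_map, ← V'.inner_map_map, V.apply_symm_apply,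
        V'.apply_symm_apply, inner_eq_integral (MemLp.coeFn_toLp _) .rfl,
        inner_eq_integral (MemLp.coeFn_toLp _) .rfl] at h0
      rw [inner_eq_integral .rfl (MemLp.coeFn_toLp _), inner_eq_integral .rfl i2.coeFn_toLp]
      refine .trans ?_ (h0.symm.trans ?_) <;>
      · refine integral_ext fun x => ?_
        simp only [damp, map_mul, conj_ofReal, norm_conj]; ring
    filter_upwards [(memLp_damp hm (V' v)).coeFn_toLp, i2.coeFn_toLp,
      (MemLp.toLp_eq_toLp_iff _ _).1 key] with x h1 h2 h3
    refine mul_left_cancel₀ (damp_ne_zero m x) (h3.trans ?_)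
    simp only [damp, norm_conj]; ring
  · intro h a b hab
    rw [mem_mulOp_graph] at hab
    rw [sub_eq_zero, ← V.inner_map_map, ← V'.inner_map_map, inner_eq_integral hab .rfl,
      inner_eq_integral .rfl h]
    refine integral_ext fun x => ?_
    rw [map_mul]; ring

end BoundedMul

/-! ### Testing against tensors of smooth functions -/

section Tests

variable {E : Type*} [NormedAddCommGroup E] [InnerProductSpace ℝ E] [FiniteDimensional ℝ E]
  [MeasurableSpace E] [BorelSpace E]

lemma memLp_ofReal_of_hasCompactSupport {a : E → ℝ} (ha : ContDiff ℝ ∞ a) (ha' : HasCompactSupport a) :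
    MemLp (fun x => (a x : ℂ)) 2 (volume : Measure E) :=
  (Complex.continuous_ofReal.comp ha.continuous).memLp_of_hasCompactSupport
    (ha'.comp_left ofReal_zero)

/-- The real test functions, as vectors of `L²`. -/
def testVec (a : {a : E → ℝ // ContDiff ℝ ∞ a ∧ HasCompactSupport a}) :
    Lp ℂ 2 (volume : Measure E) := (memLp_ofReal_of_hasCompactSupport a.2.1 a.2.2).toLp

lemma coeFn_testVec (a : {a : E → ℝ // ContDiff ℝ ∞ a ∧ HasCompactSupport a}) :
    testVec a =ᵐ[volume] fun x => (a.1 x : ℂ) := MemLp.coeFn_toLp _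

lemma testVec_total : TotalFam (testVec (E := E)) := fun G h => by
  refine Lp.eq_zero_iff_ae_eq_zero.2 (ae_eq_zero_of_integral_contDiff_smul_eq_zero
    ((Lp.memLp G).locallyIntegrable (by norm_num)) fun g hg hgs => ?_)
  rw [← h ⟨g, hg, hgs⟩, inner_eq_integral (coeFn_testVec _) .rfl]
  exact integral_ext fun x => by simp [mul_comm]

lemma exists_smooth_cutoff (j : ℕ) : ∃ χ : E → ℝ, ContDiff ℝ ∞ χ ∧ HasCompactSupport χ ∧
    (∀ x, ‖x‖ ≤ j → χ x = 1) ∧ ∀ x, ‖χ x‖ ≤ 1 := by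
  let f : ContDiffBump (0 : E) := ⟨j + 1, j + 2, by positivity, by linarith⟩
  refine ⟨f, f.contDiff, f.hasCompactSupport, fun x hx => f.one_of_mem_closedBall ?_, fun x => ?_⟩
  · simp only [Metric.mem_closedBall, dist_zero_right]; exact hx.trans (by simp [f])
  · rw [norm_of_nonneg f.nonneg]; exact f.le_one

variable {α : Type*} [MeasurableSpace α] {μ : Measure α} [SigmaFinite μ]

/-- A function on a product, locally `L²` in the second variable, vanishes if its integrals
against tensors of a total family and test functions vanish. -/
theorem ae_eq_zero_of_total_test {ι : Type*} {v : ι → Lp ℂ 2 μ} (hv : TotalFam v) {R : α × E → ℂ}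
    (hR : ∀ χ : E → ℝ, ContDiff ℝ ∞ χ → HasCompactSupport χ → (∀ x, ‖χ x‖ ≤ 1) →
      MemLp (fun p => R p * (χ p.2 : ℂ)) 2 (μ.prod volume))
    (h : ∀ i, ∀ b : E → ℝ, ContDiff ℝ ∞ b → HasCompactSupport b →
      ∫ p, R p * (conj (v i p.1) * (b p.2 : ℂ)) ∂(μ.prod volume) = 0) : R =ᵐ[μ.prod volume] 0 := by
  have key : ∀ j : ℕ, ∀ᵐ p ∂(μ.prod (volume : Measure E)), ‖p.2‖ ≤ j → R p = 0 := by
    intro j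
    obtain ⟨χ, h1, h2, h3, h4⟩ := exists_smooth_cutoff (E := E) j
    have hm := hR χ h1 h2 h4
    have hz : hm.toLp = 0 := by
      refine tensor_total_of_total hv testVec_total _ fun ⟨i, b⟩ => ?_
      refine (inner_eq_integral (tensor_ae_eq (.refl _ (v i)) (coeFn_testVec b))
        hm.coeFn_toLp).trans (.trans ?_
          (h i (fun x => χ x * b.1 x) (h1.mul b.2.1) (h2.mul_right)))
      refine integral_ext fun p => ?_
      simp only [map_mul, conj_ofReal, Complex.ofReal_mul]; ring
    filter_upwards [hm.coeFn_toLp, Lp.eq_zero_iff_ae_eq_zero.1 hz] with p e1 e2 hp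
    rw [e2, h3 _ hp] at e1
    simpa using e1.symm
  filter_upwards [ae_all_iff.2 key] with p hp
  obtain ⟨j, hj⟩ := exists_nat_ge ‖p.2‖
  exact hp j hj

variable {E' : Type*} [NormedAddCommGroup E'] [InnerProductSpace ℝ E'] [FiniteDimensional ℝ E']
  [MeasurableSpace E'] [BorelSpace E']

/-- A locally square integrable function on a product vanishes if its integrals against tensors
of test functions vanish. -/
theorem ae_eq_zero_of_tensor_test {R : E' × E → ℂ}
    (hR : ∀ K, IsCompact K → MemLp R 2 (volume.restrict K))
    (h : ∀ (a : E' → ℝ) (b : E → ℝ), ContDiff ℝ ∞ a → HasCompactSupport a → ContDiff ℝ ∞ b →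
      HasCompactSupport b → ∫ p, R p * ((a p.1 : ℂ) * (b p.2 : ℂ)) = 0) : R =ᵐ[volume] 0 := by
  have key : ∀ j : ℕ, ∀ᵐ p : E' × E, ‖p.1‖ ≤ j → R p = 0 := by
    intro j
    obtain ⟨χ, h1, h2, h3, h4⟩ := exists_smooth_cutoff (E := E') j
    have : (fun p => R p * (χ p.1 : ℂ)) =ᵐ[volume.prod volume] (0 : E' × E → ℂ) := by
      refine ae_eq_zero_of_total_test testVec_total (fun χ' h1' h2' h4' => ?_) fun a b hb hb' => ?_
      · have hK : IsCompact (tsupport χ ×ˢ tsupport χ') := h2.isCompact.prod h2'.isCompact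
        have hc : Continuous fun p : E' × E => ((χ p.1 : ℂ) * (χ' p.2 : ℂ)) := by
          have := h1.continuous; have := h1'.continuous; fun_prop
        have hs : (tsupport χ ×ˢ tsupport χ').indicator (fun p => R p * (χ p.1 : ℂ) * (χ' p.2 : ℂ)) =
            fun p => R p * (χ p.1 : ℂ) * (χ' p.2 : ℂ) := Set.indicator_eq_self.2 fun p hp =>
          ⟨subset_tsupport _ fun h0 => hp (by simp [h0]), subset_tsupport _ fun h0 =>
            hp (by simp [h0])⟩
        rw [← hs, memLp_indicator_iff_restrict hK.measurableSet]
        simp only [mul_assoc]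
        refine (hR _ hK).of_le_mul (c := 1) ((hR _ hK).1.mul hc.aestronglyMeasurable)
          (.of_forall fun p => ?_)
        rw [norm_mul, norm_mul, norm_real, norm_real, one_mul]
        exact mul_le_of_le_one_right (norm_nonneg _) (mul_le_one₀ (h4 _) (norm_nonneg _) (h4' _))
      · rw [← h (fun x => χ x * a.1 x) b (h1.mul a.2.1) h2.mul_right hb hb']
        refine integral_ext_ae (ae_prod_fst (coeFn_testVec a)) fun p e3 => ?_
        simp only [e3, conj_ofReal, Complex.ofReal_mul]
        ring
    filter_upwards [this] with p hp hj
    rw [h3 _ hj] at hp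
    simpa using hp
  filter_upwards [ae_all_iff.2 key] with p hp
  obtain ⟨j, hj⟩ := exists_nat_ge ‖p.1‖
  exact hp j hj

/-- A real test function as a complex Schwartz function. -/
def schwartzOfReal {a : E → ℝ} (ha : ContDiff ℝ ∞ a) (ha' : HasCompactSupport a) : 𝓢(E, ℂ) :=
  HasCompactSupport.toSchwartzMap (f := fun x => (a x : ℂ)) (ha'.comp_left ofReal_zero)
    (ofRealCLM.contDiff.comp ha)

@[simp]
lemma schwartzOfReal_apply {a : E → ℝ} (ha : ContDiff ℝ ∞ a) (ha' : HasCompactSupport a) (x : E) :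
    schwartzOfReal ha ha' x = (a x : ℂ) := rfl

lemma schwartz_total : TotalFam fun a : 𝓢(E, ℂ) => a.toLp 2 :=
  fun G h => testVec_total G fun a => h (schwartzOfReal a.2.1 a.2.2)

end Tests

/-! ### Tensor products of unitary maps -/

section TensorMap

variable {α β α' β' : Type*} [MeasurableSpace α] [MeasurableSpace β] [MeasurableSpace α']
  [MeasurableSpace β'] {μ : Measure α} {ν : Measure β} {μ' : Measure α'} {ν' : Measure β'}
  [SigmaFinite μ] [SigmaFinite ν] [SigmaFinite μ'] [SigmaFinite ν']

lemma exists_tensor_unitary (S : Lp ℂ 2 μ ≃ₗᵢ[ℂ] Lp ℂ 2 μ') (T : Lp ℂ 2 ν ≃ₗᵢ[ℂ] Lp ℂ 2 ν') :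
    ∃ U : Lp ℂ 2 (μ.prod ν) ≃ₗᵢ[ℂ] Lp ℂ 2 (μ'.prod ν'),
      ∀ i : Lp ℂ 2 μ × Lp ℂ 2 ν, U (tensor i.1 i.2) = tensor (S i.1) (T i.2) := by
  refine exists_unitary_of_inner_eq _ _ tensor_total
    (fun G h => tensor_total G fun i => ?_) fun i j => ?_
  · simpa using h (S.symm i.1, T.symm i.2)
  · simp only [inner_tensor, LinearIsometryEquiv.inner_map_map]

/-- The tensor product `S ⊗ T` of two unitary maps. -/
def tensorMap (S : Lp ℂ 2 μ ≃ₗᵢ[ℂ] Lp ℂ 2 μ') (T : Lp ℂ 2 ν ≃ₗᵢ[ℂ] Lp ℂ 2 ν') :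
    Lp ℂ 2 (μ.prod ν) ≃ₗᵢ[ℂ] Lp ℂ 2 (μ'.prod ν') := (exists_tensor_unitary S T).choose

lemma tensorMap_tensor (S : Lp ℂ 2 μ ≃ₗᵢ[ℂ] Lp ℂ 2 μ') (T : Lp ℂ 2 ν ≃ₗᵢ[ℂ] Lp ℂ 2 ν')
    (f : Lp ℂ 2 μ) (g : Lp ℂ 2 ν) : tensorMap S T (tensor f g) = tensor (S f) (T g) :=
  (exists_tensor_unitary S T).choose_spec (f, g)

lemma tensorMap_symm_tensor (S : Lp ℂ 2 μ ≃ₗᵢ[ℂ] Lp ℂ 2 μ') (T : Lp ℂ 2 ν ≃ₗᵢ[ℂ] Lp ℂ 2 ν')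
    (f : Lp ℂ 2 μ') (g : Lp ℂ 2 ν') :
    (tensorMap S T).symm (tensor f g) = tensor (S.symm f) (T.symm g) := by
  rw [LinearIsometryEquiv.symm_apply_eq, tensorMap_tensor]; simp

end TensorMap

/-! ### The partial and the symplectic Fourier transformations -/

section Symplectic

variable {n : ℕ}

/-- The kernel `e^{2iπ (⟨y, ζ⟩ - ⟨z, η⟩)}`, at `p = (ζ, z)` and `q = (y, η)`. -/
def sympChar (p q : Eu² n) : ℂ := cexp (2 * I * π * ((⟪q.1, p.1⟫ - ⟪p.2, q.2⟫ : ℝ) : ℂ))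

lemma norm_sympChar (p q : Eu² n) : ‖sympChar p q‖ = 1 := by rw [sympChar, norm_exp]; simp

lemma conj_sympChar (p q : Eu² n) : conj (sympChar p q) =
    cexp (-(2 * I * π * ((⟪q.1, p.1⟫ - ⟪p.2, q.2⟫ : ℝ) : ℂ))) := by
  rw [sympChar, ← exp_conj]
  congr 1
  simp only [map_mul, conj_I, conj_ofReal, map_ofNat]
  ring

@[fun_prop]
lemma Continuous.sympChar {α : Type*} [TopologicalSpace α] {f g : α → Eu² n} (hf : Continuous f)
    (hg : Continuous g) : Continuous fun x => sympChar (f x) (g x) := by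
  unfold _root_.sympChar; fun_prop

/-- The symplectic Fourier transformation `u ↦ ∫ u(y, η) e^{-2iπ (⟨y, ζ⟩ - ⟨z, η⟩)} dy dη` of
`L²(ℝⁿ × ℝⁿ)`. -/
def sympF (n : ℕ) : L2Sigma n ≃ₗᵢ[ℂ] L2Sigma n :=
  tensorMap (Lp.fourierTransformₗᵢ (Eu n) ℂ) (Lp.fourierTransformₗᵢ (Eu n) ℂ).symm

lemma sympF_tensor (a b : 𝓢(Eu n, ℂ)) :
    sympF n (tensor (a.toLp 2) (b.toLp 2)) = tensor ((𝓕 a).toLp 2) ((𝓕⁻ b).toLp 2) := by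
  rw [sympF, tensorMap_tensor]
  exact congr_arg₂ _ (SchwartzMap.toLp_fourier_eq a) (SchwartzMap.toLp_fourierInv_eq b)

lemma sympF_symm_tensor (a b : 𝓢(Eu n, ℂ)) :
    (sympF n).symm (tensor (a.toLp 2) (b.toLp 2)) = tensor ((𝓕⁻ a).toLp 2) ((𝓕 b).toLp 2) := by
  rw [sympF, tensorMap_symm_tensor]
  exact congr_arg₂ _ (SchwartzMap.toLp_fourierInv_eq a) (SchwartzMap.toLp_fourier_eq b)

lemma tensor_schwartz_coe (a b : 𝓢(Eu n, ℂ)) :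
    tensor (a.toLp 2) (b.toLp 2) =ᵐ[(volume : Measure (Eu² n))] fun p => a p.1 * b p.2 := by
  have := tensor_ae_eq (a.coeFn_toLp 2 volume) (b.coeFn_toLp 2 volume)
  exact this

lemma memLp_restrict_of_continuous {n : ℕ} {R : Eu² n → ℂ} (hR : Continuous R)
    {K : Set (Eu² n)} (hK : IsCompact K) : MemLp R 2 (volume.restrict K) := by
  have : IsFiniteMeasure ((volume : Measure (Eu² n)).restrict K) := ⟨by simpa using hK.measure_lt_top⟩
  obtain ⟨C, hC⟩ := hK.exists_bound_of_continuousOn hR.continuousOn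
  exact MemLp.of_bound hR.aestronglyMeasurable C ((ae_restrict_iff' hK.measurableSet).2 (.of_forall hC))

/-- A unitary map given by an integral on tensors of Schwartz functions is given by an integral
on `L¹ ∩ L²`. -/
lemma unitary_ae_eq_integral (U : L2Sigma n ≃ₗᵢ[ℂ] L2Sigma n)
    {k : Eu² n → Eu² n → ℂ} (hk : Continuous fun r : (Eu² n) × (Eu² n) =>
      k r.1 r.2) (hk1 : ∀ p q, ‖k p q‖ = 1)
    (hU : ∀ a b : 𝓢(Eu n, ℂ), U.symm (tensor (a.toLp 2) (b.toLp 2)) =ᵐ[volume]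
      fun q => ∫ p, conj (k p q) * (a p.1 * b p.2)) (f : L2Sigma n) (hf : Integrable f volume) :
    U f =ᵐ[volume] fun p => ∫ q, k p q * f q := by
  have hI : Continuous fun p => ∫ q, k p q * f q := by
    refine continuous_of_dominated (bound := fun q => ‖f q‖) (fun p => ?_) (fun p => ?_) hf.norm ?_
    · exact (hk.comp (Continuous.prodMk_right p)).aestronglyMeasurable.mul hf.1
    · exact .of_forall fun q => by simp [hk1]
    · exact .of_forall fun q => (hk.comp (Continuous.prodMk_left q)).mul continuous_const
  have hz : (fun p => U f p - ∫ q, k p q * f q) =ᵐ[volume] 0 := by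
    refine ae_eq_zero_of_tensor_test (fun K hK => ?_) fun a b ha ha' hb hb' => ?_
    · exact ((Lp.memLp _).restrict K).sub (memLp_restrict_of_continuous hI hK)
    · set a' := schwartzOfReal ha ha'
      set b' := schwartzOfReal hb hb'
      have iT : Integrable fun p : Eu² n => a' p.1 * b' p.2 :=
        a'.integrable.mul_prod b'.integrable
      have hT := tensor_schwartz_coe a' b'
      have i1 := integrable_mul_conj_of_ae_eq hT (.refl _ (U f))
      have e1 := inner_eq_integral hT (.refl _ (U f))
      simp only [a', b', schwartzOfReal_apply, map_mul, conj_ofReal] at i1 e1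
      have i2 : Integrable fun p => (∫ q, k p q * f q) * ((a p.1 : ℂ) * (b p.2 : ℂ)) := by
        refine iT.bdd_mul (c := ∫ q, ‖f q‖) hI.aestronglyMeasurable (.of_forall fun p => ?_)
        exact (norm_integral_le_integral_norm _).trans (le_of_eq (by simp [hk1]))
      simp only [sub_mul]
      rw [integral_sub i1 i2, ← e1, sub_eq_zero, ← U.symm.inner_map_map, U.symm_apply_apply,
        inner_eq_integral (hU a' b') .rfl]
      simp only [← integral_mul_const]
      rw [integral_integral_swap]
      · refine integral_ext fun q => ?_
        rw [← integral_conj, ← integral_const_mul]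
        refine integral_ext fun p => ?_
        simp only [a', b', schwartzOfReal_apply, map_mul, conj_conj, conj_ofReal]
        ring
      · refine ((iT.mul_prod hf).bdd_mul (c := 1) hk.aestronglyMeasurable
          (.of_forall fun r => (hk1 _ _).le)).congr (.of_forall fun r => ?_)
        simp only [Function.uncurry, a', b', schwartzOfReal_apply]; ring
  filter_upwards [hz] with p hp
  simpa [sub_eq_zero] using hp

lemma fourier_eq_exp (a : Eu n → ℂ) (w : Eu n) :
    𝓕 a w = ∫ v, cexp (-(2 * I * π * ((⟪v, w⟫ : ℝ) : ℂ))) * a v := by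
  rw [fourier_eq']
  refine integral_ext fun v => ?_
  simp only [smul_eq_mul]
  congr 2; push_cast; ring

lemma fourierInv_eq_exp (a : Eu n → ℂ) (w : Eu n) :
    𝓕⁻ a w = ∫ v, cexp (2 * I * π * ((⟪v, w⟫ : ℝ) : ℂ)) * a v := by
  rw [Real.fourierInv_eq']
  refine integral_ext fun v => ?_
  simp only [smul_eq_mul]
  congr 2; push_cast; ring

lemma integral_conj_sympChar_tensor (a b : Eu n → ℂ) (p : Eu² n) :
    ∫ q, conj (sympChar p q) * (a q.1 * b q.2) = 𝓕 a p.1 * 𝓕⁻ b p.2 := by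
  rw [fourier_eq_exp, fourierInv_eq_exp, ← integral_prod_mul]
  refine integral_ext fun q => ?_
  simp only [conj_sympChar]
  rw [mul_mul_mul_comm, ← Complex.exp_add]
  congr 2
  rw [real_inner_comm p.2 q.2]; push_cast; ring

lemma integral_sympChar_tensor (a b : Eu n → ℂ) (q : Eu² n) :
    ∫ p, sympChar p q * (a p.1 * b p.2) = 𝓕⁻ a q.1 * 𝓕 b q.2 := by
  rw [fourier_eq_exp, fourierInv_eq_exp, ← integral_prod_mul]
  refine integral_ext fun p => ?_
  simp only [sympChar]
  rw [mul_mul_mul_comm, ← Complex.exp_add]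
  congr 2
  rw [real_inner_comm q.1 p.1]; push_cast; ring

lemma sympF_ae_eq (f : L2Sigma n) (hf : Integrable f volume) :
    sympF n f =ᵐ[volume] fun p => ∫ q, conj (sympChar p q) * f q := by
  refine unitary_ae_eq_integral _ (k := fun p q => conj (sympChar p q))
    (continuous_conj.comp (by fun_prop)) (fun p q => ?_) (fun a b => ?_) f hf
  · rw [norm_conj, norm_sympChar]
  · rw [sympF_symm_tensor]
    filter_upwards [tensor_schwartz_coe (𝓕⁻ a) (𝓕 b)] with q hq
    rw [hq, SchwartzMap.fourier_coe, SchwartzMap.fourierInv_coe, ← integral_sympChar_tensor]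
    simp only [conj_conj]

lemma sympF_symm_ae_eq (f : L2Sigma n) (hf : Integrable f volume) :
    (sympF n).symm f =ᵐ[volume] fun q => ∫ p, sympChar p q * f p := by
  have hc : Continuous fun r : (Eu² n) × (Eu² n) => sympChar r.2 r.1 := by
    unfold sympChar; fun_prop
  refine unitary_ae_eq_integral _ (k := fun q p => sympChar p q) hc (fun p q => norm_sympChar _ _) (fun a b => ?_) f hf
  rw [LinearIsometryEquiv.symm_symm, sympF_tensor]
  filter_upwards [tensor_schwartz_coe (𝓕 a) (𝓕⁻ b)] with q hq
  rw [hq, SchwartzMap.fourier_coe, SchwartzMap.fourierInv_coe, ← integral_conj_sympChar_tensor]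

end Symplectic

/-! ### Weighted composition operators -/

section WeightedComp

variable {X Z : Type*} [MeasurableSpace X] [MeasurableSpace Z]

/-- `T` is, up to null sets, a bijection with inverse `S`, and `ν` is the image of `ρ² μ`
under `T`. Then `F ↦ ρ · F ∘ T` is unitary from `L²(ν)` to `L²(μ)`. -/
structure IsWeightedMap (μ : Measure X) (ν : Measure Z) (T : X → Z) (S : Z → X) (ρ : X → ℝ) :
    Prop where
  measT : Measurable T
  measS : Measurable S
  measρ : Measurable ρ
  pos : ∀ x, 0 < ρ x
  map_eq : (μ.withDensity fun x => ofReal (ρ x ^ 2)).map T = ν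
  left_inv : ∀ᵐ x ∂μ, S (T x) = x

namespace IsWeightedMap

variable {μ : Measure X} {ν : Measure Z} {T : X → Z} {S : Z → X} {ρ : X → ℝ}
  (h : IsWeightedMap μ ν T S ρ)
include h

lemma absolutelyContinuous : μ ≪ μ.withDensity fun x => ofReal (ρ x ^ 2) :=
  withDensity_absolutelyContinuous' (h.measρ.pow_const 2).ennreal_ofReal.aemeasurable
    (.of_forall fun x => by simpa using (h.pos x).ne')

lemma quasi : Measure.QuasiMeasurePreserving T μ ν := ⟨h.measT, by
    rw [← h.map_eq]; exact h.absolutelyContinuous.map h.measT⟩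

lemma lintegral_eq (f : Z → ENNReal) (hf : AEMeasurable f ν) :
    ∫⁻ z, f z ∂ν = ∫⁻ x, ofReal (ρ x ^ 2) * f (T x) ∂μ := by
  rw [← h.map_eq] at hf ⊢
  rw [lintegral_map' hf h.measT.aemeasurable]
  exact lintegral_withDensity_eq_lintegral_mul₀'
    (h.measρ.pow_const 2).ennreal_ofReal.aemeasurable (hf.comp_measurable h.measT)

lemma eLpNorm_eq (F : Z → ℂ) (hF : AEStronglyMeasurable F ν) :
    eLpNorm (fun x => (ρ x : ℂ) * F (T x)) 2 μ = eLpNorm F 2 ν := by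
  rw [eLpNorm_eq_lintegral_rpow_enorm_toReal (by norm_num) (by norm_num),
    eLpNorm_eq_lintegral_rpow_enorm_toReal (by norm_num) (by norm_num),
    h.lintegral_eq _ (hF.enorm.pow_const _)]
  congr 1
  refine lintegral_congr fun x => ?_
  have hp := h.pos x
  simp only [enorm_mul, ENNReal.toReal_ofNat, ENNReal.rpow_ofNat, mul_pow]
  congr 1
  rw [ofReal_pow hp.le, ← ofReal_norm, norm_real, norm_of_nonneg hp.le]

lemma memLp {F : Z → ℂ} (hF : MemLp F 2 ν) : MemLp (fun x => (ρ x : ℂ) * F (T x)) 2 μ :=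
  ⟨(measurable_ofReal.comp h.measρ).aestronglyMeasurable.mul
    (hF.1.comp_quasiMeasurePreserving h.quasi), by rw [h.eLpNorm_eq F hF.1]; exact hF.2⟩

lemma exists_unitary : ∃ U : Lp ℂ 2 ν ≃ₗᵢ[ℂ] Lp ℂ 2 μ,
    ∀ F, U F =ᵐ[μ] fun x => (ρ x : ℂ) * F (T x) := by
  let L : Lp ℂ 2 ν →ₗᵢ[ℂ] Lp ℂ 2 μ :=
    { toFun := fun F => (h.memLp (Lp.memLp F)).toLp
      map_add' := fun F G => by
        refine Lp.ext ((MemLp.coeFn_toLp _).trans (.trans ?_ (Lp.coeFn_add _ _).symm))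
        filter_upwards [h.quasi.ae (Lp.coeFn_add F G), (h.memLp (Lp.memLp F)).coeFn_toLp,
          (h.memLp (Lp.memLp G)).coeFn_toLp] with x a b c
        rw [Pi.add_apply, a, b, c, Pi.add_apply]; ring
      map_smul' := fun k F => by
        refine Lp.ext ((MemLp.coeFn_toLp _).trans (.trans ?_ (Lp.coeFn_smul _ _).symm))
        filter_upwards [h.quasi.ae (Lp.coeFn_smul k F), (h.memLp (Lp.memLp F)).coeFn_toLp]
          with x a b
        rw [RingHom.id_apply, Pi.smul_apply, a, b, Pi.smul_apply, smul_eq_mul, smul_eq_mul]; ring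
      norm_map' := fun F => by
        change ‖MemLp.toLp (fun x => (ρ x : ℂ) * F (T x)) (h.memLp (Lp.memLp F))‖ = ‖F‖
        rw [Lp.norm_toLp, h.eLpNorm_eq _ (Lp.memLp F).1, Lp.norm_def] }
  have hL : ∀ F, L F =ᵐ[μ] fun x => (ρ x : ℂ) * F (T x) := fun F =>
    (h.memLp (Lp.memLp F)).coeFn_toLp
  have surj : Function.Surjective L := by
    intro G
    have qS : Measure.QuasiMeasurePreserving S ν μ := ⟨h.measS, by
      rw [← h.map_eq, Measure.map_map h.measS h.measT, Measure.map_congr (f := S ∘ T) (g := id)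
        ((withDensity_absolutelyContinuous _ _).ae_le h.left_inv), Measure.map_id]
      exact withDensity_absolutelyContinuous _ _⟩
    have mF : AEStronglyMeasurable (fun z => ((ρ (S z) : ℂ))⁻¹ * G (S z)) ν :=
      ((measurable_ofReal.comp (h.measρ.comp h.measS)).inv.aestronglyMeasurable).mul
        ((Lp.aestronglyMeasurable G).comp_quasiMeasurePreserving qS)
    have e : (fun x => (ρ x : ℂ) * (((ρ (S (T x)) : ℂ))⁻¹ * G (S (T x)))) =ᵐ[μ] G :=
      h.left_inv.mono fun x hx => by
        simp only [hx]
        exact mul_inv_cancel_left₀ (ofReal_ne_zero.2 (h.pos x).ne') _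
    have hF : MemLp (fun z => ((ρ (S z) : ℂ))⁻¹ * G (S z)) 2 ν := ⟨mF, by
      rw [← h.eLpNorm_eq _ mF, eLpNorm_congr_ae e]; exact (Lp.memLp G).2⟩
    refine ⟨hF.toLp, Lp.ext ((hL _).trans (.trans ?_ e))⟩
    filter_upwards [h.quasi.ae hF.coeFn_toLp] with x hx
    rw [hx]
  exact ⟨LinearIsometryEquiv.ofSurjective L surj, hL⟩

/-- The unitary map `F ↦ ρ · F ∘ T`. -/
def unitary : Lp ℂ 2 ν ≃ₗᵢ[ℂ] Lp ℂ 2 μ := h.exists_unitary.choose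

lemma unitary_coe (F : Lp ℂ 2 ν) : h.unitary F =ᵐ[μ] fun x => (ρ x : ℂ) * F (T x) :=
  h.exists_unitary.choose_spec F

lemma unitary_of_ae_eq {F : Lp ℂ 2 ν} {f : Z → ℂ} (hf : F =ᵐ[ν] f) :
    h.unitary F =ᵐ[μ] fun x => (ρ x : ℂ) * f (T x) := by
  filter_upwards [h.unitary_coe F, h.quasi.ae hf] with x h1 h2
  rw [h1, h2]

end IsWeightedMap

/-- An involution that preserves the measure. -/
lemma isWeightedMap_of_involutive {μ : Measure X} {T : X → X} (hT : MeasurePreserving T μ μ)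
    (hi : Function.Involutive T) : IsWeightedMap μ μ T T fun _ => 1 where
  measT := hT.measurable
  measS := hT.measurable
  measρ := measurable_const
  pos _ := one_pos
  map_eq := by simpa using hT.map_eq
  left_inv := .of_forall hi

end WeightedComp

/-! ### The Fourier transformation in the second variable -/

section PartialFourier

variable {Y : Type*} [MeasurableSpace Y] {μ : Measure Y} [SigmaFinite μ]

/-- The Fourier transformation in the real variable on `L²(Y × ℝ)`. -/
def partialF (μ : Measure Y) [SigmaFinite μ] :
    Lp ℂ 2 (μ.prod (volume : Measure ℝ)) ≃ₗᵢ[ℂ] Lp ℂ 2 (μ.prod (volume : Measure ℝ)) :=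
  tensorMap (LinearIsometryEquiv.refl ℂ _) (Lp.fourierTransformₗᵢ ℝ ℂ)

lemma partialF_symm_tensor (g : Lp ℂ 2 μ) (b : 𝓢(ℝ, ℂ)) :
    (partialF μ).symm (tensor g (b.toLp 2)) = tensor g ((𝓕⁻ b).toLp 2) := by
  rw [partialF, tensorMap_symm_tensor]
  exact congr_arg₂ _ rfl (SchwartzMap.toLp_fourierInv_eq b)

lemma tensor_schwartz_right_coe (g : Lp ℂ 2 μ) (b : 𝓢(ℝ, ℂ)) :
    tensor g (b.toLp 2) =ᵐ[μ.prod (volume : Measure ℝ)] fun p => g p.1 * b p.2 :=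
  tensor_ae_eq (.refl _ g) (b.coeFn_toLp 2 volume)

lemma integral_fourier_mul_conj (b : 𝓢(ℝ, ℂ)) {f : ℝ → ℂ} (hf : Integrable f) :
    ∫ ξ, 𝓕 f ξ * conj (b ξ) = ∫ τ, f τ * conj ((𝓕⁻ b) τ) := by
  have hb : Integrable fun ξ => conj (b ξ) :=
    Integrable.mono (g := fun ξ => b ξ) (b.integrable (μ := (volume : Measure ℝ)))
      (continuous_conj.comp b.continuous).aestronglyMeasurable (.of_forall fun x => by simp)
  have := VectorFourier.integral_fourierIntegral_smul_eq_flip (e := Real.fourierChar)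
    (L := innerₗ ℝ) (μ := (volume : Measure ℝ)) (ν := (volume : Measure ℝ))
    Real.continuous_fourierChar (by simp only [innerₗ_apply_apply]; fun_prop) hf hb
  simp only [smul_eq_mul] at this
  rw [flip_innerₗ] at this
  refine this.trans (integral_ext fun τ => ?_)
  congr 1
  rw [SchwartzMap.fourierInv_coe, Real.fourierInv_eq', ← integral_conj]
  change 𝓕 (fun ξ => conj (b ξ)) τ = _
  rw [fourier_eq']
  refine integral_ext fun ξ => ?_
  simp only [smul_eq_mul, map_mul, ← exp_conj, conj_I, conj_ofReal]
  congr 2; push_cast; ring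

lemma inner_tensor_partialF {f : Y × ℝ → ℂ} (hf2 : MemLp f 2 (μ.prod volume))
    (hfi : ∀ o, Integrable fun τ => f (o, τ)) (g : Lp ℂ 2 μ) (b : 𝓢(ℝ, ℂ))
    (i2 : Integrable (fun p : Y × ℝ => 𝓕 (fun τ => f (p.1, τ)) p.2 * conj (g p.1 * b p.2))
      (μ.prod volume)) : ⟪tensor g (b.toLp 2), partialF μ hf2.toLp⟫_ℂ =
    ∫ p : Y × ℝ, 𝓕 (fun τ => f (p.1, τ)) p.2 * conj (g p.1 * b p.2) ∂(μ.prod volume) := by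
  have h3 := tensor_schwartz_right_coe g (𝓕⁻ b)
  have e2 : ⟪tensor g (b.toLp 2), partialF μ hf2.toLp⟫_ℂ =
      ⟪tensor g ((𝓕⁻ b).toLp 2), hf2.toLp⟫_ℂ := by
    rw [← partialF_symm_tensor]
    exact ((partialF μ).symm.inner_map_eq_flip _ _).symm
  rw [e2, inner_eq_integral h3 hf2.coeFn_toLp, integral_prod _ i2,
    integral_prod _ (integrable_mul_conj_of_ae_eq h3 hf2.coeFn_toLp)]
  refine integral_ext fun o => ?_
  simp only [map_mul, mul_left_comm _ (conj (g o)), integral_const_mul]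
  rw [integral_fourier_mul_conj b (hfi o)]

/-- The partial Fourier transformation is given by the integral, for functions dominated by a
product of a square integrable and an integrable function. -/
theorem partialF_ae_eq {f : Y × ℝ → ℂ} (hf : Measurable f) (hf2 : MemLp f 2 (μ.prod volume))
    {A : Y → ℝ} (hA : MemLp A 2 μ) {B : ℝ → ℝ} (hB : Integrable B)
    (hfAB : ∀ p, ‖f p‖ ≤ A p.1 * B p.2) (hB0 : ∀ τ, 0 < B τ) :
    partialF μ hf2.toLp =ᵐ[μ.prod volume] fun p => 𝓕 (fun τ => f (p.1, τ)) p.2 := by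
  have hfi : ∀ o, Integrable fun τ => f (o, τ) := fun o =>
    (hB.const_mul (A o)).mono' (hf.comp measurable_prodMk_left).aestronglyMeasurable
      (.of_forall fun τ => hfAB (o, τ))
  have hIm : StronglyMeasurable fun p : Y × ℝ => 𝓕 (fun τ => f (p.1, τ)) p.2 := by
    simp only [fourier_eq']
    refine StronglyMeasurable.integral_prod_right (f := fun (p : Y × ℝ) (v : ℝ) =>
      cexp (↑(-2 * π * ⟪v, p.2⟫) * I) • f (p.1, v)) (Measurable.stronglyMeasurable ?_)
    simp only [smul_eq_mul, inner_apply, conj_trivial]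
    exact Measurable.mul (by fun_prop) (hf.comp (measurable_fst.fst.prodMk measurable_snd))
  have hIb : ∀ p : Y × ℝ, ‖𝓕 (fun τ => f (p.1, τ)) p.2‖ ≤ A p.1 * ∫ τ, B τ := by
    intro p
    rw [fourier_eq', ← integral_const_mul]
    refine norm_integral_le_of_norm_le (hB.const_mul _) (.of_forall fun τ => ?_)
    rw [norm_smul, Complex.norm_exp_ofReal_mul_I, one_mul]
    exact hfAB (p.1, τ)
  have hz : (fun p => partialF μ hf2.toLp p - 𝓕 (fun τ => f (p.1, τ)) p.2) =ᵐ[μ.prod volume] 0 := by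
    refine ae_eq_zero_of_total_test (v := fun g : Lp ℂ 2 μ => g)
      (fun G hG => inner_self_eq_zero.1 (hG G)) (fun χ h1 h2 h3 => ?_) fun g b hb hb' => ?_
    · have mχ : Measurable fun p : Y × ℝ => (χ p.2 : ℂ) :=
        measurable_ofReal.comp (h1.continuous.measurable.comp measurable_snd)
      have m2 : MemLp (fun p : Y × ℝ => 𝓕 (fun τ => f (p.1, τ)) p.2 * (χ p.2 : ℂ)) 2
          (μ.prod volume) := by
        refine (memLp_tensor (hA.ofReal (K := ℂ)) (memLp_ofReal_of_hasCompactSupport h1 h2)).of_le_mul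
          (c := ∫ τ, B τ) (hIm.aestronglyMeasurable.mul mχ.aestronglyMeasurable)
          (.of_forall fun p => ?_)
        rw [norm_mul, norm_mul, ← mul_assoc, mul_comm (∫ τ, B τ)]
        gcongr
        refine (hIb p).trans (mul_le_mul_of_nonneg_right ?_ (integral_nonneg fun τ => (hB0 τ).le))
        exact (le_abs_self _).trans (norm_real _).ge
      have m1 := memLp_bounded_mul mχ (C := 1) (fun p => by rw [norm_real]; exact h3 _)
        (partialF μ hf2.toLp)
      simp only [mul_comm (χ _ : ℂ)] at m1
      (simp only [sub_mul]; exact m1.sub m2)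
    · set b' := schwartzOfReal hb hb'
      have hT := tensor_schwartz_right_coe g b'
      have iAg : Integrable (fun o => ‖g o‖ * A o) μ := (Lp.memLp g).norm.integrable_mul hA
      have i2 : Integrable (fun p : Y × ℝ => 𝓕 (fun τ => f (p.1, τ)) p.2 *
          conj (g p.1 * b' p.2)) (μ.prod volume) := by
        refine ((iAg.mul_prod (b'.integrable (μ := volume)).norm).const_mul (∫ τ, B τ)).mono'
          (hIm.aestronglyMeasurable.mul (continuous_conj.comp_aestronglyMeasurable
            ((Lp.aestronglyMeasurable g).comp_fst.mul
              (b'.continuous.measurable.comp measurable_snd).aestronglyMeasurable)))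
          (.of_forall fun p => ?_)
        rw [norm_mul, norm_conj, norm_mul]
        calc _ ≤ (A p.1 * ∫ τ, B τ) * (‖g p.1‖ * ‖b' p.2‖) := by gcongr; exact hIb p
          _ = _ := by ring
      have e1 := inner_eq_integral hT (.refl _ (partialF μ hf2.toLp))
      have := integral_sub (integrable_mul_conj_of_ae_eq hT (.refl _ (partialF μ hf2.toLp))) i2
      rw [← e1, inner_tensor_partialF hf2 hfi g b' i2, sub_self] at this
      refine .trans (integral_ext fun p => ?_) this
      simp only [b', schwartzOfReal_apply, map_mul, conj_ofReal]
      ring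
  filter_upwards [hz] with p hp
  simpa [sub_eq_zero] using hp

end PartialFourier

/-! ### Last coordinate, projective coordinates -/

section Coordinates

variable {n : ℕ}

@[simp] lemma joinLast_castSucc (v : Eu n) (c : ℝ) (i : Fin n) : joinLast v c i.castSucc = v i := by
  simp [joinLast]

@[simp] lemma joinLast_last (v : Eu n) (c : ℝ) : joinLast v c (Fin.last n) = c := by simp [joinLast]

@[simp] lemma lastCoord_joinLast (v : Eu n) (c : ℝ) : lastCoord (joinLast v c) = c := by
  simp [lastCoord]

@[simp] lemma starPart_joinLast (v : Eu n) (c : ℝ) : starPart (joinLast v c) = v := by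
  ext i; simp [starPart]

lemma joinLast_starPart_lastCoord (y : Eu (n + 1)) : joinLast (starPart y) (lastCoord y) = y := by
  ext i
  refine Fin.lastCases ?_ (fun j => ?_) i <;> simp [starPart, lastCoord]

lemma smul_joinLast (t : ℝ) (v : Eu n) (c : ℝ) : t • joinLast v c = joinLast (t • v) (t * c) := by
  ext i
  refine Fin.lastCases ?_ (fun j => ?_) i <;> simp

lemma inner_joinLast (v w : Eu n) (c d : ℝ) :
    ⟪joinLast v c, joinLast w d⟫ = ⟪v, w⟫ + c * d := by
  simp only [PiLp.inner_apply, inner_apply, conj_trivial, Fin.sum_univ_castSucc,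
    joinLast_castSucc, joinLast_last]
  ring

lemma norm_sq_joinLast (v : Eu n) (c : ℝ) : ‖joinLast v c‖ ^ 2 = ‖v‖ ^ 2 + c ^ 2 := by
  rw [← real_inner_self_eq_norm_sq, inner_joinLast, real_inner_self_eq_norm_sq]; ring

/-- `joinLast` as a linear isomorphism. -/
def joinLastCLE (n : ℕ) : (Eu n × ℝ) ≃L[ℝ] Eu (n + 1) := LinearEquiv.toContinuousLinearEquiv
    { toFun := fun p => joinLast p.1 p.2
      invFun := fun y => (starPart y, lastCoord y)
      map_add' := fun p q => by
        ext i; refine Fin.lastCases ?_ (fun j => ?_) i <;> simp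
      map_smul' := fun c p => by
        ext i; refine Fin.lastCases ?_ (fun j => ?_) i <;> simp
      left_inv := fun p => by simp
      right_inv := joinLast_starPart_lastCoord }

lemma joinLast_eq_zero_iff (v : Eu n) (c : ℝ) : joinLast v c = 0 ↔ v = 0 ∧ c = 0 :=
  ((joinLastCLE n).map_eq_zero_iff (x := (v, c))).trans Prod.mk_eq_zero

@[fun_prop]
lemma Continuous.joinLast {α : Type*} [TopologicalSpace α] {f : α → Eu n} {g : α → ℝ}
    (hf : Continuous f) (hg : Continuous g) : Continuous fun a => joinLast (f a) (g a) :=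
  (joinLastCLE n).continuous.comp (hf.prodMk hg)

@[fun_prop]
lemma Measurable.joinLast {α : Type*} [MeasurableSpace α] {f : α → Eu n} {g : α → ℝ}
    (hf : Measurable f) (hg : Measurable g) : Measurable fun a => joinLast (f a) (g a) :=
  (joinLastCLE n).continuous.measurable.comp (hf.prodMk hg)

@[fun_prop]
lemma continuous_starPart : Continuous (starPart (n := n)) :=
  continuous_fst.comp (joinLastCLE n).symm.continuous

@[fun_prop]
lemma continuous_lastCoord : Continuous (lastCoord (n := n)) :=
  continuous_snd.comp (joinLastCLE n).symm.continuous

lemma contDiff_starPart : ContDiff ℝ ∞ (starPart (n := n)) :=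
  contDiff_fst.comp (joinLastCLE n).symm.contDiff

lemma contDiff_lastCoord : ContDiff ℝ ∞ (lastCoord (n := n)) :=
  contDiff_snd.comp (joinLastCLE n).symm.contDiff

lemma measurePreserving_joinLast :
    MeasurePreserving (fun p : Eu n × ℝ => joinLast p.1 p.2) volume volume := by
  have h1 : MeasurePreserving (fun p : Eu n × ℝ => (p.2, WithLp.ofLp p.1)) volume volume :=
    Measure.measurePreserving_swap.comp
      ((EuclideanSpace.volume_preserving_symm_measurableEquiv_toLp (Fin n)).prod (.id volume))
  refine cast (congrArg (MeasurePreserving · volume volume) (funext fun p => ?_))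
    ((EuclideanSpace.volume_preserving_symm_measurableEquiv_toLp (Fin (n + 1))).symm.comp
    ((volume_preserving_piFinSuccAbove (fun _ : Fin (n + 1) => ℝ) (Fin.last n)).symm.comp h1))
  ext i
  refine Fin.lastCases ?_ (fun j => ?_) i <;> simp [MeasurableEquiv.piFinSuccAbove]

lemma lintegral_eq_comp_smul {E : Type*} [NormedAddCommGroup E] [InnerProductSpace ℝ E]
    [FiniteDimensional ℝ E] [MeasurableSpace E] [BorelSpace E] {t : ℝ} (ht : t ≠ 0)
    (f : E → ENNReal) :
    ∫⁻ v, f v = ofReal (|t| ^ Module.finrank ℝ E) * ∫⁻ v, f (t • v) := by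
  have h := lintegral_map_equiv (μ := (volume : Measure E)) f
    (Homeomorph.smulOfNeZero t ht).toMeasurableEquiv
  change ∫⁻ v, f v ∂(Measure.map (t • ·) volume) = ∫⁻ v, f (t • v) at h
  rw [← h, Measure.map_addHaar_smul _ ht, lintegral_smul_measure, smul_eq_mul, ← mul_assoc,
    ← ofReal_mul (by positivity), abs_inv, abs_pow, mul_inv_cancel₀ (by positivity), ofReal_one,
    one_mul]

lemma lintegral_comp_mul {t : ℝ} (ht : t ≠ 0) (f : ℝ → ENNReal) :
    ∫⁻ s, f s = ofReal |t| * ∫⁻ s, f (t * s) := by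
  simpa using lintegral_eq_comp_smul ht f

lemma lintegral_comp_smul {k : ℕ} {t : ℝ} (ht : t ≠ 0) (f : Eu k → ENNReal) :
    ∫⁻ v, f v = ofReal (|t| ^ k) * ∫⁻ v, f (t • v) := by
  simpa using lintegral_eq_comp_smul ht f

/-- Integration in projective coordinates `y = (t v, t)`. -/
lemma lintegral_joinLast_smul (f : Eu (n + 1) → ENNReal) (hf : Measurable f) :
    ∫⁻ y, f y = ∫⁻ t : ℝ, ∫⁻ v : Eu n, ofReal (|t| ^ n) * f (joinLast (t • v) t) := by
  rw [← measurePreserving_joinLast.lintegral_comp hf, volume_eq_prod,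
    lintegral_prod_symm' _ (by fun_prop)]
  refine lintegral_congr_ae ?_
  filter_upwards [Measure.ae_ne volume (0 : ℝ)] with t ht
  rw [lintegral_comp_smul ht, lintegral_const_mul _ (by fun_prop)]

end Coordinates

/-! ### The multiplicative group `ℝˣ` and the cone measure -/

/-- The signs `1` and `-1`. -/
def boolSign (b : Bool) : ℝ := if b then 1 else -1

@[simp] lemma boolSign_true : boolSign true = 1 := rfl
@[simp] lemma boolSign_false : boolSign false = -1 := rfl

lemma boolSign_not (b : Bool) : boolSign (!b) = -boolSign b := by cases b <;> simp
lemma boolSign_ne_zero (b : Bool) : boolSign b ≠ 0 := by cases b <;> simp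
lemma abs_boolSign (b : Bool) : |boolSign b| = 1 := by cases b <;> simp

/-- The invariant measure `dt / |t|` of `ℝˣ`, as the image of two copies of Lebesgue measure
under `s ↦ ± e ^ s`. -/
def scaleMeasure : Measure ℝ :=
  (volume : Measure ℝ).map exp + (volume : Measure ℝ).map fun s => -exp s

lemma lintegral_scaleMeasure (f : ℝ → ENNReal) (hf : Measurable f) :
    ∫⁻ t, f t ∂scaleMeasure = (∫⁻ s, f (exp s)) + ∫⁻ s, f (-exp s) := by
  rw [scaleMeasure, lintegral_add_measure, lintegral_map hf (by fun_prop),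
    lintegral_map hf (by fun_prop)]

lemma lintegral_Ioi_exp (f : ℝ → ENNReal) :
    ∫⁻ t in Set.Ioi 0, f t = ∫⁻ s, ofReal (exp s) * f (exp s) := by
  have := lintegral_image_eq_lintegral_abs_deriv_mul (s := Set.univ) MeasurableSet.univ
    (fun x _ => (Real.hasDerivAt_exp x).hasDerivWithinAt) Real.exp_injective.injOn f
  rw [Set.image_univ, Real.range_exp] at this
  simpa using this

lemma lintegral_eq_exp (f : ℝ → ENNReal) (hf : Measurable f) :
    ∫⁻ t, f t = (∫⁻ s, ofReal (exp s) * f (exp s)) + ∫⁻ s, ofReal (exp s) * f (-exp s) := by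
  rw [← lintegral_Ioi_exp, ← lintegral_Ioi_exp (fun t => f (-t))]
  have h1 : ∫⁻ t, f t = (∫⁻ t in Set.Ioi 0, f t) + ∫⁻ t in Set.Iic 0, f t := by
    rw [← lintegral_add_compl f (measurableSet_Ioi (a := (0:ℝ))), Set.compl_Ioi]
  rw [h1]
  congr 1
  have e : MeasurePreserving (fun t : ℝ => -t) volume volume := Measure.measurePreserving_neg volume
  rw [← e.setLIntegral_comp_preimage (measurableSet_Iic (a := (0 : ℝ))) hf]
  have : (fun t : ℝ => -t) ⁻¹' Set.Iic 0 = Set.Ici 0 := by ext; simp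
  rw [this, setLIntegral_congr Ioi_ae_eq_Ici.symm]

lemma lintegral_eq_scaleMeasure (f : ℝ → ENNReal) (hf : Measurable f) :
    ∫⁻ t, f t = ∫⁻ t, ofReal |t| * f t ∂scaleMeasure := by
  rw [lintegral_scaleMeasure _ (by fun_prop), lintegral_eq_exp f hf]
  simp [abs_of_pos (exp_pos _)]

lemma ae_ne_zero_scaleMeasure : ∀ᵐ t ∂scaleMeasure, t ≠ 0 := by
  have hm : MeasurableSet {t : ℝ | t ≠ 0} := (measurableSet_singleton 0).compl
  rw [scaleMeasure, ae_add_measure_iff, ae_map_iff (by fun_prop) hm, ae_map_iff (by fun_prop) hm]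
  simp

instance : SFinite scaleMeasure := by unfold scaleMeasure; infer_instance

section Cone
variable {n : ℕ}

/-- The parametrization of the cone by `ℝˣ × Σ_n^•`. -/
def coneMap (r : ℝ × (Eu² n)) : Eu (n + 1) × Eu (n + 1) := scaleAct r.1 (sigmaPoint r.2)

lemma coneMap_eq (t : ℝ) (v η : Eu n) : coneMap (t, (v, η)) =
    (joinLast (t • v) t, joinLast (t⁻¹ • η) (-(t⁻¹ * ⟪v, η⟫))) := by
  simp [coneMap, scaleAct, sigmaPoint, smul_joinLast]

@[fun_prop]
lemma measurable_coneMap : Measurable (coneMap (n := n)) := by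
  have : (coneMap (n := n)) = fun r => (joinLast (r.1 • r.2.1) r.1,
      joinLast (r.1⁻¹ • r.2.2) (-(r.1⁻¹ * ⟪r.2.1, r.2.2⟫))) := funext fun r => coneMap_eq _ _ _
  rw [this]
  fun_prop

attribute [fun_prop] measurable_conePoint

lemma coneMeasure_eq_map : coneMeasure n = (scaleMeasure.prod volume).map coneMap := by
  refine Measure.ext_of_lintegral _ fun f hf => ?_
  have e1 : ∫⁻ z, f z ∂(coneMeasure n) = ∫⁻ y : Eu (n + 1), ∫⁻ η : Eu n,
      ofReal |lastCoord y|⁻¹ * f (conePoint (y, η)) := by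
    rw [coneMeasure, lintegral_map hf measurable_conePoint]
    refine (lintegral_withDensity_eq_lintegral_mul _ (by fun_prop) (by fun_prop)).trans ?_
    exact lintegral_prod _ (by fun_prop)
  rw [e1, lintegral_joinLast_smul _ (Measurable.lintegral_prod_right (by fun_prop)),
    lintegral_map hf measurable_coneMap, lintegral_prod _ (by fun_prop),
    lintegral_eq_scaleMeasure _ (Measurable.lintegral_prod_right (Measurable.mul (by fun_prop)
      (Measurable.lintegral_prod_right (by fun_prop))))]
  refine lintegral_congr_ae ?_
  filter_upwards [ae_ne_zero_scaleMeasure] with t ht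
  simp only [lastCoord_joinLast]
  rw [volume_eq_prod, lintegral_prod _ (by fun_prop), ← lintegral_const_mul _
    ((Measurable.lintegral_prod_right (by fun_prop)).const_mul _)]
  refine lintegral_congr fun v => ?_
  rw [lintegral_comp_smul (inv_ne_zero ht), lintegral_const_mul _ (by fun_prop), ← mul_assoc,
    ← mul_assoc, ← mul_assoc, ← ofReal_mul (by positivity), ← ofReal_mul (by positivity),
    ← ofReal_mul (by positivity)]
  have : |t| * |t| ^ n * |t⁻¹| ^ n * |t|⁻¹ = 1 := by
    have := abs_pos.2 ht
    rw [abs_inv, inv_pow]; field_simp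
  rw [this, ofReal_one, one_mul]
  refine lintegral_congr fun η => ?_
  rw [coneMap_eq, conePoint]
  simp only [starPart_joinLast, lastCoord_joinLast, inner_smul_left, inner_smul_right]
  congr 4
  field_simp
  simp

lemma tilde_coneMap (u : Eu² n → ℂ) {t : ℝ} (ht : t ≠ 0) (q : Eu² n) :
    tilde u (coneMap (t, q)) = u q := by
  obtain ⟨v, η⟩ := q
  rw [coneMap_eq, tilde]
  simp [smul_smul, ht]

/-- Up to null sets, the projection of the cone to its quotient. -/
def coneProj (z : Eu (n + 1) × Eu (n + 1)) : Eu² n :=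
  ((lastCoord z.1)⁻¹ • starPart z.1, lastCoord z.1 • starPart z.2)

lemma quasiMeasurePreserving_coneProj :
    Measure.QuasiMeasurePreserving (coneProj (n := n)) (coneMeasure n) volume := by
  have hm : Measurable (coneProj (n := n)) := by unfold coneProj; fun_prop
  refine ⟨hm, ?_⟩
  rw [coneMeasure_eq_map, Measure.map_map hm measurable_coneMap, Measure.map_congr (g := Prod.snd)]
  · exact quasiMeasurePreserving_snd.absolutelyContinuous
  filter_upwards [ae_prod_fst ae_ne_zero_scaleMeasure] with ⟨t, v, η⟩ hr
  simp only [Function.comp, coneMap_eq, coneProj]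
  simp [smul_smul, hr]

lemma ae_tilde_coneMap (u : Eu² n → ℂ) :
    ∀ᵐ r ∂(scaleMeasure.prod (volume : Measure (Eu² n))), tilde u (coneMap r) = u r.2 := by
  filter_upwards [ae_prod_fst ae_ne_zero_scaleMeasure] with r hr
  exact tilde_coneMap u hr r.2

lemma aestronglyMeasurable_tilde_mul {u : Eu² n → ℂ} (hu : AEStronglyMeasurable u volume)
    {φ : Chart n → ℂ} (hφ : Continuous φ) : AEStronglyMeasurable (fun z => tilde u z * φ z)
      ((scaleMeasure.prod volume).map coneMap) := by
  rw [← coneMeasure_eq_map]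
  exact (hu.comp_quasiMeasurePreserving quasiMeasurePreserving_coneProj).mul hφ.aestronglyMeasurable

/-- Integrals over the cone in the coordinates `(t, q) ∈ ℝˣ × Σ_n^•`. -/
lemma integrable_cone_iff {u : Eu² n → ℂ} (hu : AEStronglyMeasurable u volume)
    {φ : Chart n → ℂ} (hφ : Continuous φ) :
    Integrable (fun z => tilde u z * φ z) (coneMeasure n) ↔
      Integrable (fun r => u r.2 * φ (coneMap r)) (scaleMeasure.prod volume) := by
  rw [coneMeasure_eq_map, integrable_map_measure (aestronglyMeasurable_tilde_mul hu hφ)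
    measurable_coneMap.aemeasurable]
  exact integrable_congr ((ae_tilde_coneMap u).mono fun r hr => by simp only [Function.comp, hr])

lemma conePairing_eq {u : Eu² n → ℂ} (hu : AEStronglyMeasurable u volume)
    {φ : Chart n → ℂ} (hφ : Continuous φ) :
    conePairing u φ = ∫ r, u r.2 * φ (coneMap r) ∂(scaleMeasure.prod volume) := by
  rw [conePairing, coneMeasure_eq_map,
    integral_map measurable_coneMap.aemeasurable (aestronglyMeasurable_tilde_mul hu hφ)]
  exact integral_ext_ae (ae_tilde_coneMap u) fun r hr => by rw [hr]

end Cone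

/-! ### Coordinates adapted to dilations -/

section Fiber
variable {m : ℕ}

/-- The parameters `((ζ, w), ε)` of the half-lines `{(ζ, λ (w, 1)) : ε λ ⟨ζ, (w, 1)⟩ > 0}`. -/
abbrev RaySpace (m : ℕ) : Type := (Eu (m + 1) × Eu m) × Bool

/-- The product `⟨ζ, (w, 1)⟩`. -/
def rayDen (p : Eu (m + 1) × Eu m) : ℝ := ⟪p.1, joinLast p.2 1⟫

/-- The measure `|⟨ζ, (w, 1)⟩|⁻ⁿ dζ dw`, `n = m + 1`, on each of the two sheets. -/
def rayMeasure (m : ℕ) : Measure (RaySpace m) := ((volume : Measure (Eu (m + 1) × Eu m)).withDensity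
    fun p => ofReal (|rayDen p| ^ (m + 1))⁻¹).prod Measure.count

notation:max "rayVol" m:max => Measure.prod (rayMeasure m) (volume : Measure ℝ)

/-- The point of the half-line at which `⟨ζ, z⟩ = ε e ^ τ`. -/
def rayPoint (r : RaySpace m × ℝ) : Chart m :=
  (r.1.1.1, (boolSign r.1.2 * exp r.2 / rayDen r.1.1) • joinLast r.1.1.2 1)

/-- The coordinates of a point `(ζ, z)`. -/
def rayCoord (p : Chart m) : RaySpace m × ℝ :=
  (((p.1, (lastCoord p.2)⁻¹ • starPart p.2), decide (0 < ⟪p.1, p.2⟫)), log |⟪p.1, p.2⟫|)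

@[fun_prop]
lemma continuous_rayDen : Continuous (rayDen (m := m)) := by unfold rayDen; fun_prop

instance : SigmaFinite ((volume : Measure (Eu (m + 1) × Eu m)).withDensity
    fun p => ofReal (|rayDen p| ^ (m + 1))⁻¹) := SigmaFinite.withDensity_ofReal _

instance : SigmaFinite (rayMeasure m) := by unfold rayMeasure; infer_instance

lemma measurable_boolSign : Measurable boolSign := measurable_of_finite _

@[fun_prop]
lemma measurable_rayPoint : Measurable (rayPoint (m := m)) := by
  have := measurable_boolSign
  unfold rayPoint
  fun_prop

lemma measurable_rayCoord : Measurable (rayCoord (m := m)) := by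
  have h2 : Measurable fun p : Chart m => decide (0 < ⟪p.1, p.2⟫) := measurable_to_bool (by
    simpa [Set.preimage] using measurableSet_lt (f := fun _ : Chart m => (0 : ℝ))
      (g := fun p => ⟪p.1, p.2⟫) (by fun_prop) (by fun_prop))
  unfold rayCoord
  fun_prop

lemma ae_rayDen_ne_zero : ∀ᵐ r ∂(rayMeasure m), rayDen r.1 ≠ 0 := by
  refine ae_prod_fst (p := fun p => rayDen p ≠ 0) ?_
  rw [ae_withDensity_iff (by fun_prop)]
  exact .of_forall fun p hp h => hp (by simp [h])

lemma inner_rayPoint {r : RaySpace m × ℝ} (hr : rayDen r.1.1 ≠ 0) :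
    ⟪(rayPoint r).1, (rayPoint r).2⟫ = boolSign r.1.2 * exp r.2 := by
  simp only [rayPoint, inner_smul_right]
  change _ * rayDen r.1.1 = _
  field_simp

lemma rayCoord_rayPoint {r : RaySpace m × ℝ} (hr : rayDen r.1.1 ≠ 0) :
    rayCoord (rayPoint r) = r := by
  have h := inner_rayPoint hr
  rw [rayCoord, h]
  obtain ⟨⟨⟨ζ, w⟩, b⟩, τ⟩ := r
  have h1 : boolSign b * exp τ / rayDen (ζ, w) ≠ 0 :=
    div_ne_zero (mul_ne_zero (boolSign_ne_zero b) (exp_pos τ).ne') hr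
  have h2 : log |boolSign b * exp τ| = τ := by
    rw [abs_mul, abs_boolSign, one_mul, abs_of_pos (exp_pos τ), Real.log_exp]
  simp only [h2]
  simp only [rayPoint, smul_joinLast, lastCoord_joinLast, starPart_joinLast, mul_one, smul_smul,
    inv_mul_cancel₀ h1, one_smul]
  congr 2
  cases b <;> simp [exp_pos, (exp_pos τ).le]

lemma lintegral_rayMeasure (f : RaySpace m → ENNReal) (hf : Measurable f) :
    ∫⁻ r, f r ∂(rayMeasure m) = ∫⁻ p : Eu (m + 1) × Eu m,
      ofReal (|rayDen p| ^ (m + 1))⁻¹ * (f (p, true) + f (p, false)) := by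
  rw [rayMeasure, lintegral_prod _ hf.aemeasurable]
  have e : ∀ p, ∫⁻ b, f (p, b) ∂Measure.count = f (p, true) + f (p, false) := fun p => by
    rw [lintegral_count, tsum_fintype]; simp
  simp only [e]
  exact lintegral_withDensity_eq_lintegral_mul _ (by fun_prop) (by fun_prop)

lemma ae_volume_rayDen_ne_zero : ∀ᵐ p : Eu (m + 1) × Eu m, rayDen p ≠ 0 := by
  have key : ∀ w : Eu m, ∀ᵐ ζ : Eu (m + 1), rayDen (ζ, w) ≠ 0 := fun w => by
    have hw : joinLast w 1 ≠ 0 := fun h => one_ne_zero ((joinLast_eq_zero_iff _ _).1 h).2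
    have := Measure.addHaar_submodule (volume : Measure (Eu (m + 1))) (ℝ ∙ joinLast w 1)ᗮ
      fun h => hw (by simpa using h)
    rw [ae_iff]
    convert this using 2
    ext ζ
    simp [rayDen, Submodule.mem_orthogonal_singleton_iff_inner_left]
  have h2 : ∀ᵐ p ∂((volume : Measure (Eu m)).prod (volume : Measure (Eu (m + 1)))),
      rayDen (p.2, p.1) ≠ 0 := by
    rw [Measure.ae_prod_iff_ae_ae]
    · exact .of_forall key
    · exact measurable_swap (continuous_rayDen.measurable (measurableSet_singleton 0)).compl
  exact Measure.measurePreserving_swap.quasiMeasurePreserving.ae h2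

/-- `F ↦ e ^ (n τ / 2) F (rayPoint)` is unitary. -/
lemma isWeightedMap_ray : IsWeightedMap (rayVol m) volume
    (rayPoint (m := m)) rayCoord (fun r => exp ((m + 1 : ℕ) * r.2 / 2)) where
  measT := measurable_rayPoint
  measS := measurable_rayCoord
  measρ := by fun_prop
  pos r := exp_pos _
  left_inv := (ae_prod_fst ae_rayDen_ne_zero).mono fun r hr => rayCoord_rayPoint hr
  map_eq := by
    refine Measure.ext_of_lintegral _ fun f hf => ?_
    rw [lintegral_map hf measurable_rayPoint]
    refine (lintegral_withDensity_eq_lintegral_mul _ (by fun_prop) (by fun_prop)).trans ?_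
    rw [lintegral_prod _ (by fun_prop),
      lintegral_rayMeasure _ (Measurable.lintegral_prod_right' (by fun_prop)),
      volume_eq_prod (Eu (m + 1)) (Eu (m + 1)), lintegral_prod _ hf.aemeasurable]
    have e1 : ∀ ζ : Eu (m + 1), ∫⁻ z : Eu (m + 1), f (ζ, z) = ∫⁻ w : Eu m, ∫⁻ l : ℝ,
        ofReal (|l| ^ m) * f (ζ, joinLast (l • w) l) := fun ζ => by
      rw [lintegral_joinLast_smul _ (by fun_prop)]
      exact lintegral_lintegral_swap (by fun_prop)
    simp only [e1]
    rw [← lintegral_prod (μ := (volume : Measure (Eu (m + 1)))) (ν := (volume : Measure (Eu m)))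
      (fun p => ∫⁻ l : ℝ, ofReal (|l| ^ m) * f (p.1, joinLast (l • p.2) l))
      (Measurable.lintegral_prod_right (by fun_prop)).aemeasurable]
    refine lintegral_congr_ae ?_
    filter_upwards [ae_volume_rayDen_ne_zero (m := m)] with p hp
    refine Eq.trans ?_ ((lintegral_comp_mul (inv_ne_zero hp) fun l => ofReal (|l| ^ m) *
      f (p.1, joinLast (l • p.2) l)).trans (congrArg _ (lintegral_eq_exp _ (by fun_prop)))).symm
    have key : ∀ b : Bool, ofReal (|rayDen p| ^ (m + 1))⁻¹ * ∫⁻ τ : ℝ,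
        ofReal (exp ((m + 1 : ℕ) * τ / 2) ^ 2) * f (rayPoint ((p, b), τ)) =
        ofReal |(rayDen p)⁻¹| * ∫⁻ s, ofReal (exp s) * (ofReal (|(rayDen p)⁻¹ *
          (boolSign b * exp s)| ^ m) * f (p.1, joinLast (((rayDen p)⁻¹ * (boolSign b *
            exp s)) • p.2) ((rayDen p)⁻¹ * (boolSign b * exp s)))) := fun b => by
      rw [← lintegral_const_mul _ (by fun_prop), ← lintegral_const_mul _ (by fun_prop)]
      refine lintegral_congr fun s => ?_
      rw [← mul_assoc, ← mul_assoc, ← mul_assoc, ← ofReal_mul (by positivity),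
        ← ofReal_mul (by positivity), ← ofReal_mul (by positivity)]
      have hd0 : 0 < |rayDen p| := abs_pos.2 hp
      congr 2
      · rw [abs_mul, abs_mul, abs_boolSign, abs_of_pos (exp_pos s), one_mul, abs_inv, mul_pow, inv_pow,
          ← exp_nat_mul, ← exp_nat_mul, pow_succ]
        have : exp ((2 : ℕ) * ((m + 1 : ℕ) * s / 2)) = exp s * exp (m * s) := by
          rw [← exp_add]; congr 1; push_cast; ring
        rw [this]
        field_simp
      · simp only [rayPoint, smul_joinLast, mul_one]
        congr 2 <;> · congr 1; try ring
    rw [mul_add, mul_add]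
    simpa using congr_arg₂ (· + ·) (key true) (key false)

end Fiber

/-! ### Dilations, reflections, and the spectral representation -/

lemma TotalFam.clm_ext {E E' ι : Type*} [NormedAddCommGroup E] [InnerProductSpace ℂ E]
    [CompleteSpace E] [NormedAddCommGroup E'] [NormedSpace ℂ E'] {v : ι → E} (hv : TotalFam v)
    {A B : E →L[ℂ] E'} (h : ∀ i, A (v i) = B (v i)) (u : E) : A u = B u :=
  congr_arg (fun L : E →L[ℂ] E' => L u)
    (ContinuousLinearMap.ext_on hv.dense fun y hy => by obtain ⟨i, rfl⟩ := hy; exact h i)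

lemma unitary_eq_of_total {E E' ι : Type*} [NormedAddCommGroup E] [InnerProductSpace ℂ E]
    [CompleteSpace E] [NormedAddCommGroup E'] [InnerProductSpace ℂ E'] {v : ι → E}
    (hv : TotalFam v) (A B : E ≃ₗᵢ[ℂ] E') (h : ∀ i, A (v i) = B (v i)) (u : E) : A u = B u :=
  hv.clm_ext (A := (A.toContinuousLinearEquiv : E →L[ℂ] E'))
    (B := (B.toContinuousLinearEquiv : E →L[ℂ] E')) h u

lemma tensor_schwartz_total (n : ℕ) : TotalFam fun i : 𝓢(Eu n, ℂ) × 𝓢(Eu n, ℂ) =>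
    (tensor (i.1.toLp 2) (i.2.toLp 2) : L2Sigma n) := fun G h => by
  have hv : TotalFam fun a : 𝓢(Eu n, ℂ) => (a.toLp 2 : Lp ℂ 2 (volume : Measure (Eu n))) :=
    schwartz_total
  exact tensor_total_of_total hv hv G h

namespace IsWeightedMap

variable {X Z : Type*} [MeasurableSpace X] [MeasurableSpace Z]
  {μ : Measure X} {ν : Measure Z} {T : X → Z} {S : Z → X} {ρ : X → ℝ} (h : IsWeightedMap μ ν T S ρ)
include h

lemma integral_eq {f : Z → ℂ} (hf : AEStronglyMeasurable f ν) :
    ∫ z, f z ∂ν = ∫ x, ((ρ x ^ 2 : ℝ) : ℂ) * f (T x) ∂μ := by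
  rw [← h.map_eq] at hf ⊢
  rw [integral_map h.measT.aemeasurable hf, integral_withDensity_eq_integral_toReal_smul
    (h.measρ.pow_const 2).ennreal_ofReal (.of_forall fun x => ofReal_lt_top)]
  refine integral_ext fun x => ?_
  rw [ENNReal.toReal_ofReal (sq_nonneg _), real_smul]

lemma integrable_iff {f : Z → ℂ} (hf : AEStronglyMeasurable f ν) :
    Integrable f ν ↔ Integrable (fun x => ((ρ x ^ 2 : ℝ) : ℂ) * f (T x)) μ := by
  rw [← h.map_eq] at hf ⊢
  rw [integrable_map_measure hf h.measT.aemeasurable, integrable_withDensity_iff_integrable_smul'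
    (h.measρ.pow_const 2).ennreal_ofReal (.of_forall fun x => ofReal_lt_top)]
  refine integrable_congr (.of_forall fun x => ?_)
  simp only [Function.comp]
  rw [ENNReal.toReal_ofReal (sq_nonneg _), real_smul]

end IsWeightedMap

section Dilation

variable {n : ℕ}

/-- The dilation `(y, η) ↦ (y, c η)`. -/
lemma isWeightedMap_dilate (n : ℕ) {c : ℝ} (hc : c ≠ 0) :
    IsWeightedMap (volume : Measure (Eu² n)) volume (fun q => (q.1, c • q.2))
      (fun q => (q.1, c⁻¹ • q.2)) fun _ => sqrt (|c| ^ n) where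
  measT := by fun_prop
  measS := by fun_prop
  measρ := measurable_const
  pos _ := by positivity
  left_inv := .of_forall fun q => by simp [smul_smul, hc]
  map_eq := by
    refine Measure.ext_of_lintegral _ fun f hf => ?_
    rw [lintegral_map hf (by fun_prop)]
    refine (lintegral_withDensity_eq_lintegral_mul _ measurable_const (by fun_prop)).trans ?_
    simp only [Pi.mul_apply]
    rw [volume_eq_prod, lintegral_prod _ (by fun_prop), lintegral_prod _ hf.aemeasurable]
    refine lintegral_congr fun y => ?_
    rw [lintegral_comp_smul hc fun η => f (y, η), sq_sqrt (by positivity),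
      lintegral_const_mul _ (by fun_prop)]

/-- The unitary dilation `u(y, η) ↦ |c| ^ (n / 2) u(y, c η)`. -/
def dilate (n : ℕ) (c : ℝ) (hc : c ≠ 0) : L2Sigma n ≃ₗᵢ[ℂ] L2Sigma n :=
  (isWeightedMap_dilate n hc).unitary

lemma dilate_coe {c : ℝ} (hc : c ≠ 0) {u : L2Sigma n} {f : Eu² n → ℂ} (hf : u =ᵐ[volume] f) :
    dilate n c hc u =ᵐ[volume] fun q => (sqrt (|c| ^ n) : ℂ) * f (q.1, c • q.2) :=
  (isWeightedMap_dilate n hc).unitary_of_ae_eq hf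

lemma integrable_dilate {c : ℝ} (hc : c ≠ 0) {u : L2Sigma n} (hu : Integrable u volume) :
    Integrable (dilate n c hc u) volume := by
  have h1 := ((isWeightedMap_dilate n hc).integrable_iff (Lp.aestronglyMeasurable u)).1 hu
  have h0 : sqrt (|c| ^ n) ≠ 0 := (Real.sqrt_pos.2 (by positivity)).ne'
  refine (h1.const_mul ((sqrt (|c| ^ n) : ℂ))⁻¹).congr ?_
  filter_upwards [dilate_coe hc (.refl _ u)] with q hq
  rw [hq]; push_cast; field_simp

lemma sympChar_dilate (c : ℝ) (ζ z y η : Eu n) :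
    sympChar (ζ, z) (y, c • η) = sympChar (ζ, c • z) (y, η) := by
  simp only [sympChar, inner_smul_left, inner_smul_right, conj_trivial]

lemma sympF_dilate {c : ℝ} (hc : c ≠ 0) (u : L2Sigma n) :
    sympF n (dilate n c hc u) = dilate n c⁻¹ (inv_ne_zero hc) (sympF n u) := by
  refine unitary_eq_of_total (tensor_schwartz_total n) ((dilate n c hc).trans (sympF n))
    ((sympF n).trans (dilate n c⁻¹ (inv_ne_zero hc))) (fun i => ?_) u
  set v : L2Sigma n := tensor (i.1.toLp 2) (i.2.toLp 2)
  have hv : Integrable v volume :=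
    (i.1.integrable.mul_prod i.2.integrable).congr (tensor_schwartz_coe i.1 i.2).symm
  change sympF n (dilate n c hc v) = dilate n c⁻¹ (inv_ne_zero hc) (sympF n v)
  refine Lp.ext <| (sympF_ae_eq _ (integrable_dilate hc hv)).trans
    (.trans (.of_forall fun p => ?_) (dilate_coe _ (sympF_ae_eq v hv)).symm)
  simp only
  have h0 : (sqrt (|c| ^ n) : ℂ) ≠ 0 := by exact_mod_cast (Real.sqrt_pos.2 (by positivity)).ne'
  have e1 : (sqrt (|c⁻¹| ^ n) : ℂ) = (sqrt (|c| ^ n) : ℂ)⁻¹ := by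
    rw [abs_inv, inv_pow, Real.sqrt_inv]; push_cast; rfl
  have key := (isWeightedMap_dilate n hc).integral_eq (f := fun q =>
    (sqrt (|c| ^ n) : ℂ)⁻¹ * (conj (sympChar (p.1, c⁻¹ • p.2) q) * v q)) (by
    refine AEStronglyMeasurable.const_mul (AEStronglyMeasurable.mul ?_ (Lp.aestronglyMeasurable v)) _
    refine Continuous.aestronglyMeasurable (continuous_conj.comp ?_)
    unfold sympChar; fun_prop)
  rw [e1, ← integral_const_mul, key]
  refine integral_ext_ae (dilate_coe hc (.refl _ v)) fun q hq => ?_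
  rw [hq, ← sympChar_dilate]
  simp only [smul_smul, inv_mul_cancel₀ hc, one_smul]
  push_cast
  field_simp

end Dilation

section SpectralSide

variable {Y : Type*} [MeasurableSpace Y] {μ : Measure Y} [SigmaFinite μ]

lemma exists_mulCLM {X : Type*} [MeasurableSpace X] {μ : Measure X} {k : X → ℂ}
    (hk : Measurable k) (hk1 : ∀ x, ‖k x‖ ≤ 1) : ∃ M : Lp ℂ 2 μ →L[ℂ] Lp ℂ 2 μ,
      ∀ F, M F =ᵐ[μ] fun x => k x * F x := by
  have hK : MemLp k ⊤ μ := memLp_top_of_bound hk.aestronglyMeasurable 1 (.of_forall hk1)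
  refine ⟨(ContinuousLinearMap.mul ℂ ℂ).holderL μ ⊤ 2 2 hK.toLp, fun F => ?_⟩
  filter_upwards [(ContinuousLinearMap.mul ℂ ℂ).coeFn_holder (r := 2) hK.toLp F, hK.coeFn_toLp]
    with x h1 h2
  rw [← h2]; exact h1

/-- The translation `(o, τ) ↦ (o, τ - s)`. -/
lemma isWeightedMap_shift (μ : Measure Y) [SigmaFinite μ] (s : ℝ) :
    IsWeightedMap (μ.prod (volume : Measure ℝ)) (μ.prod volume) (fun r => (r.1, r.2 - s))
      (fun r => (r.1, r.2 + s)) fun _ => 1 where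
  measT := by fun_prop
  measS := by fun_prop
  measρ := measurable_const
  pos _ := one_pos
  left_inv := .of_forall fun r => by simp
  map_eq := by
    have h := ((MeasurePreserving.id μ).prod
      (measurePreserving_sub_right (volume : Measure ℝ) s)).map_eq
    simp only [one_pow, ofReal_one]
    rw [withDensity_const, one_smul]
    exact h

/-- The reflection `(o, τ) ↦ (o, -τ)`. -/
lemma isWeightedMap_reflect (μ : Measure Y) [SigmaFinite μ] :
    IsWeightedMap (μ.prod (volume : Measure ℝ)) (μ.prod volume) (fun r => (r.1, -r.2))
      (fun r => (r.1, -r.2)) fun _ => 1 := isWeightedMap_of_involutive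
    ((MeasurePreserving.id μ).prod (Measure.measurePreserving_neg (volume : Measure ℝ)))
    fun r => by simp

/-- The translation by `s` in the real variable, on `L²(Y × ℝ)`. -/
def shiftU (μ : Measure Y) [SigmaFinite μ] (s : ℝ) := (isWeightedMap_shift μ s).unitary

/-- The reflection of the real variable, on `L²(Y × ℝ)`. -/
def reflectU (μ : Measure Y) [SigmaFinite μ] := (isWeightedMap_reflect μ).unitary

lemma shiftU_coe (s : ℝ) {F : Lp ℂ 2 (μ.prod (volume : Measure ℝ))} {f : Y × ℝ → ℂ}
    (hf : F =ᵐ[μ.prod volume] f) : shiftU μ s F =ᵐ[μ.prod volume] fun r => f (r.1, r.2 - s) := by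
  exact ((isWeightedMap_shift μ s).unitary_of_ae_eq hf).trans (.of_forall fun r => by simp)

lemma reflectU_coe {F : Lp ℂ 2 (μ.prod (volume : Measure ℝ))} {f : Y × ℝ → ℂ}
    (hf : F =ᵐ[μ.prod volume] f) : reflectU μ F =ᵐ[μ.prod volume] fun r => f (r.1, -r.2) := by
  exact ((isWeightedMap_reflect μ).unitary_of_ae_eq hf).trans (.of_forall fun r => by simp)

lemma tensor_total_schwartz_right (μ : Measure Y) [SigmaFinite μ] :
    TotalFam fun i : Lp ℂ 2 μ × 𝓢(ℝ, ℂ) => tensor i.1 (i.2.toLp 2) := fun G h => by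
  have hv : TotalFam fun a : 𝓢(ℝ, ℂ) => (a.toLp 2 : Lp ℂ 2 (volume : Measure ℝ)) := schwartz_total
  have hw : TotalFam fun g : Lp ℂ 2 μ => g := fun G hG => inner_self_eq_zero.1 (hG G)
  exact tensor_total_of_total hw hv G h

lemma partialF_of_ae_eq (g : Lp ℂ 2 μ) {b : ℝ → ℂ} (hb : Measurable b) (hb1 : Integrable b)
    (F : Lp ℂ 2 (μ.prod (volume : Measure ℝ))) (hF : F =ᵐ[μ.prod volume] fun p => g p.1 * b p.2) :
    partialF μ F =ᵐ[μ.prod volume] fun p => g p.1 * 𝓕 b p.2 := by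
  have hg := (Lp.stronglyMeasurable g).measurable
  have h2 : MemLp (fun p : Y × ℝ => g p.1 * b p.2) 2 (μ.prod volume) :=
    (memLp_congr_ae hF).1 (Lp.memLp F)
  have e : F = h2.toLp := Lp.ext (hF.trans h2.coeFn_toLp.symm)
  rw [e]
  refine (partialF_ae_eq (by fun_prop) h2 (Lp.memLp g).norm
    (B := fun τ => ‖b τ‖ + exp (-1 * τ ^ 2)) (hb1.norm.add (integrable_exp_neg_mul_sq one_pos))
    (fun p => ?_) fun τ => by positivity).trans (.of_forall fun p => ?_)
  · rw [norm_mul]; gcongr; linarith [exp_pos (-1 * p.2 ^ 2)]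
  · simp only [fourier_eq', smul_eq_mul]
    rw [← integral_const_mul]
    refine integral_ext fun τ => ?_
    ring

lemma fourier_shift (b : ℝ → ℂ) (s ξ : ℝ) :
    𝓕 (fun τ => b (τ - s)) ξ = cexp (-(I * (s * (2 * π * ξ)))) * 𝓕 b ξ := by
  rw [fourier_eq', fourier_eq', ← integral_sub_right_eq_self _ (-s), ← integral_const_mul]
  refine integral_ext fun τ => ?_
  simp only [smul_eq_mul, inner_apply, conj_trivial, sub_neg_eq_add, add_sub_cancel_right]
  rw [← mul_assoc (cexp _) (cexp _), ← Complex.exp_add]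
  congr 2; push_cast; ring

lemma fourier_reflect (b : ℝ → ℂ) (ξ : ℝ) : 𝓕 (fun τ => b (-τ)) ξ = 𝓕 b (-ξ) := by
  rw [fourier_eq', fourier_eq', ← integral_neg_eq_self]
  refine integral_ext fun τ => ?_
  simp

/-- The frequency variable `a = 2 π ξ`. -/
def freq (r : Y × ℝ) : ℝ := 2 * π * r.2

lemma partialF_shift_tensor (s : ℝ) (g : Lp ℂ 2 μ) (b : 𝓢(ℝ, ℂ)) :
    partialF μ (shiftU μ s (tensor g (b.toLp 2))) =ᵐ[μ.prod volume]
      fun r => cexp (-(I * (s * freq r))) * partialF μ (tensor g (b.toLp 2)) r := by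
  refine (partialF_of_ae_eq g (b := fun τ => b (τ - s)) (by have := b.continuous; fun_prop)
    (b.integrable.comp_sub_right s) _ (shiftU_coe s (tensor_schwartz_right_coe g b))).trans ?_
  filter_upwards [partialF_of_ae_eq g b.continuous.measurable b.integrable _
    (tensor_schwartz_right_coe g b)] with r hr
  rw [hr, fourier_shift, freq]
  push_cast; ring

lemma partialF_shift (s : ℝ) (F : Lp ℂ 2 (μ.prod (volume : Measure ℝ))) :
    partialF μ (shiftU μ s F) =ᵐ[μ.prod volume]
      fun r => cexp (-(I * (s * freq r))) * partialF μ F r := by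
  obtain ⟨M, hM⟩ := exists_mulCLM (μ := μ.prod (volume : Measure ℝ))
    (k := fun r : Y × ℝ => cexp (-(I * (s * freq r))))
    (by unfold freq; fun_prop) fun r => by rw [norm_exp]; simp
  have e : partialF μ (shiftU μ s F) = M (partialF μ F) := (tensor_total_schwartz_right μ).clm_ext
    (A := ((shiftU μ s).trans (partialF μ)).toContinuousLinearEquiv)
    (B := M ∘L ((partialF μ).toContinuousLinearEquiv : _ →L[ℂ] _)) (fun i =>
      Lp.ext ((partialF_shift_tensor s i.1 i.2).trans (hM _).symm)) F
  exact e ▸ hM _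

lemma partialF_reflect (F : Lp ℂ 2 (μ.prod (volume : Measure ℝ))) :
    partialF μ (reflectU μ F) = reflectU μ (partialF μ F) := by
  refine unitary_eq_of_total (tensor_total_schwartz_right _) ((reflectU μ).trans (partialF μ))
    ((partialF μ).trans (reflectU μ)) (fun i => Lp.ext ?_) F
  obtain ⟨g, b⟩ := i
  refine (partialF_of_ae_eq g (b := fun τ => b (-τ)) (by have := b.continuous; fun_prop)
    b.integrable.comp_neg _ (reflectU_coe (tensor_schwartz_right_coe g b))).trans ?_
  refine .trans (.of_forall fun r => ?_) (reflectU_coe (partialF_of_ae_eq g b.continuous.measurable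
    b.integrable _ (tensor_schwartz_right_coe g b))).symm
  simp only [fourier_reflect]

end SpectralSide

section Spectral
variable {m : ℕ}

/-- The exchange of the two sheets of `RaySpace`. -/
lemma measurePreserving_flip : MeasurePreserving (fun o : RaySpace m => (o.1, !o.2))
    (rayMeasure m) (rayMeasure m) := by
  have h : MeasurePreserving (fun b : Bool => !b) Measure.count Measure.count := by
    refine ⟨measurable_of_finite _, Measure.ext fun s _ => ?_⟩
    rw [Measure.map_apply (measurable_of_finite _) (Set.toFinite s).measurableSet]
    exact Measure.count_injective_image (f := fun b : Bool => !b) Bool.not_injective _ ▸ (by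
      congr 1; ext b; simp)
  exact (MeasurePreserving.id _).prod h

lemma isWeightedMap_flip (m : ℕ) : IsWeightedMap (rayVol m)
    (rayVol m) (fun r => ((r.1.1, !r.1.2), r.2))
      (fun r => ((r.1.1, !r.1.2), r.2)) fun _ => 1 :=
  isWeightedMap_of_involutive (measurePreserving_flip.prod (MeasurePreserving.id _))
    fun r => by simp

/-- The exchange of the two sheets, on `L²`. -/
def flipU (m : ℕ) := (isWeightedMap_flip m).unitary

lemma flipU_coe {F : Lp ℂ 2 (rayVol m)}
    {f : RaySpace m × ℝ → ℂ} (hf : F =ᵐ[rayVol m] f) :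
    flipU m F =ᵐ[rayVol m] fun r => f ((r.1.1, !r.1.2), r.2) := by
  exact ((isWeightedMap_flip m).unitary_of_ae_eq hf).trans (.of_forall fun r => by simp)

lemma partialF_flip (F : Lp ℂ 2 (rayVol m)) :
    partialF (rayMeasure m) (flipU m F) = flipU m (partialF (rayMeasure m) F) := by
  refine unitary_eq_of_total (tensor_total_schwartz_right _) ((flipU m).trans (partialF (rayMeasure m)))
    ((partialF (rayMeasure m)).trans (flipU m)) (fun i => Lp.ext ?_) F
  obtain ⟨g, b⟩ := i
  have hw := isWeightedMap_of_involutive (measurePreserving_flip (m := m)) fun o => by simp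
  have hg : hw.unitary g =ᵐ[rayMeasure m] fun o => g (o.1, !o.2) := by simpa using hw.unitary_coe g
  refine (partialF_of_ae_eq (hw.unitary g) b.continuous.measurable b.integrable _ ?_).trans ?_
  · refine (flipU_coe (tensor_schwartz_right_coe g b)).trans ?_
    filter_upwards [ae_prod_fst hg] with r hr
    rw [hr]
  · refine .trans ?_ (flipU_coe (partialF_of_ae_eq g b.continuous.measurable
      b.integrable _ (tensor_schwartz_right_coe g b))).symm
    filter_upwards [ae_prod_fst hg] with r hr
    rw [hr]

/-- The passage to the coordinates of `rayPoint`. -/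
def rayU (m : ℕ) : L2Sigma (m + 1) ≃ₗᵢ[ℂ] Lp ℂ 2 (rayVol m) :=
  isWeightedMap_ray.unitary

lemma rayU_coe {F : L2Sigma (m + 1)} {f : Chart m → ℂ} (hf : F =ᵐ[volume] f) :
    rayU m F =ᵐ[rayVol m]
      fun r => (exp ((m + 1 : ℕ) * r.2 / 2) : ℂ) * f (rayPoint r) :=
  isWeightedMap_ray.unitary_of_ae_eq hf

lemma rayU_dilate_exp (s : ℝ) (F : L2Sigma (m + 1)) :
    rayU m (dilate (m + 1) (exp (-s)) (exp_ne_zero _) F) = shiftU (rayMeasure m) s (rayU m F) := by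
  refine Lp.ext ((rayU_coe (dilate_coe _ (.refl _ F))).trans
    (.trans (.of_forall fun r => ?_) (shiftU_coe s (rayU_coe (.refl _ F))).symm))
  have e1 : rayPoint (r.1, r.2 - s) = ((rayPoint r).1, exp (-s) • (rayPoint r).2) := by
    simp only [rayPoint, smul_smul]
    congr 2
    rw [sub_eq_add_neg, exp_add]; ring
  simp only
  rw [e1, ← mul_assoc, ← Complex.ofReal_mul, Real.sqrt_eq_rpow, ← rpow_natCast,
    ← Real.rpow_mul (abs_nonneg _), abs_of_pos (exp_pos _), ← exp_mul, ← exp_add]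
  congr 3
  ring

lemma rayU_dilate_neg_one (F : L2Sigma (m + 1)) :
    rayU m (dilate (m + 1) (-1) (by norm_num) F) = flipU m (rayU m F) := by
  refine Lp.ext ((rayU_coe (dilate_coe _ (.refl _ F))).trans
    (.trans (.of_forall fun r => ?_) (flipU_coe (rayU_coe (.refl _ F))).symm))
  have e1 : rayPoint ((r.1.1, !r.1.2), r.2) = ((rayPoint r).1, (-1 : ℝ) • (rayPoint r).2) := by
    simp only [rayPoint, smul_smul, boolSign_not]
    congr 2; ring
  simp only
  rw [e1]
  simp

/-- The spectral representation of the group of dilations: the symplectic Fourier transformation,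
followed by the Fourier transformation along the half-lines `RaySpace`. -/
def spectralU (m : ℕ) : L2Sigma (m + 1) ≃ₗᵢ[ℂ] Lp ℂ 2 (rayVol m) :=
  (sympF (m + 1)).trans ((rayU m).trans (partialF (rayMeasure m)))

lemma spectralU_apply (u : L2Sigma (m + 1)) :
    spectralU m u = partialF (rayMeasure m) (rayU m (sympF (m + 1) u)) := rfl

lemma spectralU_dilate_exp (s : ℝ) (u : L2Sigma (m + 1)) :
    spectralU m (dilate (m + 1) (exp s) (exp_ne_zero _) u) =ᵐ[rayVol m]
      fun r => cexp (-(I * (s * freq r))) * spectralU m u r := by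
  rw [spectralU_apply, sympF_dilate]
  have : dilate (m + 1) (exp s)⁻¹ (inv_ne_zero (exp_ne_zero _)) (sympF (m + 1) u) =
      dilate (m + 1) (exp (-s)) (exp_ne_zero _) (sympF (m + 1) u) := by
    simp only [exp_neg]
  rw [this, rayU_dilate_exp]
  exact partialF_shift s _

lemma spectralU_dilate_neg_one (u : L2Sigma (m + 1)) :
    spectralU m (dilate (m + 1) (-1) (by norm_num) u) = flipU m (spectralU m u) := by
  rw [spectralU_apply, sympF_dilate]
  have : dilate (m + 1) (-1)⁻¹ (inv_ne_zero (by norm_num)) (sympF (m + 1) u) =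
      dilate (m + 1) (-1) (by norm_num) (sympF (m + 1) u) := by
    congr 1; norm_num
  rw [this, rayU_dilate_neg_one, partialF_flip]
  rfl

end Spectral

/-! ### The Euler operator as a multiplication operator -/

section Euler
variable {n : ℕ}

lemma hasCompactSupport_conj {α : Type*} [TopologicalSpace α] {χ : α → ℂ} (hs : HasCompactSupport χ) :
    HasCompactSupport fun q => conj (χ q) := hs.comp_left (map_zero _)

lemma contDiff_conj {E : Type*} [NormedAddCommGroup E] [NormedSpace ℝ E] {χ : E → ℂ}
    (h : ContDiff ℝ ∞ χ) : ContDiff ℝ ∞ fun q => conj (χ q) := Complex.conjCLE.contDiff.comp h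

/-- The conjugate of a test function, as a vector of `L²`. -/
def conjTest {χ : Eu² n → ℂ} (h : ContDiff ℝ ∞ χ) (hs : HasCompactSupport χ) : L2Sigma n :=
  ((contDiff_conj h).continuous.memLp_of_hasCompactSupport (p := 2)
    (hasCompactSupport_conj hs)).toLp

lemma conjTest_coe {χ : Eu² n → ℂ} (h : ContDiff ℝ ∞ χ) (hs : HasCompactSupport χ) :
    conjTest h hs =ᵐ[volume] fun q => conj (χ q) := MemLp.coeFn_toLp _

lemma inner_conjTest {χ : Eu² n → ℂ} (h : ContDiff ℝ ∞ χ) (hs : HasCompactSupport χ)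
    (Φ : L2Sigma n) : ⟪conjTest h hs, Φ⟫_ℂ = ∫ q, Φ q * χ q := by
  rw [inner_eq_integral (conjTest_coe h hs) (.refl _ Φ)]
  simp only [conj_conj]

lemma conjTest_total :
    TotalFam fun χ : {χ : Eu² n → ℂ // ContDiff ℝ ∞ χ ∧ HasCompactSupport χ} =>
      conjTest χ.2.1 χ.2.2 := fun G h => by
  refine Lp.eq_zero_iff_ae_eq_zero.2 <| ae_eq_zero_of_integral_contDiff_smul_eq_zero
    ((Lp.memLp G).locallyIntegrable (by norm_num)) fun g hg hgs => ?_
  rw [← h ⟨fun p => (g p : ℂ), ofRealCLM.contDiff.comp hg, hgs.comp_left ofReal_zero⟩,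
    inner_conjTest]
  exact integral_ext fun p => by simp [mul_comm]

/-- The dilation of a function by `e ^ s`. -/
def dilFun (s : ℝ) (χ : Eu² n → ℂ) (q : Eu² n) : ℂ :=
  (exp (n * s / 2) : ℂ) * χ (q.1, exp s • q.2)

lemma dilFun_add (s t : ℝ) (χ : Eu² n → ℂ) : dilFun (s + t) χ = dilFun t (dilFun s χ) := by
  funext q
  simp only [dilFun, smul_smul, ← exp_add, ← mul_assoc, ← Complex.ofReal_mul]
  congr 3; ring

lemma dilFun_zero (χ : Eu² n → ℂ) : dilFun 0 χ = χ := by funext q; simp [dilFun]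

lemma contDiff_dilFun (s : ℝ) {χ : Eu² n → ℂ} (h : ContDiff ℝ ∞ χ) :
    ContDiff ℝ ∞ (dilFun s χ) := by
  unfold dilFun; fun_prop

lemma hasCompactSupport_dilate {c : ℝ} (hc : c ≠ 0) {χ : Eu² n → ℂ}
    (hs : HasCompactSupport χ) : HasCompactSupport fun q : Eu² n => χ (q.1, c • q.2) :=
  hs.comp_homeomorph ((Homeomorph.refl (Eu n)).prodCongr (Homeomorph.smulOfNeZero c hc))

lemma hasCompactSupport_dilFun (s : ℝ) {χ : Eu² n → ℂ} (hs : HasCompactSupport χ) :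
    HasCompactSupport (dilFun s χ) := (hasCompactSupport_dilate (exp_ne_zero s) hs).mul_left

lemma sqrt_exp_pow (s : ℝ) : sqrt (|exp s| ^ n) = exp (n * s / 2) := by
  rw [abs_of_pos (exp_pos s), ← exp_nat_mul, Real.sqrt_eq_rpow, ← exp_mul]
  congr 1; ring

lemma conjTest_dilFun (s : ℝ) {χ : Eu² n → ℂ} (h : ContDiff ℝ ∞ χ)
    (hs : HasCompactSupport χ) : conjTest (contDiff_dilFun s h) (hasCompactSupport_dilFun s hs) =
      dilate n (exp s) (exp_ne_zero s) (conjTest h hs) := by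
  refine Lp.ext ((conjTest_coe _ _).trans (.trans (.of_forall fun q => ?_)
    (dilate_coe _ (conjTest_coe h hs)).symm))
  simp only [dilFun, map_mul, conj_ofReal, sqrt_exp_pow]

/-- The Euler operator, shifted so as to be formally skew-adjoint. -/
def eulerSkew (χ : Eu² n → ℂ) (q : Eu² n) : ℂ := (n : ℂ) / 2 * χ q + eulerDeriv χ q

lemma hasDerivAt_dilFun {χ : Eu² n → ℂ} (h : ContDiff ℝ ∞ χ) (q : Eu² n) (s : ℝ) :
    HasDerivAt (fun s => dilFun s χ q) (dilFun s (eulerSkew χ) q) s := by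
  have h1 : HasDerivAt (fun s : ℝ => (q.1, exp s • q.2)) ((0 : Eu n), exp s • q.2) s :=
    (hasDerivAt_const s q.1).prodMk ((Real.hasDerivAt_exp s).smul_const q.2)
  have h2 := ((h.differentiable (by simp)) (q.1, exp s • q.2)).hasFDerivAt.comp_hasDerivAt s h1
  have h3 := (((hasDerivAt_id s).const_mul (n : ℝ)).div_const 2).exp.ofReal_comp
  refine (h3.mul h2).congr_deriv ?_
  simp only [dilFun, eulerSkew, eulerDeriv, Function.comp, id]
  push_cast; ring

lemma continuous_eulerSkew {χ : Eu² n → ℂ} (h : ContDiff ℝ ∞ χ) :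
    Continuous (eulerSkew χ) := by
  have h1 : Continuous (fderiv ℝ χ) := h.continuous_fderiv (by simp)
  have h2 := h.continuous
  unfold eulerSkew eulerDeriv
  fun_prop

lemma hasCompactSupport_eulerSkew {χ : Eu² n → ℂ} (h : HasCompactSupport χ) :
    HasCompactSupport (eulerSkew χ) := by
  refine .add h.mul_left ((h.fderiv ℝ).mono fun p hp hh => hp ?_)
  simp [eulerDeriv, hh]

lemma hasDerivAt_integral_dilFun {χ : Eu² n → ℂ} (h : ContDiff ℝ ∞ χ)
    (hs : HasCompactSupport χ) (Φ : L2Sigma n) :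
    HasDerivAt (fun s => ∫ q, Φ q * dilFun s χ q) (∫ q, Φ q * eulerSkew χ q) 0 := by
  obtain ⟨M, hM⟩ := (hasCompactSupport_eulerSkew hs).exists_bound_of_continuous
    (continuous_eulerSkew h)
  obtain ⟨R, hR⟩ := (hasCompactSupport_eulerSkew hs).isCompact.isBounded.subset_closedBall 0
  have hM0 : 0 ≤ M := (norm_nonneg _).trans (hM 0)
  set B : Set (Eu² n) := Metric.closedBall 0 (exp 1 * |R|)
  have key := hasDerivAt_integral_of_dominated_loc_of_deriv_le (μ := (volume : Measure (Eu² n)))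
    (F := fun s q => Φ q * dilFun s χ q) (F' := fun s q => Φ q * dilFun s (eulerSkew χ) q)
    (x₀ := 0) (s := Metric.ball 0 1) (bound := fun q => B.indicator (fun q => ‖Φ q‖) q *
      (exp n * M)) (Metric.ball_mem_nhds 0 one_pos) ?_ ?_ ?_ ?_ ?_ ?_
  · simpa only [dilFun_zero] using key.2
  · refine .of_forall fun s => (Lp.aestronglyMeasurable Φ).mul ?_
    exact (contDiff_dilFun s h).continuous.aestronglyMeasurable
  · rw [dilFun_zero]; exact integrable_L2_mul Φ h.continuous hs
  · rw [dilFun_zero]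
    exact (Lp.aestronglyMeasurable Φ).mul (continuous_eulerSkew h).aestronglyMeasurable
  · refine .of_forall fun q s hs' => ?_
    have hs1 : |s| < 1 := by simpa using hs'
    have hs2 := abs_lt.1 hs1
    by_cases hq : eulerSkew χ (q.1, exp s • q.2) = 0
    · simp only [dilFun, hq, mul_zero, norm_zero]
      exact mul_nonneg (Set.indicator_nonneg (fun _ _ => norm_nonneg _) _) (by positivity)
    · have hmem := hR (subset_tsupport _ hq)
      rw [Metric.mem_closedBall, dist_zero_right, Prod.norm_def, max_le_iff] at hmem
      have hqB : q ∈ B := by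
        rw [Metric.mem_closedBall, dist_zero_right, Prod.norm_def, max_le_iff]
        have h1 : 1 ≤ exp 1 := Real.one_le_exp zero_le_one
        have hRR := le_abs_self R
        refine ⟨hmem.1.trans (hRR.trans (le_mul_of_one_le_left (abs_nonneg R) h1)), ?_⟩
        have e : ‖q.2‖ = exp (-s) * ‖exp s • q.2‖ := by
          rw [norm_smul, norm_of_nonneg (exp_pos s).le, ← mul_assoc, ← exp_add]; simp
        rw [e]
        gcongr
        exacts [by linarith, hmem.2.trans hRR]
      rw [indicator_of_mem hqB, norm_mul, dilFun, norm_mul, norm_real, norm_of_nonneg (exp_pos _).le]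
      gcongr
      exacts [by nlinarith [n.cast_nonneg (α := ℝ)], hM _]
  · have hB : IsCompact B := isCompact_closedBall _ _
    have : IntegrableOn (fun q => ‖Φ q‖) B :=
      (((Lp.memLp Φ).locallyIntegrable (by norm_num)).integrableOn_isCompact hB).norm
    exact (this.integrable_indicator hB.measurableSet).mul_const _
  · exact .of_forall fun q s _ => (hasDerivAt_dilFun h q s).const_mul _

lemma weakEuler_iff_skew (Φ Ψ : L2Sigma n) : WeakEuler Φ Ψ ↔
    ∀ χ : Eu² n → ℂ, ContDiff ℝ ∞ χ → HasCompactSupport χ →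
      ∫ q, Φ q * eulerSkew χ q = I * ∫ q, Ψ q * χ q := by
  rw [weakEuler_iff]
  refine forall₃_congr fun χ h hs => ?_
  have e : ∫ q, Φ q * (-((n : ℂ) * χ q + eulerDeriv χ q)) =
      -(∫ q, Φ q * eulerSkew χ q) - (n : ℂ) / 2 * ∫ q, Φ q * χ q := by
    have i1 : Integrable fun q => -(Φ q * eulerSkew χ q) :=
      (integrable_L2_mul Φ (continuous_eulerSkew h) (hasCompactSupport_eulerSkew hs)).neg
    rw [← integral_const_mul, ← integral_neg, ← integral_sub i1 ((integrable_L2_mul Φ h.continuous hs).const_mul _)]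
    refine integral_ext fun q => ?_
    simp only [eulerSkew]; ring
  rw [e]
  constructor <;> intro H <;> linear_combination -H

end Euler

section EulerSpectral
variable {m : ℕ}

lemma inner_dilate_eq (s : ℝ) (c Φ : L2Sigma (m + 1)) :
    ⟪dilate (m + 1) (exp s) (exp_ne_zero s) c, Φ⟫_ℂ = ∫ r, cexp (I * (s * freq r)) *
        (spectralU m Φ r * conj (spectralU m c r)) ∂(rayVol m) := by
  rw [← (spectralU m).inner_map_map, inner_eq_integral (spectralU_dilate_exp s c) (.refl _ _)]
  refine integral_ext fun r => ?_
  rw [map_mul, ← exp_conj]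
  simp only [map_neg, map_mul, conj_I, conj_ofReal]
  ring_nf

lemma integrable_mul_conj {X : Type*} [MeasurableSpace X] {μ : Measure X} (F G : Lp ℂ 2 μ) :
    Integrable (fun r => F r * conj (G r)) μ := integrable_mul_conj_of_ae_eq (.refl _ G) (.refl _ F)

@[fun_prop]
lemma measurable_freq {Y : Type*} [MeasurableSpace Y] : Measurable (freq (Y := Y)) := by
  unfold freq; fun_prop

lemma norm_exp_I_freq (s a : ℝ) : ‖cexp (I * (s * a))‖ = 1 := by rw [norm_exp]; simp

lemma ae_exp_freq_ne_one {Y : Type*} [MeasurableSpace Y] (μ : Measure Y) [SigmaFinite μ] :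
    ∀ᵐ r ∂(μ.prod (volume : Measure ℝ)), cexp (I * freq r) ≠ 1 := by
  refine ae_prod_snd (p := fun ξ => cexp (I * ((2 * π * ξ : ℝ) : ℂ)) ≠ 1) ?_
  filter_upwards [(Set.countable_range fun k : ℤ => (k : ℝ)).ae_notMem volume] with ξ hξ h
  obtain ⟨k, hk⟩ := Complex.exp_eq_one_iff.1 h
  refine hξ ⟨k, ?_⟩
  have h2 : ((2 * π * ξ : ℝ) : ℂ) = (2 * π * k : ℝ) :=
    mul_left_cancel₀ I_ne_zero (hk.trans (by push_cast; ring))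
  exact mul_left_cancel₀ (by positivity) (ofReal_inj.1 h2).symm

/-- The averages `i ∫₀¹ e ^ {i s a} ds`. -/
lemma freq_mul_integral_exp (a : ℝ) : (a : ℂ) * (I * ∫ s in (0 : ℝ)..1, cexp (I * (s * a))) =
      cexp (I * a) - 1 := by
  by_cases ha : a = 0
  · simp [ha]
  have ha' : (a : ℂ) ≠ 0 := by exact_mod_cast ha
  have hI : I * (a : ℂ) ≠ 0 := mul_ne_zero I_ne_zero ha'
  simp_rw [mul_comm _ (a : ℂ), ← mul_assoc I, integral_exp_mul_complex hI]
  simp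
  field_simp

theorem weakEuler_iff_spectral (Φ Ψ : L2Sigma (m + 1)) : WeakEuler Φ Ψ ↔
    spectralU m Ψ =ᵐ[rayVol m] fun r => (freq r : ℂ) * spectralU m Φ r := by
  rw [weakEuler_iff_skew]
  set μ := rayVol m
  constructor
  · intro H
    -- the bounded function of the frequency obtained by integrating the group over `[0, 1]`
    set k : RaySpace m × ℝ → ℂ := fun r => I * ∫ s in (0 : ℝ)..1, cexp (I * (s * freq r)) with hk
    have hkm : Measurable k := by
      simp only [hk, intervalIntegral.integral_of_le zero_le_one]
      exact (StronglyMeasurable.integral_prod_right (f := fun (r : RaySpace m × ℝ) (s : ℝ) =>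
        cexp (I * (s * freq r))) (Measurable.stronglyMeasurable (by fun_prop))).measurable.const_mul _
    have hkb : ∀ r, ‖k r‖ ≤ 1 := fun r => by
      rw [hk, norm_mul, norm_I, one_mul]
      refine (intervalIntegral.norm_integral_le_of_norm_le_const (C := 1) fun s _ => ?_).trans
        (by simp)
      rw [norm_exp_I_freq]
    have hem : Measurable fun r : RaySpace m × ℝ => cexp (I * freq r) - 1 := by fun_prop
    have heb : ∀ r : RaySpace m × ℝ, ‖cexp (I * freq r) - 1‖ ≤ 2 := fun r => by
      refine (norm_sub_le _ _).trans ?_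
      rw [norm_exp]; norm_num
    have hA := memLp_bounded_mul hem heb (spectralU m Φ)
    have hB := memLp_bounded_mul hkm hkb (spectralU m Ψ)
    have key : hA.toLp = hB.toLp := by
      rw [← sub_eq_zero]
      refine (spectralU m).symm.map_eq_zero_iff.1 (conjTest_total _ fun χ => ?_)
      set c := conjTest χ.2.1 χ.2.2
      rw [← (spectralU m).inner_map_map, LinearIsometryEquiv.apply_symm_apply, inner_sub_right,
        sub_eq_zero]
      have hj : ∀ s : ℝ, HasDerivAt (fun s => ⟪dilate (m + 1) (exp s) (exp_ne_zero s) c, Φ⟫_ℂ)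
          (I * ⟪dilate (m + 1) (exp s) (exp_ne_zero s) c, Ψ⟫_ℂ) s := fun s => by
        have h1 := hasDerivAt_integral_dilFun (contDiff_dilFun s χ.2.1)
          (hasCompactSupport_dilFun s χ.2.2) Φ
        rw [H _ (contDiff_dilFun s χ.2.1) (hasCompactSupport_dilFun s χ.2.2),
          ← inner_conjTest (contDiff_dilFun s χ.2.1) (hasCompactSupport_dilFun s χ.2.2),
          conjTest_dilFun] at h1
        have h2 : ∀ t, ∫ q, Φ q * dilFun t (dilFun s χ.1) q =
            ⟪dilate (m + 1) (exp (s + t)) (exp_ne_zero _) c, Φ⟫_ℂ := fun t => by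
          rw [← conjTest_dilFun, inner_conjTest, dilFun_add]
        simp only [h2] at h1
        have h3 := HasDerivAt.comp_sub_const (f := fun t => ⟪dilate (m + 1) (exp (s + t))
          (exp_ne_zero _) c, Φ⟫_ℂ) s s (by rw [sub_self]; exact h1)
        simpa using h3
      have hcont : Continuous fun s : ℝ => ⟪dilate (m + 1) (exp s) (exp_ne_zero s) c, Ψ⟫_ℂ := by
        simp only [inner_dilate_eq]
        refine continuous_of_dominated (bound := fun r => ‖spectralU m Ψ r *
          conj (spectralU m c r)‖) (fun s => ?_) (fun s => .of_forall fun r => ?_)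
          (integrable_mul_conj _ _).norm (.of_forall fun r => by fun_prop)
        · exact (Measurable.aestronglyMeasurable (by fun_prop)).mul
            (integrable_mul_conj _ _).aestronglyMeasurable
        · rw [norm_mul, norm_exp_I_freq, one_mul]
      have hftc := intervalIntegral.integral_eq_sub_of_hasDerivAt (a := 0) (b := 1)
        (fun s _ => hj s) ((hcont.const_mul _).intervalIntegrable 0 1)
      have eA : ⟪spectralU m c, hA.toLp⟫_ℂ = ⟪dilate (m + 1) (exp 1) (exp_ne_zero 1) c, Φ⟫_ℂ -
          ⟪dilate (m + 1) (exp 0) (exp_ne_zero 0) c, Φ⟫_ℂ := by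
        rw [inner_dilate_eq, inner_dilate_eq, ← integral_sub,
          inner_eq_integral (.refl _ _) hA.coeFn_toLp]
        · refine integral_ext fun r => ?_
          simp; ring
        all_goals
          refine (integrable_mul_conj _ _).bdd_mul (c := 1)
            (Measurable.aestronglyMeasurable (by fun_prop)) (.of_forall fun r => ?_)
          rw [norm_exp_I_freq]
      have eB : ⟪spectralU m c, hB.toLp⟫_ℂ = ∫ s in (0 : ℝ)..1, I *
          ⟪dilate (m + 1) (exp s) (exp_ne_zero s) c, Ψ⟫_ℂ := by
        simp only [inner_dilate_eq]
        rw [intervalIntegral.integral_const_mul, intervalIntegral.integral_of_le zero_le_one,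
          integral_integral_swap, ← integral_const_mul, inner_eq_integral (.refl _ _) hB.coeFn_toLp]
        · refine integral_ext fun r => ?_
          rw [hk]
          simp only
          rw [intervalIntegral.integral_of_le zero_le_one, integral_mul_const]
          ring
        · have := (integrable_const (1 : ℂ) (μ := volume.restrict (Set.Ioc (0 : ℝ) 1))).mul_prod
            (integrable_mul_conj (spectralU m Ψ) (spectralU m c))
          refine this.mono ?_ (.of_forall fun r => ?_)
          · refine AEStronglyMeasurable.mul ?_ (integrable_mul_conj _ _).aestronglyMeasurable.comp_snd
            exact Measurable.aestronglyMeasurable (by fun_prop)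
          · rw [Function.uncurry, norm_mul, norm_exp_I_freq, one_mul, one_mul]
      rw [eA, eB, hftc]
    filter_upwards [(MemLp.toLp_eq_toLp_iff hA hB).1 key, ae_exp_freq_ne_one (rayMeasure m)]
      with r hr hne
    have h2 : (freq r : ℂ) * k r = cexp (I * freq r) - 1 := freq_mul_integral_exp (freq r)
    rw [← h2] at hr
    refine mul_left_cancel₀ (fun h0 => hne ?_) (hr.symm.trans (by ring))
    rw [h0, mul_zero] at h2
    exact sub_eq_zero.1 h2.symm
  · intro H χ hχ hs
    set c := conjTest hχ hs
    have h1 := hasDerivAt_integral_dilFun hχ hs Φ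
    have h2 : ∀ t, ∫ q, Φ q * dilFun t χ q =
        ⟪dilate (m + 1) (exp t) (exp_ne_zero _) c, Φ⟫_ℂ := fun t => by
      rw [← conjTest_dilFun, inner_conjTest]
    simp only [h2, inner_dilate_eq] at h1
    have hint : Integrable (fun r => (freq r : ℂ) * (spectralU m Φ r *
        conj (spectralU m c r))) μ :=
      (integrable_mul_conj (spectralU m Ψ) (spectralU m c)).congr
        (H.mono fun r hr => by simp only [hr]; ring)
    have h3 := hasDerivAt_integral_of_dominated_loc_of_deriv_le (μ := μ)
      (F := fun (s : ℝ) r => cexp (I * (s * freq r)) * (spectralU m Φ r * conj (spectralU m c r)))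
      (F' := fun s r => cexp (I * (s * freq r)) * (I * ((freq r : ℂ) *
        (spectralU m Φ r * conj (spectralU m c r))))) (x₀ := 0) (s := Metric.ball 0 1)
      (bound := fun r => ‖(freq r : ℂ) * (spectralU m Φ r * conj (spectralU m c r))‖)
      (Metric.ball_mem_nhds 0 one_pos) (.of_forall fun s => ?_) ?_ ?_
      (.of_forall fun r s _ => ?_) hint.norm (.of_forall fun r s _ => ?_)
    · rw [h1.unique h3.2, ← inner_conjTest hχ hs, ← (spectralU m).inner_map_map,
        inner_eq_integral (.refl _ _) H, ← integral_const_mul]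
      refine integral_ext fun r => ?_
      simp; ring
    · exact (Measurable.aestronglyMeasurable (by fun_prop)).mul
        (integrable_mul_conj _ _).aestronglyMeasurable
    · simpa using integrable_mul_conj (spectralU m Φ) (spectralU m c)
    · exact (Measurable.aestronglyMeasurable (by fun_prop)).mul
        (hint.aestronglyMeasurable.const_mul _)
    · rw [norm_mul, norm_exp_I_freq, one_mul, norm_mul, norm_I, one_mul]
    · have : HasDerivAt (fun s : ℝ => I * (s * (freq r : ℂ))) (I * freq r) s := by
        simpa using ((hasDerivAt_id s).ofReal_comp.mul_const (freq r : ℂ)).const_mul I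
      refine (this.cexp.mul_const _).congr_deriv ?_
      ring

theorem eulerOp_eq_mulOp : eulerOp (m + 1) =
    mulOp (spectralU m) (spectralU m) fun r => (freq r : ℂ) := by
  refine LinearPMap.eq_of_eq_graph ?_
  ext ⟨u, v⟩
  rw [mem_eulerOp_graph, mem_mulOp_graph, weakEuler_iff_spectral]

theorem isSelfAdjoint_eulerOp : IsSelfAdjoint (eulerOp (m + 1)) := by
  rw [eulerOp_eq_mulOp]
  exact isSelfAdjoint_mulOp _ _ (by fun_prop) fun u v => by simp

end EulerSpectral

/-! ### The symbols -/

section Symbols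

/-- The symbol of `𝓗` in the spectral representation. -/
def gammaSymbol (l : ℝ) : ℂ := (normalizingSymbol l)⁻¹

lemma half_add_ne (l : ℝ) (k : ℕ) : (1 / 2 : ℂ) + I * l ≠ -k := by
  intro h
  have := congr_arg Complex.re h
  simp at this
  linarith

lemma I_mul_ne {l : ℝ} (hl : l ≠ 0) (k : ℕ) : -(I * l) ≠ -k := by
  intro h
  have := congr_arg im h
  simp at this
  exact hl this

@[fun_prop]
lemma measurable_Gamma : Measurable Gamma := by
  simpa [Pi.inv_def] using Complex.differentiable_one_div_Gamma.continuous.measurable.inv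

@[fun_prop]
lemma measurable_normalizingSymbol : Measurable normalizingSymbol := by
  unfold normalizingSymbol
  fun_prop

@[fun_prop]
lemma measurable_gammaSymbol : Measurable gammaSymbol := measurable_normalizingSymbol.inv

lemma normalizingSymbol_ne_zero {l : ℝ} (hl : l ≠ 0) : normalizingSymbol l ≠ 0 := by
  unfold normalizingSymbol
  refine mul_ne_zero ?_ (div_ne_zero (Complex.Gamma_ne_zero (half_add_ne l))
    (Complex.Gamma_ne_zero (I_mul_ne hl)))
  simp

lemma normalizingSymbol_neg (l : ℝ) : normalizingSymbol (-l) = conj (normalizingSymbol l) := by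
  unfold normalizingSymbol
  have hpi : (π : ℂ).arg ≠ π := by
    rw [Complex.arg_ofReal_of_nonneg pi_pos.le]; exact pi_ne_zero.symm
  have h := Complex.cpow_conj (π : ℂ) (-(1 / 2 : ℂ) - 2 * I * l) hpi
  rw [conj_ofReal] at h
  rw [map_mul, map_div₀, ← Complex.Gamma_conj, ← Complex.Gamma_conj, ← h]
  have h2 : conj (2 : ℂ) = 2 := map_ofNat _ 2
  simp [conj_ofReal, h2]

lemma gammaSymbol_neg (l : ℝ) : gammaSymbol (-l) = conj (gammaSymbol l) := by
  rw [gammaSymbol, gammaSymbol, normalizingSymbol_neg, map_inv₀]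

lemma gammaSymbol_mul_neg (l : ℝ) : gammaSymbol l * gammaSymbol (-l) = squareSymbol l := by
  have hpi : (π : ℂ) ≠ 0 := ofReal_ne_zero.2 pi_ne_zero
  have hp : (π : ℂ) ^ (-(1 / 2 : ℂ) - 2 * I * l) *
      (π : ℂ) ^ (-(1 / 2 : ℂ) + 2 * I * l) = (π : ℂ)⁻¹ := by
    rw [← cpow_add _ _ hpi, ← Complex.cpow_neg_one]; congr 1; ring
  rw [gammaSymbol, gammaSymbol, ← mul_inv, normalizingSymbol, normalizingSymbol, squareSymbol]
  simp only [Complex.ofReal_neg, mul_neg, neg_neg, sub_neg_eq_add]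
  grind

lemma squareSymbol_eq {l : ℝ} (hl : l ≠ 0) :
    squareSymbol l = ((π * cosh (π * l) / (l * sinh (π * l)) : ℝ) : ℂ) := by
  have hpi : (π : ℂ) ≠ 0 := ofReal_ne_zero.2 pi_ne_zero
  have hl' : (l : ℂ) ≠ 0 := ofReal_ne_zero.2 hl
  have hs : sinh (π * l) ≠ 0 := by positivity
  have hs' : Complex.sinh (π * l) ≠ 0 := by exact_mod_cast hs
  have hc' : Complex.cosh (π * l) ≠ 0 := by exact_mod_cast (Real.cosh_pos (π * l)).ne'
  have h1 := Complex.Gamma_mul_Gamma_one_sub (I * l)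
  have h2 : Gamma (1 - I * l) = -(I * l) * Gamma (-(I * l)) := by
    rw [← Complex.Gamma_add_one _ (neg_ne_zero.2 (mul_ne_zero I_ne_zero hl'))]
    congr 1; ring
  have h3 := Complex.Gamma_mul_Gamma_one_sub (1 / 2 + I * l)
  have h4 : (1 : ℂ) - (1 / 2 + I * l) = 1 / 2 - I * l := by ring
  have h5 : sin (π * (I * l)) = Complex.sinh (π * l) * I := by
    rw [← Complex.sin_mul_I]; congr 1; ring
  have h6 : sin (π * (1 / 2 + I * l)) = Complex.cosh (π * l) := by
    rw [← Complex.cos_mul_I, ← Complex.sin_add_pi_div_two]; congr 1; ring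
  rw [h2, h5] at h1
  rw [h4, h6] at h3
  have h7 : Gamma (I * l) * Gamma (-(I * l)) = π / (l * Complex.sinh (π * l)) := by
    rw [eq_div_iff (mul_ne_zero hs' I_ne_zero)] at h1
    rw [eq_div_iff (mul_ne_zero hl' hs')]
    linear_combination h1 + Gamma (I * l) * Gamma (-(I * l)) * l * Complex.sinh (π * l) * I_sq
  rw [squareSymbol, h3, h7]
  push_cast
  field_simp

lemma norm_sq_gammaSymbol {l : ℝ} (hl : l ≠ 0) :
    ‖gammaSymbol l‖ ^ 2 = π * cosh (π * l) / (l * sinh (π * l)) := by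
  have h := gammaSymbol_mul_neg l
  rw [gammaSymbol_neg, Complex.mul_conj', squareSymbol_eq hl] at h
  exact_mod_cast h

lemma gammaSymbol_zero : gammaSymbol 0 = 0 := by
  simp [gammaSymbol, normalizingSymbol, Complex.Gamma_zero]

lemma le_norm_sq_gammaSymbol {l : ℝ} (hl : 0 < l) : (l ^ 2)⁻¹ ≤ 2 * ‖gammaSymbol l‖ ^ 2 := by
  have h2 : 0 < sinh (π * l) := Real.sinh_pos_iff.2 (by positivity)
  -- `1 - e ^ (-2 x) ≤ 2 x`, hence `sinh x ≤ x e ^ x ≤ 2 x cosh x`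
  have h1 : sinh (π * l) ≤ π * l * (2 * cosh (π * l)) := by
    have h3 := mul_le_mul_of_nonneg_right (Real.add_one_le_exp (-(2 * (π * l)))) (exp_pos (π * l)).le
    rw [← exp_add, show -(2 * (π * l)) + π * l = -(π * l) by ring] at h3
    have : 0 < π * l * exp (-(π * l)) := by positivity
    rw [Real.sinh_eq, Real.cosh_eq]
    linarith
  rw [norm_sq_gammaSymbol hl.ne', inv_eq_one_div, ← mul_div_assoc,
    div_le_div_iff₀ (by positivity) (by positivity)]
  nlinarith

lemma norm_sq_gammaSymbol_le (l : ℝ) (hl : l ≠ 0) :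
    ‖gammaSymbol l‖ ^ 2 ≤ (1 + π) * (1 + (l ^ 2)⁻¹) := by
  have key : ∀ l : ℝ, 0 < l → ‖gammaSymbol l‖ ^ 2 ≤ (1 + π) * (1 + (l ^ 2)⁻¹) := fun l hl => by
    have h1 : π * l ≤ sinh (π * l) := Real.self_le_sinh_iff.2 (by positivity)
    have h2 : exp (-(π * l)) ≤ 1 := Real.exp_le_one_iff.2 (by simp; positivity)
    have h3 : π * l * cosh (π * l) ≤ (1 + π) * (l ^ 2 + 1) * sinh (π * l) := by
      have h4 : 0 ≤ π * l := by positivity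
      have h5 := Real.cosh_sub_sinh (π * l)
      have h6 : 1 + π * l ≤ (1 + π) * (l ^ 2 + 1) := by nlinarith [sq_nonneg (l - 1), pi_pos]
      nlinarith
    rw [norm_sq_gammaSymbol hl.ne', show (1 + π) * (1 + (l ^ 2)⁻¹) =
      (1 + π) * (l ^ 2 + 1) / l ^ 2 by field_simp, div_le_div_iff₀ (by positivity) (by positivity)]
    nlinarith
  rcases hl.lt_or_gt with h | h
  · simpa [gammaSymbol_neg] using key (-l) (by linarith)
  · exact key l h

/-- The multiplier of the difference between a dilation and the identity compensates the
singularity of the symbol of `𝓗`. -/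
lemma exists_norm_gammaSymbol_mul_le : ∃ C : ℝ, ∀ l : ℝ,
    ‖gammaSymbol l * (cexp (-(I * l)) - 1)‖ ≤ C := by
  refine ⟨sqrt ((1 + π) * 5), fun l => Real.le_sqrt_of_sq_le ?_⟩
  have hpi := pi_pos
  by_cases hl : l = 0
  · rw [hl, gammaSymbol_zero]; simp; positivity
  have h1 := norm_sq_gammaSymbol_le l hl
  have e : cexp (-(I * l)) = cexp (I * ((-l : ℝ) : ℂ)) := by congr 1; push_cast; ring
  have h2 : ‖cexp (-(I * l)) - 1‖ ≤ |l| := by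
    rw [e]
    simpa using Real.norm_exp_I_mul_ofReal_sub_one_le (x := -l)
  have h3 : ‖cexp (-(I * l)) - 1‖ ≤ 2 := by
    refine (norm_sub_le _ _).trans ?_
    rw [e, norm_exp]; simp; norm_num
  have h4 : ‖cexp (-(I * l)) - 1‖ ^ 2 ≤ l ^ 2 := by rw [← sq_abs l]; gcongr
  have h5 : ‖cexp (-(I * l)) - 1‖ ^ 2 ≤ 4 := by nlinarith [norm_nonneg (cexp (-(I * l)) - 1)]
  rw [norm_mul, mul_pow]
  calc _ ≤ ((1 + π) * (1 + (l ^ 2)⁻¹)) * ‖cexp (-(I * l)) - 1‖ ^ 2 := by gcongr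
    _ = (1 + π) * (‖cexp (-(I * l)) - 1‖ ^ 2 + (l ^ 2)⁻¹ * ‖cexp (-(I * l)) - 1‖ ^ 2) := by ring
    _ ≤ (1 + π) * (4 + (l ^ 2)⁻¹ * l ^ 2) := by gcongr
    _ = _ := by grind

end Symbols

/-! ### The operators `𝓗` and `𝓚` in the spectral representation -/

section Operators
variable {m : ℕ}

/-- The spectral representation, followed by the exchange of the sheets and by the reflection of
the frequency. -/
def spectralFlipU (m : ℕ) :
    L2Sigma (m + 1) ≃ₗᵢ[ℂ] Lp ℂ 2 (rayVol m) :=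
  (spectralU m).trans ((flipU m).trans (reflectU (rayMeasure m)))

/-- The point with opposite frequency, on the other sheet. -/
def oppo (r : RaySpace m × ℝ) : RaySpace m × ℝ := ((r.1.1, !r.1.2), -r.2)

lemma spectralFlipU_coe (u : L2Sigma (m + 1)) :
    spectralFlipU m u =ᵐ[rayVol m] fun r => spectralU m u (oppo r) :=
  reflectU_coe (flipU_coe (.refl _ (spectralU m u)))

lemma oppo_oppo (r : RaySpace m × ℝ) : oppo (oppo r) = r := by simp [oppo]

lemma freq_oppo (r : RaySpace m × ℝ) : freq (oppo r) = -freq r := by simp [oppo, freq]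

lemma measurePreserving_oppo : MeasurePreserving (oppo (m := m)) (rayVol m)
    (rayVol m) :=
  measurePreserving_flip.prod (Measure.measurePreserving_neg (volume : Measure ℝ))

/-- The self-adjoint operator that extends `𝓗`. -/
def hOp (m : ℕ) : L2Sigma (m + 1) →ₗ.[ℂ] L2Sigma (m + 1) :=
  mulOp (spectralU m) (spectralFlipU m) fun r => gammaSymbol (freq r)

lemma mem_hOp_graph_oppo (u v : L2Sigma (m + 1)) : (u, v) ∈ (hOp m).graph ↔
    spectralU m v =ᵐ[rayVol m] fun r => gammaSymbol (freq r) * spectralU m u (oppo r) := by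
  have e : (fun r => gammaSymbol (freq r) * spectralFlipU m u r) =ᵐ[rayVol m]
      fun r => gammaSymbol (freq r) * spectralU m u (oppo r) :=
    (spectralFlipU_coe u).mono fun r hr => by simp only [hr]
  rw [hOp, mem_mulOp_graph]
  exact ⟨fun h => h.trans e, fun h => h.trans e.symm⟩

lemma isSelfAdjoint_hOp : IsSelfAdjoint (hOp m) := by
  refine isSelfAdjoint_mulOp _ _ (by fun_prop) fun u v => ?_
  rw [← mem_mulOp_graph, ← hOp, mem_hOp_graph_oppo]
  have q := (measurePreserving_oppo (m := m)).quasiMeasurePreserving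
  constructor <;> intro h
  · filter_upwards [q.ae_eq h, spectralFlipU_coe v] with r h1 h2
    simp only [Function.comp, oppo_oppo, freq_oppo, gammaSymbol_neg] at h1
    rw [h2, ← h1]
  · filter_upwards [q.ae_eq ((spectralFlipU_coe v).symm.trans h)] with r h1
    simp only [Function.comp, oppo_oppo, freq_oppo, gammaSymbol_neg, conj_conj] at h1
    exact h1

/-- The unitary involution `𝓚`. -/
def kOp (m : ℕ) : L2Sigma (m + 1) ≃ₗᵢ[ℂ] L2Sigma (m + 1) :=
  (spectralU m).trans ((reflectU (rayMeasure m)).trans (spectralU m).symm)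

lemma reflectU_reflectU {Y : Type*} [MeasurableSpace Y] {μ : Measure Y} [SigmaFinite μ]
    (F : Lp ℂ 2 (μ.prod (volume : Measure ℝ))) : reflectU μ (reflectU μ F) = F :=
  Lp.ext ((reflectU_coe (reflectU_coe (.refl _ F))).trans
    (.of_forall fun r => by simp))

lemma kOp_kOp (u : L2Sigma (m + 1)) : kOp m (kOp m u) = u := by simp [kOp, reflectU_reflectU]

lemma spectralU_kOp (u : L2Sigma (m + 1)) :
    spectralU m (kOp m u) = reflectU (rayMeasure m) (spectralU m u) := by
  simp [kOp]

/-- The function `normalizingSymbol` of the operator `r`. -/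
def normOp (m : ℕ) : L2Sigma (m + 1) →ₗ.[ℂ] L2Sigma (m + 1) :=
  mulOp (spectralU m) (spectralU m) fun r => normalizingSymbol (freq r)

lemma mem_eulerOp_graph_spectral (u v : L2Sigma (m + 1)) : (u, v) ∈ (eulerOp (m + 1)).graph ↔
    spectralU m v =ᵐ[rayVol m] fun r => (freq r : ℂ) * spectralU m u r := by
  rw [mem_eulerOp_graph, weakEuler_iff_spectral]

lemma isFunctionOf_normOp : IsFunctionOf (eulerOp (m + 1)) normalizingSymbol (normOp m) :=
  ⟨RaySpace m × ℝ, inferInstance, rayVol m, freq, spectralU m, inferInstance,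
    measurable_freq, mem_eulerOp_graph_spectral, fun _ _ => mem_mulOp_graph _ _ _ _ _⟩

lemma isFunctionOf_hOp_sq :
    IsFunctionOf (eulerOp (m + 1)) squareSymbol (opComp (hOp m) (hOp m)) := by
  refine ⟨RaySpace m × ℝ, inferInstance, rayVol m, freq, spectralU m,
    inferInstance, measurable_freq, mem_eulerOp_graph_spectral, fun u w => ?_⟩
  have q := (measurePreserving_oppo (m := m)).quasiMeasurePreserving
  rw [mem_opComp_graph]
  simp only [mem_hOp_graph_oppo]
  constructor
  · rintro ⟨v, h1, h2⟩
    filter_upwards [h2, q.ae_eq h1] with r h3 h4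
    simp only [Function.comp, oppo_oppo, freq_oppo] at h4
    rw [h3, h4, ← mul_assoc, gammaSymbol_mul_neg]
  · intro h
    have hm : AEStronglyMeasurable (fun r => gammaSymbol (freq r) * spectralFlipU m u r)
        (rayVol m) :=
      (measurable_gammaSymbol.comp measurable_freq).aestronglyMeasurable.mul
        (Lp.aestronglyMeasurable _)
    have hF := (spectralFlipU_coe u).symm
    -- `γ V u` is square integrable, since `|γ| ≤ 1 + |γ|²`
    have hL : MemLp (fun r => gammaSymbol (freq r) * spectralFlipU m u r) 2
        (rayVol m) := by
      have h2 : MemLp (fun r => spectralU m w (oppo r)) 2 (rayVol m) :=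
        (Lp.memLp (spectralU m w)).comp_measurePreserving measurePreserving_oppo
      refine MemLp.of_le ((Lp.memLp (spectralFlipU m u)).norm.add h2.norm) hm ?_
      filter_upwards [hF, q.ae_eq h] with r h3 h4
      simp only [Function.comp, h3, freq_oppo] at h4
      rw [← gammaSymbol_mul_neg, neg_neg, gammaSymbol_neg, mul_comm (conj _),
        Complex.mul_conj'] at h4
      simp only [Pi.add_apply, h4, norm_mul]
      have hx := norm_nonneg (spectralFlipU m u r)
      rw [norm_pow, norm_real, norm_norm, norm_of_nonneg (by positivity)]
      nlinarith [mul_nonneg hx (sq_nonneg (‖gammaSymbol (freq r)‖ - 1)),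
        mul_nonneg hx (sq_nonneg ‖gammaSymbol (freq r)‖)]
    refine ⟨(spectralU m).symm hL.toLp, ?_, ?_⟩
    all_goals rw [LinearIsometryEquiv.apply_symm_apply]
    · filter_upwards [hL.coeFn_toLp, hF] with r h3 h4
      rw [h3, h4]
    · filter_upwards [q.ae_eq hL.coeFn_toLp, q.ae_eq hF, h] with r h3 h4 h5
      simp only [Function.comp, oppo_oppo, freq_oppo] at h3 h4
      rw [h3, h5, ← h4, ← mul_assoc, gammaSymbol_mul_neg]

lemma opComp_hOp : opComp (hOp m) (hOp m) = opComp (hOp m).adjoint (hOp m) := by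
  rw [(LinearPMap.isSelfAdjoint_def).1 isSelfAdjoint_hOp]

/-- The relation between `𝓗`, `𝓚` and the normalizing factor, on functions of given parity. -/
lemma exists_normOp_of_parity (δ : Fin 2) (u v : L2Sigma (m + 1)) (hp : HasParity δ u)
    (huv : (u, v) ∈ (hOp m).graph) :
    ∃ w, (v, w) ∈ (normOp m).graph ∧ kOp m u = (-1 : ℂ) ^ (δ : ℕ) • w := by
  have hs : ((-1 : ℂ) ^ (δ : ℕ)) * (-1 : ℂ) ^ (δ : ℕ) = 1 := by rw [← mul_pow]; simp
  refine ⟨(-1 : ℂ) ^ (δ : ℕ) • kOp m u, ?_, by rw [smul_smul, hs, one_smul]⟩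
  have hd : dilate (m + 1) (-1) (by norm_num) u = (-1 : ℂ) ^ (δ : ℕ) • u := by
    exact Lp.ext ((dilate_coe _ (.refl _ u)).trans
      (.trans (hp.mono fun q hq => by simpa using hq) (Lp.coeFn_smul _ _).symm))
  have hV := spectralU_dilate_neg_one u
  rw [hd, map_smul] at hV
  rw [normOp, mem_mulOp_graph, map_smul, spectralU_kOp, ← map_smul, hV]
  rw [mem_hOp_graph_oppo] at huv
  have hne : ∀ᵐ r ∂(rayVol m), freq r ≠ 0 := by
    filter_upwards [ae_exp_freq_ne_one (rayMeasure m)] with r hr h0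
    exact hr (by rw [h0]; simp)
  filter_upwards [huv, hne, spectralFlipU_coe u] with r h1 h2 h3
  rw [h1, ← mul_assoc, gammaSymbol, mul_inv_cancel₀ (normalizingSymbol_ne_zero h2), one_mul]
  exact h3

lemma rayMeasure_ne_zero : rayMeasure m ≠ 0 := by
  intro h0
  have h1 := lintegral_rayMeasure (m := m) (fun _ => 1) measurable_const
  rw [h0, lintegral_zero_measure, eq_comm, lintegral_eq_zero_iff (by fun_prop)] at h1
  have h2 : ∀ᵐ _p : Eu (m + 1) × Eu m, False := by
    filter_upwards [h1, ae_volume_rayDen_ne_zero] with p h3 h4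
    have : 0 < (|rayDen p| ^ (m + 1))⁻¹ := by positivity
    simp only [Pi.zero_apply, mul_eq_zero, ofReal_eq_zero] at h3
    rcases h3 with h3 | h3
    exacts [by linarith, by norm_num at h3]
  rw [Filter.eventually_false_iff_eq_bot, ae_eq_bot] at h2
  exact NeZero.ne (volume : Measure (Eu (m + 1) × Eu m)) h2

/-- The symbol is not square integrable at the frequency `0`. -/
lemma hOp_domain_ne_top : (hOp m).domain ≠ ⊤ := by
  intro htop
  obtain ⟨k, hk⟩ : ∃ k, rayMeasure m (spanningSets (rayMeasure m) k) ≠ 0 := by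
    by_contra! h
    exact rayMeasure_ne_zero (m := m) (Measure.measure_univ_eq_zero.1
      (by rw [← iUnion_spanningSets (rayMeasure m)]; exact measure_iUnion_null h))
  set S := spanningSets (rayMeasure m) k
  have mS : MeasurableSet S := measurableSet_spanningSets _ k
  have mI : MeasurableSet (Set.Ioo (0 : ℝ) 1) := measurableSet_Ioo
  have fS : rayVol m (S ×ˢ Set.Ioo 0 1) ≠ ⊤ := by
    rw [Measure.prod_prod]
    exact (mul_lt_top (measure_spanningSets_lt_top _ k) (by simp)).ne
  have hu : (spectralFlipU m).symm (indicatorConstLp 2 (mS.prod mI) fS (1 : ℂ)) ∈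
      (hOp m).domain := htop ▸ Submodule.mem_top
  rw [hOp, mem_mulOp_domain, LinearIsometryEquiv.apply_symm_apply] at hu
  have hu2 : MemLp (fun r : RaySpace m × ℝ =>
      (S ×ˢ Set.Ioo (0 : ℝ) 1).indicator (fun r => gammaSymbol (freq r)) r) 2
      (rayVol m) := by
    refine (memLp_congr_ae ?_).1 hu
    filter_upwards [indicatorConstLp_coeFn (p := 2) (hs := mS.prod mI) (hμs := fS) (c := (1 : ℂ))]
      with r hr
    rw [hr]
    by_cases h : r ∈ S ×ˢ Set.Ioo (0 : ℝ) 1 <;> simp [h]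
  have hi := ((memLp_two_iff_integrable_sq_norm hu2.1).1 hu2).prod_right_ae
  have : ∃ y ∈ S, Integrable (fun x : ℝ => ‖(S ×ˢ Set.Ioo (0 : ℝ) 1).indicator
      (fun r => gammaSymbol (freq r)) (y, x)‖ ^ 2) := by
    by_contra! h
    refine hk (measure_mono_null (fun y hy => ?_) (ae_iff.1 hi))
    exact h y hy
  obtain ⟨y, hy, hi⟩ := this
  refine absurd ((intervalIntegral.integrableOn_Ioo_rpow_iff (s := -2) (t := 1) one_pos).1 ?_)
    (by norm_num)
  refine Integrable.mono' (g := fun x => (2 * π) ^ 2 * 2 * ‖(S ×ˢ Set.Ioo (0 : ℝ) 1).indicator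
      (fun r => gammaSymbol (freq r)) (y, x)‖ ^ 2) (hi.integrableOn.const_mul _) (by fun_prop) ?_
  refine (ae_restrict_iff' mI).2 (.of_forall fun x hx => ?_)
  have h1 := le_norm_sq_gammaSymbol (l := freq (y, x)) (by
    have := pi_pos; have := hx.1; simp only [freq]; positivity)
  rw [indicator_of_mem (show (y, x) ∈ S ×ˢ Set.Ioo (0 : ℝ) 1 from ⟨hy, hx⟩),
    norm_of_nonneg (Real.rpow_nonneg hx.1.le _), mul_assoc]
  refine le_trans (le_of_eq ?_) (mul_le_mul_of_nonneg_left h1 (by positivity))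
  have := hx.1.ne'
  rw [rpow_neg hx.1.le, show (2 : ℝ) = (2 : ℕ) by norm_num, rpow_natCast]
  simp only [freq]
  push_cast
  field_simp

/-- The difference between a dilation and the identity maps into the domain of `𝓗`. -/
lemma dilate_sub_mem_domain (u : L2Sigma (m + 1)) :
    dilate (m + 1) (exp 1) (exp_ne_zero _) u - u ∈ (hOp m).domain := by
  obtain ⟨C, hC⟩ := exists_norm_gammaSymbol_mul_le
  have hV : spectralU m (dilate (m + 1) (exp 1) (exp_ne_zero _) u - u)
      =ᵐ[rayVol m] fun r => (cexp (-(I * freq r)) - 1) * spectralU m u r := by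
    rw [map_sub]
    filter_upwards [Lp.coeFn_sub (spectralU m (dilate (m + 1) (exp 1) (exp_ne_zero _) u))
      (spectralU m u), spectralU_dilate_exp 1 u] with r h1 h2
    rw [h1, Pi.sub_apply, h2]
    push_cast; rw [one_mul]; ring_nf
  have q := (measurePreserving_oppo (m := m)).quasiMeasurePreserving
  have hm := memLp_bounded_mul (k := fun r : RaySpace m × ℝ => gammaSymbol (freq r) *
    (cexp (I * freq r) - 1)) (by fun_prop) (C := C) (fun r => by
      have := hC (-freq r)
      rw [gammaSymbol_neg, norm_mul, norm_conj, ← norm_mul] at this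
      simpa using this) (spectralFlipU m u)
  rw [LinearPMap.mem_domain_iff]
  refine ⟨(spectralU m).symm hm.toLp, (mem_hOp_graph_oppo _ _).2 ?_⟩
  rw [LinearIsometryEquiv.apply_symm_apply]
  filter_upwards [hm.coeFn_toLp, q.ae_eq hV, spectralFlipU_coe u] with r h1 h2 h3
  simp only [Function.comp, freq_oppo] at h2
  rw [h1, h2, h3, oppo, mul_assoc]
  congr 3
  push_cast; ring_nf

end Operators

/-! ### Singular integrals -/

section Singular

/-- The weight `(1 + |x|)^{-p}`. -/
def decay (p x : ℝ) : ENNReal := ofReal ((1 + |x|) ^ (-p))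

@[fun_prop]
lemma measurable_decay (p : ℝ) : Measurable (decay p) := by unfold decay; fun_prop

lemma decay_le_one {p : ℝ} (hp : 0 ≤ p) (x : ℝ) : decay p x ≤ 1 := by
  rw [decay, ENNReal.ofReal_le_one]
  exact Real.rpow_le_one_of_one_le_of_nonpos (by linarith [abs_nonneg x]) (by linarith)

lemma lintegral_decay_lt_top {p : ℝ} (hp : 1 < p) : ∫⁻ x, decay p x < ⊤ :=
  finite_integral_one_add_norm (E := ℝ) (by simpa using hp)

lemma lintegral_eq_Ioi (f : ℝ → ENNReal) (hf : Measurable f) :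
    ∫⁻ t, f t = (∫⁻ t in Set.Ioi 0, f t) + ∫⁻ t in Set.Ioi 0, f (-t) := by
  rw [lintegral_eq_exp f hf, ← lintegral_Ioi_exp, ← lintegral_Ioi_exp (fun t => f (-t))]

lemma rpow_neg_anti {a b : ENNReal} (h : a ≤ b) {e : ℝ} (he : 0 ≤ e) : b ^ (-e) ≤ a ^ (-e) := by
  rw [ENNReal.rpow_neg, ENNReal.rpow_neg]
  exact ENNReal.inv_le_inv.2 (rpow_le_rpow h he)

lemma lintegral_near_zero_lt_top {e : ℝ} (he : e < 1) :
    ∫⁻ x : ℝ, (Set.Ioo (-1 : ℝ) 1).indicator (fun x => ‖x‖ₑ ^ (-e)) x < ⊤ := by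
  have key : ∫⁻ t in Set.Ioi (0 : ℝ), (Set.Ioo (-1 : ℝ) 1).indicator (fun x => ‖x‖ₑ ^ (-e)) t < ⊤ := by
    rw [setLIntegral_indicator measurableSet_Ioo, Set.Ioo_inter_Ioi, max_eq_right (by norm_num)]
    refine ((intervalIntegral.integrableOn_Ioo_rpow_iff (s := -e) one_pos).2
      (by linarith)).2.trans_eq' (setLIntegral_congr_fun measurableSet_Ioo fun x hx => ?_)
    simp only
    rw [Real.enorm_eq_ofReal hx.1.le, ofReal_rpow_of_pos hx.1,
      Real.enorm_eq_ofReal (Real.rpow_nonneg hx.1.le _)]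
  have e2 : ∀ t : ℝ, (Set.Ioo (-1 : ℝ) 1).indicator (fun x => ‖x‖ₑ ^ (-e)) (-t) =
      (Set.Ioo (-1 : ℝ) 1).indicator (fun x => ‖x‖ₑ ^ (-e)) t := fun t => by
    simp only [Set.indicator, Set.mem_Ioo, enorm_neg, neg_lt_neg_iff]; congr 1; grind
  rw [lintegral_eq_Ioi _ (by fun_prop (disch := exact measurableSet_Ioo))]
  simp only [e2]
  exact add_lt_top.2 ⟨key, key⟩

/-- The singularity `|c x + s|^{-e}` costs a factor `|c|^{-e}`, uniformly in `s`. -/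
lemma exists_lintegral_decay_sing {p e : ℝ} (hp : 1 < p) (he0 : 0 < e) (he : e < 1) :
    ∃ K : ENNReal, K ≠ ⊤ ∧ K ≠ 0 ∧ ∀ c s : ℝ,
      ∫⁻ x, decay p x * ‖c * x + s‖ₑ ^ (-e) ≤ K * ‖c‖ₑ ^ (-e) := by
  refine ⟨(∫⁻ x, decay p x) +
    (∫⁻ x : ℝ, (Set.Ioo (-1 : ℝ) 1).indicator (fun x => ‖x‖ₑ ^ (-e)) x) + 1, ?_, by simp, ?_⟩
  · exact add_ne_top.2 ⟨add_ne_top.2 ⟨(lintegral_decay_lt_top hp).ne,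
      (lintegral_near_zero_lt_top he).ne⟩, by simp⟩
  intro c s
  by_cases hc : c = 0
  · subst hc
    rw [enorm_zero, zero_rpow_of_neg (by linarith), mul_top (by simp)]
    exact le_top
  have h1 : ∀ x : ℝ, ‖c * x + s‖ₑ ^ (-e) = ‖c‖ₑ ^ (-e) * ‖x + s / c‖ₑ ^ (-e) := fun x => by
    rw [← mul_rpow_of_ne_top (by simp) (by simp), ← enorm_mul]
    congr 2; field_simp
  calc ∫⁻ x, decay p x * ‖c * x + s‖ₑ ^ (-e) ≤ ∫⁻ x, ‖c‖ₑ ^ (-e) * (decay p x +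
        (Set.Ioo (-1 : ℝ) 1).indicator (fun x => ‖x‖ₑ ^ (-e)) (x + s / c)) := by
        refine lintegral_mono fun x => ?_
        simp only [h1]
        rw [mul_left_comm]
        refine mul_le_mul_right ?_ _
        by_cases h : x + s / c ∈ Set.Ioo (-1 : ℝ) 1
        · rw [indicator_of_mem h]
          exact le_add_left (mul_le_of_le_one_left zero_le (decay_le_one (by linarith) x))
        · rw [indicator_of_notMem h, add_zero]
          refine mul_le_of_le_one_right zero_le ?_
          have h2 : 1 ≤ ‖x + s / c‖ₑ := by
            rw [enorm_eq_ofReal_abs, one_le_ofReal]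
            by_contra! h3
            exact h (abs_lt.1 h3)
          simpa using rpow_neg_anti h2 he0.le
    _ = ‖c‖ₑ ^ (-e) * ((∫⁻ x, decay p x) +
        ∫⁻ x, (Set.Ioo (-1 : ℝ) 1).indicator (fun x => ‖x‖ₑ ^ (-e)) x) := by
        rw [lintegral_const_mul _ (by fun_prop (disch := exact measurableSet_Ioo)),
          lintegral_add_left (by fun_prop), lintegral_add_right_eq_self (fun x : ℝ => (Set.Ioo (-1 : ℝ) 1).indicator
            (fun x => ‖x‖ₑ ^ (-e)) x)]
    _ ≤ _ := by
        rw [mul_comm]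
        exact mul_le_mul_left le_self_add _

variable {m : ℕ}

lemma lintegral_insertNth (i : Fin (m + 1)) (f : Eu (m + 1) → ENNReal) (hf : Measurable f) :
    ∫⁻ v, f v = ∫⁻ w : Fin m → ℝ, ∫⁻ x : ℝ, f (WithLp.toLp 2 (i.insertNth x w)) := by
  have h := (EuclideanSpace.volume_preserving_symm_measurableEquiv_toLp (Fin (m + 1))).symm.comp
    (volume_preserving_piFinSuccAbove (fun _ : Fin (m + 1) => ℝ) i).symm
  rw [← h.lintegral_comp hf, volume_eq_prod]
  exact lintegral_prod_symm _ (hf.comp h.measurable).aemeasurable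

lemma lintegral_prod_decay (k : ℕ) {p : ℝ} :
    ∫⁻ w : Fin k → ℝ, ∏ j, decay p (w j) = (∫⁻ x, decay p x) ^ k := by
  induction k with
  | zero => simp [volume_pi]
  | succ k ih =>
    have h := (volume_preserving_piFinSuccAbove (fun _ : Fin (k + 1) => ℝ) 0).symm
    rw [← h.lintegral_comp (f := fun w => ∏ j, decay p (w j)) (by fun_prop)]
    simp only [Fin.prod_univ_succ]
    rw [pow_succ', ← ih, volume_eq_prod]
    exact lintegral_prod_mul (f := decay p) (g := fun w : Fin k → ℝ => ∏ j, decay p (w j))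
      (Measurable.aemeasurable (by fun_prop)) (Measurable.aemeasurable (by fun_prop))

lemma lintegral_prod_decay_Eu (k : ℕ) {p : ℝ} :
    ∫⁻ w : Eu k, ∏ j, decay p (w j) = (∫⁻ x, decay p x) ^ k := by
  rw [← lintegral_prod_decay]
  exact (EuclideanSpace.volume_preserving_symm_measurableEquiv_toLp (Fin k)).lintegral_comp
    (f := fun w : Fin k → ℝ => ∏ j, decay p (w j)) (by fun_prop)

lemma inner_insertNth (i : Fin (m + 1)) (c : Eu (m + 1)) (x : ℝ) (w : Fin m → ℝ) :
    ⟪c, WithLp.toLp 2 (i.insertNth (α := fun _ => ℝ) x w)⟫ =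
      c i * x + ∑ j, c (i.succAbove j) * w j := by
  rw [PiLp.inner_apply, Fin.sum_univ_succAbove _ i]
  simp [mul_comm]

/-- The several variables version: any one of the coefficients may be used. -/
lemma exists_lintegral_prod_decay_sing (m : ℕ) {p e : ℝ} (hp : 1 < p) (he0 : 0 < e) (he : e < 1) :
    ∃ K : ENNReal, K ≠ ⊤ ∧ K ≠ 0 ∧ ∀ (i : Fin (m + 1)) (c : Eu (m + 1)) (s : ℝ),
      ∫⁻ v : Eu (m + 1), (∏ j, decay p (v j)) * ‖⟪c, v⟫ + s‖ₑ ^ (-e) ≤ K * ‖c i‖ₑ ^ (-e) := by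
  obtain ⟨K, hK, hK0, h⟩ := exists_lintegral_decay_sing hp he0 he
  refine ⟨((∫⁻ x, decay p x) ^ m + 1) * K, mul_ne_top ?_ hK, mul_ne_zero (by simp) hK0,
    fun i c s => ?_⟩
  · simp [(lintegral_decay_lt_top hp).ne]
  rw [lintegral_insertNth i _ (by fun_prop)]
  have e1 : ∀ (w : Fin m → ℝ) (x : ℝ),
      (∏ j, decay p ((WithLp.toLp 2 (i.insertNth (α := fun _ => ℝ) x w) : Eu (m + 1)) j)) *
      ‖⟪c, WithLp.toLp 2 (i.insertNth (α := fun _ => ℝ) x w)⟫ + s‖ₑ ^ (-e) =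
      (∏ j, decay p (w j)) * (decay p x *
        ‖c i * x + ((∑ j, c (i.succAbove j) * w j) + s)‖ₑ ^ (-e)) := fun w x => by
    rw [inner_insertNth, Fin.prod_univ_succAbove _ i, add_assoc]
    simp only [Fin.insertNth_apply_same, Fin.insertNth_apply_succAbove]
    ring
  simp only [e1]
  calc _ ≤ ∫⁻ w : Fin m → ℝ, (∏ j, decay p (w j)) * (K * ‖c i‖ₑ ^ (-e)) := by
        refine lintegral_mono fun w => ?_
        simp only
        rw [lintegral_const_mul _ (by fun_prop)]
        gcongr
        exact h _ _
    _ = (∫⁻ x, decay p x) ^ m * K * ‖c i‖ₑ ^ (-e) := by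
        rw [lintegral_mul_const _ (by fun_prop), lintegral_prod_decay, mul_assoc]
    _ ≤ _ := by gcongr; exact le_self_add

/-- The weight `(1 + ‖v‖)^{-q}`. -/
def normDecay {k : ℕ} (q : ℝ) (v : Eu k) : ENNReal := ofReal ((1 + ‖v‖) ^ (-q))

@[fun_prop]
lemma measurable_normDecay {k : ℕ} (q : ℝ) : Measurable (normDecay (k := k) q) := by
  unfold normDecay; fun_prop

lemma normDecay_le_one {k : ℕ} {q : ℝ} (hq : 0 ≤ q) (v : Eu k) : normDecay q v ≤ 1 := by
  rw [normDecay, ENNReal.ofReal_le_one]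
  exact Real.rpow_le_one_of_one_le_of_nonpos (by linarith [norm_nonneg v]) (by linarith)

lemma normDecay_add {k : ℕ} (q q' : ℝ) (v : Eu k) :
    normDecay (q + q') v = normDecay q v * normDecay q' v := by
  have : 0 < 1 + ‖v‖ := by positivity
  rw [normDecay, normDecay, normDecay, ← ofReal_mul (by positivity), ← rpow_add this]
  congr 2; ring

lemma normDecay_anti {k : ℕ} {q q' : ℝ} (h : q ≤ q') (v : Eu k) : normDecay q' v ≤ normDecay q v := by
  rw [show q' = q + (q' - q) by ring, normDecay_add]
  exact mul_le_of_le_one_right zero_le (normDecay_le_one (by linarith) v)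

lemma abs_coord_le {k : ℕ} (v : Eu k) (j : Fin k) : |v j| ≤ ‖v‖ := by
  simpa using PiLp.norm_apply_le v j

lemma normDecay_le_prod {k : ℕ} {p : ℝ} (hp : 0 ≤ p) (v : Eu k) :
    normDecay (k * p) v ≤ ∏ j, decay p (v j) := by
  have h0 : 0 < 1 + ‖v‖ := by positivity
  have e1 : normDecay (k * p) v = ∏ _j : Fin k, ofReal ((1 + ‖v‖) ^ (-p)) := by
    rw [Finset.prod_const, Finset.card_univ, Fintype.card_fin, normDecay,
      ← ofReal_pow (by positivity), ← rpow_natCast, ← Real.rpow_mul h0.le]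
    congr 2; ring
  rw [e1]
  refine Finset.prod_le_prod' fun j _ => ofReal_le_ofReal ?_
  exact Real.rpow_le_rpow_of_nonpos (by positivity) (by linarith [abs_coord_le v j]) (by linarith)

lemma lintegral_normDecay_lt_top {k : ℕ} {q : ℝ} (hq : k < q) : ∫⁻ v : Eu k, normDecay q v < ⊤ :=
  finite_integral_one_add_norm (E := Eu k) (by simpa using hq)

/-- Integration over an affine chart of the projective space of a negative power of a linear
form: any one of the coefficients may be used, the constant one included. -/
lemma exists_lintegral_normDecay_sing (m : ℕ) {e : ℝ} (he0 : 0 < e) (he : e < 1) {q : ℝ}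
    (hq : (m + 1 : ℕ) + e < q) :
    ∃ K : ENNReal, K ≠ ⊤ ∧ K ≠ 0 ∧ ∀ (j : Fin (m + 2)) (ξ : Eu (m + 2)),
      ∫⁻ v : Eu (m + 1), normDecay q v * ‖⟪joinLast v 1, ξ⟫‖ₑ ^ (-e) ≤ K * ‖ξ j‖ₑ ^ (-e) := by
  set n : ℕ := m + 1 with hn
  set p : ℝ := (q - e) / n with hp
  have hn0 : (0 : ℝ) < n := by simp [hn]; positivity
  have hp1 : 1 < p := by rw [hp, one_lt_div hn0]; linarith
  obtain ⟨K, hK, hK0, h⟩ := exists_lintegral_prod_decay_sing m hp1 he0 he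
  have hq2 : q = n * p + e := by rw [hp]; field_simp; ring
  set I : ENNReal := ∫⁻ v : Eu n, ∏ j, decay p (v j) with hI
  have hI1 : I ≠ ⊤ := by rw [hI, lintegral_prod_decay_Eu]; simp [(lintegral_decay_lt_top hp1).ne]
  have hC : I + (n : ENNReal) ^ e * K ≠ ⊤ :=
    add_ne_top.2 ⟨hI1, mul_ne_top (rpow_ne_top_of_nonneg he0.le (by simp)) hK⟩
  refine ⟨K + (I + (n : ENNReal) ^ e * K), add_ne_top.2 ⟨hK, hC⟩, by simp [hK0], fun j ξ => ?_⟩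
  have hin : ∀ v : Eu n, ⟪joinLast v 1, ξ⟫ = ⟪starPart ξ, v⟫ + lastCoord ξ := fun v => by
    conv_lhs => rw [← joinLast_starPart_lastCoord ξ]
    rw [inner_joinLast, real_inner_comm, one_mul]
  have hle : ∀ v : Eu n, normDecay q v ≤ (∏ j, decay p (v j)) * normDecay e v := fun v => by
    rw [hq2, normDecay_add]
    gcongr
    exact normDecay_le_prod (by linarith) v
  simp only [hin]
  refine Fin.lastCases ?_ (fun i => ?_) j
  · -- `|d|^e ≤ |L|^e + |L - d|^e` for the linear form `L(v)` with constant coefficient `d`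
    set d := lastCoord ξ with hd
    change _ ≤ _ * ‖d‖ₑ ^ (-e)
    by_cases hd0 : d = 0
    · rw [hd0, enorm_zero, zero_rpow_of_neg (by linarith), mul_top (by simp [hK0])]
      exact le_top
    obtain ⟨i, hi⟩ := Finite.exists_max fun i : Fin (m + 1) => |starPart ξ i|
    set E := starPart ξ i with hE
    have hne : ∀ x : ENNReal, x ≠ ⊤ → x ^ e * x ^ (-e) ≤ 1 := fun x hx => by
      rcases eq_or_ne x 0 with rfl | h0
      · simp [he0]
      · rw [← ENNReal.rpow_add _ _ h0 hx]; simp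
    have pt : ∀ v : Eu n, ‖d‖ₑ ^ e * (normDecay q v * ‖⟪starPart ξ, v⟫ + d‖ₑ ^ (-e)) ≤
        (∏ j, decay p (v j)) + (n : ENNReal) ^ e * ‖E‖ₑ ^ e *
          ((∏ j, decay p (v j)) * ‖⟪starPart ξ, v⟫ + d‖ₑ ^ (-e)) := fun v => by
      set L := ⟪starPart ξ, v⟫ + d with hL
      have h1 : |⟪starPart ξ, v⟫| ≤ n * |E| * (1 + ‖v‖) := by
        rw [PiLp.inner_apply]
        refine (Finset.abs_sum_le_sum_abs _ _).trans ?_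
        calc ∑ j, |⟪starPart ξ j, v j⟫| ≤ ∑ _j : Fin n, |E| * (1 + ‖v‖) := by
              refine Finset.sum_le_sum fun j _ => ?_
              rw [inner_apply, conj_trivial, abs_mul, mul_comm]
              exact mul_le_mul (hi j) (by linarith [abs_coord_le v j]) (abs_nonneg _) (abs_nonneg _)
          _ = _ := by simp [mul_assoc]
      have h2 : ‖d‖ₑ ≤ ‖L‖ₑ + n * ‖E‖ₑ * ofReal (1 + ‖v‖) := by
        refine (show ‖d‖ₑ ≤ ‖L‖ₑ + ‖⟪starPart ξ, v⟫‖ₑ by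
          simpa [hL] using enorm_sub_le (a := L) (b := ⟪starPart ξ, v⟫)).trans ?_
        gcongr
        rw [enorm_eq_ofReal_abs, enorm_eq_ofReal_abs]
        refine (ofReal_le_ofReal h1).trans_eq ?_
        rw [ofReal_mul (by positivity), ofReal_mul (by positivity), ENNReal.ofReal_natCast]
      have h3 := (rpow_le_rpow h2 he0.le).trans (ENNReal.rpow_add_le_add_rpow _ _ he0.le he.le)
      rw [mul_rpow_of_nonneg _ _ he0.le, mul_rpow_of_nonneg _ _ he0.le] at h3
      have h4 : ofReal (1 + ‖v‖) ^ e * normDecay e v ≤ 1 := by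
        rw [normDecay, ← ofReal_rpow_of_pos (by positivity)]
        exact hne _ ofReal_ne_top
      calc _ ≤ (‖L‖ₑ ^ e + n ^ e * ‖E‖ₑ ^ e * ofReal (1 + ‖v‖) ^ e) *
            ((∏ j, decay p (v j)) * normDecay e v * ‖L‖ₑ ^ (-e)) := by gcongr; exact hle v
        _ = (∏ j, decay p (v j)) * normDecay e v * (‖L‖ₑ ^ e * ‖L‖ₑ ^ (-e)) + n ^ e * ‖E‖ₑ ^ e *
            (ofReal (1 + ‖v‖) ^ e * normDecay e v) * ((∏ j, decay p (v j)) * ‖L‖ₑ ^ (-e)) := by ring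
        _ ≤ (∏ j, decay p (v j)) * 1 * 1 + n ^ e * ‖E‖ₑ ^ e * 1 *
            ((∏ j, decay p (v j)) * ‖L‖ₑ ^ (-e)) := by
            gcongr
            exacts [normDecay_le_one he0.le v, hne _ enorm_ne_top]
        _ = _ := by ring
    calc _ = ‖d‖ₑ ^ e * (∫⁻ v : Eu n, normDecay q v * ‖⟪starPart ξ, v⟫ + d‖ₑ ^ (-e)) *
          ‖d‖ₑ ^ (-e) := by
          rw [mul_right_comm, ← ENNReal.rpow_add _ _ (by simpa using hd0) enorm_ne_top]
          simp; rfl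
      _ ≤ (I + n ^ e * ‖E‖ₑ ^ e * (K * ‖E‖ₑ ^ (-e))) * ‖d‖ₑ ^ (-e) := by
          gcongr
          rw [← lintegral_const_mul _ (by fun_prop)]
          refine (lintegral_mono pt).trans ?_
          rw [lintegral_add_left (by fun_prop), lintegral_const_mul _ (by fun_prop)]
          gcongr
          exact h i _ _
      _ = (I + n ^ e * K * (‖E‖ₑ ^ e * ‖E‖ₑ ^ (-e))) * ‖d‖ₑ ^ (-e) := by ring
      _ ≤ (I + n ^ e * K * 1) * ‖d‖ₑ ^ (-e) := by gcongr; exact hne _ enorm_ne_top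
      _ ≤ _ := by rw [mul_one]; exact mul_le_mul_left le_add_self _
  · calc _ ≤ ∫⁻ v : Eu n, (∏ j, decay p (v j)) * ‖⟪starPart ξ, v⟫ + lastCoord ξ‖ₑ ^ (-e) := by
          refine lintegral_mono fun v => ?_
          gcongr
          exact (hle v).trans (mul_le_of_le_one_right zero_le (normDecay_le_one he0.le v))
      _ ≤ K * ‖ξ i.castSucc‖ₑ ^ (-e) := h i _ _
      _ ≤ _ := by gcongr; exact le_self_add

end Singular

/-! ### The distribution defined by a square integrable function -/

section SympSchwartz
variable {k : ℕ}

/-- The rotation `(y, η) ↦ (η, -y)` that relates the symplectic and the Euclidean Fourier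
transformations. -/
def sympRot (k : ℕ) : (Eu² k) ≃L[ℝ] (Eu² k) := ContinuousLinearEquiv.equivOfInverse
    ((ContinuousLinearMap.snd ℝ _ _).prod (-(ContinuousLinearMap.fst ℝ _ _)))
    ((-(ContinuousLinearMap.snd ℝ _ _)).prod (ContinuousLinearMap.fst ℝ _ _))
    (fun z => by simp) (fun z => by simp)

/-- The symplectic Fourier transformation of Schwartz functions. -/
def sympS (k : ℕ) : 𝓢(Eu² k, ℂ) →L[ℂ] 𝓢(Eu² k, ℂ) :=
  (SchwartzMap.compCLMOfContinuousLinearEquiv ℂ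
    ((sympRot k).trans (WithLp.prodContinuousLinearEquiv 2 ℝ (Eu k) (Eu k)).symm)).comp
  ((FourierTransform.fourierInvCLM ℂ 𝓢(WithLp 2 (Eu² k), ℂ)).comp
    (SchwartzMap.compCLMOfContinuousLinearEquiv ℂ
      (WithLp.prodContinuousLinearEquiv 2 ℝ (Eu k) (Eu k))))

lemma sympS_apply (φ : 𝓢(Eu² k, ℂ)) (z : Eu² k) : sympS k φ z = ∫ p : Eu² k,
      cexp (2 * I * π * ((⟪p.1, z.2⟫ - ⟪z.1, p.2⟫ : ℝ) : ℂ)) * φ p := by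
  set φ' : 𝓢(WithLp 2 (Eu² k), ℂ) := SchwartzMap.compCLMOfContinuousLinearEquiv ℂ
      (WithLp.prodContinuousLinearEquiv 2 ℝ (Eu k) (Eu k)) φ with hφ
  change (𝓕⁻ φ') (WithLp.toLp 2 (sympRot k z)) = _
  rw [SchwartzMap.fourierInv_coe, Real.fourierInv_eq', ← (WithLp.volume_preserving_ofLp (Eu k) (Eu k)).integral_comp
    (MeasurableEquiv.toLp 2 (Eu² k)).symm.measurableEmbedding]
  refine integral_ext fun p => ?_
  simp only [smul_eq_mul, WithLp.prod_inner_apply]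
  have e1 : ⟪p.ofLp.2, (sympRot k z).2⟫ = -⟪z.1, p.ofLp.2⟫ := by
    rw [real_inner_comm]; exact inner_neg_left _ _
  have e2 : (sympRot k z).1 = z.2 := rfl
  rw [e1, e2]
  refine congr_arg₂ (· * ·) (congr_arg _ ?_) rfl
  push_cast; ring

end SympSchwartz

section Tempered
variable {m : ℕ}

lemma sympKernel_integral (ψ : 𝓢(Chart m, ℂ)) (z : Chart m) :
    ∫ p, sympKernel p z * ψ p = sympS (m + 1) ψ z := (sympS_apply ψ z).symm

/-- A seminorm that controls the decay needed below. -/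
def decaySeminorm (k : ℕ) (φ : 𝓢(Eu² k, ℂ)) : ℝ :=
  2 ^ (2 * k + 2) * ((Finset.Iic (2 * k + 2, 0)).sup (schwartzSeminormFamily ℂ (Eu² k) ℂ)) φ

lemma decaySeminorm_nonneg (k : ℕ) (φ : 𝓢(Eu² k, ℂ)) : 0 ≤ decaySeminorm k φ :=
  mul_nonneg (by positivity) (apply_nonneg _ _)

lemma norm_le_decaySeminorm {k : ℕ} (φ : 𝓢(Eu² k, ℂ)) (z : Eu² k) :
    (1 + ‖z‖) ^ (2 * k + 2) * ‖φ z‖ ≤ decaySeminorm k φ := by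
  have := SchwartzMap.one_add_le_sup_seminorm_apply (𝕜 := ℂ) (m := (2 * k + 2, 0)) le_rfl le_rfl φ z
  rw [norm_iteratedFDeriv_zero] at this
  exact this

/-- The pointwise bound behind the integrability on the cone. -/
lemma enorm_sq_coneMap_le (φ : 𝓢(Phase m, ℂ)) {t : ℝ} (ht : t ≠ 0) (v η : Eu (m + 1)) :
    ‖φ (coneMap (t, (v, η)))‖ₑ ^ 2 ≤ ofReal (decaySeminorm (m + 2) φ) ^ 2 *
      (ofReal (1 + |t|) ^ (-2 : ℝ) * ((∏ j, decay 2 ((t • v) j)) *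
        ((∏ j, decay 2 ((t⁻¹ • η) j)) * ‖t⁻¹ * ⟪t • v, t⁻¹ • η⟫‖ₑ ^ (-(1 / 4) : ℝ)))) := by
  set z := coneMap (t, (v, η)) with hz
  have hz' := coneMap_eq t v η
  rw [← hz] at hz'
  set A : ENNReal := ofReal (1 + ‖z‖) with hA
  have hA1 : 1 ≤ A := by rw [hA, one_le_ofReal]; linarith [norm_nonneg z]
  have hA0 : A ≠ 0 := (lt_of_lt_of_le one_pos hA1).ne'
  have hAt : A ≠ ⊤ := ofReal_ne_top
  have c1 : ∀ i, |z.1 i| ≤ ‖z‖ := fun i => (abs_coord_le _ i).trans (norm_fst_le z)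
  have c2 : ∀ i, |z.2 i| ≤ ‖z‖ := fun i => (abs_coord_le _ i).trans (norm_snd_le z)
  have b1 : |t| ≤ ‖z‖ := by simpa [hz'] using c1 (Fin.last _)
  have b2 : ∀ j, |(t • v) j| ≤ ‖z‖ := fun j => by simpa [hz'] using c1 j.castSucc
  have b3 : ∀ j, |(t⁻¹ • η) j| ≤ ‖z‖ := fun j => by simpa [hz'] using c2 j.castSucc
  have b4 : |t⁻¹ * ⟪t • v, t⁻¹ • η⟫| ≤ ‖z‖ := by
    simpa [hz', inner_smul_left, inner_smul_right, ht] using c2 (Fin.last _)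
  have hd : ∀ x : ℝ, |x| ≤ ‖z‖ → A ^ (-2 : ℝ) ≤ decay 2 x := fun x hx => by
    rw [decay, ← ofReal_rpow_of_pos (by positivity)]
    exact rpow_neg_anti (ofReal_le_ofReal (by linarith)) (by norm_num)
  have h1 : ‖φ z‖ₑ ≤ ofReal (decaySeminorm (m + 2) φ) * A ^ (-(2 * m + 6 : ℝ)) := by
    have h := norm_le_decaySeminorm φ z
    have hp : 0 < 1 + ‖z‖ := by positivity
    rw [← ofReal_norm, hA, ofReal_rpow_of_pos hp, ← ofReal_mul (decaySeminorm_nonneg _ _)]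
    refine ofReal_le_ofReal ?_
    rw [rpow_neg hp.le, ← div_eq_mul_inv, le_div_iff₀ (by positivity), mul_comm]
    refine le_trans (le_of_eq ?_) h
    congr 1
    rw [← rpow_natCast]
    congr 1; push_cast; ring
  calc ‖φ z‖ₑ ^ 2 ≤ (ofReal (decaySeminorm (m + 2) φ) * A ^ (-(2 * m + 6 : ℝ))) ^ 2 := by gcongr
    _ = ofReal (decaySeminorm (m + 2) φ) ^ 2 * A ^ (-(4 * m + 12 : ℝ)) := by
        rw [mul_pow, ← ENNReal.rpow_natCast (A ^ _), ← rpow_mul]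
        congr 2; push_cast; ring
    _ ≤ ofReal (decaySeminorm (m + 2) φ) ^ 2 * (A ^ (-2 : ℝ) *
        ((A ^ (-2 : ℝ)) ^ (m + 1) * ((A ^ (-2 : ℝ)) ^ (m + 1) * A ^ (-(1 / 4) : ℝ)))) := by
        refine mul_le_mul_right ?_ _
        simp only [← ENNReal.rpow_natCast, ← rpow_mul, ← ENNReal.rpow_add _ _ hA0 hAt]
        refine ENNReal.rpow_le_rpow_of_exponent_le hA1 ?_
        push_cast; linarith
    _ ≤ _ := by
        refine mul_le_mul_right (mul_le_mul' (rpow_neg_anti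
          (ofReal_le_ofReal (by linarith)) (by norm_num)) (mul_le_mul' ?_
            (mul_le_mul' ?_ (rpow_neg_anti ?_ (by norm_num))))) _
        · simpa using Finset.prod_le_prod' fun j (_ : j ∈ Finset.univ) => hd _ (b2 j)
        · simpa using Finset.prod_le_prod' fun j (_ : j ∈ Finset.univ) => hd _ (b3 j)
        · rw [enorm_eq_ofReal_abs]
          exact ofReal_le_ofReal (by linarith)

lemma integrable_exp_neg_abs {c : ℝ} (hc : 0 < c) : ∫⁻ s : ℝ, ofReal (exp (-c * |s|)) < ⊤ := by
  rw [lintegral_eq_Ioi _ (by fun_prop)]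
  have key : ∫⁻ t in Set.Ioi (0 : ℝ), ofReal (exp (-c * |t|)) < ⊤ :=
    (exp_neg_integrableOn_Ioi 0 hc).2.trans_eq' <| setLIntegral_congr_fun measurableSet_Ioi
      fun s hs => by simp only [Real.enorm_eq_ofReal (exp_pos _).le, abs_of_pos (Set.mem_Ioi.1 hs)]
  simp only [abs_neg]
  exact add_lt_top.2 ⟨key, key⟩

lemma lintegral_scale_weight_lt_top :
    ∫⁻ t, ofReal ((1 + |t|)⁻¹ * |t| ^ (1 / 8 : ℝ)) ∂scaleMeasure < ⊤ := by
  have key : ∫⁻ s : ℝ, ofReal ((1 + exp s)⁻¹ * exp s ^ (1 / 8 : ℝ)) < ⊤ := by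
    refine lt_of_le_of_lt (lintegral_mono fun s => ?_)
      (integrable_exp_neg_abs (c := 1 / 8) (by norm_num))
    refine ofReal_le_ofReal ?_
    rw [← exp_mul]
    have h0 := exp_pos s
    rw [inv_mul_le_iff₀ (by positivity), add_mul, one_mul, ← exp_add]
    rcases abs_cases s with ⟨hs, h1⟩ | ⟨hs, h1⟩ <;> rw [hs]
    · exact (exp_le_exp.2 (by linarith)).trans (le_add_of_nonneg_left (exp_pos _).le)
    · exact (exp_le_exp.2 (by linarith)).trans (le_add_of_nonneg_right (exp_pos _).le)
  rw [lintegral_scaleMeasure _ (by fun_prop)]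
  simp only [abs_neg, abs_of_pos (exp_pos _)]
  exact add_lt_top.2 ⟨key, key⟩

lemma lintegral_dilate_pair {k : ℕ} {t : ℝ} (ht : t ≠ 0) (W : Eu² k → ENNReal)
    (hW : Measurable W) : ∫⁻ q : Eu² k, W (t • q.1, t⁻¹ • q.2) = ∫⁻ q, W q := by
  have hm2 : Measurable fun v : Eu k => ∫⁻ η, W (v, η) := hW.lintegral_prod_right'
  rw [volume_eq_prod, lintegral_prod _ (by fun_prop), lintegral_prod _ hW.aemeasurable,
    lintegral_comp_smul ht (fun v => ∫⁻ η, W (v, η)), ← lintegral_const_mul _ (by fun_prop)]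
  refine lintegral_congr fun v => ?_
  rw [lintegral_comp_smul (inv_ne_zero ht) fun η => W (t • v, η), ← mul_assoc,
    ← ofReal_mul (by positivity), ← mul_pow, ← abs_mul, mul_inv_cancel₀ ht]
  simp

/-- The `L²` norm of the restriction of a Schwartz function to a translate of the section. -/
lemma exists_lintegral_sq_coneMap_le (m : ℕ) : ∃ C : ENNReal, C ≠ ⊤ ∧
    ∀ (φ : 𝓢(Phase m, ℂ)) (t : ℝ), t ≠ 0 → ∫⁻ q : Chart m, ‖φ (coneMap (t, q))‖ₑ ^ 2 ≤
        (C * ofReal (decaySeminorm (m + 2) φ) * ofReal ((1 + |t|)⁻¹ * |t| ^ (1 / 8 : ℝ))) ^ 2 := by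
  obtain ⟨K, hK, hK0, h⟩ := exists_lintegral_prod_decay_sing m (p := 2) (e := 1 / 4) (by norm_num)
    (by norm_num) (by norm_num)
  set D : ENNReal := K * (K * ‖(1 : ℝ)‖ₑ ^ (-(1 / 4) : ℝ)) with hD
  have hD1 : D ≠ ⊤ := by simp [hD, hK, mul_eq_top]
  refine ⟨D ^ (1 / 2 : ℝ), rpow_ne_top_of_nonneg (by norm_num) hD1, fun φ t ht => ?_⟩
  set W : Chart m → ENNReal := fun q => (∏ j, decay 2 (q.1 j)) *
    ((∏ j, decay 2 (q.2 j)) * ‖t⁻¹ * ⟪q.1, q.2⟫‖ₑ ^ (-(1 / 4) : ℝ)) with hW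
  have hWm : Measurable W := by rw [hW]; fun_prop
  have hin : ∫⁻ q, W q ≤ ‖t‖ₑ ^ (1 / 4 : ℝ) * D := by
    rw [volume_eq_prod, lintegral_prod _ hWm.aemeasurable]
    have e1 : ∀ v η : Eu (m + 1), W (v, η) = ‖t‖ₑ ^ (1 / 4 : ℝ) * ((∏ j, decay 2 (v j)) *
        ((∏ j, decay 2 (η j)) * ‖⟪v, η⟫ + 0‖ₑ ^ (-(1 / 4) : ℝ))) := fun v η => by
      simp only [hW, add_zero]
      rw [enorm_mul, mul_rpow_of_ne_top (by simp) (by simp), enorm_inv ht,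
        ENNReal.inv_rpow, ← ENNReal.rpow_neg, neg_neg]
      ring
    simp only [e1]
    calc _ ≤ ∫⁻ v : Eu (m + 1), ‖t‖ₑ ^ (1 / 4 : ℝ) * (K * ((∏ j, decay 2 (v j)) *
          ‖⟪EuclideanSpace.single 0 1, v⟫ + 0‖ₑ ^ (-(1 / 4) : ℝ))) := by
          refine lintegral_mono fun v => ?_
          simp only
          rw [lintegral_const_mul _ (by fun_prop), lintegral_const_mul _ (by fun_prop)]
          rw [mul_left_comm K]
          gcongr
          refine (h 0 v 0).trans (le_of_eq ?_)
          simp [EuclideanSpace.inner_single_left]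
      _ ≤ ‖t‖ₑ ^ (1 / 4 : ℝ) * D := by
          rw [lintegral_const_mul _ (by fun_prop), lintegral_const_mul _ (by fun_prop), hD]
          gcongr
          refine (h 0 (EuclideanSpace.single 0 1) 0).trans (le_of_eq ?_)
          simp
  calc ∫⁻ q : Chart m, ‖φ (coneMap (t, q))‖ₑ ^ 2
      ≤ ∫⁻ q : Chart m, ofReal (decaySeminorm (m + 2) φ) ^ 2 *
        (ofReal (1 + |t|) ^ (-2 : ℝ) * W (t • q.1, t⁻¹ • q.2)) :=
        lintegral_mono fun q => enorm_sq_coneMap_le φ ht q.1 q.2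
    _ = ofReal (decaySeminorm (m + 2) φ) ^ 2 * (ofReal (1 + |t|) ^ (-2 : ℝ) * ∫⁻ q, W q) := by
        clear_value W
        rw [lintegral_const_mul _ (by fun_prop), lintegral_const_mul _ (by fun_prop),
          lintegral_dilate_pair ht W hWm]
    _ ≤ ofReal (decaySeminorm (m + 2) φ) ^ 2 *
        (ofReal (1 + |t|) ^ (-2 : ℝ) * (‖t‖ₑ ^ (1 / 4 : ℝ) * D)) := by gcongr
    _ = _ := by
        have ht' : 0 < |t| := abs_pos.2 ht
        rw [mul_pow, mul_pow, ← ENNReal.rpow_natCast (D ^ (1 / 2 : ℝ)), ← rpow_mul,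
          ← ofReal_pow (p := (1 + |t|)⁻¹ * |t| ^ (1 / 8 : ℝ)) (by positivity), mul_pow,
          ofReal_mul (by positivity), enorm_eq_ofReal_abs, ofReal_rpow_of_pos ht',
          ofReal_rpow_of_pos (by positivity)]
        have e1 : ((1 + |t|)⁻¹) ^ 2 = (1 + |t|) ^ (-2 : ℝ) := by
          rw [rpow_neg (by positivity), inv_pow]; norm_num
        have e2 : (|t| ^ (1 / 8 : ℝ)) ^ 2 = |t| ^ (1 / 4 : ℝ) := by
          rw [← rpow_natCast, ← Real.rpow_mul (by positivity)]; norm_num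
        rw [e1, e2]
        norm_num
        ring

/-- The integral of `|u| |φ|` over the cone. -/
lemma exists_lintegral_cone_le (m : ℕ) : ∃ C : NNReal, ∀ (φ : 𝓢(Phase m, ℂ)) (u : L2Sigma (m + 1)),
      ∫⁻ r, ‖u r.2 * φ (coneMap r)‖ₑ ∂(scaleMeasure.prod volume) ≤
        C * ofReal (decaySeminorm (m + 2) φ) * ‖u‖ₑ := by
  obtain ⟨C, hC, h⟩ := exists_lintegral_sq_coneMap_le m
  set J := ∫⁻ t, ofReal ((1 + |t|)⁻¹ * |t| ^ (1 / 8 : ℝ)) ∂scaleMeasure with hJ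
  have hJ1 : J ≠ ⊤ := lintegral_scale_weight_lt_top.ne
  lift C to NNReal using hC
  lift J to NNReal using hJ1 with J'
  refine ⟨C * J', fun φ u => ?_⟩
  have hu := (Lp.stronglyMeasurable u).measurable
  have hφ : Measurable fun r : ℝ × Chart m => ‖φ (coneMap r)‖ₑ :=
    (φ.continuous.measurable.comp measurable_coneMap).enorm
  have hn2 : (∫⁻ q, ‖u q‖ₑ ^ (2 : ℝ)) ^ (1 / 2 : ℝ) = ‖u‖ₑ := by
    rw [Lp.enorm_def, eLpNorm_eq_lintegral_rpow_enorm_toReal (by norm_num) (by norm_num)]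
    norm_num
  simp only [enorm_mul]
  rw [lintegral_prod _ (by fun_prop)]
  calc _ ≤ ∫⁻ t, (‖u‖ₑ * (C * ofReal (decaySeminorm (m + 2) φ))) *
        ofReal ((1 + |t|)⁻¹ * |t| ^ (1 / 8 : ℝ)) ∂scaleMeasure := by
        refine lintegral_mono_ae ?_
        filter_upwards [ae_ne_zero_scaleMeasure] with t ht
        have hH := ENNReal.lintegral_mul_le_Lp_mul_Lq (volume : Measure Chart m)
          Real.HolderConjugate.two_two (f := fun q => ‖u q‖ₑ) (g := fun q => ‖φ (coneMap (t, q))‖ₑ)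
          (Lp.aestronglyMeasurable u).enorm (hφ.comp measurable_prodMk_left).aemeasurable
        refine hH.trans ?_
        rw [hn2, mul_assoc]
        refine mul_le_mul_right ?_ _
        have h1 := rpow_le_rpow (h φ t ht) (z := 1 / 2) (by norm_num)
        rw [← ENNReal.rpow_natCast, ← rpow_mul] at h1
        norm_num at h1 ⊢
        exact h1
    _ = _ := by
        rw [lintegral_const_mul _ (by fun_prop), ← hJ]
        push_cast; ring

end Tempered

section Pairing
variable {m : ℕ}

lemma integrable_coneMap (u : L2Sigma (m + 1)) (φ : 𝓢(Phase m, ℂ)) :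
    Integrable (fun r => u r.2 * φ (coneMap r)) (scaleMeasure.prod volume) := by
  obtain ⟨C, hC⟩ := exists_lintegral_cone_le m
  refine ⟨?_, lt_of_le_of_lt (hC φ u) ?_⟩
  · exact ((Lp.stronglyMeasurable u).measurable.comp measurable_snd).aestronglyMeasurable.mul
      (φ.continuous.measurable.comp measurable_coneMap).aestronglyMeasurable
  · exact mul_lt_top (mul_lt_top (by simp) (by simp)) (by simp)

lemma conePairing_L2 (u : L2Sigma (m + 1)) (φ : 𝓢(Phase m, ℂ)) :
    conePairing u φ = ∫ r, u r.2 * φ (coneMap r) ∂(scaleMeasure.prod volume) :=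
  conePairing_eq (Lp.aestronglyMeasurable u) φ.continuous

lemma exists_norm_conePairing_le (m : ℕ) : ∃ C : ℝ, 0 ≤ C ∧
    ∀ (φ : 𝓢(Phase m, ℂ)) (u : L2Sigma (m + 1)),
      ‖conePairing u φ‖ ≤ C * decaySeminorm (m + 2) φ * ‖u‖ := by
  obtain ⟨C, hC⟩ := exists_lintegral_cone_le m
  refine ⟨C, C.2, fun φ u => ?_⟩
  rw [conePairing_L2]
  have h := (enorm_integral_le_lintegral_enorm _).trans (hC φ u)
  have h0 : (0 : ℝ) ≤ C := C.2
  rw [← ENNReal.ofReal_coe_nnreal, ← ofReal_norm, ← ofReal_norm, ← ofReal_mul h0,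
    ← ofReal_mul (mul_nonneg h0 (decaySeminorm_nonneg _ _))] at h
  exact (ENNReal.ofReal_le_ofReal_iff (mul_nonneg (mul_nonneg C.2 (decaySeminorm_nonneg _ _))
    (norm_nonneg u))).1 h

/-- `Φ̃ dm` is a tempered distribution. -/
theorem exists_tempered (u : L2Sigma (m + 1)) : ∃ T : 𝓢(Phase m, ℂ) →L[ℂ] ℂ,
    ∀ φ, Integrable (fun z => tilde u z * φ z) (coneMeasure (m + 1)) ∧ T φ = conePairing u φ := by
  have hi : ∀ φ : 𝓢(Phase m, ℂ),
      Integrable (fun z => tilde u z * φ z) (coneMeasure (m + 1)) := fun φ =>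
    (integrable_cone_iff (Lp.aestronglyMeasurable u) φ.continuous).2 (integrable_coneMap u φ)
  obtain ⟨C, hC0, hC⟩ := exists_norm_conePairing_le m
  refine ⟨SchwartzMap.mkCLMtoNormedSpace (σ := RingHom.id ℂ)
    (fun φ : 𝓢(Phase m, ℂ) => conePairing u φ)
    (fun f g => ?_) (fun a f => ?_) ⟨Finset.Iic (2 * (m + 2) + 2, 0),
      C * 2 ^ (2 * (m + 2) + 2) * ‖u‖, by positivity, fun f => (hC f u).trans (le_of_eq ?_)⟩,
    fun φ => ⟨hi φ, rfl⟩⟩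
  · simp only [conePairing, add_apply, mul_add]
    exact integral_add (hi f) (hi g)
  · simp only [conePairing, smul_apply, smul_eq_mul, RingHom.id_apply]
    rw [← integral_const_mul]
    exact integral_ext fun z => by ring
  · rw [decaySeminorm]; ring

lemma conePairing_congr {u w : Chart m → ℂ} (h : u =ᵐ[volume] w)
    (φ : Phase m → ℂ) : conePairing u φ = conePairing w φ :=
  integral_ext_ae (quasiMeasurePreserving_coneProj.ae_eq h) fun z hz => congr_arg (· * φ z) hz

lemma thetaDist_congr {u w : Chart m → ℂ} (h : u =ᵐ[volume] w)
    (ψ : 𝓢(Phase m, ℂ)) : thetaDist u ψ = thetaDist w ψ := conePairing_congr h _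

lemma thetaDist_eq (u : Chart m → ℂ) (ψ : 𝓢(Phase m, ℂ)) :
    thetaDist u ψ = conePairing u (sympS (m + 2) ψ) :=
  congr_arg (conePairing u) (funext (sympKernel_integral ψ))

/-- The pairing with a fixed Schwartz function is a continuous linear form on `L²`. -/
lemma exists_thetaCLM (ψ : 𝓢(Phase m, ℂ)) :
    ∃ T : L2Sigma (m + 1) →L[ℂ] ℂ, ∀ u, T u = thetaDist u ψ := by
  obtain ⟨C, hC0, hC⟩ := exists_norm_conePairing_le m
  let L : L2Sigma (m + 1) →ₗ[ℂ] ℂ :=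
    { toFun := fun u => thetaDist u ψ
      map_add' := fun u w => by
        rw [thetaDist_congr (Lp.coeFn_add u w), thetaDist_eq, thetaDist_eq, thetaDist_eq,
          conePairing_eq ((Lp.aestronglyMeasurable u).add (Lp.aestronglyMeasurable w))
          (sympS (m + 2) ψ).continuous, conePairing_L2, conePairing_L2,
          ← integral_add (integrable_coneMap u _) (integrable_coneMap w _)]
        exact integral_ext fun r => by simp [add_mul]
      map_smul' := fun c u => by
        rw [thetaDist_congr (Lp.coeFn_smul c u), thetaDist_eq, thetaDist_eq, conePairing_eq ((Lp.aestronglyMeasurable u).const_smul c)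
          (sympS (m + 2) ψ).continuous, conePairing_L2, RingHom.id_apply, smul_eq_mul,
          ← integral_const_mul]
        exact integral_ext fun r => by simp [mul_assoc] }
  refine ⟨L.mkContinuous (C * decaySeminorm (m + 2) (sympS (m + 2) ψ)) fun u => ?_, fun u => rfl⟩
  change ‖thetaDist u ψ‖ ≤ _
  rw [thetaDist_eq]
  exact hC _ u

end Pairing

/-! ### An oscillatory integral -/

section Osc

/-- The phase `e^{2iπ (a e^{-s} - b e^s)}`. -/
def osc (a b s : ℝ) : ℂ := cexp (2 * π * ((a * exp (-s) - b * exp s : ℝ) : ℂ) * I)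

lemma norm_osc (a b s : ℝ) : ‖osc a b s‖ = 1 := by
  rw [osc, ← Complex.ofReal_ofNat, ← Complex.ofReal_mul, ← Complex.ofReal_mul]
  exact Complex.norm_exp_ofReal_mul_I _

@[fun_prop]
lemma Continuous.osc {α : Type*} [TopologicalSpace α] {f g h : α → ℝ} (hf : Continuous f)
    (hg : Continuous g) (hh : Continuous h) : Continuous fun x => osc (f x) (g x) (h x) := by
  unfold _root_.osc; fun_prop

@[fun_prop]
lemma Measurable.osc {α : Type*} [MeasurableSpace α] {f g h : α → ℝ} (hf : Measurable f)
    (hg : Measurable g) (hh : Measurable h) : Measurable fun x => osc (f x) (g x) (h x) := by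
  unfold _root_.osc; fun_prop

lemma intervalIntegrable_osc (a b x y : ℝ) : IntervalIntegrable (osc a b) volume x y :=
  Continuous.intervalIntegrable (by fun_prop) _ _

lemma osc_neg (a b s : ℝ) : osc a b (-s) = osc (-b) (-a) s := by
  rw [osc, osc]; congr 3; congr 1; simp; ring

lemma hasDerivAt_osc_exp (a b s : ℝ) : HasDerivAt (fun s => osc a b s * exp (-s))
    (-(2 * π * b * I * osc a b s) - osc a b s * (2 * π * a * I * exp (-(2 * s)) + exp (-s))) s := by
  have h0 : HasDerivAt (fun s : ℝ => exp (-s)) (-exp (-s)) s := by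
    simpa using (hasDerivAt_neg s).exp
  have h1 : HasDerivAt (fun s : ℝ => a * exp (-s) - b * exp s) (a * -exp (-s) - b * exp s) s :=
    (h0.const_mul a).sub ((Real.hasDerivAt_exp s).const_mul b)
  have h2 : HasDerivAt (fun s => osc a b s) (osc a b s *
      (2 * π * ((a * -exp (-s) - b * exp s : ℝ) : ℂ) * I)) s :=
    ((h1.ofReal_comp.const_mul (2 * π : ℂ)).mul_const I).cexp
  refine (h2.mul h0.ofReal_comp).congr_deriv ?_
  have e1 : (exp s : ℂ) * exp (-s) = 1 := by rw [← Complex.ofReal_mul, ← exp_add]; simp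
  have e2 : (exp (-(2 * s)) : ℂ) = exp (-s) * exp (-s) := by
    rw [← Complex.ofReal_mul, ← exp_add]; congr 2; ring
  rw [e2]
  push_cast at e1 ⊢
  linear_combination (-(2 * π * b * I * osc a b s)) * e1

/-- Integration by parts: the factor `e^{-2iπ b e^s}` oscillates faster and faster. -/
lemma norm_integral_osc_le {a b : ℝ} (hb : b ≠ 0) {L L' : ℝ} (hL : 0 ≤ L) (hLL : L ≤ L') :
    ‖∫ s in L..L', osc a b s‖ ≤ (1 + |a|) / |b| * exp (-L) := by
  have i1 : IntervalIntegrable (fun s => -(2 * π * b * I * osc a b s)) volume L L' :=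
    Continuous.intervalIntegrable (by fun_prop) _ _
  have i2 : IntervalIntegrable (fun s => osc a b s * (2 * π * a * I *
      exp (-(2 * s)) + exp (-s))) volume L L' := Continuous.intervalIntegrable (by fun_prop) _ _
  have h1 := intervalIntegral.integral_eq_sub_of_hasDerivAt
    (fun s _ => hasDerivAt_osc_exp a b s) (i1.sub i2)
  rw [intervalIntegral.integral_sub i1 i2, intervalIntegral.integral_neg,
    intervalIntegral.integral_const_mul] at h1
  have h2 : ‖∫ s in L..L', osc a b s * (2 * π * a * I * exp (-(2 * s)) + exp (-s))‖ ≤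
      (2 * π * |a| + 1) * (exp (-L) - exp (-L')) := by
    rw [show (2 * π * |a| + 1) * (exp (-L) - exp (-L')) =
      ∫ s in L..L', (2 * π * |a| + 1) * exp (-s) by simp]
    refine intervalIntegral.norm_integral_le_of_norm_le hLL (.of_forall fun s hs => ?_)
      (Continuous.intervalIntegrable (by fun_prop) _ _)
    rw [norm_mul, norm_osc, one_mul, add_mul, one_mul]
    refine (norm_add_le _ _).trans ?_
    simp only [norm_mul, norm_real, norm_I, Complex.norm_ofNat, norm_eq_abs,
      abs_of_pos (exp_pos _), abs_of_pos pi_pos, mul_one]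
    gcongr
    linarith [hs.1]
  have h4 : ‖osc a b L' * exp (-L') - osc a b L * exp (-L)‖ ≤ exp (-L') + exp (-L) := by
    refine (norm_sub_le _ _).trans (le_of_eq ?_)
    simp only [norm_mul, norm_osc, norm_real, norm_eq_abs, abs_of_pos (exp_pos _), one_mul]
  have e : ‖(2 * π * b * I) * (∫ s in L..L', osc a b s)‖ =
      ‖-(osc a b L' * exp (-L') - osc a b L * exp (-L)) -
        ∫ s in L..L', osc a b s * (2 * π * a * I * exp (-(2 * s)) + exp (-s))‖ := by
    rw [← h1]; congr 1; ring
  have h5 := e.trans_le (norm_sub_le _ _)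
  rw [norm_neg] at h5
  simp only [norm_mul, norm_real, norm_I, Complex.norm_ofNat, norm_eq_abs, abs_of_pos pi_pos,
    mul_one] at h5
  have hb' : 0 < |b| := abs_pos.2 hb
  rw [div_mul_eq_mul_div, le_div_iff₀ hb']
  refine le_of_mul_le_mul_left (a := 2 * π) ?_ (by positivity)
  have h7 : 0 ≤ 2 * π * |a| * exp (-L') := by positivity
  nlinarith [Real.pi_gt_three, exp_pos (-L)]

lemma norm_integral_osc_le_sub (a b : ℝ) {L L' : ℝ} (hLL : L ≤ L') :
    ‖∫ s in L..L', osc a b s‖ ≤ L' - L := by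
  have := intervalIntegral.norm_integral_le_of_norm_le_const (a := L) (b := L') (C := 1)
    (f := osc a b) (fun s _ => (norm_osc a b s).le)
  rwa [one_mul, abs_of_nonneg (by linarith)] at this

/-- The trivial and the oscillatory bounds, combined into a power of small exponent. -/
lemma norm_integral_osc_le_rpow {a b : ℝ} (hb : b ≠ 0) {L L' : ℝ} (hL : 0 ≤ L) (hLL : L ≤ L') :
    ‖∫ s in L..L', osc a b s‖ ≤ 17 * ((1 + |a|) / |b| * exp (-L)) ^ ε₀ := by
  set X := (1 + |a|) / |b| with hX
  have hX0 : 0 < X := by have := abs_pos.2 hb; positivity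
  set y := X * exp (-L) with hy
  have hy0 : 0 < y := by positivity
  rcases le_total y 1 with h | h
  · have h1 := norm_integral_osc_le hb hL hLL (a := a)
    have h2 : y ≤ y ^ ε₀ := by
      conv_lhs => rw [← Real.rpow_one y]
      exact Real.rpow_le_rpow_of_exponent_ge hy0 h (by norm_num)
    have h3 : 0 ≤ y ^ ε₀ := by positivity
    linarith
  · have hlog : log y ≤ 16 * y ^ ε₀ := by
      have := Real.log_le_rpow_div hy0.le (ε := 1 / 16) (by norm_num)
      linarith
    have h1y : 1 ≤ y ^ ε₀ := Real.one_le_rpow h (by norm_num)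
    have hly : log y = log X - L := by
      rw [hy, Real.log_mul hX0.ne' (exp_ne_zero _), Real.log_exp]; ring
    have hLX : L ≤ log X := by have := Real.log_nonneg h; linarith
    rcases le_total L' (log X) with h2 | h2
    · have := norm_integral_osc_le_sub a b hLL
      linarith
    · rw [← intervalIntegral.integral_add_adjacent_intervals (b := log X)
        (intervalIntegrable_osc a b _ _) (intervalIntegrable_osc a b _ _)]
      have e1 := norm_integral_osc_le_sub a b hLX
      have e2 := norm_integral_osc_le hb (hL.trans hLX) h2 (a := a)
      rw [← hX, exp_neg, exp_log hX0, mul_inv_cancel₀ hX0.ne'] at e2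
      refine (norm_add_le _ _).trans ?_
      linarith

/-- The truncated kernel of `𝓗`: the integral over `e^{-L} ≤ |t| ≤ e^L`. -/
def truncKer (L a b : ℝ) : ℂ := ∫ s in (-L)..L, (osc a b s + osc (-a) (-b) s)

/-- A function that dominates the truncated kernels. -/
def kerBound (a b : ℝ) : ENNReal := 34 * (ofReal (1 + |a|) ^ ε₀ * ‖b‖ₑ ^ (-ε₀) +
    ofReal (1 + |b|) ^ ε₀ * ‖a‖ₑ ^ (-ε₀))

lemma enorm_integral_osc_le (a b : ℝ) {l L L' : ℝ} (hl : 0 ≤ l) (hL : l ≤ L) (hL' : l ≤ L') :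
    ‖∫ s in L..L', osc a b s‖ₑ ≤ ofReal (exp (-(l / 16))) *
      (17 * (ofReal (1 + |a|) ^ ε₀ * ‖b‖ₑ ^ (-ε₀))) := by
  wlog hLL : L ≤ L' generalizing L L'
  · rw [intervalIntegral.integral_symm, enorm_neg]
    exact this hL' hL (le_of_not_ge hLL)
  refine le_trans ?_ (mul_le_mul_left (ofReal_le_ofReal (exp_le_exp.2
    (show -(L / 16) ≤ -(l / 16) by linarith))) _)
  by_cases hb : b = 0
  · have h1 : ofReal (1 + |a|) ≠ 0 := by simp; positivity
    rw [hb, enorm_zero, zero_rpow_of_neg (by norm_num), mul_top, mul_top, mul_top]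
    · exact le_top
    · simpa using exp_pos _
    · simp
    · simp [h1]
  have h := norm_integral_osc_le_rpow hb (hl.trans hL) hLL (a := a)
  have hb' := abs_pos.2 hb
  rw [← ofReal_norm]
  refine (ofReal_le_ofReal h).trans (le_of_eq ?_)
  rw [Real.mul_rpow (by positivity) (by positivity), Real.div_rpow (by positivity) (by positivity),
    ofReal_mul (by norm_num), ofReal_mul (by positivity), div_eq_mul_inv,
    ofReal_mul (by positivity), ← rpow_neg (by positivity),
    ← ofReal_rpow_of_pos (by positivity), ← ofReal_rpow_of_pos hb',
    ← enorm_eq_ofReal_abs, ← exp_mul, show -L * (1 / 16) = -(L / 16) by ring]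
  norm_num
  ring

/-- Enlarging or translating a large window changes the integral only slightly. -/
lemma enorm_integral_osc_sub_le (a b : ℝ) {l x y x' y' : ℝ} (hl : 0 ≤ l) (hx : l ≤ x) (hy : l ≤ y)
    (hx' : l ≤ x') (hy' : l ≤ y') : ‖(∫ s in (-x)..y, (osc a b s + osc (-a) (-b) s)) -
      ∫ s in (-x')..y', (osc a b s + osc (-a) (-b) s)‖ₑ ≤
      ofReal (exp (-(l / 16))) * kerBound a b := by
  have ho := intervalIntegrable_osc
  have hi : ∀ c d, IntervalIntegrable (fun s => osc a b s + osc (-a) (-b) s) volume c d :=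
    fun c d => (ho a b c d).add (ho _ _ c d)
  have e2 : ∫ s in (-x)..(-x'), (osc a b s + osc (-a) (-b) s) =
      ∫ s in x'..x, (osc (-b) (-a) s + osc b a s) := by
    rw [← intervalIntegral.integral_comp_neg]
    refine intervalIntegral.integral_congr fun s _ => ?_
    simp only [osc_neg, neg_neg]
  rw [← intervalIntegral.integral_add_adjacent_intervals (hi (-x) (-x')) (hi _ y), e2,
    ← intervalIntegral.integral_add_adjacent_intervals (hi (-x') y') (hi _ y), add_sub_assoc,
    add_sub_cancel_left, intervalIntegral.integral_add (ho _ _ _ _) (ho _ _ _ _),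
    intervalIntegral.integral_add (ho _ _ _ _) (ho _ _ _ _)]
  have h1 := enorm_integral_osc_le a b hl hy' hy
  have h2 := enorm_integral_osc_le (-a) (-b) hl hy' hy
  have h3 := enorm_integral_osc_le (-b) (-a) hl hx' hx
  have h4 := enorm_integral_osc_le b a hl hx' hx
  simp only [abs_neg, enorm_neg] at h2 h3
  refine (enorm_add_le _ _).trans ((add_le_add ((enorm_add_le _ _).trans (add_le_add h3 h4))
    ((enorm_add_le _ _).trans (add_le_add h1 h2))).trans_eq ?_)
  rw [kerBound]; ring

lemma enorm_truncKer_sub_le (a b : ℝ) {L L' : ℝ} (hL : 0 ≤ L) (hLL : L ≤ L') :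
    ‖truncKer L' a b - truncKer L a b‖ₑ ≤ ofReal (exp (-(L / 16))) * kerBound a b :=
  enorm_integral_osc_sub_le a b hL hLL hLL le_rfl le_rfl

lemma truncKer_zero (a b : ℝ) : truncKer 0 a b = 0 := by simp [truncKer]

lemma enorm_truncKer_le (a b : ℝ) {L : ℝ} (hL : 0 ≤ L) : ‖truncKer L a b‖ₑ ≤ kerBound a b := by
  simpa [truncKer_zero] using enorm_truncKer_sub_le a b le_rfl hL

lemma norm_truncKer_le (a b : ℝ) {L : ℝ} (hL : 0 ≤ L) : ‖truncKer L a b‖ ≤ 4 * L := by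
  have := intervalIntegral.norm_integral_le_of_norm_le_const (a := -L) (b := L) (C := 2)
    (f := fun s => osc a b s + osc (-a) (-b) s) (fun s _ => (norm_add_le _ _).trans
      (by rw [norm_osc, norm_osc]; norm_num))
  rw [abs_of_nonneg (by linarith)] at this
  rw [truncKer]; linarith

@[fun_prop]
lemma Continuous.truncKer {α : Type*} [TopologicalSpace α] (L : ℝ)
    {f g : α → ℝ} (hf : Continuous f) (hg : Continuous g) :
    Continuous fun x => truncKer L (f x) (g x) := by
  have h : Continuous fun p : ℝ × ℝ => _root_.truncKer L p.1 p.2 :=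
    intervalIntegral.continuous_parametric_intervalIntegral_of_continuous'
      (f := fun (p : ℝ × ℝ) s => _root_.osc p.1 p.2 s + _root_.osc (-p.1) (-p.2) s)
      (by unfold Function.uncurry; fun_prop) _ _
  exact h.comp (f := fun x => (f x, g x)) (hf.prodMk hg)

/-- The kernel is symmetric. -/
lemma truncKer_swap (L a b : ℝ) : truncKer L b a = truncKer L a b := by
  have h := intervalIntegral.integral_comp_neg (a := -L) (b := L)
    (fun s => osc a b s + osc (-a) (-b) s)
  rw [neg_neg] at h
  rw [truncKer, truncKer, ← h]
  refine intervalIntegral.integral_congr fun s _ => ?_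
  simp only [osc_neg, neg_neg, add_comm]

lemma conj_osc (a b s : ℝ) : conj (osc a b s) = osc (-a) (-b) s := by
  rw [osc, osc, ← exp_conj]
  congr 1
  simp only [map_mul, conj_I, conj_ofReal, map_ofNat]
  push_cast; ring

/-- The kernel is real. -/
lemma conj_truncKer (L a b : ℝ) : conj (truncKer L a b) = truncKer L a b := by
  rw [truncKer, ← intervalIntegral.intervalIntegral_conj]
  refine intervalIntegral.integral_congr fun s _ => ?_
  simp only [map_add, conj_osc, neg_neg, add_comm]

end Osc

/-! ### The function `𝓕_symp (Φ̃ dm)` -/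

section ThetaFun
variable {m : ℕ}

/-- The full second component of `sigmaPoint (v, η)`. -/
def fullEta (q : Chart m) : Eu (m + 2) := joinLast q.2 (-⟪q.1, q.2⟫)

@[fun_prop]
lemma continuous_fullEta : Continuous (fullEta (m := m)) := by unfold fullEta; fun_prop

@[fun_prop]
lemma measurable_fullEta : Measurable (fullEta (m := m)) := continuous_fullEta.measurable

lemma sigmaPoint_eq (q : Chart m) : sigmaPoint q = (joinLast q.1 1, fullEta q) := rfl

lemma norm_joinLast_le (v : Eu (m + 1)) (c : ℝ) : ‖joinLast v c‖ ≤ ‖v‖ + |c| := by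
  refine abs_le_of_sq_le_sq' ?_ (by positivity) |>.2
  rw [norm_sq_joinLast]
  nlinarith [mul_nonneg (norm_nonneg v) (abs_nonneg c), sq_abs c]

/-- The functions on the chart that are integrable enough for the construction of
`𝓕_symp (Φ̃ dm)` as a function.  In the second condition, any of the coordinates of `e` may be
used; its value is infinite if this coordinate is `0`. -/
structure IsChartDecaying (u : Chart m → ℂ) : Prop where
  measurable : Measurable u
  bound : ∃ C : ENNReal, C ≠ ⊤ ∧ ∀ v : Eu (m + 1),
    (∫⁻ η, ‖u (v, η)‖ₑ * ofReal (1 + ‖fullEta (v, η)‖) ≤ C * normDecay ((m + 1 : ℕ) + 3 / 16) v) ∧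
    ∀ (e : Eu (m + 1)) (i : Fin (m + 1)), ∫⁻ η, ‖u (v, η)‖ₑ * ‖⟪e, η⟫‖ₑ ^ (-ε₀) ≤
        C * normDecay ((m + 1 : ℕ) + 3 / 16) v * ‖e i‖ₑ ^ (-ε₀)

/-- The arguments of the kernel. -/
def argA (p : Phase m) (q : Chart m) : ℝ := ⟪p.1, fullEta q⟫

/-- The arguments of the kernel. -/
def argB (p : Phase m) (q : Chart m) : ℝ := ⟪joinLast q.1 1, p.2⟫

lemma argA_eq (p : Phase m) (v η : Eu (m + 1)) :
    argA p (v, η) = ⟪starPart p.1 - lastCoord p.1 • v, η⟫ := by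
  rw [argA, fullEta]
  conv_lhs => rw [← joinLast_starPart_lastCoord p.1]
  rw [inner_joinLast, inner_sub_left, inner_smul_left]
  simp; ring

lemma ofReal_rpow_le_self {x : ℝ} (hx : 1 ≤ x) : ofReal x ^ ε₀ ≤ ofReal x := by
  conv_rhs => rw [← ENNReal.rpow_one (ofReal x)]
  exact ENNReal.rpow_le_rpow_of_exponent_le (by rwa [one_le_ofReal]) (by norm_num)

/-- The integral of the dominating function. -/
def kerIntegral (u : Chart m → ℂ) (p : Phase m) : ENNReal :=
  ∫⁻ q, ‖u q‖ₑ * kerBound (argA p q) (argB p q)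

@[fun_prop]
lemma Measurable.kerBound {α : Type*} [MeasurableSpace α] {f g : α → ℝ} (hf : Measurable f)
    (hg : Measurable g) : Measurable fun x => kerBound (f x) (g x) := by
  unfold _root_.kerBound; fun_prop

@[fun_prop]
lemma Continuous.argA {α : Type*} [TopologicalSpace α] {f : α → Phase m} {g : α → Chart m}
    (hf : Continuous f) (hg : Continuous g) : Continuous fun x => argA (f x) (g x) := by
  unfold _root_.argA; fun_prop

@[fun_prop]
lemma Continuous.argB {α : Type*} [TopologicalSpace α] {f : α → Phase m} {g : α → Chart m}
    (hf : Continuous f) (hg : Continuous g) : Continuous fun x => argB (f x) (g x) := by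
  unfold _root_.argB; fun_prop

@[fun_prop]
lemma Measurable.argA {α : Type*} [MeasurableSpace α] {f : α → Phase m} {g : α → Chart m}
    (hf : Measurable f) (hg : Measurable g) : Measurable fun x => argA (f x) (g x) := by
  unfold _root_.argA; fun_prop

@[fun_prop]
lemma Measurable.argB {α : Type*} [MeasurableSpace α] {f : α → Phase m} {g : α → Chart m}
    (hf : Measurable f) (hg : Measurable g) : Measurable fun x => argB (f x) (g x) := by
  unfold _root_.argB; fun_prop

lemma exists_kerIntegral_le {u : Chart m → ℂ} (hu : IsChartDecaying u) :
    ∃ C : ENNReal, C ≠ ⊤ ∧ ∀ (i j : Fin (m + 2)) (p : Phase m),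
      kerIntegral u p ≤ C * ofReal (1 + ‖p.1‖) * ofReal (1 + ‖p.2‖) *
        (‖p.1 i‖ₑ ^ (-ε₀) + ‖p.2 j‖ₑ ^ (-ε₀)) := by
  obtain ⟨hum, C, hC, hb⟩ := hu
  obtain ⟨K, hK, hK0, h⟩ := exists_lintegral_normDecay_sing m (e := 1 / 16) (by norm_num)
    (by norm_num) (q := (m + 1 : ℕ) + 2 / 16) (by norm_num)
  refine ⟨34 * (C * K), by simp [hC, hK, mul_eq_top], fun i j p => ?_⟩
  set Q : ℝ := (m + 1 : ℕ) + 3 / 16 with hQ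
  set X := ofReal (1 + ‖p.1‖) with hX
  set Z := ofReal (1 + ‖p.2‖) with hZ
  have hX1 : 1 ≤ X := by rw [hX, one_le_ofReal]; linarith [norm_nonneg p.1]
  have hZ1 : 1 ≤ Z := by rw [hZ, one_le_ofReal]; linarith [norm_nonneg p.2]
  have hBv : ∀ v : Eu (m + 1), |⟪joinLast v 1, p.2⟫| ≤ (1 + ‖v‖) * ‖p.2‖ := fun v =>
    (abs_real_inner_le_norm _ _).trans (by
      gcongr; have := norm_joinLast_le v 1; simpa [add_comm] using this)
  -- the two terms of the bound
  have t1 : ∀ v : Eu (m + 1), ∫⁻ η, ‖u (v, η)‖ₑ * (ofReal (1 + |argA p (v, η)|) ^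
      ε₀ * ‖argB p (v, η)‖ₑ ^ (-ε₀)) ≤
      X * C * (normDecay ((m + 1 : ℕ) + 2 / 16) v * ‖⟪joinLast v 1, p.2⟫‖ₑ ^ (-ε₀)) := fun v => by
    calc _ ≤ ∫⁻ η, (X * ‖⟪joinLast v 1, p.2⟫‖ₑ ^ (-ε₀)) *
          (‖u (v, η)‖ₑ * ofReal (1 + ‖fullEta (v, η)‖)) := by
          refine lintegral_mono fun η => ?_
          have h1 : ofReal (1 + |argA p (v, η)|) ^ ε₀ ≤ X * ofReal (1 + ‖fullEta (v, η)‖) := by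
            refine (ofReal_rpow_le_self (by linarith [abs_nonneg (argA p (v, η))])).trans ?_
            rw [hX, ← ofReal_mul (by positivity)]
            refine ofReal_le_ofReal ?_
            have := abs_real_inner_le_norm p.1 (fullEta (v, η))
            change 1 + |⟪p.1, fullEta (v, η)⟫| ≤ _
            nlinarith [norm_nonneg p.1, norm_nonneg (fullEta (v, η))]
          exact (mul_le_mul_right (mul_le_mul_left h1 _) _).trans_eq (by simp only [argB]; ring)
      _ = (X * ‖⟪joinLast v 1, p.2⟫‖ₑ ^ (-ε₀)) *
          ∫⁻ η, ‖u (v, η)‖ₑ * ofReal (1 + ‖fullEta (v, η)‖) := by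
          rw [lintegral_const_mul _ (by fun_prop)]
      _ ≤ (X * ‖⟪joinLast v 1, p.2⟫‖ₑ ^ (-ε₀)) * (C * normDecay ((m + 1 : ℕ) + 2 / 16) v) := by
          gcongr
          exact (hb v).1.trans (by gcongr; exact normDecay_anti (by rw [hQ]; norm_num) v)
      _ = _ := by ring
  -- an index and a coefficient vector for the second term
  obtain ⟨k, j', hkj⟩ : ∃ (k : Fin (m + 1)) (j' : Fin (m + 2)),
      ‖(joinLast (EuclideanSpace.single k (-lastCoord p.1)) (starPart p.1 k)) j'‖ₑ = ‖p.1 i‖ₑ := by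
    refine Fin.lastCases ?_ (fun k => ?_) i
    · refine ⟨0, (0 : Fin (m + 1)).castSucc, ?_⟩
      rw [joinLast_castSucc]; simp [lastCoord]
    · refine ⟨k, Fin.last _, ?_⟩
      rw [joinLast_last]; rfl
  set ζ := joinLast (EuclideanSpace.single k (-lastCoord p.1)) (starPart p.1 k) with hζ
  have hζv : ∀ v : Eu (m + 1), (starPart p.1 - lastCoord p.1 • v) k = ⟪joinLast v 1, ζ⟫ := fun v => by
    rw [hζ, inner_joinLast]; simp [EuclideanSpace.inner_single_right]; ring
  have t2 : ∀ v : Eu (m + 1), ∫⁻ η, ‖u (v, η)‖ₑ * (ofReal (1 + |argB p (v, η)|) ^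
      ε₀ * ‖argA p (v, η)‖ₑ ^ (-ε₀)) ≤
      Z * C * (normDecay ((m + 1 : ℕ) + 2 / 16) v * ‖⟪joinLast v 1, ζ⟫‖ₑ ^ (-ε₀)) := fun v => by
    have h1 : ofReal (1 + |⟪joinLast v 1, p.2⟫|) ^ ε₀ ≤ Z * ofReal (1 + ‖v‖) ^ ε₀ := by
      have : ofReal (1 + |⟪joinLast v 1, p.2⟫|) ≤ Z * ofReal (1 + ‖v‖) := by
        rw [hZ, ← ofReal_mul (by positivity)]
        refine ofReal_le_ofReal ?_
        nlinarith [hBv v, norm_nonneg v, norm_nonneg p.2]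
      refine (rpow_le_rpow this (by norm_num)).trans ?_
      rw [mul_rpow_of_nonneg _ _ (by norm_num)]
      gcongr
      exact ofReal_rpow_le_self (by linarith [norm_nonneg p.2])
    have h2 : normDecay Q v * ofReal (1 + ‖v‖) ^ ε₀ = normDecay ((m + 1 : ℕ) + 2 / 16) v := by
      have hp : 0 < 1 + ‖v‖ := by positivity
      rw [normDecay, normDecay, ofReal_rpow_of_pos hp, ← ofReal_mul (by positivity), ← rpow_add hp]
      congr 2; rw [hQ]; ring
    calc _ = ofReal (1 + |⟪joinLast v 1, p.2⟫|) ^ ε₀ *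
          ∫⁻ η, ‖u (v, η)‖ₑ * ‖⟪starPart p.1 - lastCoord p.1 • v, η⟫‖ₑ ^ (-ε₀) := by
          rw [← lintegral_const_mul _ (by fun_prop)]
          refine lintegral_congr fun η => ?_
          rw [argA_eq]; simp only [argB]; ring
      _ ≤ (Z * ofReal (1 + ‖v‖) ^ ε₀) * (C * normDecay Q v * ‖⟪joinLast v 1, ζ⟫‖ₑ ^ (-ε₀)) := by
          have h3 := (hb v).2 (starPart p.1 - lastCoord p.1 • v) k
          rw [hζv v] at h3
          exact mul_le_mul' h1 h3
      _ = _ := by rw [← h2]; ring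
  have s1 : ∫⁻ q : Chart m, ‖u q‖ₑ * (ofReal (1 + |argA p q|) ^ ε₀ * ‖argB p q‖ₑ ^ (-ε₀)) ≤
      X * C * (K * ‖p.2 j‖ₑ ^ (-ε₀)) := by
    rw [volume_eq_prod, lintegral_prod _ (by fun_prop)]
    refine (lintegral_mono t1).trans ?_
    rw [lintegral_const_mul _ (by fun_prop)]
    gcongr
    exact h j p.2
  have s2 : ∫⁻ q : Chart m, ‖u q‖ₑ * (ofReal (1 + |argB p q|) ^ ε₀ * ‖argA p q‖ₑ ^ (-ε₀)) ≤
      Z * C * (K * ‖p.1 i‖ₑ ^ (-ε₀)) := by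
    rw [volume_eq_prod, lintegral_prod _ (by fun_prop)]
    refine (lintegral_mono t2).trans ?_
    rw [lintegral_const_mul _ (by fun_prop)]
    gcongr
    exact (h j' ζ).trans (by rw [hkj])
  calc kerIntegral u p = 34 * ((∫⁻ q : Chart m, ‖u q‖ₑ *
        (ofReal (1 + |argA p q|) ^ ε₀ * ‖argB p q‖ₑ ^ (-ε₀))) + ∫⁻ q : Chart m, ‖u q‖ₑ *
        (ofReal (1 + |argB p q|) ^ ε₀ * ‖argA p q‖ₑ ^ (-ε₀))) := by
        rw [kerIntegral, ← lintegral_add_left (by fun_prop), ← lintegral_const_mul _ (by fun_prop)]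
        refine lintegral_congr fun q => ?_
        rw [kerBound]; ring
    _ ≤ 34 * (X * C * (K * ‖p.2 j‖ₑ ^ (-ε₀)) + Z * C * (K * ‖p.1 i‖ₑ ^ (-ε₀))) := by gcongr
    _ ≤ 34 * ((X * Z) * C * (K * ‖p.2 j‖ₑ ^ (-ε₀)) + (X * Z) * C * (K * ‖p.1 i‖ₑ ^ (-ε₀))) := by
        gcongr
        exacts [le_mul_of_one_le_right zero_le hZ1, le_mul_of_one_le_left zero_le hX1]
    _ = _ := by ring

end ThetaFun

section Slab
variable {X Q : Type*} [MeasurableSpace X] [MeasurableSpace Q] {μ : Measure X} {ν : Measure Q}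
  [SFinite μ] [SFinite ν]

/-- The sum of the values of the oscillating exponential at the two scales `± e^s`. -/
def oscPair (a b s : ℝ) : ℂ := osc a b s + osc (-a) (-b) s

@[fun_prop]
lemma Measurable.oscPair {α : Type*} [MeasurableSpace α] {a b s : α → ℝ} (ha : Measurable a)
    (hb : Measurable b) (hs : Measurable s) : Measurable fun x => oscPair (a x) (b x) (s x) := by
  unfold _root_.oscPair; fun_prop

lemma norm_oscPair_le (a b s : ℝ) : ‖oscPair a b s‖ ≤ 2 :=
  (norm_add_le _ _).trans (by rw [norm_osc, norm_osc]; norm_num)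

/-- Fubini's theorem for the truncated kernel. -/
lemma integral_truncKer_mul {u : Q → ℂ} (hu : Integrable u ν) {ψ : X → ℂ} (hψ : Integrable ψ μ)
    {A B : X → Q → ℝ} (hA : Measurable fun r : X × Q => A r.1 r.2)
    (hB : Measurable fun r : X × Q => B r.1 r.2) {L : ℝ} (hL : 0 ≤ L) :
    ∫ x, (∫ q, u q * truncKer L (A x q) (B x q) ∂ν) * ψ x ∂μ =
      ∫ s in (-L)..L, ∫ q, u q * ∫ x, oscPair (A x q) (B x q) s * ψ x ∂μ ∂ν := by
  set I : Measure ℝ := volume.restrict (Set.Ioc (-L) L) with hI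
  have hA' : Measurable fun r : X × (Q × ℝ) => A r.1 r.2.1 :=
    hA.comp (f := fun r : X × (Q × ℝ) => (r.1, r.2.1)) (by fun_prop)
  have hB' : Measurable fun r : X × (Q × ℝ) => B r.1 r.2.1 :=
    hB.comp (f := fun r : X × (Q × ℝ) => (r.1, r.2.1)) (by fun_prop)
  have hint : Integrable (fun r : X × (Q × ℝ) => oscPair (A r.1 r.2.1) (B r.1 r.2.1) r.2.2 *
      (ψ r.1 * (u r.2.1 * 1))) (μ.prod (ν.prod I)) :=
    (hψ.mul_prod (hu.mul_prod (integrable_const (1 : ℂ)))).bdd_mul (c := 2)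
      (Measurable.aestronglyMeasurable (by fun_prop)) (.of_forall fun r => norm_oscPair_le _ _ _)
  have e1 : ∫ x, (∫ q, u q * truncKer L (A x q) (B x q) ∂ν) * ψ x ∂μ =
      ∫ r, oscPair (A r.1 r.2.1) (B r.1 r.2.1) r.2.2 * (ψ r.1 * (u r.2.1 * 1))
        ∂(μ.prod (ν.prod I)) := by
    rw [integral_prod _ hint]
    refine integral_ext_ae hint.prod_right_ae fun x hx => ?_
    rw [integral_prod _ hx, ← integral_mul_const]
    refine integral_ext fun q => ?_
    change u q * truncKer L (A x q) (B x q) * ψ x = ∫ s, oscPair (A x q) (B x q) s *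
      (ψ x * (u q * 1)) ∂I
    rw [integral_mul_const, truncKer, intervalIntegral.integral_of_le (by linarith)]
    simp only [oscPair]; ring
  rw [e1, intervalIntegral.integral_of_le (by linarith), integral_prod_symm _ hint]
  refine (integral_prod_symm _ hint.integral_prod_right).trans ?_
  refine integral_congr_ae (.of_forall fun s => integral_ext fun q => ?_)
  change ∫ x, oscPair (A x q) (B x q) s * (ψ x * (u q * 1)) ∂μ =
    u q * ∫ x, oscPair (A x q) (B x q) s * ψ x ∂μ
  rw [← integral_const_mul]
  exact integral_congr_ae (.of_forall fun x => by ring)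

end Slab

instance (k : ℕ) : (volume : Measure (Eu² k)).IsAddHaarMeasure := by
  rw [volume_eq_prod]; infer_instance

section ThetaFun
variable {m : ℕ} {u : Chart m → ℂ}

lemma IsChartDecaying.integrable (hu : IsChartDecaying u) : Integrable u volume := by
  refine ⟨hu.measurable.aestronglyMeasurable, ?_⟩
  obtain ⟨C, hC, h⟩ := hu.bound
  have hm := hu.measurable
  have : ∫⁻ q, ‖u q‖ₑ ≤ C * ∫⁻ v : Eu (m + 1), normDecay ((m + 1 : ℕ) + 3 / 16) v := by
    rw [volume_eq_prod, lintegral_prod _ (by fun_prop),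
      ← lintegral_const_mul _ (by fun_prop)]
    refine lintegral_mono fun v => le_trans (lintegral_mono fun η => ?_) (h v).1
    exact le_mul_of_one_le_right zero_le
      (by rw [one_le_ofReal]; linarith [norm_nonneg (fullEta (v, η))])
  exact this.trans_lt (mul_lt_top hC.lt_top (lintegral_normDecay_lt_top (by norm_num)))

/-- The function `𝓕_symp (Φ̃ dm)`, with the integral over the scales truncated. -/
def truncTheta (u : Chart m → ℂ) (L : ℕ) (p : Phase m) : ℂ :=
  ∫ q, u q * truncKer L (argA p q) (argB p q)

/-- The function `𝓕_symp (Φ̃ dm)`, as the limit of its truncations. -/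
def thetaLim (u : Chart m → ℂ) (p : Phase m) : ℂ := limUnder atTop fun L : ℕ => truncTheta u L p

lemma integrable_mul_truncKer (hu : Integrable u volume) (L : ℕ) (p : Phase m) :
    Integrable fun q => u q * truncKer L (argA p q) (argB p q) :=
  hu.mul_bdd (c := 4 * L) (Continuous.aestronglyMeasurable (by fun_prop))
    (.of_forall fun q => norm_truncKer_le _ _ (Nat.cast_nonneg L))

lemma continuous_truncTheta (hu : Integrable u volume) (L : ℕ) : Continuous (truncTheta u L) := by
  refine continuous_of_dominated (F := fun p q => u q * truncKer L (argA p q) (argB p q))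
    (bound := fun q => ‖u q‖ * (4 * L)) (fun p => (integrable_mul_truncKer hu L p).1)
    (fun p => .of_forall fun q => ?_) (hu.norm.mul_const _) (.of_forall fun q => ?_)
  · rw [norm_mul]; gcongr; exact norm_truncKer_le _ _ (Nat.cast_nonneg L)
  · fun_prop

lemma enorm_truncTheta_le (p : Phase m) (L : ℕ) : ‖truncTheta u L p‖ₑ ≤ kerIntegral u p := by
  refine (enorm_integral_le_lintegral_enorm _).trans (lintegral_mono fun q => ?_)
  rw [enorm_mul]
  exact mul_le_mul_right (enorm_truncKer_le _ _ (Nat.cast_nonneg L)) _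

lemma enorm_truncTheta_sub_le (hu : Integrable u volume) (hm : Measurable u)
    (p : Phase m) {L L' : ℕ} (h : L ≤ L') : ‖truncTheta u L' p - truncTheta u L p‖ₑ ≤
      ofReal (exp (-(L / 16))) * kerIntegral u p := by
  rw [truncTheta, truncTheta, ← integral_sub (integrable_mul_truncKer hu L' p)
    (integrable_mul_truncKer hu L p), kerIntegral, ← lintegral_const_mul _ (by fun_prop)]
  refine (enorm_integral_le_lintegral_enorm _).trans ?_
  have key : ∀ (c k k' : ℂ) (e B : ENNReal), ‖k' - k‖ₑ ≤ e * B →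
      ‖c * k' - c * k‖ₑ ≤ e * (‖c‖ₑ * B) := fun c k k' e B h => by
    rw [← mul_sub, enorm_mul]
    exact (mul_le_mul_right h _).trans (le_of_eq (by ring))
  exact lintegral_mono fun q => key _ _ _ _ _
    (enorm_truncKer_sub_le _ _ (Nat.cast_nonneg L) (Nat.cast_le.2 h))

lemma tendsto_exp_neg_div : Tendsto (fun L : ℕ => ofReal (exp (-(L / 16 : ℝ)))) atTop (𝓝 0) := by
  rw [← ENNReal.ofReal_zero]
  refine tendsto_ofReal (Real.tendsto_exp_neg_atTop_nhds_zero.comp ?_)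
  exact tendsto_natCast_atTop_atTop.atTop_div_const (by norm_num)

lemma tendsto_truncTheta (hu : Integrable u volume) (hm : Measurable u)
    {p : Phase m} (hp : kerIntegral u p ≠ ⊤) :
    Tendsto (fun L => truncTheta u L p) atTop (𝓝 (thetaLim u p)) := by
  refine CauchySeq.tendsto_limUnder (EMetric.cauchySeq_iff_le_tendsto_0.2
    ⟨fun L : ℕ => ofReal (exp (-(L / 16))) * kerIntegral u p +
      ofReal (exp (-(L / 16))) * kerIntegral u p, fun a b N ha hb => ?_, ?_⟩)
  · have h1 := enorm_truncTheta_sub_le hu hm p ha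
    have h2 := enorm_truncTheta_sub_le hu hm p hb
    rw [← edist_eq_enorm_sub] at h1 h2
    exact (edist_triangle_right _ _ _).trans (add_le_add h1 h2)
  · have := ENNReal.Tendsto.mul_const tendsto_exp_neg_div (Or.inr hp)
    simpa using this.add this

lemma enorm_thetaLim_sub_le (hu : Integrable u volume) (hm : Measurable u)
    {p : Phase m} (hp : kerIntegral u p ≠ ⊤) (L : ℕ) :
    ‖thetaLim u p - truncTheta u L p‖ₑ ≤ ofReal (exp (-(L / 16))) * kerIntegral u p := by
  exact le_of_tendsto ((tendsto_truncTheta hu hm hp).sub_const (truncTheta u L p)).enorm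
    ((eventually_ge_atTop L).mono fun L' => enorm_truncTheta_sub_le hu hm p)

lemma exists_coord_ne_zero {k : ℕ} {v : Eu k} (hv : v ≠ 0) : ∃ i, v i ≠ 0 := by
  by_contra! h
  exact hv (PiLp.ext h)

lemma exists_nhds_kerIntegral_le (hu : IsChartDecaying u) {p : Phase m}
    (hp : p ∈ regularSet (m + 1)) : ∃ B : ENNReal, B ≠ ⊤ ∧ ∀ᶠ p' in 𝓝 p, kerIntegral u p' ≤ B := by
  obtain ⟨C, hC, h⟩ := exists_kerIntegral_le hu
  obtain ⟨i, hi⟩ := exists_coord_ne_zero hp.1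
  obtain ⟨j, hj⟩ := exists_coord_ne_zero hp.2
  have a1 : 0 < |p.1 i| := abs_pos.2 hi
  have a2 : 0 < |p.2 j| := abs_pos.2 hj
  refine ⟨C * ofReal (1 + (‖p.1‖ + 1)) * ofReal (1 + (‖p.2‖ + 1)) *
    (ofReal (|p.1 i| / 2) ^ (-ε₀) + ofReal (|p.2 j| / 2) ^ (-ε₀)), ?_, ?_⟩
  · rw [ofReal_rpow_of_pos (by positivity), ofReal_rpow_of_pos (by positivity)]
    simp [mul_eq_top, hC]
  have o {f : Phase m → ℝ} {c} (hf : Continuous f) (hc : f p < c) : ∀ᶠ p' in 𝓝 p, f p' < c :=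
    hf.continuousAt.eventually_lt_const hc
  filter_upwards [o (f := fun p => -|p.1 i|) (by fun_prop) (neg_lt_neg (half_lt_self a1)),
    o (f := fun p => -|p.2 j|) (by fun_prop) (neg_lt_neg (half_lt_self a2)),
    o (f := fun p => ‖p.1‖) (by fun_prop) (lt_add_one _),
    o (f := fun p => ‖p.2‖) (by fun_prop) (lt_add_one _)] with p' h1 h2 h3 h4
  refine (h i j p').trans ?_
  rw [enorm_eq_ofReal_abs, enorm_eq_ofReal_abs]
  refine mul_le_mul' (mul_le_mul' (mul_le_mul_right (ofReal_le_ofReal (by linarith)) _)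
    (ofReal_le_ofReal (by linarith))) (add_le_add ?_ ?_)
  · exact rpow_neg_anti (ofReal_le_ofReal (neg_le_neg_iff.1 h1.le)) (by norm_num)
  · exact rpow_neg_anti (ofReal_le_ofReal (neg_le_neg_iff.1 h2.le)) (by norm_num)

lemma kerIntegral_ne_top (hu : IsChartDecaying u) {p : Phase m} (hp : p ∈ regularSet (m + 1)) :
    kerIntegral u p ≠ ⊤ :=
  have ⟨_, hB, hB'⟩ := exists_nhds_kerIntegral_le hu hp
  ne_top_of_le_ne_top hB hB'.self_of_nhds

lemma isOpen_regularSet (n : ℕ) : IsOpen (regularSet n) :=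
  (isOpen_ne.preimage continuous_fst).inter (isOpen_ne.preimage continuous_snd)

lemma continuousOn_thetaLim (hu : IsChartDecaying u) :
    ContinuousOn (thetaLim u) (regularSet (m + 1)) := by
  have key : TendstoLocallyUniformlyOn (fun L p => truncTheta u L p) (thetaLim u) atTop
      (regularSet (m + 1)) := by
    rw [EMetric.tendstoLocallyUniformlyOn_iff]
    intro ε hε p hp
    obtain ⟨B, hB, hb⟩ := exists_nhds_kerIntegral_le hu hp
    refine ⟨_, mem_nhdsWithin_of_mem_nhds hb, ?_⟩
    have ht := ENNReal.Tendsto.mul_const tendsto_exp_neg_div (b := B) (Or.inr hB)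
    rw [zero_mul] at ht
    filter_upwards [ht.eventually_lt_const hε] with L hL p' hp'
    rw [edist_eq_enorm_sub]
    exact ((enorm_thetaLim_sub_le hu.integrable hu.measurable
      (ne_top_of_le_ne_top hB hp') L).trans (mul_le_mul_right hp' _)).trans_lt hL
  exact key.continuousOn (.of_forall fun L => (continuous_truncTheta hu.integrable L).continuousOn)

/-- The pairing of `𝓕_symp (Φ̃ dm)`, pulled back by a map `P`, with an integrable function, is the
limit of the pairings of the truncations. -/
lemma tendsto_integral_truncTheta {X : Type*} [MeasurableSpace X] {μ : Measure X} [SFinite μ]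
    (hu : IsChartDecaying u) {P : X → Phase m} (hP : Measurable P) {ψ : X → ℂ}
    (hψ : Integrable ψ μ) (hfin : ∫⁻ x, kerIntegral u (P x) * ‖ψ x‖ₑ ∂μ ≠ ⊤) :
    Tendsto (fun L : ℕ => ∫ s in (-(L : ℝ))..L, ∫ q, u q * ∫ x,
      oscPair (argA (P x) q) (argB (P x) q) s * ψ x ∂μ) atTop
      (𝓝 (∫ x, thetaLim u (P x) * ψ x ∂μ)) := by
  have hum := hu.measurable
  have hk : Measurable fun x => kerIntegral u (P x) := by
    unfold kerIntegral
    exact Measurable.lintegral_prod_right (f := fun x (q : Chart m) =>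
      ‖u q‖ₑ * kerBound (argA (P x) q) (argB (P x) q)) (by unfold Function.uncurry; fun_prop)
  have hmm : AEMeasurable (fun x => kerIntegral u (P x) * ‖ψ x‖ₑ) μ :=
    hk.aemeasurable.mul hψ.1.enorm
  have hae := ae_lt_top' hmm hfin
  have := tendsto_integral_of_dominated_convergence
    (F := fun (L : ℕ) x => truncTheta u L (P x) * ψ x) (f := fun x => thetaLim u (P x) * ψ x) (μ := μ)
    (fun x => (kerIntegral u (P x) * ‖ψ x‖ₑ).toReal)
    (fun L => ((continuous_truncTheta hu.integrable L).measurable.comp hP).aestronglyMeasurable.mul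
      hψ.1) (integrable_toReal_of_lintegral_ne_top hmm hfin) (fun L => ?_) ?_
  · refine this.congr fun L => ?_
    exact integral_truncKer_mul hu.integrable hψ (A := fun x q => argA (P x) q)
      (B := fun x q => argB (P x) q) (by fun_prop) (by fun_prop) (Nat.cast_nonneg L)
  · filter_upwards [hae] with x hx
    rw [← toReal_enorm, enorm_mul]
    exact ENNReal.toReal_mono hx.ne (mul_le_mul_left (enorm_truncTheta_le _ _) _)
  · filter_upwards [hae] with x hx
    by_cases h0 : ψ x = 0
    · simp [h0]
    · refine (tendsto_truncTheta hu.integrable hum fun ht => ?_).mul_const _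
      rw [ht, ENNReal.top_mul (by simpa using h0)] at hx
      exact hx.ne rfl

lemma integrable_scaleMeasure {f : ℝ → ℂ} (hf : Integrable f scaleMeasure) :
    Integrable (fun s => f (exp s)) ∧ Integrable (fun s => f (-exp s)) := by
  rw [scaleMeasure, integrable_add_measure] at hf
  refine ⟨hf.1.comp_measurable (by fun_prop), hf.2.comp_measurable (by fun_prop)⟩

lemma integral_scaleMeasure {f : ℝ → ℂ} (hf : Integrable f scaleMeasure) :
    ∫ t, f t ∂scaleMeasure = ∫ s, (f (exp s) + f (-exp s)) := by
  obtain ⟨h1, h2⟩ := integrable_scaleMeasure hf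
  rw [integral_add h1 h2]
  rw [scaleMeasure, integrable_add_measure] at hf
  rw [scaleMeasure, integral_add_measure hf.1 hf.2, integral_map (by fun_prop) hf.1.1,
    integral_map (by fun_prop) hf.2.1]

lemma sympKernel_exp (p : Phase m) (q : Chart m) (s : ℝ) :
    sympKernel p (coneMap (exp s, q)) = osc (argA p q) (argB p q) s ∧
    sympKernel p (coneMap (-exp s, q)) = osc (-argA p q) (-argB p q) s := by
  constructor <;>
  · rw [sympKernel, osc, coneMap, scaleAct, sigmaPoint_eq, argA, argB]
    simp only [inner_smul_left, inner_smul_right, exp_neg, conj_trivial, inv_neg]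
    congr 1; push_cast; ring

lemma integral_oscPair_mul (ψ : 𝓢(Phase m, ℂ)) (q : Chart m) (s : ℝ) :
    ∫ p, oscPair (argA p q) (argB p q) s * ψ p =
      sympS (m + 2) ψ (coneMap (exp s, q)) + sympS (m + 2) ψ (coneMap (-exp s, q)) := by
  rw [← sympKernel_integral, ← sympKernel_integral]
  simp_rw [(sympKernel_exp _ q s).1, (sympKernel_exp _ q s).2, oscPair, add_mul]
  apply integral_add <;>
  exact ψ.integrable.bdd_mul (c := 1) (Measurable.aestronglyMeasurable (by fun_prop))
    (.of_forall fun p => (norm_osc _ _ _).le)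

lemma exists_kerIntegral_le_of_isCompact (hu : IsChartDecaying u) {K : Set Phase m}
    (hK : IsCompact K) (hKr : K ⊆ regularSet (m + 1)) :
    ∃ B : ENNReal, B ≠ ⊤ ∧ ∀ p ∈ K, kerIntegral u p ≤ B := by
  refine hK.induction_on ⟨0, by simp, by simp⟩
    (fun s t hst ⟨B, hB, h⟩ => ⟨B, hB, fun p hp => h p (hst hp)⟩)
    (fun s t ⟨B, hB, h⟩ ⟨B', hB', h'⟩ => ⟨B + B', by simp [hB, hB'], fun p hp =>
      hp.elim (fun hp => (h p hp).trans le_self_add) fun hp => (h' p hp).trans le_add_self⟩)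
    (fun p hp => ?_)
  · obtain ⟨B, hB, hb⟩ := exists_nhds_kerIntegral_le hu (hKr hp)
    exact ⟨_, mem_nhdsWithin_of_mem_nhds hb, B, hB, fun p hp => hp⟩

theorem thetaEqOn_thetaLim (hu : IsChartDecaying u) (hu2 : MemLp u 2 volume) :
    ThetaEqOn u (regularSet (m + 1)) (thetaLim u) := by
  intro ψ hψ hsupp
  obtain ⟨B, hB, hb⟩ := exists_kerIntegral_le_of_isCompact hu hψ hsupp
  have hfin : ∫⁻ x, kerIntegral u (id x) * ‖ψ x‖ₑ ≠ ⊤ := by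
    refine ne_top_of_le_ne_top (b := B * ∫⁻ x, ‖ψ x‖ₑ) (mul_ne_top hB ψ.integrable.2.ne) ?_
    rw [← lintegral_const_mul _ (by fun_prop)]
    refine lintegral_mono fun p => ?_
    by_cases hp : p ∈ tsupport ψ
    · exact mul_le_mul_left (hb p hp) _
    · simp [image_eq_zero_of_notMem_tsupport hp]
  have h1 := tendsto_integral_truncTheta hu (P := id) measurable_id ψ.integrable hfin
  simp only [id, integral_oscPair_mul] at h1
  set φ := sympS (m + 2) ψ with hφ
  have hG : Integrable (fun r => u r.2 * φ (coneMap r)) (scaleMeasure.prod volume) := by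
    refine (integrable_coneMap hu2.toLp φ).congr ?_
    filter_upwards [ae_prod_snd hu2.coeFn_toLp] with r hr
    rw [hr]
  obtain ⟨i1, i2⟩ := integrable_scaleMeasure hG.integral_prod_left
  have e1 : thetaDist u ψ = ∫ s : ℝ, ∫ q, u q * (φ (coneMap (exp s, q)) +
      φ (coneMap (-exp s, q))) ∧ Integrable fun s : ℝ => ∫ q, u q *
      (φ (coneMap (exp s, q)) + φ (coneMap (-exp s, q))) := by
    have hc : ∀ t : ℝ, Integrable fun q => u q * φ (coneMap (t, q)) := fun t => by
      obtain ⟨M, hM⟩ := φ.decay 0 0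
      refine hu.integrable.mul_bdd (c := M) (φ.continuous.measurable.comp (by fun_prop)).aestronglyMeasurable
        (.of_forall fun q => by simpa using hM.2 (coneMap (t, q)))
    simp only [mul_add, integral_add (hc _) (hc _)]
    refine ⟨?_, i1.add i2⟩
    rw [thetaDist_eq, conePairing_eq hu.measurable.aestronglyMeasurable φ.continuous,
      integral_prod _ hG]
    exact integral_scaleMeasure hG.integral_prod_left
  have h2 := intervalIntegral_tendsto_integral e1.2
    (tendsto_neg_atTop_atBot.comp tendsto_natCast_atTop_atTop) tendsto_natCast_atTop_atTop
  rw [e1.1]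
  exact tendsto_nhds_unique h2 h1

/-- Where `x ≠ 0` and `ξ ≠ 0`, a continuous function is determined by the distribution. -/
lemma IsThetaFun.eqOn {w : Chart m → ℂ} {g g' : Phase m → ℂ}
    (h : IsThetaFun w g) (h' : IsThetaFun w g') : Set.EqOn g g' (regularSet (m + 1)) := by
  have ho := isOpen_regularSet (m + 1)
  have h0 : ∀ᵐ p : Phase m, p ∈ regularSet (m + 1) → (g - g') p = 0 := by
    refine ho.ae_eq_zero_of_integral_contDiff_smul_eq_zero
      ((h.1.sub h'.1).locallyIntegrableOn ho.measurableSet) fun b hb hbs hbt => ?_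
    set ψ : 𝓢(Phase m, ℂ) := HasCompactSupport.toSchwartzMap
      (f := fun x => (b x : ℂ)) (hbs.comp_left ofReal_zero) (ofRealCLM.contDiff.comp hb) with hψ
    have hψb : ∀ x, ψ x = (b x : ℂ) := fun x => rfl
    have hψs : HasCompactSupport ψ := hbs.comp_left ofReal_zero
    have hψt : tsupport ψ ⊆ regularSet (m + 1) :=
      (closure_mono fun x hx => by simpa [hψb] using hx).trans hbt
    have int : ∀ f : Phase m → ℂ, ContinuousOn f (regularSet (m + 1)) →
        Integrable fun p => f p * ψ p := fun f hf =>
      ((hf.mul ψ.continuous.continuousOn).continuous_of_tsupport_subset ho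
        ((tsupport_mul_subset_right).trans hψt)).integrable_of_hasCompactSupport (hψs.mul_left)
    have e := (h.2 ψ hψs hψt).symm.trans (h'.2 ψ hψs hψt)
    rw [← sub_eq_zero, ← integral_sub (int g h.1) (int g' h'.1)] at e
    rw [← e]
    refine integral_ext fun p => ?_
    simp only [Pi.sub_apply, hψb, real_smul]; ring
  refine Measure.eqOn_open_of_ae_eq (μ := volume) ((ae_restrict_iff' ho.measurableSet).2 ?_) ho h.1 h'.1
  filter_upwards [h0] with p hp hpr using sub_eq_zero.1 (hp hpr)

lemma isThetaFun_thetaFun {w : Chart m → ℂ} (hu : IsChartDecaying u)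
    (hu2 : MemLp u 2 volume) (hw : w =ᵐ[volume] u) : IsThetaFun w (thetaFun w) ∧
      Set.EqOn (thetaFun w) (thetaLim u) (regularSet (m + 1)) := by
  have h : IsThetaFun w (thetaLim u) := ⟨continuousOn_thetaLim hu, fun ψ h1 h2 =>
    (thetaDist_congr hw ψ).trans (thetaEqOn_thetaLim hu hu2 ψ h1 h2)⟩
  have h' : IsThetaFun w (thetaFun w) := Classical.epsilon_spec ⟨_, h⟩
  exact ⟨h', h'.eqOn h⟩

end ThetaFun

/-! ### Rapidly decaying functions and test functions -/

section Rapid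
variable {m : ℕ}

lemma exists_norm_le_coord (v : Eu (m + 1)) : ∃ i, ‖v‖ ≤ (m + 1 : ℕ) * |v i| := by
  obtain ⟨i, -, hi⟩ := Finset.exists_max_image Finset.univ (fun i => |v i|) Finset.univ_nonempty
  refine ⟨i, abs_le_of_sq_le_sq' ?_ (by positivity) |>.2⟩
  rw [EuclideanSpace.real_norm_sq_eq]
  calc ∑ j, v j ^ 2 ≤ ∑ _j : Fin (m + 1), |v i| ^ 2 := Finset.sum_le_sum fun j _ => by
        rw [← sq_abs]; exact pow_le_pow_left₀ (abs_nonneg _) (hi j (Finset.mem_univ _)) 2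
    _ = (m + 1 : ℕ) * |v i| ^ 2 := by simp
    _ ≤ (m + 1 : ℕ) ^ 2 * |v i| ^ 2 := by
        have : (1 : ℝ) ≤ (m + 1 : ℕ) := by simp
        gcongr; nlinarith
    _ = _ := by ring

lemma exists_lintegral_normDecay_inner (m : ℕ) {ε : ℝ} (h0 : 0 < ε) (h1 : ε < 1) :
    ∃ K : ENNReal, K ≠ ⊤ ∧ ∀ (i : Fin (m + 1)) (c : Eu (m + 1)),
      ∫⁻ θ : Eu (m + 1), normDecay ((m + 1 : ℕ) * 2) θ * ‖⟪c, θ⟫‖ₑ ^ (-ε) ≤ K * ‖c i‖ₑ ^ (-ε) := by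
  obtain ⟨K, hK, -, hb⟩ := exists_lintegral_prod_decay_sing m one_lt_two h0 h1
  refine ⟨K, hK, fun i c => le_trans (lintegral_mono fun θ => ?_) (hb i c 0)⟩
  rw [add_zero]
  exact mul_le_mul_left (normDecay_le_prod zero_le_two θ) _

lemma exists_lintegral_two_sing (m : ℕ) : ∃ K : ENNReal, K ≠ ⊤ ∧
    ∀ (v e : Eu (m + 1)) (j : Fin (m + 1)),
      ∫⁻ θ : Eu (m + 1), normDecay ((m + 1 : ℕ) * 2) θ * min 1 (‖⟪v, θ⟫‖ₑ ^ (-(1 / 4) : ℝ)) *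
        ‖⟪e, θ⟫‖ₑ ^ (-ε₀) ≤ K * ofReal (1 + ‖v‖) ^ (-(1 / 4) : ℝ) * ‖e j‖ₑ ^ (-ε₀) := by
  obtain ⟨K₁, hK₁, h₁⟩ := exists_lintegral_normDecay_inner m (ε := 1 / 16) (by norm_num) (by norm_num)
  obtain ⟨K₂, hK₂, h₂⟩ := exists_lintegral_normDecay_inner m (ε := 1 / 8) (by norm_num) (by norm_num)
  obtain ⟨K₃, hK₃, h₃⟩ := exists_lintegral_normDecay_inner m (ε := 1 / 2) (by norm_num) (by norm_num)
  set N : ENNReal := ofReal ((2 * (m + 1 : ℕ)) ^ (1 / 4 : ℝ)) with hN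
  have key : ∀ (v : Eu (m + 1)) (x : ℝ), 1 + ‖v‖ ≤ 2 * (m + 1 : ℕ) * x → 0 < x →
      ofReal x ^ (-(1 / 4) : ℝ) ≤ N * ofReal (1 + ‖v‖) ^ (-(1 / 4) : ℝ) := by
    intro v x hx h0
    rw [hN, ofReal_rpow_of_pos h0, ofReal_rpow_of_pos (by positivity), ← ofReal_mul (by positivity)]
    refine ofReal_le_ofReal ?_
    calc x ^ (-(1 / 4) : ℝ) =
          (2 * (m + 1 : ℕ)) ^ (1 / 4 : ℝ) * (2 * (m + 1 : ℕ) * x) ^ (-(1 / 4) : ℝ) := by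
          rw [Real.mul_rpow (by positivity) h0.le, ← mul_assoc, ← rpow_add (by positivity)]
          norm_num
      _ ≤ _ := mul_le_mul_of_nonneg_left
        (Real.rpow_le_rpow_of_nonpos (by positivity) hx (by norm_num)) (by positivity)
  refine ⟨(K₁ + K₃ ^ (1 / 2 : ℝ) * K₂ ^ (1 / 2 : ℝ)) * N, mul_ne_top (add_ne_top.2 ⟨hK₁, mul_ne_top
      (rpow_ne_top_of_nonneg (by norm_num) hK₃)
      (rpow_ne_top_of_nonneg (by norm_num) hK₂)⟩) ofReal_ne_top, fun v e j => ?_⟩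
  rcases le_total ‖v‖ 1 with hv | hv
  · calc _ ≤ ∫⁻ θ : Eu (m + 1), normDecay ((m + 1 : ℕ) * 2) θ * ‖⟪e, θ⟫‖ₑ ^ (-ε₀) :=
          lintegral_mono fun θ => mul_le_mul_left
            (mul_le_of_le_one_right zero_le (min_le_left _ _)) _
      _ ≤ K₁ * ‖e j‖ₑ ^ (-ε₀) := h₁ j e
      _ ≤ K₁ * (N * ofReal (1 + ‖v‖) ^ (-(1 / 4) : ℝ)) * ‖e j‖ₑ ^ (-ε₀) := by
          refine mul_le_mul_left (le_mul_of_one_le_right zero_le ?_) _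
          simpa using key v 1 (by push_cast; nlinarith [Nat.cast_nonneg (α := ℝ) m]) one_pos
      _ ≤ _ := by rw [← mul_assoc]; gcongr; exact le_self_add
  · obtain ⟨i, hi⟩ := exists_norm_le_coord v
    have hvi : 0 < |v i| := by
      by_contra! h0
      nlinarith [Nat.cast_nonneg (α := ℝ) (m + 1)]
    have hD : ∀ θ : Eu (m + 1), normDecay ((m + 1 : ℕ) * 2) θ =
        normDecay (m + 1 : ℕ) θ * normDecay (m + 1 : ℕ) θ := fun θ => by
      rw [← normDecay_add]; congr 1; ring
    calc _ ≤ ∫⁻ θ : Eu (m + 1), (normDecay (m + 1 : ℕ) θ * ‖⟪v, θ⟫‖ₑ ^ (-(1 / 4) : ℝ)) *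
          (normDecay (m + 1 : ℕ) θ * ‖⟪e, θ⟫‖ₑ ^ (-ε₀)) := by
          refine lintegral_mono fun θ => ?_
          rw [hD]
          exact (mul_le_mul_left (mul_le_mul_right (min_le_right _ _) _) _).trans_eq (by ring)
      _ ≤ (∫⁻ θ : Eu (m + 1), (normDecay (m + 1 : ℕ) θ * ‖⟪v, θ⟫‖ₑ ^ (-(1 / 4) : ℝ)) ^ (2 : ℝ)) ^
            (1 / 2 : ℝ) *
          (∫⁻ θ : Eu (m + 1), (normDecay (m + 1 : ℕ) θ * ‖⟪e, θ⟫‖ₑ ^ (-ε₀)) ^ (2 : ℝ)) ^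
            (1 / 2 : ℝ) := ENNReal.lintegral_mul_le_Lp_mul_Lq _ .two_two (by fun_prop) (by fun_prop)
      _ ≤ (K₃ * ‖v i‖ₑ ^ (-(1 / 2) : ℝ)) ^ (1 / 2 : ℝ) *
          (K₂ * ‖e j‖ₑ ^ (-(1 / 8) : ℝ)) ^ (1 / 2 : ℝ) := by
          refine mul_le_mul' (rpow_le_rpow (le_trans (le_of_eq ?_) (h₃ i v)) (by norm_num))
            (rpow_le_rpow (le_trans (le_of_eq ?_) (h₂ j e)) (by norm_num))
          all_goals
            refine lintegral_congr fun θ => ?_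
            rw [mul_rpow_of_nonneg _ _ zero_le_two, ← rpow_mul, hD, rpow_two, sq]
            norm_num
      _ = (K₃ ^ (1 / 2 : ℝ) * K₂ ^ (1 / 2 : ℝ)) * ‖v i‖ₑ ^ (-(1 / 4) : ℝ) * ‖e j‖ₑ ^ (-ε₀) := by
          rw [mul_rpow_of_nonneg _ _ (by norm_num), mul_rpow_of_nonneg _ _ (by norm_num),
            ← rpow_mul, ← rpow_mul]
          norm_num; ring
      _ ≤ (K₃ ^ (1 / 2 : ℝ) * K₂ ^ (1 / 2 : ℝ)) * (N * ofReal (1 + ‖v‖) ^ (-(1 / 4) : ℝ)) *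
          ‖e j‖ₑ ^ (-ε₀) := by
          refine mul_le_mul_left (mul_le_mul_right ?_ _) _
          rw [enorm_eq_ofReal_abs]
          exact key v _ (by nlinarith) hvi
      _ ≤ _ := by rw [← mul_assoc]; gcongr; exact le_add_self

/-- The functions on the chart that decay like a large power of
`1 + (1 + |y_*|) |η|`, with `η` the full second component of the corresponding point. -/
structure IsRapid (u : Chart m → ℂ) : Prop where
  measurable : Measurable u
  bound : ∃ M : ℝ, ∀ q, (1 + (1 + ‖q.1‖) * ‖fullEta q‖) ^ (2 * (m + 1) + 3) * ‖u q‖ ≤ M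

variable {u : Chart m → ℂ}

lemma norm_le_norm_fullEta (q : Chart m) : ‖q.2‖ ≤ ‖fullEta q‖ := by
  refine abs_le_of_sq_le_sq' ?_ (norm_nonneg _) |>.2
  rw [fullEta, norm_sq_joinLast]; nlinarith [sq_nonneg (-⟪q.1, q.2⟫)]

lemma abs_inner_le_norm_fullEta (q : Chart m) : |⟪q.1, q.2⟫| ≤ ‖fullEta q‖ := by
  refine abs_le_of_sq_le_sq' ?_ (norm_nonneg _) |>.2
  rw [fullEta, norm_sq_joinLast, sq_abs]; nlinarith [sq_nonneg ‖q.2‖]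

lemma IsRapid.isChartDecaying (hu : IsRapid u) : IsChartDecaying u := by
  obtain ⟨hum, M, hM⟩ := hu
  obtain ⟨K, hK, hb⟩ := exists_lintegral_two_sing m
  have hM0 : 0 ≤ M := le_trans (by positivity) (hM 0)
  -- the pointwise bound, in the dilated variable
  have pt : ∀ q : Chart m, ‖u q‖ₑ * ofReal (1 + ‖fullEta q‖) *
      ofReal (1 + (1 + ‖q.1‖) * ‖q.2‖) ≤ ofReal M *
      (normDecay ((m + 1 : ℕ) * 2) ((1 + ‖q.1‖) • q.2) *
        min 1 (‖⟪q.1, (1 + ‖q.1‖) • q.2⟫‖ₑ ^ (-(1 / 4) : ℝ))) := by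
    intro q
    set R := 1 + ‖q.1‖ with hR
    have h0 := norm_nonneg (fullEta q)
    have hR1 : 1 ≤ R := le_add_of_nonneg_right (norm_nonneg _)
    set X := 1 + R * ‖fullEta q‖ with hX
    have hX1 : 1 ≤ X := by nlinarith
    have e1 : 1 + ‖fullEta q‖ ≤ X := by nlinarith
    have e2 : 1 + R * ‖q.2‖ ≤ X := by rw [hX]; gcongr; exact norm_le_norm_fullEta q
    have e3 : |⟪q.1, R • q.2⟫| ≤ X := by
      rw [inner_smul_right, abs_mul, abs_of_pos (by linarith), hX]
      nlinarith [abs_inner_le_norm_fullEta q]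
    have e4 : ofReal X⁻¹ ≤ min 1 (‖⟪q.1, R • q.2⟫‖ₑ ^ (-(1 / 4) : ℝ)) := by
      have : ofReal X⁻¹ ≤ ofReal X ^ (-(1 / 4) : ℝ) := by
        rw [ofReal_rpow_of_pos (by linarith), ← Real.rpow_neg_one]
        exact ofReal_le_ofReal (Real.rpow_le_rpow_of_exponent_le hX1 (by norm_num))
      refine le_min (by simpa using inv_le_one_of_one_le₀ hX1) (this.trans ?_)
      rw [enorm_eq_ofReal_abs]
      exact rpow_neg_anti (ofReal_le_ofReal e3) (by norm_num)
    have e5 : ofReal (X ^ (2 * (m + 1)))⁻¹ ≤ normDecay ((m + 1 : ℕ) * 2) (R • q.2) := by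
      rw [normDecay, norm_smul, norm_of_nonneg (by linarith), rpow_neg (by positivity)]
      refine ofReal_le_ofReal (inv_anti₀ (by positivity) ?_)
      rw [show ((m + 1 : ℕ) * 2 : ℝ) = (2 * (m + 1) : ℕ) by push_cast; ring, rpow_natCast]
      gcongr
    calc _ ≤ ofReal (M * (X ^ (2 * (m + 1) + 3))⁻¹) * ofReal X * ofReal X := by
          gcongr
          rw [← ofReal_norm]
          refine ofReal_le_ofReal ?_
          rw [← div_eq_mul_inv, le_div_iff₀ (by positivity), mul_comm]
          exact hM q
      _ = ofReal M * (ofReal (X ^ (2 * (m + 1)))⁻¹ * ofReal X⁻¹) := by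
          rw [← ofReal_mul (by positivity), ← ofReal_mul (by positivity),
            ← ofReal_mul (by positivity), ← ofReal_mul (by positivity)]
          congr 1; field_simp; ring
      _ ≤ _ := by gcongr
  -- the second bound, which contains the first
  have main : ∀ (v e : Eu (m + 1)) (i : Fin (m + 1)),
      ∫⁻ η, ‖u (v, η)‖ₑ * ofReal (1 + ‖fullEta (v, η)‖) *
        ofReal (1 + (1 + ‖v‖) * ‖η‖) * ‖⟪e, (1 + ‖v‖) • η⟫‖ₑ ^ (-ε₀) ≤
      ofReal M * K * normDecay ((m + 1 : ℕ) + 1 / 4) v * ‖e i‖ₑ ^ (-ε₀) := by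
    intro v e i
    have hR : 0 < 1 + ‖v‖ := by positivity
    set f : Eu (m + 1) → ENNReal := fun θ => normDecay ((m + 1 : ℕ) * 2) θ *
      min 1 (‖⟪v, θ⟫‖ₑ ^ (-(1 / 4) : ℝ)) * ‖⟪e, θ⟫‖ₑ ^ (-ε₀) with hf
    have hs : ∫⁻ η : Eu (m + 1), f ((1 + ‖v‖) • η) = normDecay (m + 1 : ℕ) v * ∫⁻ θ, f θ := by
      rw [lintegral_comp_smul hR.ne' f, ← mul_assoc, normDecay, ← ofReal_mul (by positivity),
        rpow_neg hR.le, rpow_natCast, abs_of_pos hR, inv_mul_cancel₀ (by positivity)]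
      simp
    calc _ ≤ ∫⁻ η : Eu (m + 1), ofReal M * f ((1 + ‖v‖) • η) := by
          exact lintegral_mono fun η => (mul_le_mul_left (pt (v, η)) _).trans_eq (by rw [hf]; ring)
      _ = ofReal M * (normDecay (m + 1 : ℕ) v * ∫⁻ θ, f θ) := by
          rw [lintegral_const_mul' _ _ ofReal_ne_top, hs]
      _ ≤ ofReal M * (normDecay (m + 1 : ℕ) v * (K * ofReal (1 + ‖v‖) ^
          (-(1 / 4) : ℝ) * ‖e i‖ₑ ^ (-ε₀))) := by gcongr; exact hb v e i
      _ = _ := by rw [normDecay_add, normDecay, normDecay, ofReal_rpow_of_pos hR]; ring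
  refine ⟨hum, ofReal M * K, mul_ne_top ofReal_ne_top hK, fun v => ⟨?_, fun e i => ?_⟩⟩
  · have hR : 0 < 1 + ‖v‖ := by positivity
    refine (lintegral_mono fun η => ?_).trans
      ((main v (EuclideanSpace.single 0 1) 0).trans ?_)
    · rw [mul_assoc (‖u (v, η)‖ₑ * _)]
      refine le_mul_of_one_le_right zero_le ?_
      have h0 : 0 < 1 + (1 + ‖v‖) * ‖η‖ := by positivity
      have h3 : ‖⟪(EuclideanSpace.single 0 1 : Eu (m + 1)), (1 + ‖v‖) • η⟫‖ₑ ≤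
          ofReal (1 + (1 + ‖v‖) * ‖η‖) := by
        rw [enorm_eq_ofReal_abs]
        exact ofReal_le_ofReal ((abs_real_inner_le_norm _ _).trans
          (by simp [norm_smul, abs_of_pos hR]))
      refine le_trans ?_ (mul_le_mul_right (rpow_neg_anti h3 (by norm_num)) _)
      rw [ofReal_rpow_of_pos h0, ← ofReal_mul h0.le, one_le_ofReal,
        ← Real.rpow_one_add' h0.le (by norm_num)]
      exact Real.one_le_rpow (le_add_of_nonneg_right (by positivity)) (by norm_num)
    · simp only [PiLp.single_apply, if_true, enorm_one, one_rpow, mul_one]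
      gcongr
      exact normDecay_anti (by norm_num) v
  · have hR : 0 < 1 + ‖v‖ := by positivity
    refine (lintegral_mono fun η => ?_).trans ((main v ((1 + ‖v‖)⁻¹ • e) i).trans_eq ?_)
    · have : ⟪(1 + ‖v‖)⁻¹ • e, (1 + ‖v‖) • η⟫ = ⟪e, η⟫ := by
        rw [inner_smul_left, inner_smul_right]; simp only [conj_trivial]; field_simp
      rw [this, mul_assoc ‖u (v, η)‖ₑ]
      refine mul_le_mul_left (le_mul_of_one_le_right zero_le (one_le_mul ?_ ?_)) _ <;>
      exact one_le_ofReal.2 (le_add_of_nonneg_right (by positivity))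
    · have e1 : ‖((1 + ‖v‖)⁻¹ • e) i‖ₑ ^ (-ε₀) = ofReal (1 + ‖v‖) ^ ε₀ * ‖e i‖ₑ ^ (-ε₀) := by
        rw [PiLp.smul_apply, smul_eq_mul, enorm_mul, mul_rpow_of_ne_top (by simp) (by simp),
          enorm_eq_ofReal_abs, abs_of_pos (by positivity), ofReal_rpow_of_pos (by positivity),
          ofReal_rpow_of_pos hR, Real.inv_rpow hR.le, rpow_neg hR.le, inv_inv]
      rw [e1]
      have e2 : normDecay ((m + 1 : ℕ) + 1 / 4) v * ofReal (1 + ‖v‖) ^ ε₀ =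
          normDecay ((m + 1 : ℕ) + 3 / 16) v := by
        rw [normDecay, normDecay, ofReal_rpow_of_pos hR, ← ofReal_mul (by positivity),
          ← rpow_add hR]
        congr 2; ring
      rw [← e2]; ring

lemma IsRapid.norm_le (hu : IsRapid u) : ∃ M : ℝ, 0 ≤ M ∧ ∀ q, ‖u q‖ ≤ M := by
  obtain ⟨M, hM⟩ := hu.bound
  refine ⟨M, le_trans (by positivity) (hM 0), fun q => le_trans ?_ (hM q)⟩
  exact le_mul_of_one_le_left (norm_nonneg _)
    (one_le_pow₀ (le_add_of_nonneg_right (by positivity)))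

lemma IsRapid.memLp (hu : IsRapid u) : MemLp u 2 volume := by
  obtain ⟨M, hM0, hM⟩ := hu.norm_le
  have hi := hu.isChartDecaying.integrable
  refine (memLp_two_iff_integrable_sq_norm hi.1).2 ?_
  refine (hi.norm.const_mul M).mono' (hi.1.norm.pow 2) (.of_forall fun q => ?_)
  rw [norm_of_nonneg (by positivity), sq]
  exact mul_le_mul_of_nonneg_right (hM q) (norm_nonneg _)

lemma norm_fullEta_le (q : Chart m) : ‖fullEta q‖ ≤ ‖q.2‖ * (1 + ‖q.1‖) := by
  refine (norm_joinLast_le _ _).trans ?_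
  rw [abs_neg]
  nlinarith [abs_real_inner_le_norm q.1 q.2]

lemma isRapid_of_schwartz_decay (hum : Measurable u) {M : ℝ}
    (hM : ∀ q, (1 + ‖q‖) ^ (3 * (2 * (m + 1) + 3)) * ‖u q‖ ≤ M) : IsRapid u := by
  refine ⟨hum, M, fun q => le_trans ?_ (hM q)⟩
  rw [pow_mul]
  have h0 := norm_nonneg q
  gcongr
  have : (1 + ‖q.1‖) * ‖fullEta q‖ ≤ (1 + ‖q‖) * (‖q‖ * (1 + ‖q‖)) := by
    have := norm_fst_le q
    grw [norm_fullEta_le q, norm_snd_le q]; gcongr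
  nlinarith [pow_nonneg h0 3, pow_nonneg h0 2]

lemma exists_schwartz_decay {E : Type*} [NormedAddCommGroup E] [NormedSpace ℝ E] (k : ℕ)
    (f : 𝓢(E, ℂ)) : ∃ M, ∀ x, (1 + ‖x‖) ^ k * ‖f x‖ ≤ M :=
  ⟨_, fun x => by
    simpa using SchwartzMap.one_add_le_sup_seminorm_apply (𝕜 := ℂ) (m := (k, 0)) (n := 0)
      le_rfl le_rfl f x⟩

lemma isRapid_schwartz (f : 𝓢(Chart m, ℂ)) : IsRapid f :=
  isRapid_of_schwartz_decay f.continuous.measurable (exists_schwartz_decay _ f).choose_spec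

lemma isRapid_tensor (a b : 𝓢(Eu (m + 1), ℂ)) :
    IsRapid fun q : Chart m => a q.1 * b q.2 := by
  obtain ⟨M, hM⟩ := exists_schwartz_decay (3 * (2 * (m + 1) + 3)) a
  obtain ⟨M', hM'⟩ := exists_schwartz_decay (3 * (2 * (m + 1) + 3)) b
  refine isRapid_of_schwartz_decay (M := M * M') (by fun_prop) fun q => ?_
  have h1 : 1 + ‖q‖ ≤ (1 + ‖q.1‖) * (1 + ‖q.2‖) := by
    have := norm_nonneg q.1; have := norm_nonneg q.2
    rw [Prod.norm_def]; rcases max_choice ‖q.1‖ ‖q.2‖ with h | h <;> rw [h] <;> nlinarith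
  have h2 := hM q.1
  have h0 : 0 ≤ M := le_trans (by positivity) h2
  calc _ ≤ ((1 + ‖q.1‖) * (1 + ‖q.2‖)) ^ (3 * (2 * (m + 1) + 3)) * ‖a q.1 * b q.2‖ := by gcongr
    _ = ((1 + ‖q.1‖) ^ (3 * (2 * (m + 1) + 3)) * ‖a q.1‖) *
        ((1 + ‖q.2‖) ^ (3 * (2 * (m + 1) + 3)) * ‖b q.2‖) := by
        rw [mul_pow, norm_mul]; ring
    _ ≤ M * M' := by gcongr; exact hM' q.2

lemma ae_snd_ne_zero : ∀ᵐ q : Chart m, q.2 ≠ 0 :=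
  ae_prod_snd (compl_mem_ae_iff.2 (measure_singleton (0 : Eu (m + 1))))

lemma sigmaPoint_mem {q : Chart m} (hq : q.2 ≠ 0) : sigmaPoint q ∈ SigmaCone (m + 1) := by
  refine ⟨?_, fun h => ?_, fun h => ?_⟩
  · rw [sigmaPoint, inner_joinLast]; ring
  · exact one_ne_zero ((joinLast_eq_zero_iff _ _).1 h).2
  · exact hq ((joinLast_eq_zero_iff _ _).1 h).1

@[fun_prop]
lemma continuous_sigmaPoint : Continuous (sigmaPoint (n := m + 1)) := by unfold sigmaPoint; fun_prop

lemma IsTestFunction.exists_isRapid {Φ : Phase m → ℂ} (hΦ : IsTestFunction Φ) :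
    ∃ u, IsRapid u ∧ inCoords Φ =ᵐ[volume] u := by
  obtain ⟨C, hC, hCs, hΦC⟩ := hΦ.compact_support
  obtain ⟨B, hB⟩ := hC.isBounded.exists_norm_le
  obtain ⟨M, hM⟩ := hC.exists_bound_of_continuousOn (hΦ.smooth.continuousOn.mono hCs)
  have ho : IsOpen {q : Chart m | q.2 ≠ 0} := isOpen_ne.preimage continuous_snd
  have hcont : ContinuousOn (inCoords Φ) {q : Chart m | q.2 ≠ 0} :=
    hΦ.smooth.continuousOn.comp (f := sigmaPoint) continuous_sigmaPoint.continuousOn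
      fun q hq => sigmaPoint_mem hq
  classical
  refine ⟨Set.piecewise {q | q.2 ≠ 0} (inCoords Φ) 0, ⟨?_, |M| * (1 + 2 * B ^ 2) ^ (2 * (m + 1) + 3),
    fun q => ?_⟩, ?_⟩
  · exact hcont.measurable_piecewise continuousOn_const ho.measurableSet
  · by_cases hq : q.2 ≠ 0
    · rw [Set.piecewise_eq_of_mem _ _ _ hq]
      by_cases h0 : inCoords Φ q = 0
      · rw [h0]; simp only [norm_zero, mul_zero]; positivity
      obtain ⟨t, ht, htC⟩ := hΦC _ (sigmaPoint_mem hq) h0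
      have hB0 : 0 ≤ B := (norm_nonneg _).trans (hB _ htC)
      have e1 : ‖inCoords Φ q‖ ≤ |M| := by
        refine le_trans ?_ (le_abs_self M)
        rw [inCoords, ← hΦ.invariant t ht _ (sigmaPoint_mem hq)]; exact hM _ htC
      have b1 := (norm_fst_le _).trans (hB _ htC)
      have b2 := (norm_snd_le _).trans (hB _ htC)
      rw [sigmaPoint_eq] at b1 b2
      simp only [scaleAct, norm_smul, norm_inv] at b1 b2
      have b3 : ‖joinLast q.1 1‖ * ‖fullEta q‖ ≤ B ^ 2 := by
        have := mul_le_mul b1 b2 (by positivity) hB0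
        have ht' : ‖t‖ ≠ 0 := norm_ne_zero_iff.2 ht
        calc _ = ‖t‖ * ‖joinLast q.1 1‖ * (‖t‖⁻¹ * ‖fullEta q‖) := by field_simp
          _ ≤ _ := by rw [sq]; exact this
      have b4 : 1 + ‖q.1‖ ≤ 2 * ‖joinLast q.1 1‖ := by
        refine abs_le_of_sq_le_sq' ?_ (by positivity) |>.2
        rw [mul_pow, norm_sq_joinLast]; nlinarith [sq_nonneg (‖q.1‖ - 1)]
      have b5 : (1 + ‖q.1‖) * ‖fullEta q‖ ≤ 2 * B ^ 2 := by nlinarith [norm_nonneg (fullEta q)]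
      calc _ ≤ (1 + 2 * B ^ 2) ^ (2 * (m + 1) + 3) * |M| := by gcongr
        _ = _ := mul_comm _ _
    · rw [Set.piecewise_eq_of_notMem _ _ _ hq]
      simp only [Pi.zero_apply, norm_zero, mul_zero]; positivity
  · filter_upwards [ae_snd_ne_zero] with q hq
    rw [Set.piecewise_eq_of_mem _ _ _ hq]

/-- The point `(x_*, 1; ξ_*, h - ⟨x_*, ξ_*⟩)`, at which `⟨x, ξ⟩ = h`. -/
def offCone (h : ℝ) (p : Chart m) : Phase m := (joinLast p.1 1, joinLast p.2 (h - ⟪p.1, p.2⟫))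

lemma offCone_zero (p : Chart m) : offCone 0 p = sigmaPoint p := by
  rw [offCone, sigmaPoint, zero_sub]

lemma scaleAct_scaleAct {n : ℕ} (s t : ℝ) (z : Eu (n + 1) × Eu (n + 1)) :
    scaleAct s (scaleAct t z) = scaleAct (s * t) z := by
  simp [scaleAct, smul_smul, mul_comm]

lemma eq_scaleAct_offCone {z : Phase m} (hz : lastCoord z.1 ≠ 0) :
    z = scaleAct (lastCoord z.1) (offCone ⟪z.1, z.2⟫ (coneProj z)) := by
  have h1 := joinLast_starPart_lastCoord z.1
  have h2 := joinLast_starPart_lastCoord z.2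
  have h3 : ⟪z.1, z.2⟫ = ⟪starPart z.1, starPart z.2⟫ + lastCoord z.1 * lastCoord z.2 := by
    rw [← inner_joinLast, h1, h2]
  refine Prod.ext ?_ ?_
  · simp only [scaleAct, offCone, coneProj, smul_joinLast, smul_inv_smul₀ hz, mul_one, h1]
  · simp only [scaleAct, offCone, coneProj, smul_joinLast, inv_smul_smul₀ hz, h3, inner_smul_left,
      inner_smul_right, conj_trivial]
    conv_lhs => rw [← h2]
    congr 1
    field_simp
    ring

/-- The functions on the chart that vanish near `η_* = 0` define test functions. -/
lemma isTestFunction_tilde {w : Chart m → ℂ} (hw : ContDiff ℝ ∞ w)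
    (hws : HasCompactSupport w) (hw0 : ∀ q ∈ tsupport w, q.2 ≠ 0) :
    IsTestFunction (tilde w) ∧ inCoords (tilde w) = w := by
  have hlast : ∀ z : Phase m, lastCoord z.1 = 0 → tilde w z = 0 := fun z hz => by
    rw [tilde, hz]
    exact image_eq_zero_of_notMem_tsupport fun h => hw0 _ h (by simp)
  have hproj : ∀ z ∈ SigmaCone (m + 1), lastCoord z.1 ≠ 0 →
      scaleAct (lastCoord z.1)⁻¹ z = sigmaPoint (coneProj z) := by
    intro z hz hl
    refine (congrArg (scaleAct (lastCoord z.1)⁻¹) (eq_scaleAct_offCone hl)).trans ?_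
    rw [scaleAct_scaleAct, inv_mul_cancel₀ hl, hz.1, offCone_zero]
    simp [scaleAct]
  have hcoord : inCoords (tilde w) = w := by funext q; simp [inCoords, tilde, sigmaPoint]
  refine ⟨⟨fun z hz => ?_, fun t ht z hz => ?_, ?_⟩, hcoord⟩
  · refine ContDiffAt.contDiffWithinAt ?_
    by_cases hl : lastCoord z.1 = 0
    · -- near such a point, the first argument of `w` is large
      have hs : starPart z.1 ≠ 0 := fun h => hz.2.1 (by
        rw [← joinLast_starPart_lastCoord z.1, h, hl, joinLast_eq_zero_iff]; simp)
      obtain ⟨B, hB⟩ := hws.isCompact.isBounded.exists_norm_le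
      refine contDiffAt_const (c := (0 : ℂ)) |>.congr_of_eventuallyEq ?_
      have c1 : Continuous fun z : Phase m => |lastCoord z.1| * B := by fun_prop
      have c2 : Continuous fun z : Phase m => ‖starPart z.1‖ := by fun_prop
      have := c1.continuousAt.eventually_lt c2.continuousAt (x₀ := z) (by simpa [hl] using hs)
      filter_upwards [this] with z' hz'
      by_cases hl' : lastCoord z'.1 = 0
      · exact hlast z' hl'
      · refine image_eq_zero_of_notMem_tsupport (f := w) fun h => ?_
        have h1 := (norm_fst_le _).trans (hB _ h)
        simp only [norm_smul, norm_inv, norm_eq_abs] at h1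
        rw [inv_mul_le_iff₀ (abs_pos.2 hl')] at h1
        linarith
    · have c1 : ContDiffAt ℝ ∞ (fun z : Phase m => lastCoord z.1) z :=
        (contDiff_lastCoord.comp contDiff_fst).contDiffAt
      have c2 : ContDiffAt ℝ ∞ (fun z : Phase m => starPart z.1) z :=
        (contDiff_starPart.comp contDiff_fst).contDiffAt
      have c3 : ContDiffAt ℝ ∞ (fun z : Phase m => starPart z.2) z :=
        (contDiff_starPart.comp contDiff_snd).contDiffAt
      exact hw.contDiffAt.comp z (((c1.inv hl).smul c2).prodMk (c1.smul c3))
  · by_cases hl : lastCoord z.1 = 0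
    · rw [hlast z hl, hlast]
      simp [scaleAct, lastCoord] at hl ⊢; exact Or.inr hl
    · have e1 : lastCoord (t • z.1) = t * lastCoord z.1 := rfl
      have e2 : ∀ (c : ℝ) (y : Eu (m + 2)), starPart (c • y) = c • starPart y := fun _ _ => rfl
      simp only [tilde, scaleAct, e1, e2, smul_smul]
      congr 3 <;> field_simp
  · refine ⟨sigmaPoint '' tsupport w, hws.isCompact.image continuous_sigmaPoint, ?_,
      fun z hz h => ?_⟩
    · rintro _ ⟨q, hq, rfl⟩; exact sigmaPoint_mem (hw0 q hq)
    · have hl : lastCoord z.1 ≠ 0 := fun hl => h (hlast z hl)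
      exact ⟨(lastCoord z.1)⁻¹, inv_ne_zero hl, coneProj z, subset_tsupport _ h, (hproj z hz hl).symm⟩

end Rapid

section Chr

/-- The character `r ↦ e^{2iπr}`. -/
def chr (r : ℝ) : ℂ := cexp (2 * π * (r : ℂ) * I)

lemma chr_add (r s : ℝ) : chr (r + s) = chr r * chr s := by
  rw [chr, chr, chr, ← Complex.exp_add]; congr 1; push_cast; ring

@[fun_prop]
lemma continuous_chr : Continuous chr := by unfold chr; fun_prop

lemma norm_chr (r : ℝ) : ‖chr r‖ = 1 := by
  rw [chr, show (2 * π * (r : ℂ) * I : ℂ) = ((2 * π * r : ℝ) : ℂ) * I by push_cast; ring]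
  exact Complex.norm_exp_ofReal_mul_I _

lemma osc_eq_chr (a b s : ℝ) : osc a b s = chr (a * exp (-s) - b * exp s) := rfl

variable {n : ℕ}

lemma sympChar_eq_chr (p q : Eu² n) : sympChar p q = chr (⟪q.1, p.1⟫ - ⟪p.2, q.2⟫) := by
  rw [sympChar, chr]; congr 1; ring

lemma sympChar_neg (p q : Eu² n) : sympChar (-p) q = conj (sympChar p q) := by
  rw [conj_sympChar, sympChar]; simp; ring_nf

lemma fourierInv_eq_chr (a : Eu n → ℂ) (w : Eu n) : 𝓕⁻ a w = ∫ v, chr ⟪v, w⟫ * a v := by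
  rw [fourierInv_eq_exp]
  refine integral_ext fun v => ?_
  simp only [chr]; ring_nf

lemma integral_comp_dilate {c : ℝ} (hc : c ≠ 0) {f : Eu² n → ℂ}
    (hf : AEStronglyMeasurable f volume) :
    ∫ p, f p = ∫ p : Eu² n, ((|c| ^ n : ℝ) : ℂ) * f (p.1, c • p.2) := by
  rw [(isWeightedMap_dilate n hc).integral_eq hf]
  simp only [sq_sqrt (pow_nonneg (abs_nonneg c) n)]

lemma integrable_chr_mul_tensor_fourier (a b : 𝓢(Eu n, ℂ)) {t : ℝ} (ht : t ≠ 0) :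
    Integrable fun p : Eu² n => ((|t| ^ n : ℝ) : ℂ) * chr (-(t * ⟪p.1, p.2⟫)) *
      (𝓕 a p.1 * 𝓕⁻ b (-(t ^ 2) • p.2)) := by
  have ib : Integrable fun z : Eu n => (𝓕⁻ b : 𝓢(Eu n, ℂ)) (-(t ^ 2) • z) :=
    (𝓕⁻ b).integrable.comp_smul (by simpa using ht)
  refine Integrable.bdd_mul (c := |t| ^ n) ((𝓕 a).integrable.mul_prod ib)
    (by fun_prop : Continuous _).aestronglyMeasurable (.of_forall fun p => ?_)
  rw [norm_mul, norm_chr, mul_one, norm_real, norm_pow, norm_eq_abs, abs_abs]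

/-- A Gaussian-type integral: an oscillating bilinear phase turns a product into a product. -/
lemma integral_chr_tensor (a b : 𝓢(Eu n, ℂ)) {t : ℝ} (ht : t ≠ 0) (q : Eu² n) :
    ∫ p : Eu² n, chr (⟪p.1 - q.1, q.2⟫ / t + t * ⟪p.1 - q.1, p.2⟫) * (a p.1 * b p.2) =
      ∫ p : Eu² n, sympChar p q * (((|t| ^ n : ℝ) : ℂ) * chr (-(t * ⟪p.1, p.2⟫)) *
        (𝓕 a p.1 * 𝓕⁻ b (-(t ^ 2) • p.2))) := by
  have e1 : ∫ p : Eu² n, chr (⟪p.1 - q.1, q.2⟫ / t + t * ⟪p.1 - q.1, p.2⟫) *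
      (a p.1 * b p.2) = ∫ x, chr (⟪x - q.1, q.2⟫ / t) * a x * 𝓕⁻ b (t • (x - q.1)) := by
    have int : Integrable (fun p : Eu² n => chr (⟪p.1 - q.1, q.2⟫ / t +
        t * ⟪p.1 - q.1, p.2⟫) * (a p.1 * b p.2)) (volume.prod volume) :=
      (a.integrable.mul_prod b.integrable).bdd_mul (c := 1)
        (by fun_prop : Continuous _).aestronglyMeasurable (.of_forall fun p => (norm_chr _).le)
    rw [volume_eq_prod, integral_prod _ int]
    refine integral_ext fun x => ?_
    rw [SchwartzMap.fourierInv_coe, fourierInv_eq_chr, ← integral_const_mul]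
    refine integral_ext fun ξ => ?_
    rw [chr_add, inner_smul_right, real_inner_comm ξ]; ring
  have e2 : ∫ p : Eu² n, sympChar p q * (((|t| ^ n : ℝ) : ℂ) * chr (-(t * ⟪p.1, p.2⟫)) *
        (𝓕 a p.1 * 𝓕⁻ b (-(t ^ 2) • p.2))) =
      ∫ z : Eu n, ((|t| ^ n : ℝ) : ℂ) * (chr (-⟪z, q.2⟫) * 𝓕⁻ b (-(t ^ 2) • z) * a (q.1 - t • z)) := by
    have int := (integrable_chr_mul_tensor_fourier a b ht).bdd_mul (c := 1)
      (by fun_prop : Continuous fun p => sympChar p q).aestronglyMeasurable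
      (.of_forall fun p => (norm_sympChar _ _).le)
    rw [volume_eq_prod, integral_prod_symm _ int]
    refine integral_ext fun z => ?_
    have inv : a (q.1 - t • z) = ∫ ζ, chr ⟪ζ, q.1 - t • z⟫ * 𝓕 a ζ := by
      rw [← fourierInv_eq_chr, ← SchwartzMap.fourierInv_coe, FourierTransform.fourierInv_fourier_eq]
    simp only
    rw [inv, ← integral_const_mul, ← integral_const_mul]
    refine integral_ext fun ζ => ?_
    rw [sympChar_eq_chr, inner_sub_right, inner_smul_right, real_inner_comm ζ, sub_eq_add_neg,
      sub_eq_add_neg, chr_add, chr_add]; ring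
  rw [e1, e2]
  set f : Eu n → ℂ := fun x => chr (⟪x - q.1, q.2⟫ / t) * a x * 𝓕⁻ b (t • (x - q.1)) with hf
  have e3 : ∫ x, f x = ∫ z : Eu n, ((|t| ^ n : ℝ) : ℂ) * f (q.1 - t • z) := by
    rw [integral_const_mul, Measure.integral_comp_smul volume (fun z => f (q.1 - z)) t,
      integral_sub_left_eq_self f, finrank_euclideanSpace_fin, abs_inv, abs_pow, real_smul,
      ← mul_assoc, ← Complex.ofReal_mul, mul_inv_cancel₀ (by positivity)]
    simp
  rw [e3]
  refine integral_ext fun z => ?_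
  simp only [hf]
  have h1 : q.1 - t • z - q.1 = -(t • z) := by abel
  rw [h1, inner_neg_left, inner_smul_left, smul_neg, smul_smul, ← sq, neg_smul]
  simp only [conj_trivial]
  rw [show -(t * ⟪z, q.2⟫) / t = -⟪z, q.2⟫ by field_simp]; ring

/-- The symplectic Fourier transform of an integrable function on the chart. -/
def sympI (u : Eu² n → ℂ) (p : Eu² n) : ℂ := ∫ q, conj (sympChar p q) * u q

lemma fourier_neg_eq (a : 𝓢(Eu n, ℂ)) (ζ : Eu n) : 𝓕 a (-ζ) = 𝓕⁻ a ζ := by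
  rw [SchwartzMap.fourier_coe, SchwartzMap.fourierInv_coe, Real.fourierInv_eq_fourier_neg]

lemma continuous_sympI {u : Eu² n → ℂ} (hu : Integrable u volume) : Continuous (sympI u) := by
  refine continuous_of_dominated (bound := fun q => ‖u q‖) (fun p => ?_)
    (fun p => .of_forall fun q => ?_) hu.norm (.of_forall fun q => ?_)
  · exact (continuous_conj.comp (by fun_prop)).aestronglyMeasurable.mul hu.1
  · rw [norm_mul, norm_conj, norm_sympChar, one_mul]
  · exact (continuous_conj.comp (by fun_prop)).mul continuous_const

lemma norm_sympI_le (u : Eu² n → ℂ) (p : Eu² n) : ‖sympI u p‖ ≤ ∫ q, ‖u q‖ := by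
  refine (norm_integral_le_integral_norm _).trans (le_of_eq ?_)
  simp only [norm_mul, norm_conj, norm_sympChar, one_mul]

lemma integral_mul_integral_chr {u : Eu² n → ℂ} (hu : Integrable u volume)
    (a b : 𝓢(Eu n, ℂ)) {t : ℝ} (ht : t ≠ 0) :
    ∫ q, u q * ∫ p : Eu² n, chr (⟪p.1 - q.1, q.2⟫ / t + t * ⟪p.1 - q.1, p.2⟫) *
      (a p.1 * b p.2) = ∫ p : Eu² n, chr (⟪p.1, p.2⟫ / t) * (𝓕⁻ a p.1 * 𝓕 b p.2) *
      ((((|t| ^ n)⁻¹ : ℝ) : ℂ) * sympI u (p.1, -(t ^ 2)⁻¹ • p.2)) := by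
  simp_rw [integral_chr_tensor a b ht]
  set G : Eu² n → ℂ := fun p => ((|t| ^ n : ℝ) : ℂ) * chr (-(t * ⟪p.1, p.2⟫)) *
    (𝓕 a p.1 * 𝓕⁻ b (-(t ^ 2) • p.2)) with hG
  have hGi : Integrable G volume := integrable_chr_mul_tensor_fourier a b ht
  have int : Integrable (fun r : (Eu² n) × (Eu² n) =>
      sympChar r.2 r.1 * (u r.1 * G r.2)) (volume.prod volume) := (hu.mul_prod hGi).bdd_mul (c := 1)
      (Continuous.aestronglyMeasurable (by fun_prop))
      (.of_forall fun r => (norm_sympChar _ _).le)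
  have e1 : ∫ q, u q * ∫ p, sympChar p q * G p = ∫ p, sympI u (-p) * G p := by
    have h1 : ∫ q, u q * ∫ p, sympChar p q * G p = ∫ q, ∫ p, sympChar p q * (u q * G p) := by
      refine integral_ext fun q => ?_
      rw [← integral_const_mul]
      exact integral_congr_ae (.of_forall fun p => by ring)
    rw [h1, integral_integral_swap int]
    refine integral_ext fun p => ?_
    simp only [sympI, sympChar_neg, conj_conj]
    rw [← integral_mul_const]
    exact integral_congr_ae (.of_forall fun q => by ring)
  have hc := continuous_sympI hu
  have hGc : Continuous G := by rw [hG]; fun_prop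
  have hnz : -(t ^ 2)⁻¹ ≠ 0 := by simpa using ht
  have : (volume : Measure (Eu² n)).IsNegInvariant := by
    rw [volume_eq_prod]; exact ⟨((Measure.measurePreserving_neg (volume : Measure (Eu n))).prod
      (Measure.measurePreserving_neg (volume : Measure (Eu n)))).map_eq⟩
  rw [e1, ← integral_neg_eq_self, integral_comp_dilate hnz (by
    simp only [neg_neg]; exact (hc.mul (hGc.comp continuous_neg)).aestronglyMeasurable)]
  refine integral_ext fun p => ?_
  simp only [neg_neg, hG, Prod.neg_mk, fourier_neg_eq, inner_neg_left, inner_neg_right,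
    inner_smul_right]
  have h2 : -(t ^ 2) • -(-(t ^ 2)⁻¹ • p.2) = -p.2 := by
    rw [smul_neg, smul_smul]; congr 1; rw [neg_mul_neg, mul_inv_cancel₀ (by positivity), one_smul]
  have h3 : (𝓕⁻ b : 𝓢(Eu n, ℂ)) (-p.2) = 𝓕 b p.2 := by rw [← fourier_neg_eq, neg_neg]
  have h4 : |(-(t ^ 2)⁻¹)| ^ n = (|t| ^ n)⁻¹ * (|t| ^ n)⁻¹ := by
    rw [abs_neg, abs_inv, abs_pow, ← mul_inv, ← mul_pow, ← sq, inv_pow]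
  have h5 : -(t * -(-(t ^ 2)⁻¹ * -⟪p.1, p.2⟫)) = ⟪p.1, p.2⟫ / t := by field_simp
  have h6 : ((|t| ^ n : ℝ) : ℂ) ≠ 0 := by exact_mod_cast (by positivity : |t| ^ n ≠ 0)
  rw [h2, h3, h4, h5]
  push_cast at h6 ⊢
  field_simp

end Chr

section Weights
variable {m : ℕ}

lemma exists_enorm_le_normDecay {k : ℕ} (a : 𝓢(Eu k, ℂ)) (N : ℕ) :
    ∃ M : ENNReal, M ≠ ⊤ ∧ ∀ x, ‖a x‖ₑ ≤ M * normDecay N x := by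
  obtain ⟨M, h⟩ := exists_schwartz_decay N a
  refine ⟨ofReal M, ofReal_ne_top, fun x => ?_⟩
  have hx := h x
  have h0 : 0 ≤ M := le_trans (by positivity) hx
  rw [← ofReal_norm, normDecay, ← ofReal_mul h0, rpow_neg (by positivity), rpow_natCast]
  refine ofReal_le_ofReal ?_
  rw [← div_eq_mul_inv, le_div_iff₀ (by positivity), mul_comm]
  exact hx

/-- The two weighted norms that make the integrals over the scales converge. -/
structure IsWeightedL2 (F : Chart m → ℂ) : Prop where
  measurable : Measurable F
  neg : ∫⁻ p, ‖F p‖ₑ ^ 2 * ‖⟪p.1, p.2⟫‖ₑ ^ (-(1 / 4) : ℝ) ≠ ⊤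
  pos : ∫⁻ p, ‖F p‖ₑ ^ 2 * ‖⟪p.1, p.2⟫‖ₑ ^ (1 / 4 : ℝ) ≠ ⊤

lemma normDecay_mul_self {k : ℕ} (q : ℝ) (v : Eu k) : normDecay q v ^ 2 = normDecay (q * 2) v := by
  rw [sq, ← normDecay_add]; congr 1; ring

lemma exists_lintegral_pair_sing (m : ℕ) {ε : ℝ} (h0 : 0 < ε) (h1 : ε < 1) :
    ∫⁻ p : Chart m, normDecay ((m + 1 : ℕ) * 2) p.1 * normDecay ((m + 1 : ℕ) * 2) p.2 *
      ‖⟪p.1, p.2⟫‖ₑ ^ (-ε) ≠ ⊤ := by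
  obtain ⟨K, hK, hb⟩ := exists_lintegral_normDecay_inner m h0 h1
  refine ne_top_of_le_ne_top (b := K * K) (mul_ne_top hK hK) ?_
  rw [volume_eq_prod, lintegral_prod _ (by fun_prop)]
  calc _ ≤ ∫⁻ ζ : Eu (m + 1), K * (normDecay ((m + 1 : ℕ) * 2) ζ *
        ‖⟪(EuclideanSpace.single 0 1 : Eu (m + 1)), ζ⟫‖ₑ ^ (-ε)) := by
        refine lintegral_mono fun ζ => ?_
        simp only [mul_assoc]
        rw [lintegral_const_mul _ (by fun_prop)]
        refine (mul_le_mul_right (hb 0 ζ) _).trans_eq ?_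
        rw [EuclideanSpace.inner_single_left]; simp; ring
    _ ≤ K * (K * ‖(EuclideanSpace.single 0 1 : Eu (m + 1)) 0‖ₑ ^ (-ε)) := by
        rw [lintegral_const_mul _ (by fun_prop)]
        exact mul_le_mul_right (hb 0 _) _
    _ = K * K := by simp

lemma isWeightedL2_tensor (a b : 𝓢(Eu (m + 1), ℂ)) :
    IsWeightedL2 fun p : Chart m => a p.1 * b p.2 := by
  obtain ⟨M, hM, h⟩ := exists_enorm_le_normDecay a (m + 2)
  obtain ⟨M', hM', h'⟩ := exists_enorm_le_normDecay b (m + 2)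
  have hsq : ∀ p : Chart m, ‖a p.1 * b p.2‖ₑ ^ 2 ≤ (M * M') ^ 2 *
      (normDecay (((m + 1 : ℕ) + 1) * 2) p.1 * normDecay (((m + 1 : ℕ) + 1) * 2) p.2) := fun p => by
    rw [← normDecay_mul_self, ← normDecay_mul_self, ← mul_pow, ← mul_pow, enorm_mul]
    refine pow_le_pow_left₀ zero_le ?_ 2
    refine (mul_le_mul' (h p.1) (h' p.2)).trans (le_of_eq ?_)
    push_cast
    rw [show ((m : ℝ) + 2) = m + 1 + 1 by ring]; ring
  have hMM : (M * M') ^ 2 ≠ ⊤ := by simp [mul_eq_top, hM, hM']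
  have key : ∀ (w : Chart m → ENNReal) (e : ℝ), (∀ p, normDecay 2 p.1 *
      normDecay 2 p.2 * w p ≤ ‖⟪p.1, p.2⟫‖ₑ ^ (-e)) → 0 < e → e < 1 →
      ∫⁻ p : Chart m, ‖a p.1 * b p.2‖ₑ ^ 2 * w p ≠ ⊤ := by
    intro w e hw h0 h1
    refine ne_top_of_le_ne_top (mul_ne_top hMM (exists_lintegral_pair_sing m h0 h1)) ?_
    rw [← lintegral_const_mul _ (by fun_prop)]
    refine lintegral_mono fun p => (mul_le_mul_left (hsq p) _).trans ?_
    simp only [add_mul, one_mul, normDecay_add]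
    calc _ = (M * M') ^ 2 * (normDecay ((m + 1 : ℕ) * 2) p.1 * normDecay ((m + 1 : ℕ) * 2) p.2 *
          (normDecay 2 p.1 * normDecay 2 p.2 * w p)) := by ring
      _ ≤ _ := by gcongr; exact hw p
  have hx : ∀ p : Chart m, ‖⟪p.1, p.2⟫‖ₑ ≤ ofReal ((1 + ‖p.1‖) * (1 + ‖p.2‖)) := fun p => by
    rw [enorm_eq_ofReal_abs]
    refine ofReal_le_ofReal ((abs_real_inner_le_norm _ _).trans ?_)
    nlinarith [norm_nonneg p.1, norm_nonneg p.2]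
  refine ⟨by fun_prop, key _ (1 / 4) (fun p => ?_) (by norm_num) (by norm_num),
    key _ (1 / 4) (fun p => ?_) (by norm_num) (by norm_num)⟩
  · refine mul_le_of_le_one_left zero_le ?_
    exact mul_le_one' (normDecay_le_one zero_le_two _) (normDecay_le_one zero_le_two _)
  · have h0 : 0 < (1 + ‖p.1‖) * (1 + ‖p.2‖) := by positivity
    refine le_trans ?_ (rpow_neg_anti (hx p) (by norm_num))
    refine (mul_le_mul_right (rpow_le_rpow (hx p) (by norm_num)) _).trans ?_
    rw [normDecay, normDecay, ofReal_rpow_of_pos h0, ofReal_rpow_of_pos h0,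
      ← ofReal_mul (by positivity), ← ofReal_mul (by positivity),
      ← Real.mul_rpow (by positivity) (by positivity), ← rpow_add h0]
    refine ofReal_le_ofReal (Real.rpow_le_rpow_of_exponent_le ?_ (by norm_num))
    nlinarith [norm_nonneg p.1, norm_nonneg p.2]

/-- The function `e^{-ns} F(ζ, -e^{-2s} z)`, a multiple of the transform of a function moved by the
scale `± e^s`. -/
def scaledF (F : Chart m → ℂ) (s : ℝ) (p : Chart m) : ℂ :=
  (exp (-((m + 1 : ℕ) * s)) : ℂ) * F (p.1, -(exp (-(2 * s))) • p.2)

lemma lintegral_sq_scaledF {F : Chart m → ℂ} (hF : Measurable F) (e s : ℝ) :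
    ∫⁻ p, ‖scaledF F s p‖ₑ ^ 2 * ‖⟪p.1, p.2⟫‖ₑ ^ e =
      ofReal (exp (2 * e * s)) * ∫⁻ p, ‖F p‖ₑ ^ 2 * ‖⟪p.1, p.2⟫‖ₑ ^ e := by
  have hc : -exp (-(2 * s)) ≠ 0 := neg_ne_zero.2 (exp_ne_zero _)
  rw [(isWeightedMap_dilate (m + 1) hc).lintegral_eq (fun p => ‖F p‖ₑ ^ 2 * ‖⟪p.1, p.2⟫‖ₑ ^ e)
    (by fun_prop), ← lintegral_const_mul' _ _ ofReal_ne_top]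
  refine lintegral_congr fun p => ?_
  have h1 : ‖((exp (-((m + 1 : ℕ) * s)) : ℝ) : ℂ)‖ₑ = ofReal (exp (-((m + 1 : ℕ) * s))) := by
    rw [← ofReal_norm, norm_real, norm_of_nonneg (exp_pos _).le]
  have h2 : ‖⟪p.1, -exp (-(2 * s)) • p.2⟫‖ₑ = ofReal (exp (-(2 * s))) * ‖⟪p.1, p.2⟫‖ₑ := by
    rw [inner_smul_right, enorm_mul, enorm_eq_ofReal_abs, abs_neg, abs_exp]
  simp only [scaledF, h2]
  rw [sq_sqrt (by positivity), enorm_mul, mul_pow, h1,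
    mul_rpow_of_ne_top (by simp) (by simp), abs_neg, abs_exp,
    ofReal_rpow_of_pos (exp_pos _), ← ofReal_pow (exp_pos _).le,
    ← exp_mul, ← exp_nat_mul, ← exp_nat_mul]
  have : ofReal (exp ((2 : ℕ) * -((m + 1 : ℕ) * s))) =
      ofReal (exp (2 * e * s)) * ofReal (exp ((m + 1 : ℕ) * -(2 * s))) *
        ofReal (exp (-(2 * s) * e)) := by
    rw [← ofReal_mul (by positivity), ← exp_add, ← ofReal_mul (by positivity), ← exp_add]
    congr 2; push_cast; ring
  rw [this]; ring

lemma ae_inner_ne_zero : ∀ᵐ p : Chart m, ⟪p.1, p.2⟫ ≠ 0 := by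
  have h := ae_lt_top' (by fun_prop) (exists_lintegral_pair_sing m (ε := 1 / 2) (by norm_num)
    (by norm_num))
  filter_upwards [h] with p hp h0
  rw [h0, enorm_zero, zero_rpow_of_neg (by norm_num), mul_top] at hp
  · exact hp.ne rfl
  · have : ∀ v : Eu (m + 1), normDecay ((m + 1 : ℕ) * 2) v ≠ 0 := fun v => by
      rw [normDecay, ne_eq, ofReal_eq_zero, not_le]; positivity
    exact mul_ne_zero (this _) (this _)

lemma lintegral_mul_scaledF_lt_top {f F : Chart m → ℂ} (hf : IsWeightedL2 f)
    (hF : IsWeightedL2 F) : ∫⁻ s : ℝ, ∫⁻ p, ‖f p‖ₑ * ‖scaledF F s p‖ₑ ≠ ⊤ := by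
  have hfm := hf.measurable
  have hFm := hF.measurable
  have hsm : ∀ s, Measurable (scaledF F s) := fun s => by unfold scaledF; fun_prop
  -- the Cauchy-Schwarz inequality, with a weight and its inverse
  have cs : ∀ e s : ℝ, ∫⁻ p, ‖f p‖ₑ * ‖scaledF F s p‖ₑ ≤
      (∫⁻ p, ‖f p‖ₑ ^ 2 * ‖⟪p.1, p.2⟫‖ₑ ^ (-e)) ^ (1 / 2 : ℝ) *
      (∫⁻ p, ‖F p‖ₑ ^ 2 * ‖⟪p.1, p.2⟫‖ₑ ^ e) ^ (1 / 2 : ℝ) * ofReal (exp (e * s)) := by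
    intro e s
    have hs := hsm s
    have h2 : ∀ (x w : ENNReal) (a : ℝ), (x * w ^ (a / 2)) ^ (2 : ℝ) = x ^ 2 * w ^ a := fun x w a => by
      rw [mul_rpow_of_nonneg _ _ zero_le_two, ← rpow_mul, rpow_two, div_mul_cancel₀ _ two_ne_zero]
    calc _ ≤ ∫⁻ p, (‖f p‖ₑ * ‖⟪p.1, p.2⟫‖ₑ ^ (-e / 2)) *
          (‖scaledF F s p‖ₑ * ‖⟪p.1, p.2⟫‖ₑ ^ (e / 2)) := by
          refine lintegral_mono_ae (ae_inner_ne_zero.mono fun p hp => ?_)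
          have : ‖⟪p.1, p.2⟫‖ₑ ^ (-e / 2) * ‖⟪p.1, p.2⟫‖ₑ ^ (e / 2) = 1 := by
            rw [← ENNReal.rpow_add _ _ (by simpa using hp) (by simp)]
            simp [neg_div]
          rw [mul_mul_mul_comm, this, mul_one]
      _ ≤ _ := ENNReal.lintegral_mul_le_Lp_mul_Lq _ .two_two (by fun_prop) (by fun_prop)
      _ = _ := by
          simp only [h2]
          rw [lintegral_sq_scaledF hFm, mul_rpow_of_nonneg _ _ (by norm_num),
            ofReal_rpow_of_pos (exp_pos _), ← exp_mul, show 2 * e * s * (1 / 2) = e * s by ring]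
          ring
  have ht : ∀ {x y : ENNReal}, x ≠ ⊤ → y ≠ ⊤ → x ^ (1 / 2 : ℝ) * y ^ (1 / 2 : ℝ) ≠ ⊤ :=
    fun hx hy => mul_ne_top (rpow_ne_top_of_nonneg (by norm_num) hx)
      (rpow_ne_top_of_nonneg (by norm_num) hy)
  have c1 := ht hf.neg hF.pos
  have c2 := ht hf.pos hF.neg
  have n1 : (-(-(1 / 4)) : ℝ) = 1 / 4 := by norm_num
  refine ne_top_of_le_ne_top (mul_ne_top (add_ne_top.2 ⟨c1, c2⟩)
    (integrable_exp_neg_abs (c := 1 / 4) (by norm_num)).ne) ?_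
  rw [← lintegral_const_mul _ (by fun_prop)]
  refine lintegral_mono fun s => ?_
  rcases le_total 0 s with hs | hs
  · refine (cs (-(1 / 4)) s).trans ?_
    rw [n1, abs_of_nonneg hs]
    exact mul_le_mul_left le_add_self _
  · refine (cs (1 / 4) s).trans ?_
    rw [abs_of_nonpos hs, show -(1 / 4) * -s = 1 / 4 * s by ring]
    exact mul_le_mul_left le_self_add _

end Weights

/-! ### The slices `⟨x, ξ⟩ = h` -/

section Link
variable {m : ℕ} {u : Chart m → ℂ}

@[fun_prop]
lemma continuous_offCone (h : ℝ) : Continuous (offCone (m := m) h) := by unfold offCone; fun_prop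

lemma argA_offCone (h : ℝ) (p q : Chart m) : argA (offCone h p) q = ⟪p.1 - q.1, q.2⟫ := by
  rw [argA, offCone, fullEta, inner_joinLast, inner_sub_left]; ring

lemma argB_offCone (h : ℝ) (p q : Chart m) : argB (offCone h p) q = h - ⟪p.1 - q.1, p.2⟫ := by
  rw [argB, offCone, inner_joinLast, inner_sub_left]; ring

lemma lintegral_sq_kerIntegral_offCone_ne_top (hu : IsChartDecaying u) (h : ℝ) :
    ∫⁻ p : Chart m, kerIntegral u (offCone h p) ^ 2 *
      (normDecay ((m + 1 : ℕ) * 2 + 4) p.1 * normDecay ((m + 1 : ℕ) * 2 + 4) p.2) ≠ ⊤ := by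
  obtain ⟨C, hC, hb⟩ := exists_kerIntegral_le hu
  obtain ⟨K, hK, hs⟩ := exists_lintegral_normDecay_inner m (ε := 1 / 8) (by norm_num) (by norm_num)
  set e0 : Eu (m + 1) := EuclideanSpace.single 0 1 with he0
  set D : Eu (m + 1) → ENNReal := normDecay ((m + 1 : ℕ) * 2) with hD
  have hDi : ∫⁻ v, D v < ⊤ := lintegral_normDecay_lt_top (by push_cast; linarith [Nat.cast_nonneg (α := ℝ) m])
  have hDs : ∫⁻ v, D v * ‖⟪e0, v⟫‖ₑ ^ (-(1 / 8) : ℝ) ≤ K := (hs 0 e0).trans (by simp [he0])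
  have hone : ∀ v : Eu (m + 1), normDecay 4 v * ofReal (1 + ‖v‖) ^ 4 = 1 := fun v => by
    have h0 : 0 < 1 + ‖v‖ := by positivity
    rw [normDecay, ← ofReal_pow h0.le, ← ofReal_mul (by positivity), rpow_neg h0.le,
      show (4 : ℝ) = (4 : ℕ) by norm_num, rpow_natCast, inv_mul_cancel₀ (by positivity), ofReal_one]
  have hDm : Measurable D := measurable_normDecay _
  set A : ENNReal := C * ofReal 2 * ofReal (2 + |h|) with hA
  have pt : ∀ p : Chart m, kerIntegral u (offCone h p) ^ 2 *
      (normDecay ((m + 1 : ℕ) * 2 + 4) p.1 * normDecay ((m + 1 : ℕ) * 2 + 4) p.2) ≤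
      (A ^ 2 * 2) * (D p.1 * (D p.2 * (1 + ‖⟪e0, p.2⟫‖ₑ ^ (-(1 / 8) : ℝ)))) := by
    intro p
    have k := hb (Fin.last _) (Fin.castSucc 0) (offCone h p)
    simp only [offCone, joinLast_last, joinLast_castSucc, enorm_one, one_rpow] at k
    have n1 := norm_joinLast_le p.1 1
    have n2 := norm_joinLast_le p.2 (h - ⟪p.1, p.2⟫)
    have b1 : ofReal (1 + ‖joinLast p.1 1‖) ≤ ofReal 2 * ofReal (1 + ‖p.1‖) := by
      rw [← ofReal_mul zero_le_two]
      refine ofReal_le_ofReal ?_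
      simp only [abs_one] at n1; linarith [norm_nonneg p.1]
    have b2 : ofReal (1 + ‖joinLast p.2 (h - ⟪p.1, p.2⟫)‖) ≤
        ofReal (2 + |h|) * (ofReal (1 + ‖p.1‖) * ofReal (1 + ‖p.2‖) ^ 2) := by
      rw [← ofReal_pow (by positivity), ← ofReal_mul (by positivity), ← ofReal_mul (by positivity)]
      refine ofReal_le_ofReal ?_
      have h1 := abs_sub h ⟪p.1, p.2⟫
      have h2 := abs_real_inner_le_norm p.1 p.2
      have h3 := abs_nonneg h
      have h4 := norm_nonneg p.1
      have h5 := norm_nonneg p.2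
      calc 1 + ‖joinLast p.2 (h - ⟪p.1, p.2⟫)‖ ≤ 1 + ‖p.2‖ + |h| + ‖p.1‖ * ‖p.2‖ := by linarith
        _ ≤ (2 + |h|) * ((1 + ‖p.1‖) * (1 + ‖p.2‖)) := by
          nlinarith [mul_nonneg h4 h5, mul_nonneg h3 h4, mul_nonneg h3 h5,
            mul_nonneg h3 (mul_nonneg h4 h5)]
        _ ≤ _ := by gcongr; nlinarith
    have b3 : p.2 0 = ⟪e0, p.2⟫ := by simp [he0, EuclideanSpace.inner_single_left]
    have b4 : ∀ S : ENNReal, (1 + S ^ (-ε₀)) ^ 2 ≤ 2 * (1 + S ^ (-(1 / 8) : ℝ)) := fun S => by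
      have := ENNReal.rpow_add_le_mul_rpow_add_rpow 1 (S ^ (-ε₀)) one_le_two
      rw [← rpow_mul, one_rpow, rpow_two] at this
      norm_num at this ⊢
      exact this
    calc _ ≤ (C * (ofReal 2 * ofReal (1 + ‖p.1‖)) * (ofReal (2 + |h|) *
          (ofReal (1 + ‖p.1‖) * ofReal (1 + ‖p.2‖) ^ 2)) * (1 + ‖⟪e0, p.2⟫‖ₑ ^ (-ε₀))) ^ 2 *
          ((D p.1 * normDecay 4 p.1) * (D p.2 * normDecay 4 p.2)) := by
          rw [normDecay_add, normDecay_add]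
          refine mul_le_mul_left (pow_le_pow_left' (k.trans ?_) 2) _
          rw [b3]; gcongr
      _ = A ^ 2 * (D p.1 * (D p.2 * (1 + ‖⟪e0, p.2⟫‖ₑ ^ (-ε₀)) ^ 2)) *
        ((normDecay 4 p.1 * ofReal (1 + ‖p.1‖) ^ 4) *
        (normDecay 4 p.2 * ofReal (1 + ‖p.2‖) ^ 4)) := by ring
      _ ≤ A ^ 2 * (D p.1 * (D p.2 * (2 * (1 + ‖⟪e0, p.2⟫‖ₑ ^ (-(1 / 8) : ℝ))))) * (1 * 1) := by
        rw [hone, hone]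
        gcongr; exact b4 _
      _ = _ := by ring
  refine ne_top_of_le_ne_top (b := (A ^ 2 * 2) * ((∫⁻ v, D v) * ((∫⁻ v, D v) + K))) ?_ ?_
  · simp [hA, mul_eq_top, hC, hDi.ne, hK]
  · refine (lintegral_mono pt).trans ?_
    rw [lintegral_const_mul _ (by fun_prop)]
    refine mul_le_mul_right ?_ _
    rw [volume_eq_prod, lintegral_prod_mul (f := D)
      (g := fun v => D v * (1 + ‖⟪e0, v⟫‖ₑ ^ (-(1 / 8) : ℝ))) (by fun_prop) (by fun_prop)]
    refine mul_le_mul_right ?_ _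
    simp only [mul_add, mul_one]
    rw [lintegral_add_left hDm]
    exact add_le_add le_rfl hDs

lemma lintegral_normDecay_pair_ne_top : ∫⁻ p : Chart m, normDecay ((m + 1 : ℕ) * 2 + 4) p.1 *
      normDecay ((m + 1 : ℕ) * 2 + 4) p.2 ≠ ⊤ := by
  have h : ∫⁻ v : Eu (m + 1), normDecay ((m + 1 : ℕ) * 2 + 4) v < ⊤ :=
    lintegral_normDecay_lt_top (by push_cast; linarith [Nat.cast_nonneg (α := ℝ) m])
  rw [volume_eq_prod, lintegral_prod_mul (by fun_prop) (by fun_prop)]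
  exact mul_ne_top h.ne h.ne

lemma lintegral_kerIntegral_offCone_ne_top (hu : IsChartDecaying u) (a b : 𝓢(Eu (m + 1), ℂ)) (h : ℝ) :
    ∫⁻ p : Chart m, kerIntegral u (offCone h p) * ‖a p.1 * b p.2‖ₑ ≠ ⊤ := by
  obtain ⟨M, hM, hMa⟩ := exists_enorm_le_normDecay a ((m + 1) * 2 + 4)
  obtain ⟨M', hM', hMb⟩ := exists_enorm_le_normDecay b ((m + 1) * 2 + 4)
  push_cast at hMa hMb
  have h1 := lintegral_sq_kerIntegral_offCone_ne_top hu h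
  have h2 := lintegral_normDecay_pair_ne_top (m := m)
  push_cast at h1 h2
  refine ne_top_of_le_ne_top (mul_ne_top (mul_ne_top hM hM') (add_ne_top.2 ⟨h2, h1⟩)) ?_
  rw [← lintegral_add_left (by fun_prop), ← lintegral_const_mul' _ _ (mul_ne_top hM hM')]
  refine lintegral_mono fun p => ?_
  have hk : ∀ k : ENNReal, k ≤ 1 + k ^ 2 := fun k => by
    rcases le_total k 1 with hk | hk
    · exact hk.trans le_self_add
    · exact (le_self_pow₀ hk two_ne_zero).trans le_add_self
  rw [enorm_mul]
  refine (mul_le_mul' (hk _) (mul_le_mul' (hMa p.1) (hMb p.2))).trans (le_of_eq ?_)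
  ring

/-- On the cone, the singularity of `𝓕_symp (Φ̃ dm)` at `ξ = 0` is locally square integrable. -/
lemma memLp_thetaLim_sigmaPoint (hu : IsChartDecaying u) {K : Set Chart m}
    (hK : IsCompact K) : MemLp (fun p => thetaLim u (sigmaPoint p)) 2 (volume.restrict K) := by
  have hm : AEStronglyMeasurable (fun p : Chart m => thetaLim u (sigmaPoint p)) volume := by
    refine aestronglyMeasurable_of_tendsto_ae atTop (f := fun (L : ℕ) p => truncTheta u L (sigmaPoint p))
      (fun L => ((continuous_truncTheta hu.integrable L).comp continuous_sigmaPoint).aestronglyMeasurable) ?_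
    exact ae_snd_ne_zero.mono fun p hp => tendsto_truncTheta hu.integrable hu.measurable
      (kerIntegral_ne_top hu (sigmaPoint_mem hp).2)
  obtain ⟨R, hR0, hR⟩ := hK.isBounded.exists_pos_norm_le
  set c : ENNReal := ofReal ((1 + R) ^ (-((m + 1 : ℕ) * 2 + 4 : ℝ))) with hc
  have hc0 : c ≠ 0 := by rw [hc, Ne, ofReal_eq_zero, not_le]; positivity
  have hcb : ∀ p ∈ K, c * c ≤ normDecay ((m + 1 : ℕ) * 2 + 4) p.1 * normDecay ((m + 1 : ℕ) * 2 + 4) p.2 := by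
    have : ∀ v : Eu (m + 1), ‖v‖ ≤ R → c ≤ normDecay ((m + 1 : ℕ) * 2 + 4) v := fun v hv =>
      ofReal_le_ofReal (Real.rpow_le_rpow_of_nonpos (by positivity) (by linarith)
        (neg_nonpos.2 (by positivity)))
    exact fun p hp => mul_le_mul' (this _ ((norm_fst_le p).trans (hR p hp)))
      (this _ ((norm_snd_le p).trans (hR p hp)))
  refine ⟨hm.restrict, ?_⟩
  rw [eLpNorm_lt_top_iff_lintegral_rpow_enorm_lt_top two_ne_zero ENNReal.ofNat_ne_top]
  simp only [ENNReal.toReal_ofNat, rpow_two]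
  have h1 := lintegral_sq_kerIntegral_offCone_ne_top hu 0
  have hcc : c * c ≠ 0 := mul_ne_zero hc0 hc0
  have hct : c * c ≠ ⊤ := mul_ne_top ofReal_ne_top ofReal_ne_top
  refine lt_of_le_of_lt ?_ (mul_lt_top (ENNReal.inv_lt_top.2 (pos_iff_ne_zero.2 hcc)) h1.lt_top)
  rw [← ENNReal.mul_le_iff_le_inv (r := c * c) hcc hct, ← lintegral_const_mul' _ _ hct]
  refine (setLIntegral_mono_ae' hK.measurableSet ?_).trans (setLIntegral_le_lintegral _ _)
  filter_upwards [ae_snd_ne_zero] with p hp hpK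
  rw [offCone_zero, mul_comm]
  refine mul_le_mul' (pow_le_pow_left' ?_ 2) (hcb p hpK)
  exact le_of_tendsto (tendsto_truncTheta hu.integrable hu.measurable
    (kerIntegral_ne_top hu (sigmaPoint_mem hp).2)).enorm (.of_forall fun L => enorm_truncTheta_le _ L)

/-- The integrand of the pairing of `𝓕_symp (Φ̃ dm)`, on the slice `⟨x, ξ⟩ = h`, with a function
having the transform `f`, in terms of the transform `F` of `Φ`. -/
def linkIntegrand (h : ℝ) (f F : Chart m → ℂ) (r : ℝ × Chart m) :
    ℂ := oscPair ⟪r.2.1, r.2.2⟫ h r.1 * f r.2 * scaledF F r.1 r.2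

lemma measurable_scaledF {F : Chart m → ℂ} (hF : Measurable F) :
    Measurable fun r : ℝ × Chart m => scaledF F r.1 r.2 :=
  Measurable.mul (by fun_prop) (hF.comp (f := fun r : ℝ × Chart m =>
    (r.2.1, -(exp (-(2 * r.1))) • r.2.2)) (by fun_prop))

lemma integrable_mul_scaledF {f F : Chart m → ℂ} (hf : IsWeightedL2 f) (hF : IsWeightedL2 F) :
    Integrable (fun r : ℝ × Chart m => f r.2 * scaledF F r.1 r.2) (volume.prod volume) := by
  have hm : Measurable fun r : ℝ × Chart m => f r.2 * scaledF F r.1 r.2 :=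
    (hf.measurable.comp measurable_snd).mul (measurable_scaledF hF.measurable)
  refine ⟨hm.aestronglyMeasurable, ?_⟩
  rw [hasFiniteIntegral_iff_enorm, lintegral_prod _ hm.enorm.aemeasurable]
  simpa only [enorm_mul] using (lintegral_mul_scaledF_lt_top hf hF).lt_top

lemma integrable_linkIntegrand {f F : Chart m → ℂ} (hf : IsWeightedL2 f) (hF : IsWeightedL2 F)
    (h : ℝ) : Integrable (linkIntegrand h f F) (volume.prod volume) := by
  unfold linkIntegrand
  simp only [mul_assoc]
  exact (integrable_mul_scaledF hf hF).bdd_mul (c := 2)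
    (Measurable.aestronglyMeasurable (by fun_prop)) (.of_forall fun r => norm_oscPair_le _ _ _)

lemma integrable_tensor (a b : 𝓢(Eu (m + 1), ℂ)) :
    Integrable (fun p : Chart m => a p.1 * b p.2) volume := by
  rw [volume_eq_prod]; exact a.integrable.mul_prod b.integrable

lemma continuous_integral_chr_tensor (a b : 𝓢(Eu (m + 1), ℂ)) (t : ℝ) :
    Continuous fun q : Chart m => ∫ p : Chart m,
      chr (⟪p.1 - q.1, q.2⟫ / t + t * ⟪p.1 - q.1, p.2⟫) * (a p.1 * b p.2) := by
  refine continuous_of_dominated (bound := fun p => ‖a p.1 * b p.2‖) (fun q => ?_)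
    (fun q => .of_forall fun p => ?_) (integrable_tensor a b).norm (.of_forall fun p => ?_)
  · exact Continuous.aestronglyMeasurable (by fun_prop)
  · rw [norm_mul, norm_chr, one_mul]
  · fun_prop

lemma integrable_mul_integral_chr_tensor (hu : Integrable u) (a b : 𝓢(Eu (m + 1), ℂ)) (t : ℝ) :
    Integrable fun q => u q * ∫ p : Chart m,
      chr (⟪p.1 - q.1, q.2⟫ / t + t * ⟪p.1 - q.1, p.2⟫) * (a p.1 * b p.2) := by
  refine hu.mul_bdd (c := ∫ p : Chart m, ‖a p.1 * b p.2‖)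
    (continuous_integral_chr_tensor a b t).aestronglyMeasurable (.of_forall fun q => ?_)
  exact (norm_integral_le_integral_norm _).trans_eq (by simp only [norm_mul, norm_chr, one_mul])

lemma integrable_chr_mul_sympI (hu : Integrable u) (a b : 𝓢(Eu (m + 1), ℂ)) (t : ℝ) :
    Integrable fun p : Chart m => chr (⟪p.1, p.2⟫ / t) * (a p.1 * b p.2) *
      ((((|t| ^ (m + 1))⁻¹ : ℝ) : ℂ) * sympI u (p.1, -(t ^ 2)⁻¹ • p.2)) := by
  have hS := continuous_sympI hu
  refine ((integrable_tensor a b).bdd_mul (c := 1) (Continuous.aestronglyMeasurable (by fun_prop))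
    (.of_forall fun p => (norm_chr _).le)).mul_bdd (c := |(|t| ^ (m + 1))⁻¹| * ∫ q, ‖u q‖)
    (Continuous.aestronglyMeasurable (by fun_prop)) (.of_forall fun p => ?_)
  rw [norm_mul, norm_real, norm_eq_abs]
  exact mul_le_mul_of_nonneg_left (norm_sympI_le _ _) (abs_nonneg _)

/-- Apart from the part of the phase that depends on `h`, the two scales `± e^s` contribute two
values of one and the same function. -/
lemma oscPair_sub_eq (x y h s : ℝ) : oscPair x (h - y) s =
    chr (-(exp s * h)) * chr (x / exp s + exp s * y) +
      chr (exp s * h) * chr (x / (-exp s) + (-exp s) * y) := by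
  rw [oscPair, osc_eq_chr, osc_eq_chr, ← chr_add, ← chr_add]
  congr 2 <;> rw [exp_neg] <;> field_simp <;> ring

lemma integral_oscPair_offCone (a b : 𝓢(Eu (m + 1), ℂ)) (h s : ℝ) (q : Chart m) : ∫ p : Chart m,
    oscPair (argA (offCone h p) q) (argB (offCone h p) q) s * (a p.1 * b p.2) = 
    chr (-(exp s * h)) * (∫ p : Chart m, chr (⟪p.1 - q.1, q.2⟫ / exp s +
      exp s * ⟪p.1 - q.1, p.2⟫) * (a p.1 * b p.2)) +
    chr (exp s * h) * (∫ p : Chart m, chr (⟪p.1 - q.1, q.2⟫ / (-exp s) +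
      (-exp s) * ⟪p.1 - q.1, p.2⟫) * (a p.1 * b p.2)) := by
  have int : ∀ t : ℝ, Integrable (fun p : Chart m =>
      chr (⟪p.1 - q.1, q.2⟫ / t + t * ⟪p.1 - q.1, p.2⟫) * (a p.1 * b p.2)) volume := fun t =>
    (integrable_tensor a b).bdd_mul (c := 1)
        (Continuous.aestronglyMeasurable (by fun_prop))
      (.of_forall fun p => (norm_chr _).le)
  rw [← integral_const_mul, ← integral_const_mul, ← integral_add ((int _).const_mul _)
    ((int _).const_mul _)]
  refine integral_ext fun p => ?_
  simp only [argA_offCone, argB_offCone, oscPair_sub_eq]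
  ring

theorem integral_thetaLim_offCone (hu : IsRapid u) (hF : IsWeightedL2 (sympI u))
    (a b : 𝓢(Eu (m + 1), ℂ)) (h : ℝ) : ∫ p : Chart m, thetaLim u (offCone h p) * (a p.1 * b p.2) =
      ∫ r, linkIntegrand h (fun p => 𝓕⁻ a p.1 * 𝓕 b p.2) (sympI u) r ∂(volume.prod volume) := by
  have huc := hu.isChartDecaying
  have hψ := integrable_tensor a b
  have hI := integrable_mul_integral_chr_tensor huc.integrable a b
  have hJ := integrable_chr_mul_sympI huc.integrable (𝓕⁻ a) (𝓕 b)
  have h1 := tendsto_integral_truncTheta huc (P := offCone h) (by fun_prop) hψ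
    (lintegral_kerIntegral_offCone_ne_top huc a b h)
  have hi := integrable_linkIntegrand (isWeightedL2_tensor (𝓕⁻ a) (𝓕 b)) hF h
  have hin : ∀ s : ℝ, ∫ q, u q * ∫ p : Chart m,
      oscPair (argA (offCone h p) q) (argB (offCone h p) q) s * (a p.1 * b p.2) =
      ∫ p, linkIntegrand h (fun p => 𝓕⁻ a p.1 * 𝓕 b p.2) (sympI u) (s, p) := by
    intro s
    simp only [integral_oscPair_offCone, mul_add]
    rw [integral_add]
    · simp only [mul_left_comm (u _), integral_const_mul]
      rw [integral_mul_integral_chr huc.integrable a b (exp_ne_zero s),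
        integral_mul_integral_chr huc.integrable a b (neg_ne_zero.2 (exp_ne_zero s)),
        ← integral_const_mul, ← integral_const_mul,
        ← integral_add ((hJ _).const_mul _) ((hJ _).const_mul _)]
      refine integral_ext fun p => ?_
      have e1 := oscPair_sub_eq ⟪p.1, p.2⟫ 0 h s
      simp only [sub_zero, mul_zero, add_zero] at e1
      have e3 : (exp s ^ 2)⁻¹ = exp (-(2 * s)) := by rw [exp_neg, ← exp_nat_mul]; norm_num
      have e4 : (exp s ^ (m + 1))⁻¹ = exp (-((m + 1 : ℕ) * s)) := by rw [exp_neg, ← exp_nat_mul]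
      simp only [linkIntegrand, e1, scaledF, neg_sq, abs_neg, abs_exp, e3, e4]
      ring
    all_goals simpa only [mul_left_comm (u _)] using (hI _).const_mul _
  simp only [hin] at h1
  have h2 := intervalIntegral_tendsto_integral hi.integral_prod_left
    (tendsto_neg_atTop_atBot.comp tendsto_natCast_atTop_atTop) tendsto_natCast_atTop_atTop
  rw [integral_prod _ hi]
  exact tendsto_nhds_unique h1 h2

end Link

/-! ### A Gamma integral -/

section Mellin

/-- The integrand of the Gamma integral `∫ v^s e^{-z v} dv / v`, in the variable `x = 2 log v`. -/
def gammaKer (s z : ℂ) (x : ℝ) : ℂ := cexp (s * (x / 2 : ℝ) - z * exp (x / 2))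

@[fun_prop]
lemma continuous_gammaKer (s z : ℂ) : Continuous (gammaKer s z) := by unfold gammaKer; fun_prop

lemma norm_gammaKer (s z : ℂ) (x : ℝ) :
    ‖gammaKer s z x‖ = exp (s.re * (x / 2) - z.re * exp (x / 2)) := by
  rw [gammaKer, norm_exp, sub_re, Complex.re_mul_ofReal, Complex.re_mul_ofReal]

lemma gammaKer_add (s w z : ℂ) (x : ℝ) :
    gammaKer (s + w) z x = cexp (w * (x / 2 : ℝ)) * gammaKer s z x := by
  rw [gammaKer, gammaKer, ← Complex.exp_add]; ring_nf

lemma gammaKer_succ (s z : ℂ) (x : ℝ) :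
    gammaKer (s + 1) z x = (exp (x / 2) : ℂ) * gammaKer s z x := by
  rw [gammaKer_add, one_mul, Complex.ofReal_exp]

lemma integrable_gammaKer {s z : ℂ} (hs : 0 < s.re) (hz : 0 < z.re) :
    Integrable (gammaKer s z) := by
  have h0 : Integrable fun x : ℝ => exp (-(s.re / 2) * |x|) := by
    refine ⟨by fun_prop, ?_⟩
    refine lt_of_le_of_lt (lintegral_mono fun x => ?_) (integrable_exp_neg_abs (half_pos hs))
    rw [Real.enorm_of_nonneg (exp_pos _).le]
  refine (h0.const_mul (exp (2 * s.re ^ 2 / z.re))).mono'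
    (continuous_gammaKer s z).aestronglyMeasurable (.of_forall fun x => ?_)
  rw [norm_gammaKer, ← exp_add]
  refine exp_le_exp.2 ?_
  have h1 : 0 < exp (x / 2) := exp_pos _
  have h2 : 0 ≤ 2 * s.re ^ 2 / z.re := by positivity
  rcases le_total x 0 with hx | hx
  · rw [abs_of_nonpos hx]; nlinarith [mul_pos hz h1]
  · rw [abs_of_nonneg hx]
    have h3 := Real.quadratic_le_exp_of_nonneg (x := x / 2) (by positivity)
    have h4 : s.re * x - z.re * (x ^ 2 / 8) ≤ 2 * s.re ^ 2 / z.re := by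
      rw [le_div_iff₀ hz]; nlinarith [sq_nonneg (4 * s.re - z.re * x)]
    have h5 : z.re * (x ^ 2 / 8) ≤ z.re * exp (x / 2) :=
      mul_le_mul_of_nonneg_left (by nlinarith) hz.le
    linarith

lemma hasDerivAt_gammaKer (s z : ℂ) (x : ℝ) : HasDerivAt (gammaKer s z)
    ((1 / 2 : ℂ) * (s * gammaKer s z x - z * gammaKer (s + 1) z x)) x := by
  have h1 : HasDerivAt (fun x : ℝ => ((x / 2 : ℝ) : ℂ)) ((1 / 2 : ℝ) : ℂ) x :=
    ((hasDerivAt_id x).div_const 2).ofReal_comp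
  have h2 : HasDerivAt (fun x : ℝ => ((exp (x / 2) : ℝ) : ℂ))
      ((exp (x / 2) * (1 / 2) : ℝ) : ℂ) x := ((hasDerivAt_id x).div_const 2).exp.ofReal_comp
  refine (((h1.const_mul s).sub (h2.const_mul z)).cexp).congr_deriv ?_
  rw [gammaKer_succ, gammaKer]
  simp only [Pi.sub_apply]
  push_cast; ring

lemma integral_gammaKer_succ {s z : ℂ} (hs : 0 < s.re) (hz : 0 < z.re) :
    z * ∫ x, gammaKer (s + 1) z x = s * ∫ x, gammaKer s z x := by
  have i1 := integrable_gammaKer hs hz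
  have i2 := integrable_gammaKer (s := s + 1) (z := z) (by simp; linarith) hz
  have h := integral_eq_zero_of_hasDerivAt_of_integrable (hasDerivAt_gammaKer s z)
    (((i1.const_mul s).sub (i2.const_mul z)).const_mul _) i1
  rw [integral_const_mul, integral_sub (i1.const_mul s) (i2.const_mul z), integral_const_mul,
    integral_const_mul] at h
  have h' := (mul_eq_zero.1 h).resolve_left (by norm_num)
  exact (sub_eq_zero.1 h').symm

lemma hasDerivAt_integral_gammaKer {s z : ℂ} (hs : 0 < s.re) (hz : 0 < z.re) :
    HasDerivAt (fun z => ∫ x, gammaKer s z x) (-∫ x, gammaKer (s + 1) z x) z := by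
  rw [← integral_neg]
  have hb := integrable_gammaKer (s := s + 1) (z := (z.re / 2 : ℝ)) (by simp; linarith) (by simpa)
  refine (hasDerivAt_integral_of_dominated_loc_of_deriv_le (F := fun z x => gammaKer s z x)
    (F' := fun z x => -gammaKer (s + 1) z x) (bound := fun x => ‖gammaKer (s + 1) (z.re / 2 : ℝ) x‖)
    (Metric.ball_mem_nhds z (half_pos hz)) (.of_forall fun w => (continuous_gammaKer s w).aestronglyMeasurable)
    (integrable_gammaKer hs hz) (continuous_gammaKer _ z).neg.aestronglyMeasurable
    (.of_forall fun x w hw => ?_) hb.norm (.of_forall fun x w _ => ?_)).2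
  · rw [norm_neg, norm_gammaKer, norm_gammaKer]
    refine exp_le_exp.2 (sub_le_sub_left ?_ _)
    refine mul_le_mul_of_nonneg_right ?_ (exp_pos _).le
    have := (Complex.abs_re_le_norm (w - z)).trans (mem_ball_iff_norm.1 hw).le
    rw [sub_re, abs_le] at this
    simp only [Complex.ofReal_re]; linarith [this.1]
  · have h := ((hasDerivAt_id w).mul_const (exp (x / 2) : ℂ)).const_sub (s * (x / 2 : ℝ))
    refine h.cexp.congr_deriv ?_
    rw [gammaKer_succ, gammaKer]; simp only [id]; ring

lemma integral_gammaKer_one {s : ℂ} (hs : 0 < s.re) : ∫ x, gammaKer s 1 x = 2 * Gamma s := by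
  have himg : (fun x : ℝ => exp (x / 2)) '' Set.univ = Set.Ioi 0 := by
    ext v
    simp only [Set.image_univ, Set.mem_range, Set.mem_Ioi]
    refine ⟨fun ⟨x, hx⟩ => hx ▸ exp_pos _, fun hv => ⟨2 * log v, ?_⟩⟩
    rw [mul_div_cancel_left₀ _ two_ne_zero, exp_log hv]
  have h := integral_image_eq_integral_abs_deriv_smul (s := Set.univ) (f := fun x : ℝ => exp (x / 2))
    (f' := fun x => exp (x / 2) * (1 / 2)) MeasurableSet.univ
    (fun x _ => ((hasDerivAt_id x).div_const 2).exp.hasDerivWithinAt)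
    (fun x _ y _ hxy => by have := Real.exp_injective hxy; simpa using this)
    (fun v : ℝ => cexp (-v) * (v : ℂ) ^ (s - 1))
  rw [himg, setIntegral_univ] at h
  rw [Complex.Gamma_eq_integral hs, Complex.GammaIntegral]
  push_cast
  rw [h, ← integral_const_mul]
  refine integral_ext fun x => ?_
  have e1 : ((exp (x / 2) : ℝ) : ℂ) ≠ 0 := ofReal_ne_zero.2 (exp_ne_zero _)
  have e2 : ((exp (x / 2) : ℝ) : ℂ) ^ (s - 1) = cexp ((s - 1) * (x / 2 : ℝ)) := by
    rw [cpow_def_of_ne_zero e1, ← Complex.ofReal_log (exp_pos _).le, Real.log_exp, mul_comm]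
  have e3 : ((exp (x / 2) : ℝ) : ℂ) = cexp (x / 2 : ℝ) := Complex.ofReal_exp _
  simp only [abs_of_pos (mul_pos (exp_pos (x / 2)) one_half_pos), real_smul, e2, gammaKer]
  rw [Complex.ofReal_mul]
  have e4 : cexp (s * (x / 2 : ℝ) - 1 * (exp (x / 2) : ℂ)) =
      ((exp (x / 2) : ℝ) : ℂ) * (cexp (-(exp (x / 2) : ℂ)) * cexp ((s - 1) * (x / 2 : ℝ))) := by
    nth_rewrite 2 [e3]
    rw [← Complex.exp_add, ← Complex.exp_add]; congr 1; ring
  rw [e4]; push_cast; ring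

theorem integral_gammaKer {s z : ℂ} (hs : 0 < s.re) (hz : 0 < z.re) :
    ∫ x, gammaKer s z x = 2 * (z⁻¹ ^ s * Gamma s) := by
  have hne : ∀ {w : ℂ}, 0 < w.re → w ≠ 0 := fun hw h => by simp [h] at hw
  have hsl : ∀ {w : ℂ}, 0 < w.re → w ∈ Complex.slitPlane := fun hw => Or.inl hw
  have hU : IsOpen {w : ℂ | 0 < w.re} := isOpen_lt continuous_const Complex.continuous_re
  have hd : ∀ w ∈ {w : ℂ | 0 < w.re}, HasDerivAt (fun w => w ^ s * ∫ x, gammaKer s w x) 0 w := by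
    intro w hw
    refine (((hasDerivAt_id w).cpow_const (hsl hw)).mul (hasDerivAt_integral_gammaKer hs hw)).congr_deriv ?_
    have h := integral_gammaKer_succ hs hw
    have e : w ^ s = w ^ (s - 1) * w := by
      nth_rewrite 3 [← Complex.cpow_one w]
      rw [← cpow_add _ _ (hne hw), sub_add_cancel]
    simp only [id, e]
    linear_combination -(w ^ (s - 1)) * h
  have hconv : IsPreconnected {w : ℂ | 0 < w.re} := (convex_halfSpace_re_gt 0).isPreconnected
  have h1 := hU.is_const_of_deriv_eq_zero hconv
    (fun w hw => (hd w hw).differentiableAt.differentiableWithinAt) (fun w hw => (hd w hw).deriv)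
    (x := z) (y := 1) hz (by simp)
  simp only [Complex.one_cpow, one_mul, integral_gammaKer_one hs] at h1
  have harg : z.arg ≠ π := fun h => by
    have := Complex.arg_eq_pi_iff.1 h
    exact absurd this.1 (not_lt.2 (le_of_lt hz))
  rw [Complex.inv_cpow _ _ harg, mul_left_comm, ← h1, inv_mul_cancel_left₀]
  exact (Complex.cpow_ne_zero_iff_of_exponent_ne_zero (hne hs)).2 (hne hz)

lemma inv_cpow_eq (l ε : ℝ) (hε : ε = 1 ∨ ε = -1) :
    (((-ε * (2 * π) : ℝ) : ℂ) * I)⁻¹ ^ (-(2 * I * l)) =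
      (2 * π : ℂ) ^ (2 * I * l) * cexp (ε * (π * l)) := by
  have hp : (0 : ℝ) < (2 * π)⁻¹ := by positivity
  have h2 : (2 * π : ℂ) ≠ 0 := by exact_mod_cast (by positivity : (2 * π : ℝ) ≠ 0)
  have hl : Complex.log (2 * π : ℂ) = (log (2 * π) : ℂ) := by
    rw [Complex.ofReal_log (by positivity)]; push_cast; rfl
  have hI : ∀ w : ℂ, w ≠ 0 → ((2 * π)⁻¹ : ℝ) * w ≠ 0 := fun w hw =>
    mul_ne_zero (ofReal_ne_zero.2 hp.ne') hw
  rcases hε with rfl | rfl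
  · have e : ((((-1 : ℝ) * (2 * π) : ℝ) : ℂ) * I)⁻¹ = (((2 * π)⁻¹ : ℝ) : ℂ) * I := by
      push_cast; field_simp; simp
    rw [e, cpow_def_of_ne_zero (hI _ I_ne_zero), Complex.log_ofReal_mul hp I_ne_zero,
      Complex.log_I, cpow_def_of_ne_zero h2, ← Complex.exp_add, Real.log_inv, hl]
    congr 1; push_cast; linear_combination (-(π * l : ℂ)) * I_sq
  · have e : (((-(-1) : ℝ) * (2 * π) : ℝ) * I)⁻¹ = (((2 * π)⁻¹ : ℝ) : ℂ) * (-I) := by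
      push_cast; field_simp; simp
    rw [e, cpow_def_of_ne_zero (hI _ (neg_ne_zero.2 I_ne_zero)),
      Complex.log_ofReal_mul hp (neg_ne_zero.2 I_ne_zero),
      Complex.log_neg_I, cpow_def_of_ne_zero h2, ← Complex.exp_add, Real.log_inv, hl]
    congr 1; push_cast; linear_combination (π * l : ℂ) * I_sq

lemma gammaSymbol_eq {l : ℝ} (hl : l ≠ 0) : gammaSymbol l = (2 * π : ℂ) ^ (2 * I * l) *
    Gamma (-(2 * I * l)) * (cexp (π * l) + cexp (-(π * l))) := by
  set s : ℂ := -(2 * I * l) with hs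
  have h := Complex.Gammaℝ_div_Gammaℝ_one_sub (s := s) fun k hk => by
    have := congrArg im hk
    simp [hs] at this
    exact hl this
  have hp : (π : ℂ) ≠ 0 := ofReal_ne_zero.2 pi_ne_zero
  have hc : cos (π * s / 2) = (cexp (π * l) + cexp (-(π * l))) / 2 := by
    rw [cos]
    congr 2
    · congr 1; rw [hs]; linear_combination (-(π * l : ℂ)) * I_sq
    · congr 1; rw [hs]; linear_combination (π * l : ℂ) * I_sq
  rw [Complex.Gammaℂ_def, hc, Complex.Gammaℝ_def, Complex.Gammaℝ_def] at h
  have e1 : s / 2 = -(I * l) := by rw [hs]; ring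
  have e2 : (1 - s) / 2 = 1 / 2 + I * l := by rw [hs]; ring
  have e3 : (π : ℂ) ^ (-s / 2) = (π : ℂ) ^ (1 / 2 + 2 * I * l) * (π : ℂ) ^ (-(1 - s) / 2) := by
    rw [← cpow_add _ _ hp]; congr 1; rw [hs]; ring
  have e4 : (π : ℂ) ^ (-(1 / 2 : ℂ) - 2 * I * l) = ((π : ℂ) ^ (1 / 2 + 2 * I * l))⁻¹ := by
    rw [← Complex.cpow_neg]; congr 1; ring
  have h0 : (π : ℂ) ^ (-(1 - s) / 2) ≠ 0 := by simp [Complex.cpow_eq_zero_iff, hp]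
  rw [gammaSymbol, normalizingSymbol, e4, ← e1, ← e2, mul_inv, inv_inv, inv_div, ← mul_div_assoc]
  rw [e3, mul_comm ((π : ℂ) ^ (1 / 2 + 2 * I * l)), mul_assoc, mul_div_mul_left _ _ h0] at h
  rw [h, hs, neg_neg]; ring

lemma exp_mul_norm_Gamma_le {l : ℝ} (hl : l ≠ 0) :
    exp (π * |l|) * ‖Gamma (-(2 * I * l))‖ ≤ ‖gammaSymbol l‖ := by
  have h2 : (2 * π : ℂ) = ((2 * π : ℝ) : ℂ) := by push_cast; rfl
  have h1 : ‖(2 * π : ℂ) ^ (2 * I * l)‖ = 1 := by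
    rw [h2, Complex.norm_cpow_eq_rpow_re_of_pos (by positivity)]; simp
  have h3 : ‖cexp (π * l) + cexp (-(π * l))‖ = exp (π * l) + exp (-(π * l)) := by
    have : cexp (π * l) + cexp (-(π * l)) =
        ((exp (π * l) + exp (-(π * l)) : ℝ) : ℂ) := by push_cast; rfl
    rw [this, norm_real, norm_of_nonneg (by positivity)]
  rw [gammaSymbol_eq hl, norm_mul, norm_mul, h1, h3, one_mul, mul_comm]
  refine mul_le_mul_of_nonneg_left ?_ (norm_nonneg _)
  rcases abs_cases l with ⟨h, -⟩ | ⟨h, -⟩ <;> rw [h]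
  · linarith [exp_pos (-(π * l))]
  · rw [mul_neg]; linarith [exp_pos (π * l)]

lemma norm_inv_cpow_le {z : ℂ} (hz0 : z ≠ 0) (hz : 0 ≤ z.re) (l : ℝ) :
    ‖z⁻¹ ^ (-(2 * I * l))‖ ≤ exp (π * |l|) := by
  have hr : 0 ≤ (z⁻¹).re := by rw [Complex.inv_re]; exact div_nonneg hz (Complex.normSq_nonneg _)
  rw [cpow_def_of_ne_zero (inv_ne_zero hz0), norm_exp]
  refine exp_le_exp.2 ?_
  have e : (Complex.log z⁻¹ * -(2 * I * l)).re = 2 * (arg z⁻¹ * l) := by simp [Complex.log_im]; ring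
  have ha := Complex.abs_arg_le_pi_div_two_iff.2 hr
  rw [e]
  calc 2 * (arg z⁻¹ * l) ≤ 2 * (|arg z⁻¹| * |l|) := by rw [← abs_mul]; gcongr; exact le_abs_self _
    _ ≤ 2 * (π / 2 * |l|) := by gcongr
    _ = π * |l| := by ring

lemma norm_exp_sub_one_le (l : ℝ) : ‖cexp (I * l) - 1‖ ≤ |l| := by
  simpa using Real.norm_exp_I_mul_ofReal_sub_one_le (x := l)

lemma norm_exp_sub_one_eq (l : ℝ) : ‖cexp (I * l) - 1‖ = ‖cexp (-(I * l)) - 1‖ := by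
  rw [← Complex.norm_conj, map_sub, map_one, ← exp_conj]
  simp

variable {X : Type*} [MeasurableSpace X] {μ : Measure X} [SFinite μ] {a : X → ℝ}

lemma integral_gammaKer_mul_charFun (ha : Measurable a) {M : X → ℂ} (hM : Integrable M μ) {s z : ℂ}
    (hs : 0 < s.re) (hz : 0 < z.re) :
    ∫ x, gammaKer s z x * (∫ r, cexp (-(I * (x * a r))) * M r ∂μ) =
      ∫ r, M r * (∫ x, gammaKer (s + -(2 * I * a r)) z x) ∂μ := by
  have hn : ∀ x b : ℝ, ‖cexp (-(I * (x * b)))‖ = 1 := fun x b => by rw [norm_exp]; simp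
  have hi : Integrable (fun p : ℝ × X => cexp (-(I * (p.1 * a p.2))) *
      (gammaKer s z p.1 * M p.2)) (volume.prod μ) :=
    ((integrable_gammaKer hs hz).mul_prod hM).bdd_mul (c := 1)
      (Measurable.aestronglyMeasurable (by fun_prop)) (.of_forall fun p => (hn _ _).le)
  calc _ = ∫ x : ℝ, (∫ r, cexp (-(I * (x * a r))) * (gammaKer s z x * M r) ∂μ) := by
        simp only [← integral_const_mul, mul_left_comm]
    _ = ∫ r, (∫ x : ℝ, cexp (-(I * (x * a r))) * (gammaKer s z x * M r)) ∂μ :=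
        integral_integral_swap hi
    _ = _ := by
        refine integral_ext fun r => ?_
        simp only [← integral_const_mul]
        refine integral_ext fun x => ?_
        simp only [gammaKer_add]
        rw [show (-(2 * I * a r) * (x / 2 : ℝ) : ℂ) = -(I * (x * a r)) by push_cast; ring]
        ring

/-- With a damping factor, the limit of vanishing power weight. -/
lemma integral_gammaKer_zero_mul (ha : Measurable a) (ha0 : ∀ᵐ r ∂μ, a r ≠ 0) {N M : X → ℂ}
    (hN : Integrable N μ) (hM : ∀ r, M r = (cexp (I * a r) - 1) * N r) (hMi : Integrable M μ)
    (hC : Integrable fun x : ℝ => ∫ r, cexp (-(I * (x * a r))) * M r ∂μ) {z : ℂ} (hz : 0 < z.re) :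
    ∫ x, gammaKer 0 z x * (∫ r, cexp (-(I * (x * a r))) * M r ∂μ) =
      ∫ r, M r * (2 * (z⁻¹ ^ (-(2 * I * a r)) * Gamma (-(2 * I * a r)))) ∂μ := by
  set C : ℝ → ℂ := fun x => ∫ r, cexp (-(I * (x * a r))) * M r ∂μ with hCd
  have hev : ∀ᶠ d : ℝ in 𝓝[>] 0, d ∈ Set.Ioc (0 : ℝ) 1 := Ioc_mem_nhdsGT one_pos
  have hre : ∀ d b : ℝ, ((d : ℂ) + -(2 * I * b)).re = d := fun d b => by simp
  set J : ℝ → ℝ → ℂ := fun d b => ∫ x, gammaKer (d + -(2 * I * b)) z x with hJ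
  have hJe : ∀ d : ℝ, 0 < d → ∀ b, J d b = 2 * (z⁻¹ ^ ((d : ℂ) + -(2 * I * b)) *
      Gamma (d + -(2 * I * b))) := fun d hd b => integral_gammaKer (by rwa [hre]) hz
  have hz0 : z⁻¹ ≠ 0 := inv_ne_zero fun h => by simp [h] at hz
  have hJm : ∀ d, Measurable (J d) := fun d =>
    (StronglyMeasurable.integral_prod_right (f := fun b x : ℝ => gammaKer (d + -(2 * I * b)) z x)
      (Continuous.stronglyMeasurable (by unfold Function.uncurry gammaKer; fun_prop))).measurable
  -- `s ∫ v^s e^{-zv} dv/v = z ∫ v^{s+1} e^{-zv} dv/v` controls the pole at `s = 0`.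
  set B : ℝ := ‖z‖ * ∫ x, (‖gammaKer 1 z x‖ + ‖gammaKer 2 z x‖) with hB
  have hB0 : 0 ≤ B := by positivity
  have i1 := integrable_gammaKer (s := 1) (z := z) (by simp) hz
  have i2 := integrable_gammaKer (s := 2) (z := z) (by simp) hz
  have hJb : ∀ d : ℝ, d ∈ Set.Ioc (0 : ℝ) 1 → ∀ b : ℝ, |b| * ‖J d b‖ ≤ B := fun d hd b => by
    have hs : 0 < ((d : ℂ) + -(2 * I * b)).re := by rw [hre]; exact hd.1
    have h := congrArg norm (integral_gammaKer_succ hs hz)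
    rw [norm_mul, norm_mul] at h
    have hb : |b| ≤ ‖(d : ℂ) + -(2 * I * b)‖ := by
      refine le_trans ?_ (Complex.abs_im_le_norm _)
      have : ((d : ℂ) + -(2 * I * b)).im = -(2 * b) := by simp
      rw [this, abs_neg, abs_mul, abs_two]; linarith [abs_nonneg b]
    refine (mul_le_mul_of_nonneg_right hb (norm_nonneg _)).trans (h.symm.le.trans ?_)
    refine mul_le_mul_of_nonneg_left ((norm_integral_le_integral_norm _).trans ?_) (norm_nonneg _)
    refine integral_mono (integrable_gammaKer (by rw [add_re, hre]; simp; linarith [hd.1]) hz).norm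
      (i1.norm.add i2.norm) fun x => ?_
    simp only [norm_gammaKer, add_re, hre, Complex.one_re, Complex.re_ofNat]
    rcases le_total x 0 with hx | hx
    · refine le_add_of_le_of_nonneg (exp_le_exp.2 ?_) (exp_pos _).le
      nlinarith [hd.1]
    · refine le_add_of_nonneg_of_le (exp_pos _).le (exp_le_exp.2 ?_)
      nlinarith [hd.2]
  have hL : Tendsto (fun d : ℝ => ∫ x, gammaKer d z x * C x) (𝓝[>] 0) (𝓝 (∫ x, gammaKer 0 z x * C x)) := by
    refine tendsto_integral_filter_of_dominated_convergence (fun x => (1 + z.re⁻¹) * ‖C x‖)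
      (.of_forall fun d => (continuous_gammaKer _ _).aestronglyMeasurable.mul hC.aestronglyMeasurable) ?_
      (hC.norm.const_mul _) (.of_forall fun x => ?_)
    · filter_upwards [hev] with d hd
      refine .of_forall fun x => ?_
      rw [norm_mul, norm_gammaKer]
      refine mul_le_mul_of_nonneg_right ?_ (norm_nonneg _)
      rw [Complex.ofReal_re, Real.exp_sub, div_le_iff₀ (exp_pos _)]
      have hp := exp_pos (x / 2)
      have hi0 : 0 < z.re⁻¹ := inv_pos.2 hz
      calc exp (d * (x / 2)) ≤ 1 + exp (x / 2) := by
            rcases le_total x 0 with hx | hx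
            · linarith [Real.exp_le_one_iff.2 (show d * (x / 2) ≤ 0 by nlinarith [hd.1])]
            · linarith [exp_le_exp.2 (show d * (x / 2) ≤ x / 2 by nlinarith [hd.2])]
        _ ≤ 1 + exp (x / 2) + (z.re⁻¹ + z.re * exp (x / 2)) :=
            le_add_of_nonneg_right (by positivity)
        _ = (1 + z.re⁻¹) * (z.re * exp (x / 2) + 1) := by field_simp; ring
        _ ≤ _ := by gcongr; exact Real.add_one_le_exp _
    · refine (Tendsto.mul_const _ ?_)
      have : Continuous fun d : ℝ => gammaKer d z x := by unfold gammaKer; fun_prop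
      simpa using (this.tendsto 0).mono_left nhdsWithin_le_nhds
  have hR : Tendsto (fun d : ℝ => ∫ r, M r * J d (a r) ∂μ) (𝓝[>] 0) (𝓝 (∫ r, M r *
      (2 * (z⁻¹ ^ (-(2 * I * a r)) * Gamma (-(2 * I * a r)))) ∂μ)) := by
    refine tendsto_integral_filter_of_dominated_convergence (fun r => B * ‖N r‖) ?_ ?_
      (hN.norm.const_mul _) ?_
    · exact .of_forall fun d => hMi.1.mul ((hJm d).comp ha).aestronglyMeasurable
    · filter_upwards [hev] with d hd
      refine .of_forall fun r => ?_
      rw [hM, norm_mul, norm_mul, mul_right_comm]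
      refine mul_le_mul_of_nonneg_right (le_trans ?_ (hJb d hd (a r))) (norm_nonneg _)
      exact mul_le_mul_of_nonneg_right (norm_exp_sub_one_le _) (norm_nonneg _)
    · filter_upwards [ha0] with r hr
      refine Tendsto.const_mul _ ?_
      have hd0 : Tendsto (fun d : ℝ => (d : ℂ) + -(2 * I * a r)) (𝓝[>] 0) (𝓝 (-(2 * I * a r))) := by
        have : Continuous fun d : ℝ => (d : ℂ) + -(2 * I * a r) := by fun_prop
        simpa using (this.tendsto 0).mono_left nhdsWithin_le_nhds
      have hg : DifferentiableAt ℂ Gamma (-(2 * I * a r)) :=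
        Complex.differentiableAt_Gamma _ fun k hk => by
          have := congrArg im hk
          simp at this
          exact hr this
      refine Tendsto.congr' ?_ ((((continuousAt_const_cpow hz0).tendsto.comp hd0).mul
        (hg.continuousAt.tendsto.comp hd0)).const_mul 2)
      filter_upwards [hev] with d hd
      exact (hJe d hd.1 _).symm
  refine tendsto_nhds_unique hL (hR.congr' ?_)
  filter_upwards [hev] with d hd
  exact (integral_gammaKer_mul_charFun ha hMi (s := (d : ℂ)) (by simpa using hd.1) hz).symm

/-- The one-dimensional case of the theorem: `2 cos (2π e^{x/2})` has, as a Fourier transform, twice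
the symbol, when tested on functions which are differences of translates. -/
theorem integral_chr_mul_charFun (ha : Measurable a) (ha0 : ∀ᵐ r ∂μ, a r ≠ 0) {N M : X → ℂ}
    (hN : Integrable N μ) (hM : ∀ r, M r = (cexp (I * a r) - 1) * N r) (hMi : Integrable M μ)
    (hC : Integrable fun x : ℝ => ∫ r, cexp (-(I * (x * a r))) * M r ∂μ) :
    ∫ x : ℝ, (chr (exp (x / 2)) + chr (-exp (x / 2))) *
      (∫ r, cexp (-(I * (x * a r))) * M r ∂μ) = 2 * ∫ r, gammaSymbol (a r) * M r ∂μ := by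
  obtain ⟨K, hK⟩ := exists_norm_gammaSymbol_mul_le
  set C : ℝ → ℂ := fun x => ∫ r, cexp (-(I * (x * a r))) * M r ∂μ with hCd
  have bd : ∀ r, a r ≠ 0 → ∀ z : ℂ, z ≠ 0 → 0 ≤ z.re →
      ‖M r * (2 * (z⁻¹ ^ (-(2 * I * a r)) * Gamma (-(2 * I * a r))))‖ ≤ 2 * K * ‖N r‖ := by
    intro r hr z hz0 hz
    have h3 := hK (a r)
    rw [norm_mul, ← norm_exp_sub_one_eq] at h3
    rw [hM, norm_mul, norm_mul, norm_mul, norm_mul, Complex.norm_two]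
    calc _ ≤ ‖cexp (I * a r) - 1‖ * ‖N r‖ * (2 * ‖gammaSymbol (a r)‖) := by
          gcongr
          exact (mul_le_mul_of_nonneg_right (norm_inv_cpow_le hz0 hz (a r))
            (norm_nonneg _)).trans (exp_mul_norm_Gamma_le hr)
      _ = 2 * (‖gammaSymbol (a r)‖ * ‖cexp (I * a r) - 1‖) * ‖N r‖ := by ring
      _ ≤ _ := by gcongr
  -- the two boundary values of `e^{-zv}` at `z = ∓ 2πi`
  have key : ∀ ε : ℝ, (ε = 1 ∨ ε = -1) → ∫ x : ℝ, chr (ε * exp (x / 2)) * C x =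
      ∫ r, M r * (2 * ((((-ε * (2 * π) : ℝ) : ℂ) * I)⁻¹ ^ (-(2 * I * a r)) *
        Gamma (-(2 * I * a r)))) ∂μ ∧
      Integrable (fun r => M r * (2 * ((((-ε * (2 * π) : ℝ) : ℂ) * I)⁻¹ ^ (-(2 * I * a r)) *
        Gamma (-(2 * I * a r))))) μ := by
    intro ε hε
    set z : ℝ → ℂ := fun δ => (δ : ℂ) + ((-ε * (2 * π) : ℝ) : ℂ) * I with hzd
    have hzr : ∀ δ, (z δ).re = δ := fun δ => by simp [hzd]
    have hz0 : ((-ε * (2 * π) : ℝ) : ℂ) * I = z 0 := by simp [hzd]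
    have hzne : ∀ δ, z δ ≠ 0 := fun δ h => by
      have := congrArg im h
      rcases hε with rfl | rfl <;> simp [hzd, pi_ne_zero] at this
    rw [hz0]
    have hzt : Tendsto z (𝓝[>] 0) (𝓝 (z 0)) :=
      ((by fun_prop : Continuous z).tendsto 0).mono_left nhdsWithin_le_nhds
    have hpos : ∀ᶠ δ : ℝ in 𝓝[>] 0, 0 < δ := self_mem_nhdsWithin
    set T : ℝ → X → ℂ := fun δ r => M r * (2 * ((z δ)⁻¹ ^ (-(2 * I * a r)) *
      Gamma (-(2 * I * a r)))) with hT
    have hTm : ∀ δ, AEStronglyMeasurable (T δ) μ := fun δ =>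
      hMi.1.mul (Measurable.aestronglyMeasurable (by fun_prop))
    have hbd : ∀ δ, 0 ≤ δ → ∀ᵐ r ∂μ, ‖T δ r‖ ≤ 2 * K * ‖N r‖ := fun δ hδ =>
      ha0.mono fun r hr => bd r hr _ (hzne δ) (by rwa [hzr])
    have hlim : ∀ r, Tendsto (fun δ => T δ r) (𝓝[>] 0) (𝓝 (T 0 r)) := fun r => by
      refine Tendsto.const_mul _ (Tendsto.const_mul _ (Tendsto.mul_const _ ?_))
      refine ((continuousAt_cpow_const ?_).tendsto).comp (hzt.inv₀ (hzne 0))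
      rw [Complex.mem_slitPlane_iff, ← hz0]; right
      rcases hε with rfl | rfl <;> simp [pi_ne_zero]
    have hR := tendsto_integral_filter_of_dominated_convergence _ (.of_forall hTm)
      (hpos.mono fun δ hδ => hbd δ hδ.le) (hN.norm.const_mul (2 * K)) (.of_forall hlim)
    have hL : Tendsto (fun δ => ∫ x, gammaKer 0 (z δ) x * C x) (𝓝[>] 0)
        (𝓝 (∫ x : ℝ, chr (ε * exp (x / 2)) * C x)) := by
      refine tendsto_integral_filter_of_dominated_convergence (fun x => ‖C x‖)
        (.of_forall fun d => (continuous_gammaKer _ _).aestronglyMeasurable.mul hC.1)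
        (hpos.mono fun δ hδ => .of_forall fun x => ?_) hC.norm
        (.of_forall fun x => Tendsto.mul_const _ ?_)
      · rw [norm_mul, norm_gammaKer, hzr, Complex.zero_re, zero_mul, zero_sub]
        exact mul_le_of_le_one_left (norm_nonneg _)
          (Real.exp_le_one_iff.2 (neg_nonpos.2 (mul_pos hδ (exp_pos _)).le))
      · have hc : Continuous fun w : ℂ => gammaKer 0 w x := by unfold gammaKer; fun_prop
        have h := (hc.tendsto (z 0)).comp hzt
        have e : gammaKer 0 (z 0) x = chr (ε * exp (x / 2)) := by
          rw [gammaKer, chr, ← hz0]; congr 1; push_cast; ring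
        rwa [e] at h
    exact ⟨tendsto_nhds_unique hL (hR.congr' (hpos.mono fun δ hδ =>
      (integral_gammaKer_zero_mul ha ha0 hN hM hMi hC (z := z δ) (by rwa [hzr])).symm)),
      (hN.norm.const_mul (2 * K)).mono' (hTm 0) (hbd 0 le_rfl)⟩
  obtain ⟨k1, j1⟩ := key 1 (Or.inl rfl)
  obtain ⟨k2, j2⟩ := key (-1) (Or.inr rfl)
  have hb : ∀ ε : ℝ, Integrable fun x : ℝ => chr (ε * exp (x / 2)) * C x := fun ε =>
    hC.bdd_mul (c := 1) (Continuous.aestronglyMeasurable (by fun_prop)) (.of_forall fun x => (norm_chr _).le)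
  have e : ∀ x : ℝ, (chr (exp (x / 2)) + chr (-exp (x / 2))) * C x =
      chr (1 * exp (x / 2)) * C x + chr (-1 * exp (x / 2)) * C x := fun x => by
    rw [one_mul, neg_one_mul]; ring
  change ∫ x : ℝ, (chr (exp (x / 2)) + chr (-exp (x / 2))) * C x = _
  simp only [e]
  rw [integral_add (hb 1) (hb (-1)), k1, k2, ← integral_add j1 j2, ← integral_const_mul]
  refine integral_ext_ae ha0 fun r hr => ?_
  rw [inv_cpow_eq _ _ (Or.inl rfl), inv_cpow_eq _ _ (Or.inr rfl), gammaSymbol_eq hr]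
  push_cast; ring_nf

end Mellin

/-! ### Ray coordinates and scales -/

section RayLink
variable {m : ℕ}

/-- In ray coordinates, with the difference variable `x = 2 (τ - s)` in place of the scale `s`. -/
def rayScale (r : ℝ × (RaySpace m × ℝ)) : ℝ × Chart m := (r.2.2 - r.1 / 2, rayPoint r.2)

lemma isWeightedMap_rayScale : IsWeightedMap
    ((volume : Measure ℝ).prod (rayVol m)) (volume.prod volume)
    (rayScale (m := m)) (fun p => (2 * ((rayCoord p.2).2 - p.1), rayCoord p.2))
    (fun r => exp ((m + 1 : ℕ) * r.2.2 / 2) * (sqrt 2)⁻¹) where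
  measT := by unfold rayScale; fun_prop
  measS := by have := measurable_rayCoord (m := m); fun_prop
  measρ := by fun_prop
  pos r := by positivity
  left_inv := by
    filter_upwards [ae_prod_snd isWeightedMap_ray.left_inv] with r hr
    ext1
    · simp only [rayScale, hr]; ring
    · exact hr
  map_eq := by
    refine Measure.ext_of_lintegral _ fun f hf => ?_
    have hT : Measurable (rayScale (m := m)) := by unfold rayScale; fun_prop
    have hfT : Measurable fun r => f (rayScale (m := m) r) := hf.comp hT
    have hρ : Measurable fun r : ℝ × (RaySpace m × ℝ) =>
      ofReal ((exp ((m + 1 : ℕ) * r.2.2 / 2) * (sqrt 2)⁻¹) ^ 2) := by fun_prop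
    rw [lintegral_map hf hT]
    refine (lintegral_withDensity_eq_lintegral_mul _ hρ hfT).trans ?_
    have hm : Measurable fun r : ℝ × (RaySpace m × ℝ) =>
        ofReal (exp ((m + 1 : ℕ) * r.2.2 / 2) ^ 2) * f (r.1, rayPoint r.2) :=
      by fun_prop
    rw [lintegral_prod_symm _ (hρ.mul hfT).aemeasurable, lintegral_prod _ hf.aemeasurable]
    have hr : ∀ s : ℝ, ∫⁻ p, f (s, p) = ∫⁻ r, ofReal (exp ((m + 1 : ℕ) * r.2 / 2) ^ 2) *
        f (s, rayPoint r) ∂(rayVol m) := fun s =>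
      isWeightedMap_ray.lintegral_eq (fun p => f (s, p)) (hf.comp measurable_prodMk_left).aemeasurable
    simp only [hr]
    refine Eq.trans ?_ (lintegral_lintegral_swap (f := fun s r =>
      ofReal (exp ((m + 1 : ℕ) * r.2 / 2) ^ 2) * f (s, rayPoint r)) hm.aemeasurable).symm
    refine lintegral_congr fun r => ?_
    have h3 : ∫⁻ x : ℝ, f (r.2 - x / 2, rayPoint r) = 2 * ∫⁻ s : ℝ, f (s, rayPoint r) := by
      rw [← lintegral_add_left_eq_self (fun s : ℝ => f (s, rayPoint r)) r.2,
        lintegral_comp_mul (t := -(1 / 2)) (by norm_num) fun s => f (r.2 + s, rayPoint r), ← mul_assoc,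
        show (2 : ENNReal) = ofReal 2 by simp, ← ofReal_mul zero_le_two]
      norm_num [neg_div, sub_eq_add_neg, div_eq_inv_mul]
    simp only [Pi.mul_apply, mul_pow, rayScale]
    rw [lintegral_const_mul' _ _ (by simp), lintegral_const_mul' _ _ (by simp), h3,
      inv_pow, sq_sqrt zero_le_two, ofReal_mul (by positivity), mul_assoc, ← mul_assoc _ 2]
    congr 1
    rw [show (2 : ENNReal) = ofReal 2 by simp, ← ofReal_mul (by norm_num)]
    norm_num

/-- A function on phase space in ray coordinates, with the half-density factor. -/
def rayFun (f : Chart m → ℂ) (r : RaySpace m × ℝ) : ℂ :=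
  (exp ((m + 1 : ℕ) * r.2 / 2) : ℂ) * f (rayPoint r)

lemma rayPoint_reflect (o : RaySpace m) (τ x : ℝ) :
    ((rayPoint (o, τ)).1, -(exp (-(2 * (τ - x / 2)))) • (rayPoint (o, τ)).2) =
      rayPoint ((o.1, !o.2), x - τ) := by
  simp only [rayPoint, boolSign_not, smul_smul]
  congr 2
  have : exp (x - τ) = exp (-(2 * (τ - x / 2))) * exp τ := by rw [← exp_add]; ring_nf
  rw [this]; ring

lemma mul_scaledF_rayScale (f F : Chart m → ℂ) (x : ℝ) (r : RaySpace m × ℝ) :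
    (exp ((m + 1 : ℕ) * r.2 / 2) : ℂ) ^ 2 * (f (rayPoint r) * scaledF F (r.2 - x / 2) (rayPoint r)) =
      rayFun f r * rayFun F ((r.1.1, !r.1.2), x - r.2) := by
  have e : exp ((m + 1 : ℕ) * (x - r.2) / 2) =
      exp ((m + 1 : ℕ) * r.2 / 2) * exp (-((m + 1 : ℕ) * (r.2 - x / 2))) := by
    rw [← exp_add]; ring_nf
  rw [scaledF, rayFun, rayFun, ← rayPoint_reflect, e]
  push_cast; ring

lemma integrable_rayFun_mul {f F : Chart m → ℂ} (hf : IsWeightedL2 f)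
    (hF : IsWeightedL2 F) : Integrable (fun r : ℝ × (RaySpace m × ℝ) =>
      rayFun f r.2 * rayFun F ((r.2.1.1, !r.2.1.2), r.1 - r.2.2))
      (volume.prod (rayVol m)) := by
  have hi := integrable_mul_scaledF hf hF
  refine (((isWeightedMap_rayScale.integrable_iff hi.1).1 hi).const_mul 2).congr
    (.of_forall fun r => ?_)
  simp only [rayScale, mul_pow, inv_pow, sq_sqrt zero_le_two]
  rw [← mul_scaledF_rayScale f F r.1 r.2]
  push_cast; ring

theorem integral_linkIntegrand_zero {f F : Chart m → ℂ} (hf : IsWeightedL2 f)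
    (hF : IsWeightedL2 F) : 2 * ∫ r, linkIntegrand 0 f F r ∂(volume.prod volume) =
      ∫ x : ℝ, (chr (exp (x / 2)) + chr (-exp (x / 2))) *
        (∫ r, rayFun f r * rayFun F ((r.1.1, !r.1.2), x - r.2) ∂(rayVol m)) := by
  have hi := integrable_rayFun_mul hf hF
  rw [isWeightedMap_rayScale.integral_eq (integrable_linkIntegrand hf hF 0).aestronglyMeasurable,
    ← integral_const_mul]
  have hi2 := hi.bdd_mul (c := 2) (f := fun r => chr (exp (r.1 / 2)) + chr (-exp (r.1 / 2)))
    (Continuous.aestronglyMeasurable (by fun_prop)) (.of_forall fun r => by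
      refine (norm_add_le _ _).trans ?_; rw [norm_chr, norm_chr]; norm_num)
  simp only [← integral_const_mul]
  rw [← integral_prod _ hi2]
  refine integral_ext_ae (ae_prod_snd (ae_prod_fst ae_rayDen_ne_zero)) fun r hr => ?_
  have e : oscPair (boolSign r.2.1.2 * exp r.2.2) 0 (r.2.2 - r.1 / 2) =
      chr (exp (r.1 / 2)) + chr (-exp (r.1 / 2)) := by
    have h1 : exp r.2.2 * exp (-(r.2.2 - r.1 / 2)) = exp (r.1 / 2) := by rw [← exp_add]; ring_nf
    rw [oscPair, osc_eq_chr, osc_eq_chr, neg_mul, mul_assoc, h1]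
    cases r.2.1.2 <;> simp [add_comm]
  rw [← mul_scaledF_rayScale f F r.1 r.2, linkIntegrand, rayScale]
  simp only [inner_rayPoint hr, e, mul_pow, inv_pow, sq_sqrt zero_le_two]
  push_cast; ring

end RayLink

/-! ### The integral operator on the vectors `(U - 1) (a ⊗ b)` -/

section Agreement
variable {m : ℕ}

/-- `(U - 1) b`, where `U b (η) = e^{n/2} b (e η)`. -/
def stepDilate {n : ℕ} (b : 𝓢(Eu n, ℂ)) : 𝓢(Eu n, ℂ) :=
  (exp (n / 2) : ℂ) • SchwartzMap.compCLMOfContinuousLinearEquiv ℂ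
    (ContinuousLinearEquiv.smulLeft (Units.mk0 (exp 1) (exp_ne_zero 1))) b - b

lemma stepDilate_apply {n : ℕ} (b : 𝓢(Eu n, ℂ)) (x : Eu n) :
    stepDilate b x = (exp (n / 2) : ℂ) * b (exp 1 • x) - b x := rfl

/-- The square integrable function `a ⊗ b`. -/
def schwartzVec {n : ℕ} (a b : 𝓢(Eu n, ℂ)) : L2Sigma n := tensor (a.toLp 2) (b.toLp 2)

lemma schwartzVec_coe {n : ℕ} (a b : 𝓢(Eu n, ℂ)) :
    schwartzVec a b =ᵐ[volume] fun p => a p.1 * b p.2 := tensor_schwartz_coe a b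

lemma schwartzVec_stepDilate (a b : 𝓢(Eu (m + 1), ℂ)) : schwartzVec a (stepDilate b) =
      dilate (m + 1) (exp 1) (exp_ne_zero _) (schwartzVec a b) -
        schwartzVec a b := by
  refine Lp.ext ?_
  filter_upwards [schwartzVec_coe a (stepDilate b), Lp.coeFn_sub (dilate (m + 1) (exp 1)
    (exp_ne_zero _) (schwartzVec a b)) (schwartzVec a b),
    dilate_coe (exp_ne_zero 1) (schwartzVec_coe a b), schwartzVec_coe a b] with p h1 h2 h3 h4
  rw [h1, h2, Pi.sub_apply, h3, h4, stepDilate_apply, sqrt_exp_pow, mul_one]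
  ring

lemma spectralU_stepDilate (a b : 𝓢(Eu (m + 1), ℂ)) :
    spectralU m (schwartzVec a (stepDilate b)) =ᵐ[rayVol m] fun r =>
      (cexp (-(I * freq r)) - 1) * spectralU m (schwartzVec a b) r := by
  rw [schwartzVec_stepDilate, map_sub]
  filter_upwards [Lp.coeFn_sub (spectralU m (dilate (m + 1) (exp 1) (exp_ne_zero _)
    (schwartzVec a b))) (spectralU m (schwartzVec a b)), spectralU_dilate_exp 1 (schwartzVec a b)] with r h1 h2
  rw [h1, Pi.sub_apply, h2, Complex.ofReal_one, one_mul, sub_mul, one_mul]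

lemma conj_fourier_ofReal {n : ℕ} {a : Eu n → ℂ} (ha : ∀ x, conj (a x) = a x) (ζ : Eu n) :
    conj (𝓕 a ζ) = 𝓕⁻ a ζ ∧ conj (𝓕⁻ a ζ) = 𝓕 a ζ := by
  constructor <;> rw [fourier_eq_exp, fourierInv_eq_exp, ← integral_conj] <;>
    refine integral_ext fun v => ?_ <;> simp [ha, ← exp_conj, map_ofNat]

lemma sympI_tensor (a b : 𝓢(Eu (m + 1), ℂ)) :
    sympI (fun q => a q.1 * b q.2) = fun p : Chart m => 𝓕 a p.1 * 𝓕⁻ b p.2 := by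
  funext p
  rw [sympI, integral_conj_sympChar_tensor, SchwartzMap.fourier_coe, SchwartzMap.fourierInv_coe]

lemma isWeightedL2_sympI_tensor (a b : 𝓢(Eu (m + 1), ℂ)) :
    IsWeightedL2 (sympI fun q : Chart m => a q.1 * b q.2) := by
  rw [sympI_tensor]; exact isWeightedL2_tensor _ _

lemma rayU_sympF_tensor (a b : 𝓢(Eu (m + 1), ℂ)) :
    rayU m (sympF (m + 1) (schwartzVec a b)) =ᵐ[rayVol m]
      rayFun fun p => 𝓕 a p.1 * 𝓕⁻ b p.2 := by
  have h : sympF (m + 1) (schwartzVec a b) = schwartzVec (𝓕 a) (𝓕⁻ b) := sympF_tensor a b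
  rw [h]
  exact rayU_coe (schwartzVec_coe _ _)

/-- The correlations of `linkIntegrand` as Fourier transforms of products of spectral
representatives. -/
lemma integral_rayFun_mul {a b a' b' : 𝓢(Eu (m + 1), ℂ)} (ha : ∀ x, conj (a x) = a x)
    (hb : ∀ x, conj (b x) = b x) (x : ℝ) :
    ∫ r, rayFun (fun p => 𝓕⁻ a p.1 * 𝓕 b p.2) r * rayFun (fun p => 𝓕 a' p.1 * 𝓕⁻ b' p.2)
      ((r.1.1, !r.1.2), x - r.2) ∂(rayVol m) = ∫ r, cexp (-(I * (x * freq r))) *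
      (conj (spectralU m (schwartzVec a b) r) *
        spectralU m (schwartzVec a' b') (oppo r)) ∂(rayVol m) := by
  set F := rayU m (sympF (m + 1) (schwartzVec a b)) with hF
  set F' := rayU m (sympF (m + 1) (schwartzVec a' b')) with hF'
  have h1 : ∫ r, rayFun (fun p => 𝓕⁻ a p.1 * 𝓕 b p.2) r * rayFun (fun p => 𝓕 a' p.1 * 𝓕⁻ b' p.2)
      ((r.1.1, !r.1.2), x - r.2) ∂(rayVol m) =
      ⟪F, flipU m (shiftU (rayMeasure m) x (reflectU (rayMeasure m) F'))⟫_ℂ := by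
    rw [L2.inner_def]
    refine integral_congr_ae ?_
    filter_upwards [rayU_sympF_tensor a b, flipU_coe (shiftU_coe x (reflectU_coe
      (rayU_sympF_tensor a' b')))] with r h1 h2
    rw [inner_apply, h1, h2, mul_comm]
    congr 1
    · rw [neg_sub]
    · simp only [rayFun, map_mul, conj_ofReal, SchwartzMap.fourier_coe, SchwartzMap.fourierInv_coe,
        (conj_fourier_ofReal ha _).1, (conj_fourier_ofReal hb _).2]
  rw [h1, ← (partialF (rayMeasure m)).inner_map_map, partialF_flip, L2.inner_def]
  refine integral_congr_ae ?_
  have h2 := partialF_shift x (reflectU (rayMeasure m) F')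
  rw [partialF_reflect] at h2
  have h3 := reflectU_coe (Filter.EventuallyEq.refl _ (partialF (rayMeasure m) F'))
  filter_upwards [flipU_coe (h2.trans (h3.mono fun r hr => congrArg _ hr))] with r hr
  rw [inner_apply, hr, spectralU_apply, spectralU_apply, mul_comm _ (conj _), mul_left_comm]
  rfl

theorem integral_thetaLim_stepDilate {a b : 𝓢(Eu (m + 1), ℂ)} (ha : ∀ x, conj (a x) = a x)
    (hb : ∀ x, conj (b x) = b x) (a' b' : 𝓢(Eu (m + 1), ℂ)) {v : L2Sigma (m + 1)}
    (hv : (schwartzVec a' (stepDilate b'), v) ∈ (hOp m).graph) :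
    ∫ p : Chart m, thetaLim (fun q => a' q.1 * stepDilate b' q.2) (sigmaPoint p) *
      (a p.1 * b p.2) = ∫ p, v p * (a p.1 * b p.2) := by
  set φ := spectralU m (schwartzVec a b) with hφ
  set φ₀ := spectralU m (schwartzVec a' b') with hφ₀
  set φ₁ := spectralU m (schwartzVec a' (stepDilate b')) with hφ₁
  have hop : ∀ F : Lp ℂ 2 (rayVol m),
      Integrable (fun r => conj (φ r) * F (oppo r)) (rayVol m) := fun F => by
    refine (integrable_mul_conj_of_ae_eq (.refl _ φ) (flipU_coe (reflectU_coe (.refl _ F)))).congr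
      (.of_forall fun r => ?_)
    exact mul_comm _ _
  have hrel : ∀ᵐ r ∂(rayVol m),
      φ₁ (oppo r) = (cexp (I * freq r) - 1) * φ₀ (oppo r) := by
    filter_upwards [measurePreserving_oppo.quasiMeasurePreserving.ae
      (spectralU_stepDilate a' b')] with r hr
    rw [hφ₁, hr, freq_oppo, Complex.ofReal_neg, mul_neg, neg_neg]
  set N : RaySpace m × ℝ → ℂ := fun r => conj (φ r) * φ₀ (oppo r) with hN
  set M : RaySpace m × ℝ → ℂ := fun r => (cexp (I * freq r) - 1) * N r with hM
  have hMe : (fun r => conj (φ r) * φ₁ (oppo r)) =ᵐ[rayVol m] M :=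
    hrel.mono fun r hr => by simp only [hr, hM, hN]; ring
  have hMi : Integrable M (rayVol m) := (hop φ₁).congr hMe
  have hw1 := isWeightedL2_tensor (𝓕⁻ a) (𝓕 b)
  have hw2 := isWeightedL2_tensor (𝓕 a') (𝓕⁻ (stepDilate b'))
  have hCe : ∀ x : ℝ, ∫ r, rayFun (fun p => 𝓕⁻ a p.1 * 𝓕 b p.2) r * rayFun (fun p => 𝓕 a' p.1 *
      𝓕⁻ (stepDilate b') p.2) ((r.1.1, !r.1.2), x - r.2) ∂(rayVol m) =
      ∫ r, cexp (-(I * (x * freq r))) * M r ∂(rayVol m) := fun x => by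
    rw [integral_rayFun_mul ha hb]
    exact integral_ext_ae hMe fun r hr => by rw [← hr]
  have hC := (integrable_rayFun_mul hw1 hw2).integral_prod_left
  simp only [hCe] at hC
  have hf0 : ∀ᵐ r ∂(rayVol m), freq r ≠ 0 :=
    (ae_exp_freq_ne_one (rayMeasure m)).mono fun r hr h => hr (by simp [h])
  have key := integral_chr_mul_charFun measurable_freq hf0 (hop φ₀) (M := M) (fun r => rfl) hMi hC
  have hlink := integral_linkIntegrand_zero hw1 hw2
  simp only [hCe] at hlink
  have e1 := integral_thetaLim_offCone (isRapid_tensor a' (stepDilate b'))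
    (isWeightedL2_sympI_tensor _ _) a b 0
  simp only [offCone_zero] at e1
  rw [sympI_tensor] at e1
  rw [e1, mul_left_cancel₀ two_ne_zero (hlink.trans key)]
  have e2 : ∫ p, v p * (a p.1 * b p.2) = ⟪schwartzVec a b, v⟫_ℂ := by
    simp only [inner_eq_integral (schwartzVec_coe a b) (.refl _ v), map_mul, ha, hb]
  rw [e2, ← (spectralU m).inner_map_map, L2.inner_def]
  refine integral_congr_ae ?_
  filter_upwards [(mem_hOp_graph_oppo _ _).1 hv, hMe] with r h1 h2
  rw [inner_apply, h1, ← h2]; ring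

lemma integrable_mul_of_memLp_restrict {n : ℕ} {R χ : Eu² n → ℂ}
    (hR : MemLp R 2 (volume.restrict (tsupport χ))) (hc : Continuous χ) (hs : HasCompactSupport χ) :
    Integrable (fun p => R p * χ p) volume := by
  have h := hR.integrable_mul ((hc.memLp_of_hasCompactSupport (μ := volume) (p := 2) hs).restrict (tsupport χ))
  refine (integrableOn_iff_integrable_of_support_subset fun p hp => ?_).1 h
  exact subset_tsupport _ (right_ne_zero_of_mul (Function.mem_support.1 hp))

lemma hasCompactSupport_tensor {n : ℕ} {c d : Eu n → ℝ} (hc : HasCompactSupport c)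
    (hd : HasCompactSupport d) : HasCompactSupport fun p : Eu² n => (c p.1 : ℂ) * d p.2 := by
  refine HasCompactSupport.intro (hc.isCompact.prod hd.isCompact) fun p hp => ?_
  by_cases h : p.1 ∈ tsupport c
  · rw [image_eq_zero_of_notMem_tsupport (f := d) fun h' => hp ⟨h, h'⟩, ofReal_zero, mul_zero]
  · rw [image_eq_zero_of_notMem_tsupport h, ofReal_zero, zero_mul]

lemma integrable_mul_tensor {n : ℕ} {R : Eu² n → ℂ}
    (hR : ∀ K, IsCompact K → MemLp R 2 (volume.restrict K)) {c d : Eu n → ℝ} (hc : Continuous c)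
    (hd : Continuous d) (hcs : HasCompactSupport c) (hds : HasCompactSupport d) :
    Integrable (fun p => R p * ((c p.1 : ℂ) * d p.2)) volume :=
  integrable_mul_of_memLp_restrict (hR _ (hasCompactSupport_tensor hcs hds)) (by fun_prop)
    (hasCompactSupport_tensor hcs hds)

/-- On the test vectors `(U - 1) (a ⊗ b)`, the integral definition of `𝓗` and the spectral one
agree. -/
theorem thetaLim_ae_eq_hOp (a b : 𝓢(Eu (m + 1), ℂ)) {v : L2Sigma (m + 1)}
    (hv : (schwartzVec a (stepDilate b), v) ∈ (hOp m).graph) :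
    (fun p => thetaLim (fun q => a q.1 * stepDilate b q.2) (sigmaPoint p)) =ᵐ[volume] v := by
  have hu := (isRapid_tensor a (stepDilate b)).isChartDecaying
  have h := ae_eq_zero_of_tensor_test (E := Eu (m + 1)) (E' := Eu (m + 1)) (R := fun p =>
    thetaLim (fun q => a q.1 * stepDilate b q.2) (sigmaPoint p) - v p)
    (fun K hK => (memLp_thetaLim_sigmaPoint hu hK).sub ((Lp.memLp v).restrict K)) ?_
  · exact h.mono fun p hp => sub_eq_zero.1 hp
  · intro c d hc hcs hd hds
    have e := integral_thetaLim_stepDilate (a := schwartzOfReal hc hcs) (b := schwartzOfReal hd hds)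
      (fun x => conj_ofReal _) (fun x => conj_ofReal _) a b hv
    simp only [schwartzOfReal_apply] at e
    simp only [sub_mul]
    rw [integral_sub (integrable_mul_tensor (fun K => memLp_thetaLim_sigmaPoint hu) hc.continuous
      hd.continuous hcs hds) (integrable_mul_tensor (fun K _ => (Lp.memLp v).restrict K) hc.continuous
      hd.continuous hcs hds), e, sub_self]

end Agreement

/-! ### Functions orthogonal to the vectors `(U - 1) (a ⊗ b)` -/

section Homogeneous
variable {m : ℕ} {D : Chart m → ℂ}

lemma memLp_restrict_dilate (hD : ∀ K, IsCompact K → MemLp D 2 (volume.restrict K)) {c : ℝ} (hc : c ≠ 0)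
    {K : Set Chart m} (hK : IsCompact K) :
    MemLp (fun p => (sqrt (|c| ^ (m + 1)) : ℂ) * D (p.1, c • p.2)) 2 (volume.restrict K) := by
  set T : Chart m → Chart m := fun p => (p.1, c • p.2)
  have hT : IsCompact (T '' K) := hK.image (by fun_prop)
  have h := (isWeightedMap_dilate (m + 1) hc).memLp ((memLp_indicator_iff_restrict hT.measurableSet).2 (hD _ hT))
  refine (h.restrict K).ae_eq ?_
  filter_upwards [ae_restrict_mem hK.measurableSet] with p hp
  rw [indicator_of_mem (Set.mem_image_of_mem T hp)]

/-- A function which is homogeneous under one dilation of `η` and square integrable near `η = 0`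
vanishes: its masses on the dyadic shells are equal. -/
lemma ae_eq_zero_of_homogeneous (hD : ∀ K, IsCompact K → MemLp D 2 (volume.restrict K))
    (h : (fun p : Chart m => (sqrt (|exp (-1)| ^ (m + 1)) : ℂ) *
      D (p.1, exp (-1) • p.2)) =ᵐ[volume] D) : D =ᵐ[volume] 0 := by
  set S : ℝ → ℝ → Set Chart m := fun B R => Metric.closedBall 0 B ×ˢ Metric.closedBall 0 R
  have hS : ∀ B R, IsCompact (S B R) := fun B R =>
    (isCompact_closedBall 0 B).prod (isCompact_closedBall 0 R)
  have hm : ∀ B R, AEMeasurable ((S B R).indicator fun p => ‖D p‖ₑ ^ 2) volume := fun B R =>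
    (aemeasurable_indicator_iff (hS B R).measurableSet).2 ((hD _ (hS B R)).aestronglyMeasurable.enorm.pow_const 2)
  have step : ∀ B R, ∫⁻ p in S B (exp (-1) * R), ‖D p‖ₑ ^ 2 = ∫⁻ p in S B R, ‖D p‖ₑ ^ 2 := fun B R => by
    rw [← lintegral_indicator (hS _ _).measurableSet, ← lintegral_indicator (hS _ _).measurableSet,
      (isWeightedMap_dilate (m + 1) (exp_ne_zero (-1))).lintegral_eq _ (hm _ _)]
    refine lintegral_congr_ae ?_
    filter_upwards [h] with p hp
    have hmem : (p.1, exp (-1) • p.2) ∈ S B (exp (-1) * R) ↔ p ∈ S B R := by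
      simp only [S, Set.mem_prod, mem_closedBall_zero_iff, norm_smul, norm_eq_abs, abs_exp]
      rw [mul_le_mul_iff_right₀ (exp_pos _)]
    by_cases hpS : p ∈ S B R
    · rw [indicator_of_mem (hmem.2 hpS), indicator_of_mem hpS, ← hp, enorm_mul, mul_pow,
        ← ofReal_norm ((sqrt _ : ℝ) : ℂ), norm_real, norm_of_nonneg (Real.sqrt_nonneg _),
        ofReal_pow (Real.sqrt_nonneg _)]
    · rw [indicator_of_notMem (mt hmem.1 hpS), indicator_of_notMem hpS, mul_zero]
  have hfin : ∀ B R, ∫⁻ p in S B R, ‖D p‖ₑ ^ 2 ≠ ⊤ := fun B R => by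
    have := (eLpNorm_lt_top_iff_lintegral_rpow_enorm_lt_top two_ne_zero ENNReal.ofNat_ne_top).1
      (hD _ (hS B R)).2
    simpa using this.ne
  have hzero : ∀ B R, 0 ≤ R → ∫⁻ p in S B R, ‖D p‖ₑ ^ 2 = 0 := fun B R hR => by
    set r : ℕ → ℝ := fun k => exp (-1) ^ k * R
    have he : exp (-1) < 1 := Real.exp_zero ▸ Real.exp_lt_exp.2 (by norm_num)
    have hk : ∀ k : ℕ, ∫⁻ p in S B (r k), ‖D p‖ₑ ^ 2 = ∫⁻ p in S B R, ‖D p‖ₑ ^ 2 := by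
      intro k
      induction k with
      | zero => simp [r]
      | succ k ih => rw [← ih, ← step B (r k)]; simp only [r, pow_succ', mul_assoc]
    have hsub : ∀ k, S B (r k) ⊆ S B R := fun k => Set.prod_mono_right
      (Metric.closedBall_subset_closedBall (mul_le_of_le_one_left hR (pow_le_one₀ (exp_pos _).le he.le)))
    have hr : Tendsto r atTop (𝓝 0) := by
      simpa using (tendsto_pow_atTop_nhds_zero_of_lt_one (exp_pos _).le he).mul_const R
    have hlim : Tendsto (fun k => volume (S B (r k))) atTop (𝓝 0) := by
      have e : ∀ k, volume (S B (r k)) = volume (Metric.closedBall (0 : Eu (m + 1)) B) *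
          (ofReal (r k ^ (m + 1)) * volume (Metric.ball (0 : Eu (m + 1)) 1)) := fun k => by
        rw [volume_eq_prod, Measure.prod_prod, Measure.addHaar_closedBall _ _ (by positivity : 0 ≤ r k),
          finrank_euclideanSpace_fin]
      have h0 := tendsto_ofReal (hr.pow (m + 1))
      rw [zero_pow (Nat.succ_ne_zero m), ENNReal.ofReal_zero] at h0
      simp only [e]
      simpa using ENNReal.Tendsto.const_mul (ENNReal.Tendsto.mul_const h0
        (Or.inr (measure_ball_lt_top (μ := volume) (x := (0 : Eu (m + 1))) (r := 1)).ne))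
        (Or.inr (measure_closedBall_lt_top (μ := volume) (x := (0 : Eu (m + 1))) (r := B)).ne)
    have ht := tendsto_setLIntegral_zero (f := (S B R).indicator fun p => ‖D p‖ₑ ^ 2)
      (by rw [lintegral_indicator (hS B R).measurableSet]; exact hfin B R) hlim
    have e : ∀ k, ∫⁻ p in S B (r k), (S B R).indicator (fun p => ‖D p‖ₑ ^ 2) p =
        ∫⁻ p in S B R, ‖D p‖ₑ ^ 2 := fun k => by
      rw [← hk k]
      exact setLIntegral_congr_fun (hS _ _).measurableSet fun p hp => indicator_of_mem (hsub k hp) _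
    simp only [e] at ht
    exact tendsto_nhds_unique tendsto_const_nhds ht
  have hz : ∀ N : ℕ, ∀ᵐ p, p ∈ S N N → D p = 0 := fun N => by
    have := (lintegral_eq_zero_iff' ((hD _ (hS N N)).aestronglyMeasurable.enorm.pow_const 2)).1 (hzero N N N.cast_nonneg)
    filter_upwards [(ae_restrict_iff' (hS N N).measurableSet).1 this] with p hp hpS
    simpa using hp hpS
  filter_upwards [ae_all_iff.2 hz] with p hp
  obtain ⟨N, hN⟩ := exists_nat_ge ‖p‖
  refine hp N ⟨?_, ?_⟩
  · rw [mem_closedBall_zero_iff]; exact (norm_fst_le p).trans hN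
  · rw [mem_closedBall_zero_iff]; exact (norm_snd_le p).trans hN

theorem ae_eq_zero_of_stepDilate_test (hD : ∀ K, IsCompact K → MemLp D 2 (volume.restrict K))
    (h : ∀ a b : Eu (m + 1) → ℝ, ContDiff ℝ ∞ a → HasCompactSupport a → ContDiff ℝ ∞ b →
      HasCompactSupport b → (0 : Eu (m + 1)) ∉ tsupport b →
      ∫ p, D p * ((a p.1 : ℂ) * ((exp ((m + 1 : ℕ) / 2) : ℂ) * b (exp 1 • p.2) - b p.2)) = 0) :
    D =ᵐ[volume] 0 := by
  refine ae_eq_zero_of_homogeneous hD ?_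
  have hc := exp_ne_zero (-1)
  set D' : Chart m → ℂ := fun p =>
    (sqrt (|exp (-1)| ^ (m + 1)) : ℂ) * D (p.1, exp (-1) • p.2) with hD'
  have hD'l : ∀ K, IsCompact K → MemLp D' 2 (volume.restrict K) := fun K hK => memLp_restrict_dilate hD hc hK
  have test : ∀ a b : Eu (m + 1) → ℝ, ContDiff ℝ ∞ a → HasCompactSupport a → ContDiff ℝ ∞ b →
      HasCompactSupport b → (0 : Eu (m + 1)) ∉ tsupport b →
      ∫ p, (D' p - D p) * ((a p.1 : ℂ) * b p.2) = 0 := by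
    intro a b ha has hb hbs hb0
    have hbd : HasCompactSupport fun η : Eu (m + 1) => b (exp 1 • η) :=
      hbs.comp_homeomorph (Homeomorph.smulOfNeZero (exp 1) (exp_ne_zero _))
    have ca := ha.continuous
    have cb := hb.continuous
    have i1 := integrable_mul_tensor hD ca cb has hbs
    have i1' := integrable_mul_tensor hD'l ca cb has hbs
    have i2 := integrable_mul_tensor hD ca (d := fun η => b (exp 1 • η)) (by fun_prop) has hbd
    have e := h a b ha has hb hbs hb0
    have e1 : ∀ p : Chart m, D p * ((a p.1 : ℂ) * ((exp ((m + 1 : ℕ) / 2) : ℂ) *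
        b (exp 1 • p.2) - b p.2)) = (exp ((m + 1 : ℕ) / 2) : ℂ) *
        (D p * ((a p.1 : ℂ) * b (exp 1 • p.2))) - D p * ((a p.1 : ℂ) * b p.2) := fun p => by ring
    simp only [e1] at e
    have e2 := integral_sub (i2.const_mul (exp ((m + 1 : ℕ) / 2) : ℂ)) i1
    rw [e, integral_const_mul, integral_comp_dilate hc i2.aestronglyMeasurable] at e2
    have hee : exp ((m + 1 : ℕ) / 2) * |exp (-1)| ^ (m + 1) = sqrt (|exp (-1)| ^ (m + 1)) := by
      rw [sqrt_exp_pow, abs_exp, ← exp_nat_mul, ← exp_add]; ring_nf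
    simp only [sub_mul]
    rw [integral_sub i1' i1, e2, sub_left_inj, ← integral_const_mul]
    refine integral_ext fun p => ?_
    simp only [hD', ← hee, smul_smul, ← exp_add]
    norm_num
    ring
  obtain ⟨χ, hχ, hχs, hχ1, hχb⟩ := exists_smooth_cutoff (E := Eu (m + 1)) 1
  set θ : ℕ → Eu (m + 1) → ℝ := fun k η => 1 - χ ((k : ℝ) • η)
  have hθ : ∀ k, ContDiff ℝ ∞ (θ k) := fun k => contDiff_const.sub (hχ.comp (contDiff_const_smul _))
  have hk : ∀ k : ℕ, 1 ≤ k → (fun p => (D' p - D p) * θ k p.2) =ᵐ[volume] 0 := fun k hk1 => by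
    refine ae_eq_zero_of_tensor_test (fun K hK => ?_) fun a b ha has hb hbs => ?_
    · refine ((hD'l K hK).sub (hD K hK)).of_le_mul (c := 2) (((hD'l K hK).sub (hD K hK)).aestronglyMeasurable.mul
        (Continuous.aestronglyMeasurable (by have := (hθ k).continuous; fun_prop))) (.of_forall fun p => ?_)
      rw [norm_mul, mul_comm, norm_real]
      refine mul_le_mul_of_nonneg_right ((norm_sub_le _ _).trans ?_) (norm_nonneg _)
      have := hχb ((k : ℝ) • p.2)
      rw [norm_one]; linarith
    · rw [← test a (fun η => θ k η * b η) ha has ((hθ k).mul hb) hbs.mul_left ?_]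
      · refine integral_ext fun p => ?_
        push_cast; ring
      · refine notMem_tsupport_iff_eventuallyEq.2 ?_
        have hk0 : (0 : ℝ) < k := by exact_mod_cast hk1
        filter_upwards [Metric.ball_mem_nhds (0 : Eu (m + 1)) (inv_pos.2 hk0)] with η hη
        rw [mem_ball_zero_iff] at hη
        have : χ ((k : ℝ) • η) = 1 := hχ1 _ (by
          rw [norm_smul, norm_of_nonneg hk0.le]
          have := mul_lt_mul_of_pos_left hη hk0
          rw [mul_inv_cancel₀ hk0.ne'] at this
          simpa using this.le)
        simp [θ, this]
  filter_upwards [ae_all_iff.2 fun k : {k : ℕ // 1 ≤ k} => hk k k.2, ae_snd_ne_zero] with p hp hp0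
  obtain ⟨R, hR⟩ := hχs.isBounded.exists_norm_le
  obtain ⟨k, hkR⟩ := exists_nat_gt (max 1 (R / ‖p.2‖))
  have h1 : 1 ≤ k := by exact_mod_cast ((le_max_left _ _).trans_lt hkR).le
  have h2 := (div_lt_iff₀ (norm_pos_iff.2 hp0)).1 ((le_max_right _ _).trans_lt hkR)
  have h3 : χ ((k : ℝ) • p.2) = 0 := image_eq_zero_of_notMem_tsupport fun hmem => by
    have := hR _ hmem
    rw [norm_smul, norm_of_nonneg k.cast_nonneg] at this
    linarith
  have := hp ⟨k, h1⟩
  simpa [θ, h3, sub_eq_zero] using this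

end Homogeneous

/-! ### Symmetry of the integral operator, and its domain -/

section Generic
variable {X : Type*} [MeasurableSpace X] {μ : Measure X} [SFinite μ] {u w : X → ℂ} {A : X → X → ℝ}

lemma lintegral_kerBound_symm (hu : Measurable u) (hw : Measurable w)
    (hA : Measurable fun r : X × X => A r.1 r.2) :
    ∫⁻ p, (∫⁻ q, ‖u q‖ₑ * kerBound (A p q) (A q p) ∂μ) * ‖w p‖ₑ ∂μ =
      ∫⁻ q, (∫⁻ p, ‖w p‖ₑ * kerBound (A q p) (A p q) ∂μ) * ‖u q‖ₑ ∂μ := by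
  have hA' : Measurable fun r : X × X => A r.2 r.1 := hA.comp measurable_swap
  simp only [← lintegral_mul_const' _ _ enorm_ne_top]
  rw [lintegral_lintegral_swap]
  · refine lintegral_congr fun q => lintegral_congr fun p => ?_
    rw [kerBound, kerBound, add_comm (ofReal (1 + |A p q|) ^ _ * _)]; ring
  · exact ((hu.comp measurable_snd).enorm.mul (hA.kerBound hA')).mul
      (hw.comp measurable_fst).enorm |>.aemeasurable

lemma integral_truncKer_symm (hu : Integrable u μ) (hw : Integrable w μ)
    (hA : Measurable fun r : X × X => A r.1 r.2) {L : ℝ} (hL : 0 ≤ L) :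
    ∫ p, (∫ q, u q * truncKer L (A p q) (A q p) ∂μ) * w p ∂μ =
      ∫ q, (∫ p, w p * truncKer L (A q p) (A p q) ∂μ) * u q ∂μ := by
  have hA' : Measurable fun r : X × X => A r.2 r.1 := hA.comp measurable_swap
  have hi : Integrable (fun r : X × X => truncKer L (A r.1 r.2) (A r.2 r.1) * (w r.1 * u r.2)) (μ.prod μ) :=
    (hw.mul_prod hu).bdd_mul (c := 4 * L)
      ((by fun_prop : Continuous fun p : ℝ × ℝ => truncKer L p.1 p.2).measurable.comp
        (hA.prodMk hA')).aestronglyMeasurable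
      (.of_forall fun r => norm_truncKer_le _ _ hL)
  simp only [← integral_mul_const]
  refine .trans (integral_ext fun q => integral_ext fun p => ?_)
    ((integral_integral_swap (f := fun p q => truncKer L (A p q) (A q p) * (w p * u q)) hi).trans
      (integral_ext fun q => integral_ext fun p => ?_))
  · ring
  · simp only [truncKer_swap]; ring

end Generic

section Symmetry
variable {m : ℕ} {u w : Chart m → ℂ}

lemma argB_sigmaPoint (p q : Chart m) : argB (sigmaPoint p) q = argA (sigmaPoint q) p := by
  rw [← offCone_zero, ← offCone_zero, argB_offCone, argA_offCone, zero_sub, ← inner_neg_left, neg_sub]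

lemma lintegral_kerIntegral_symm (hu : Measurable u) (hw : Measurable w) :
    ∫⁻ p, kerIntegral u (sigmaPoint p) * ‖w p‖ₑ = ∫⁻ q, kerIntegral w (sigmaPoint q) * ‖u q‖ₑ := by
  simp only [kerIntegral, argB_sigmaPoint]
  exact lintegral_kerBound_symm (A := fun p q => argA (sigmaPoint p) q) hu hw (by fun_prop)

lemma tendsto_integral_truncTheta_mul (hu : IsChartDecaying u) (hw : Integrable w volume)
    (hfin : ∫⁻ p, kerIntegral u (sigmaPoint p) * ‖w p‖ₑ ≠ ⊤) :
    Tendsto (fun L : ℕ => ∫ p, (∫ q, u q * truncKer L (argA (sigmaPoint p) q) (argA (sigmaPoint q) p)) * w p)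
      atTop (𝓝 (∫ p, thetaLim u (sigmaPoint p) * w p)) := by
  have h := tendsto_integral_truncTheta hu (P := sigmaPoint) (by fun_prop) hw hfin
  simp only [argB_sigmaPoint] at h
  refine h.congr fun L => ?_
  exact (integral_truncKer_mul (A := fun p q => argA (sigmaPoint p) q) (B := fun p q => argA (sigmaPoint q) p)
    hu.integrable hw (by fun_prop) (by fun_prop) L.cast_nonneg).symm

/-- The kernel of `𝓗` is symmetric. -/
theorem integral_thetaLim_symm (hu : IsChartDecaying u) (hw : IsChartDecaying w)
    (hfin : ∫⁻ p, kerIntegral u (sigmaPoint p) * ‖w p‖ₑ ≠ ⊤) :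
    ∫ p, thetaLim u (sigmaPoint p) * w p = ∫ q, thetaLim w (sigmaPoint q) * u q := by
  have h1 := tendsto_integral_truncTheta_mul hu hw.integrable hfin
  have h2 := tendsto_integral_truncTheta_mul hw hu.integrable
    (by rwa [← lintegral_kerIntegral_symm hu.measurable hw.measurable])
  exact tendsto_nhds_unique h1 (h2.congr fun L => (integral_truncKer_symm
    (A := fun p q => argA (sigmaPoint p) q) hu.integrable hw.integrable (by fun_prop)
    L.cast_nonneg).symm)

lemma conj_thetaLim (hu : IsChartDecaying u) (hr : ∀ q, conj (u q) = u q)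
    {p : Chart m} (hp : p.2 ≠ 0) :
    conj (thetaLim u (sigmaPoint p)) = thetaLim u (sigmaPoint p) := by
  have h := tendsto_truncTheta hu.integrable hu.measurable (kerIntegral_ne_top hu (sigmaPoint_mem hp).2)
  refine tendsto_nhds_unique ((continuous_conj.tendsto _).comp h) (h.congr fun L => ?_)
  rw [Function.comp_apply, truncTheta, ← integral_conj]
  simp only [map_mul, hr, conj_truncKer]

end Symmetry

section Domain
variable {m : ℕ} {u₀ : Chart m → ℂ}

lemma schwartzVec_real_total {n : ℕ} (G : L2Sigma n) (h : ∀ a b : 𝓢(Eu n, ℂ),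
    (∀ x, conj (a x) = a x) → (∀ x, conj (b x) = b x) → ⟪schwartzVec a b, G⟫_ℂ = 0) : G = 0 :=
  tensor_total_of_total testVec_total testVec_total G fun ⟨a, b⟩ =>
    h (schwartzOfReal a.2.1 a.2.2) (schwartzOfReal b.2.1 b.2.2) (fun _ => conj_ofReal _)
      fun _ => conj_ofReal _

lemma exists_hOp_stepDilate (a b : 𝓢(Eu (m + 1), ℂ)) : ∃ v, (schwartzVec a (stepDilate b), v) ∈ (hOp m).graph := by
  have h := dilate_sub_mem_domain (schwartzVec a b)
  rw [← schwartzVec_stepDilate] at h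
  exact ⟨_, (hOp m).mem_graph ⟨_, h⟩⟩

lemma hasCompactSupport_stepDilate {n : ℕ} {b : Eu n → ℝ} (hb : HasCompactSupport b) :
    HasCompactSupport fun η => exp (n / 2) * b (exp 1 • η) - b η :=
  HasCompactSupport.sub (f := fun η => exp (n / 2) * b (exp 1 • η)) (HasCompactSupport.mul_left
    (hb.comp_homeomorph (Homeomorph.smulOfNeZero (exp 1) (exp_ne_zero _)))) hb

/-- The symmetry of `𝓗`, for a real test vector `(U - 1) (a ⊗ b)`. -/
lemma integral_thetaLim_eq_inner {a b : 𝓢(Eu (m + 1), ℂ)} (ha : ∀ x, conj (a x) = a x)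
    (hb : ∀ x, conj (b x) = b x) (hu : IsChartDecaying u₀) {u v : L2Sigma (m + 1)}
    (huu : u =ᵐ[volume] u₀) (hv : (schwartzVec a (stepDilate b), v) ∈ (hOp m).graph) :
    ∫ p, thetaLim u₀ (sigmaPoint p) * (a p.1 * stepDilate b p.2) = ⟪v, u⟫_ℂ := by
  have hw := (isRapid_tensor a (stepDilate b)).isChartDecaying
  have hfin := lintegral_kerIntegral_offCone_ne_top hu a (stepDilate b) 0
  simp only [offCone_zero] at hfin
  rw [integral_thetaLim_symm hu hw hfin, inner_eq_integral (thetaLim_ae_eq_hOp a b hv).symm huu]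
  refine integral_ext_ae ae_snd_ne_zero fun p h3 => ?_
  rw [conj_thetaLim hw (fun q => ?_) h3, mul_comm]
  simp only [map_mul, ha, stepDilate_apply, map_sub, hb, conj_ofReal]

theorem mem_hOp_graph_of_memLp (hu : IsChartDecaying u₀) {u G : L2Sigma (m + 1)} (huu : u =ᵐ[volume] u₀)
    (hG : G =ᵐ[volume] fun p => thetaLim u₀ (sigmaPoint p)) : (u, G) ∈ (hOp m).graph := by
  rw [mem_hOp_graph_oppo]
  obtain ⟨C, hC⟩ := exists_norm_gammaSymbol_mul_le
  set κ : RaySpace m × ℝ → ℂ := fun r => cexp (I * freq r) - 1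
  have hκ : ∀ r : RaySpace m × ℝ, conj (cexp (-(I * freq r)) - 1) = κ r := fun r => by
    simp [κ, ← exp_conj]
  have hκm : Measurable κ := by fun_prop
  have hκb : ∀ r, ‖κ r‖ ≤ 2 := fun r => by
    have := norm_exp_I_freq 1 (freq r)
    simp only [Complex.ofReal_one, one_mul] at this
    refine (norm_sub_le _ _).trans ?_
    rw [this, norm_one]; norm_num
  have hgm : Measurable fun r : RaySpace m × ℝ => gammaSymbol (freq r) * κ r := by fun_prop
  have hgb : ∀ r : RaySpace m × ℝ, ‖gammaSymbol (freq r) * κ r‖ ≤ C := fun r => by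
    refine le_trans (le_of_eq ?_) (hC (freq r))
    rw [norm_mul, norm_mul, norm_exp_sub_one_eq]
  set U := flipU m (reflectU (rayMeasure m) (spectralU m u))
  have hU : U =ᵐ[rayVol m] fun r => spectralU m u (oppo r) :=
    flipU_coe (reflectU_coe (.refl _ _))
  have m1 := memLp_bounded_mul hκm hκb (spectralU m G)
  have m2 := memLp_bounded_mul hgm hgb U
  have hZ : (spectralU m).symm (m1.toLp - m2.toLp) = 0 := by
    refine schwartzVec_real_total _ fun a b ha hb => ?_
    obtain ⟨v, hv⟩ := exists_hOp_stepDilate a b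
    rw [← (spectralU m).inner_map_map, LinearIsometryEquiv.apply_symm_apply, inner_sub_right, sub_eq_zero]
    set φ := spectralU m (schwartzVec a b) with hφ
    set φ₁ := spectralU m (schwartzVec a (stepDilate b)) with hφ₁
    have hrel : φ₁ =ᵐ[rayVol m] fun r => (cexp (-(I * freq r)) - 1) * φ r :=
      spectralU_stepDilate a b
    have e1 : ⟪φ, m1.toLp⟫_ℂ = ⟪schwartzVec a (stepDilate b), G⟫_ℂ := by
      rw [← (spectralU m).inner_map_map, inner_eq_integral (.refl _ φ) m1.coeFn_toLp,
        inner_eq_integral hrel (.refl _ _)]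
      refine integral_ext fun r => ?_
      rw [map_mul, hκ]; ring
    have e2 : ⟪φ, m2.toLp⟫_ℂ = ⟪v, u⟫_ℂ := by
      rw [← (spectralU m).inner_map_map v u, L2.inner_def, L2.inner_def]
      refine Eq.trans (integral_congr_ae ?_) (measurePreserving_oppo.integral_comp'
        (f := ⟨⟨oppo, oppo, oppo_oppo, oppo_oppo⟩, measurePreserving_oppo.measurable,
          measurePreserving_oppo.measurable⟩) fun r => inner ℂ (spectralU m v r) (spectralU m u r))
      filter_upwards [hU, m2.coeFn_toLp, hrel, measurePreserving_oppo.quasiMeasurePreserving.ae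
        ((mem_hOp_graph_oppo _ _).1 hv)] with r h1 h2 h3 h4
      change _ = inner ℂ (spectralU m v (oppo r)) (spectralU m u (oppo r))
      rw [inner_apply, inner_apply, h2, h4, oppo_oppo, freq_oppo, gammaSymbol_neg, h3,
        map_mul, map_mul, conj_conj, hκ, h1]
      ring
    rw [e1, e2, ← integral_thetaLim_eq_inner ha hb hu huu hv,
      inner_eq_integral (schwartzVec_coe a (stepDilate b)) hG]
    refine integral_ext fun p => ?_
    simp only [map_mul, ha, stepDilate_apply, map_sub, hb, conj_ofReal]
  have hZ' : m1.toLp = m2.toLp := by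
    rw [← sub_eq_zero]
    exact (spectralU m).symm.map_eq_zero_iff.1 hZ
  filter_upwards [m1.coeFn_toLp, m2.coeFn_toLp, hU, ae_exp_freq_ne_one (rayMeasure m)] with r h1 h2 h3 h4
  rw [hZ', h2, h3, mul_comm (gammaSymbol _), mul_assoc] at h1
  exact (mul_left_cancel₀ (sub_ne_zero.2 h4) h1).symm

theorem thetaLim_ae_eq_of_mem_graph (hu : IsChartDecaying u₀) {u v : L2Sigma (m + 1)}
    (huu : u =ᵐ[volume] u₀) (hv : (u, v) ∈ (hOp m).graph) :
    (fun p => thetaLim u₀ (sigmaPoint p)) =ᵐ[volume] v := by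
  have hT := fun K (hK : IsCompact K) => memLp_thetaLim_sigmaPoint hu hK
  have hV := fun (K : Set Chart m) (_ : IsCompact K) => (Lp.memLp v).restrict K
  suffices h : (fun p => thetaLim u₀ (sigmaPoint p) - v p) =ᵐ[volume] 0 from
    h.mono fun p hp => sub_eq_zero.1 hp
  refine ae_eq_zero_of_stepDilate_test (fun K hK => (hT K hK).sub (hV K hK)) fun a b ha has hb hbs _ => ?_
  obtain ⟨w, hw⟩ := exists_hOp_stepDilate (schwartzOfReal ha has) (schwartzOfReal hb hbs)
  have e1 := integral_thetaLim_eq_inner (fun _ => conj_ofReal _) (fun _ => conj_ofReal _) hu huu hw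
  have e2 : ∫ p, v p * (schwartzOfReal ha has p.1 * stepDilate (schwartzOfReal hb hbs) p.2) =
      ⟪schwartzVec (schwartzOfReal ha has) (stepDilate (schwartzOfReal hb hbs)), v⟫_ℂ := by
    rw [inner_eq_integral (schwartzVec_coe _ _) (.refl _ v)]
    simp only [stepDilate_apply, schwartzOfReal_apply, map_mul, map_sub, conj_ofReal]
  have e3 : ⟪w, u⟫_ℂ = ⟪schwartzVec (schwartzOfReal ha has) (stepDilate (schwartzOfReal hb hbs)), v⟫_ℂ := by
    obtain ⟨x, hx, rfl⟩ := (LinearPMap.mem_graph_iff _).1 hw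
    obtain ⟨y, rfl, rfl⟩ := (LinearPMap.mem_graph_iff _).1 hv
    have h := LinearPMap.adjoint_isFormalAdjoint (isSelfAdjoint_hOp (m := m)).dense_domain
    rw [(LinearPMap.isSelfAdjoint_def).1 isSelfAdjoint_hOp] at h
    rw [h x y, hx]
  have hd : HasCompactSupport fun η : Eu (m + 1) =>
      exp ((m + 1 : ℕ) / 2) * b (exp 1 • η) - b η := hasCompactSupport_stepDilate hbs
  have cb := hb.continuous
  have i1 := integrable_mul_tensor hT ha.continuous (by fun_prop) has hd
  have i2 := integrable_mul_tensor hV ha.continuous (by fun_prop) has hd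
  simp only [stepDilate_apply, schwartzOfReal_apply] at e1 e2
  push_cast at i1 i2 e1 e2 ⊢
  simp only [sub_mul]
  rw [integral_sub i1 i2, e1, e2]
  exact sub_eq_zero.2 e3

end Domain

/-! ### Density of the test functions in the domain -/

section TestFunctions
variable {m : ℕ} {Φ : Phase m → ℂ}

lemma hFun_ae_eq {w u₀ : Chart m → ℂ} (hu : IsRapid u₀) (hw : w =ᵐ[volume] u₀) :
    hFun w =ᵐ[volume] fun p => thetaLim u₀ (sigmaPoint p) := by
  filter_upwards [ae_snd_ne_zero] with p hp
  exact (isThetaFun_thetaFun hu.isChartDecaying hu.memLp hw).2 (sigmaPoint_mem hp).2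

lemma IsTestFunction.memLp (hΦ : IsTestFunction Φ) : MemLp (inCoords Φ) 2 volume := by
  obtain ⟨u₀, hu, he⟩ := hΦ.exists_isRapid
  exact (memLp_congr_ae he).2 hu.memLp

lemma IsTestFunction.isThetaFun (hΦ : IsTestFunction Φ) :
    IsThetaFun (inCoords Φ) (thetaFun (inCoords Φ)) := by
  obtain ⟨u₀, hu, he⟩ := hΦ.exists_isRapid
  exact (isThetaFun_thetaFun hu.isChartDecaying hu.memLp he).1

/-- The operator `hOp` extends the integral operator `𝓗` on test functions, with the right domain. -/
theorem IsTestFunction.mem_hOp_domain_iff (hΦ : IsTestFunction Φ) {u : L2Sigma (m + 1)}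
    (hu : u =ᵐ[volume] inCoords Φ) : (u ∈ (hOp m).domain ↔ MemLp (hFun (inCoords Φ)) 2 volume) ∧
      ∀ v : L2Sigma (m + 1), (u, v) ∈ (hOp m).graph → v =ᵐ[volume] hFun (inCoords Φ) := by
  obtain ⟨u₀, hu₀, he⟩ := hΦ.exists_isRapid
  have h1 := hFun_ae_eq hu₀ he
  have h2 : ∀ v : L2Sigma (m + 1), (u, v) ∈ (hOp m).graph → v =ᵐ[volume] hFun (inCoords Φ) := fun v hv =>
    (h1.trans (thetaLim_ae_eq_of_mem_graph hu₀.isChartDecaying (hu.trans he) hv)).symm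
  refine ⟨⟨fun h => ?_, fun h => ?_⟩, h2⟩
  · exact (memLp_congr_ae (h2 _ ((hOp m).mem_graph ⟨u, h⟩))).1 (Lp.memLp _)
  · have := mem_hOp_graph_of_memLp hu₀.isChartDecaying (hu.trans he) (h.coeFn_toLp.trans h1)
    obtain ⟨y, rfl, -⟩ := (LinearPMap.mem_graph_iff _).1 this
    exact y.2

lemma notMem_tsupport_stepDilate {n : ℕ} {b : Eu n → ℝ} (h0 : (0 : Eu n) ∉ tsupport b) (a : Eu n → ℝ)
    (c : ℂ) {q : Eu² n} (hq : q ∈ tsupport fun p : Eu² n =>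
      (a p.1 : ℂ) * (c * b (exp 1 • p.2) - b p.2)) : q.2 ≠ 0 := by
  rintro hq0
  refine notMem_tsupport_iff_eventuallyEq.2 ?_ hq
  have h := notMem_tsupport_iff_eventuallyEq.1 h0
  have t1 : Tendsto (fun p : Eu² n => p.2) (𝓝 q) (𝓝 0) := by
    rw [← hq0]; exact continuous_snd.tendsto q
  have t2 : Tendsto (fun p : Eu² n => exp 1 • p.2) (𝓝 q) (𝓝 0) := by
    simpa using t1.const_smul (exp 1)
  filter_upwards [t1.eventually h, t2.eventually h] with p h1 h2
  simp only [Pi.zero_apply] at h1 h2 ⊢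
  simp [h1, h2]

/-- Test functions in the domain of `𝓗` are dense: by `ae_eq_zero_of_stepDilate_test`, already the
`(U - 1) (a ⊗ b)` span a dense space. -/
theorem dense_testFunctions : Dense {u : L2Sigma (m + 1) | ∃ Φ : Phase m → ℂ,
    IsTestFunction Φ ∧ u =ᵐ[volume] inCoords Φ ∧ MemLp (hFun (inCoords Φ)) 2 volume} := by
  let ι := {ab : (Eu (m + 1) → ℝ) × (Eu (m + 1) → ℝ) // (ContDiff ℝ ∞ ab.1 ∧ HasCompactSupport ab.1) ∧
    (ContDiff ℝ ∞ ab.2 ∧ HasCompactSupport ab.2) ∧ (0 : Eu (m + 1)) ∉ tsupport ab.2}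
  let v : ι → L2Sigma (m + 1) := fun i =>
    schwartzVec (schwartzOfReal i.2.1.1 i.2.1.2) (stepDilate (schwartzOfReal i.2.2.1.1 i.2.2.1.2))
  have hv : ∀ i : ι, v i =ᵐ[volume] fun p => (i.1.1 p.1 : ℂ) *
      ((exp ((m + 1 : ℕ) / 2) : ℂ) * i.1.2 (exp 1 • p.2) - i.1.2 p.2) := fun i =>
    schwartzVec_coe _ _
  refine (TotalFam.dense (v := v) fun G hG => ?_).mono fun u hu => ?_
  · have := ae_eq_zero_of_stepDilate_test (D := fun p => conj (G p)) (fun K _ =>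
      ((Lp.memLp G).star.restrict K)) fun a b ha has hb hbs h0 => ?_
    · refine Lp.eq_zero_iff_ae_eq_zero.2 (this.mono fun p hp => ?_)
      simpa using hp
    · have e := hG ⟨(a, b), ⟨ha, has⟩, ⟨hb, hbs⟩, h0⟩
      rw [← inner_conj_symm, map_eq_zero, inner_eq_integral (.refl _ G) (hv _)] at e
      exact (integral_ext fun p => mul_comm _ _).trans e
  · have key : ∃ w : Chart m → ℂ, ContDiff ℝ ∞ w ∧ HasCompactSupport w ∧
        (∀ q ∈ tsupport w, q.2 ≠ 0) ∧ u =ᵐ[volume] w ∧ u ∈ (hOp m).domain := by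
      induction hu using Submodule.span_induction with
      | mem x hx =>
        obtain ⟨i, rfl⟩ := hx
        obtain ⟨z, hz⟩ := exists_hOp_stepDilate (schwartzOfReal i.2.1.1 i.2.1.2)
          (schwartzOfReal i.2.2.1.1 i.2.2.1.2)
        obtain ⟨y, hy, -⟩ := (LinearPMap.mem_graph_iff _).1 hz
        have c1 := (schwartzOfReal i.2.1.1 i.2.1.2).smooth ⊤
        have c2 := (schwartzOfReal i.2.2.1.1 i.2.2.1.2).smooth ⊤
        have hs : HasCompactSupport fun η : Eu (m + 1) =>
            exp ((m + 1 : ℕ) / 2) * i.1.2 (exp 1 • η) - i.1.2 η := hasCompactSupport_stepDilate i.2.2.1.2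
        refine ⟨_, ?_, ?_, fun q => notMem_tsupport_stepDilate i.2.2.2 _ _, hv i, ?_⟩
        · exact (c1.comp contDiff_fst).mul
            ((contDiff_const.mul (c2.comp (contDiff_snd.const_smul _))).sub (c2.comp contDiff_snd))
        · simpa using hasCompactSupport_tensor i.2.1.2 hs
        · have hy' : (y : L2Sigma (m + 1)) = v i := hy
          exact hy' ▸ y.2
      | zero => exact ⟨0, contDiff_const, .zero, by simp, Lp.coeFn_zero .., zero_mem _⟩
      | add x y _ _ hx hy =>
        obtain ⟨w, h1, h2, h3, h4, h5⟩ := hx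
        obtain ⟨w', h1', h2', h3', h4', h5'⟩ := hy
        exact ⟨w + w', h1.add h1', h2.add h2', fun q hq => (tsupport_add w w' hq).elim (h3 q) (h3' q),
          (Lp.coeFn_add x y).trans (h4.add h4'), add_mem h5 h5'⟩
      | smul c x _ hx =>
        obtain ⟨w, h1, h2, h3, h4, h5⟩ := hx
        exact ⟨c • w, h1.const_smul c, h2.smul_left (f := fun _ => c), 
          fun q hq => h3 q (tsupport_smul_subset_right (fun _ => c) w hq),         (Lp.coeFn_smul c x).trans (h4.const_smul c), Submodule.smul_mem _ _ h5⟩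
    obtain ⟨w, h1, h2, h3, h4, h5⟩ := key
    obtain ⟨hw, he⟩ := isTestFunction_tilde h1 h2 h3
    rw [← he] at h4
    exact ⟨tilde w, hw, h4, (hw.mem_hOp_domain_iff h4).1.1 h5⟩

end TestFunctions

/-! ### The reflection behind `𝓚` -/

section Involution
variable {E : Type*} [NormedAddCommGroup E] [NormedSpace ℝ E] {U : Set E} {σ : E → E}

/-- Test functions on an open set are transported by a smooth involution of it. -/
lemma contDiff_mul_comp_involution (hU : IsOpen U) (hσ : ContDiffOn ℝ ∞ σ U) (hσU : ∀ x, σ x ∈ U ↔ x ∈ U)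
    (hσσ : ∀ x ∈ U, σ (σ x) = x) {w : E → ℂ} (hw : ContDiffOn ℝ ∞ w U) {ψ : E → ℂ}
    (hψ : ContDiff ℝ ∞ ψ) (hs : HasCompactSupport ψ) (hψU : tsupport ψ ⊆ U) :
    ContDiff ℝ ∞ (fun x => w x * ψ (σ x)) ∧ HasCompactSupport (fun x => w x * ψ (σ x)) ∧
      tsupport (fun x => w x * ψ (σ x)) ⊆ U := by
  have hK : IsCompact (σ '' tsupport ψ) := hs.isCompact.image_of_continuousOn (hσ.continuousOn.mono hψU)
  have hKU : σ '' tsupport ψ ⊆ U := by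
    rintro _ ⟨x, hx, rfl⟩
    exact (hσU x).2 (hψU hx)
  have h0 : ∀ x, x ∉ σ '' tsupport ψ → w x * ψ (σ x) = 0 := fun x hx => by
    rw [image_eq_zero_of_notMem_tsupport fun h => hx ⟨σ x, h, hσσ x ((hσU x).1 (hψU h))⟩, mul_zero]
  refine ⟨contDiff_iff_contDiffAt.2 fun x => ?_, .intro hK h0,
    (closure_minimal (fun x (hx : _ ≠ _) => by_contra fun h => hx (h0 x h)) hK.isClosed).trans hKU⟩
  by_cases hx : x ∈ U
  · have := hU.mem_nhds hx
    exact (hw.contDiffAt this).mul (hψ.contDiffAt.comp x (hσ.contDiffAt this))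
  · exact (contDiffAt_const (c := (0 : ℂ))).congr_of_eventuallyEq (Filter.eventually_of_mem
      (hK.isClosed.isOpen_compl.mem_nhds fun h => hx (hKU h)) h0)

end Involution

section Unsymp
variable {n : ℕ}

lemma isOpen_inner_ne_zero (n : ℕ) : IsOpen {p : Eu² n | ⟪p.1, p.2⟫ ≠ 0} :=
  isOpen_ne_fun (by fun_prop) continuous_const

/-- The inverse image of a Schwartz function under `sympF`. -/
def unsymp (F : 𝓢(Eu² n, ℂ)) : 𝓢(Eu² n, ℂ) :=
  SchwartzMap.compCLMOfContinuousLinearEquiv ℂ (ContinuousLinearEquiv.prodComm ℝ (Eu n) (Eu n)) (sympS n F)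

lemma unsymp_apply (F : 𝓢(Eu² n, ℂ)) (q : Eu² n) :
    unsymp F q = ∫ p, sympChar p q * F p := by
  refine (sympS_apply F q.swap).trans (integral_ext fun p => ?_)
  simp only [sympChar, Prod.fst_swap, Prod.snd_swap]
  rw [real_inner_comm q.1, real_inner_comm q.2]

lemma sympF_unsymp (F : 𝓢(Eu² n, ℂ)) : sympF n ((unsymp F).toLp 2) = F.toLp 2 := by
  rw [← LinearIsometryEquiv.eq_symm_apply]
  have h1 := F.coeFn_toLp 2 volume
  refine Lp.ext (((unsymp F).coeFn_toLp 2 volume).trans (.trans (.of_forall fun q => ?_)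
    (sympF_symm_ae_eq _ (F.integrable.congr h1.symm)).symm))
  rw [unsymp_apply]
  refine integral_ext_ae h1 fun p hp => ?_
  rw [hp]

lemma sympI_unsymp (F : 𝓢(Eu² n, ℂ)) : sympI (unsymp F) = F := by
  have h1 := (unsymp F).coeFn_toLp 2 volume
  have h2 := sympF_ae_eq _ ((unsymp F).integrable.congr h1.symm)
  rw [sympF_unsymp] at h2
  refine ((continuous_sympI (unsymp F).integrable).ae_eq_iff_eq volume F.continuous).1 ?_
  filter_upwards [h2, F.coeFn_toLp 2 volume] with p hp hp'
  rw [← hp', hp]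
  refine integral_ext_ae h1 fun q hq => ?_
  rw [hq]

end Unsymp

section Inversion
variable {m : ℕ}

lemma isWeightedL2_of_hasCompactSupport {F : Chart m → ℂ} (hF : Continuous F)
    (hs : HasCompactSupport F) (hU : tsupport F ⊆ {p | ⟪p.1, p.2⟫ ≠ 0}) : IsWeightedL2 F := by
  have key : ∀ e : ℝ, ∫⁻ p, ‖F p‖ₑ ^ 2 * ‖⟪p.1, p.2⟫‖ₑ ^ e ≠ ⊤ := fun e => by
    have hc : ContinuousOn (fun p : Chart m => ‖F p‖ ^ 2 * |⟪p.1, p.2⟫| ^ e) (tsupport F) :=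
      (by fun_prop : Continuous fun p => ‖F p‖ ^ 2).continuousOn.mul
        ((by fun_prop : Continuous fun p : Chart m => |⟪p.1, p.2⟫|).continuousOn.rpow_const
          fun p hp => Or.inl (abs_ne_zero.2 (hU hp)))
    have hi := (hc.integrableOn_compact (μ := volume) hs.isCompact).2
    rw [hasFiniteIntegral_iff_enorm] at hi
    refine ne_of_lt (lt_of_le_of_lt (le_of_eq ?_) hi)
    rw [← setLIntegral_eq_of_support_subset (s := tsupport F)]
    · refine setLIntegral_congr_fun (isClosed_tsupport F).measurableSet fun p hp => ?_
      rw [enorm_mul, enorm_pow, enorm_norm, ← ofReal_norm (|_| ^ e), norm_of_nonneg (by positivity),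
        ← ofReal_rpow_of_pos (abs_pos.2 (hU hp)), ← norm_eq_abs, ofReal_norm]
    · intro p hp
      by_contra h
      exact hp (by simp [image_eq_zero_of_notMem_tsupport h])
  exact ⟨hF.measurable, key _, key _⟩

/-- The involution that `𝓚` becomes under the symplectic Fourier transformation. -/
def rayInvert (F : Chart m → ℂ) (p : Chart m) : ℂ :=
  (((|⟪p.1, p.2⟫| ^ (m + 1))⁻¹ : ℝ) : ℂ) * F (p.1, (⟪p.1, p.2⟫ ^ 2)⁻¹ • p.2)

lemma inner_rayInvert (p : Chart m) : ⟪p.1, (⟪p.1, p.2⟫ ^ 2)⁻¹ • p.2⟫ = (⟪p.1, p.2⟫)⁻¹ := by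
  rw [inner_smul_right, sq, mul_inv, mul_assoc]
  rcases eq_or_ne ⟪p.1, p.2⟫ 0 with h | h
  · simp [h]
  · rw [inv_mul_cancel₀ h, mul_one]

lemma contDiffOn_abs_inner_pow (k N : ℕ) : ContDiffOn ℝ ∞
    (fun z : Eu² k => (((|⟪z.1, z.2⟫| ^ N)⁻¹ : ℝ) : ℂ)) {p | ⟪p.1, p.2⟫ ≠ 0} := by
  refine ofRealCLM.contDiff.comp_contDiffOn (ContDiffOn.inv (fun p hp => ?_) fun p hp => ?_)
  · exact ((contDiffAt_abs hp).comp p (contDiff_fst.inner ℝ contDiff_snd).contDiffAt).pow _ |>.contDiffWithinAt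
  · exact pow_ne_zero _ (abs_ne_zero.2 hp)

lemma rayInvert_test {F : Chart m → ℂ} (hF : ContDiff ℝ ∞ F) (hs : HasCompactSupport F)
    (hU : tsupport F ⊆ {p | ⟪p.1, p.2⟫ ≠ 0}) : ContDiff ℝ ∞ (rayInvert F) ∧
      HasCompactSupport (rayInvert F) ∧ tsupport (rayInvert F) ⊆ {p | ⟪p.1, p.2⟫ ≠ 0} := by
  have hi : ContDiff ℝ ∞ fun p : Chart m => ⟪p.1, p.2⟫ := contDiff_fst.inner ℝ contDiff_snd
  refine contDiff_mul_comp_involution (isOpen_inner_ne_zero _)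
    (σ := fun p => (p.1, (⟪p.1, p.2⟫ ^ 2)⁻¹ • p.2)) ?_ (fun p => ?_) (fun p hp => ?_)
    (contDiffOn_abs_inner_pow _ _) hF hs hU
  · exact contDiff_fst.contDiffOn.prodMk (((hi.pow 2).contDiffOn.inv fun p hp => pow_ne_zero 2 hp).smul
      contDiff_snd.contDiffOn)
  · simp only [Set.mem_ofPred_eq, inner_rayInvert, ne_eq, inv_eq_zero]
  · have hp' : ⟪p.1, p.2⟫ ≠ 0 := hp
    simp only [inner_rayInvert, smul_smul]
    ext1
    · rfl
    · simp [hp']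

lemma kOp_unsymp {F F' : 𝓢(Chart m, ℂ)} (h : ∀ p, F' p = rayInvert F p) :
    kOp m ((unsymp F).toLp 2) = (unsymp F').toLp 2 := by
  refine (spectralU m).injective ?_
  rw [spectralU_kOp, spectralU_apply, spectralU_apply, ← partialF_reflect, sympF_unsymp, sympF_unsymp]
  congr 1
  refine Lp.ext ((reflectU_coe (rayU_coe (F.coeFn_toLp 2 volume))).trans (.trans ?_
    (rayU_coe (F'.coeFn_toLp 2 volume)).symm))
  filter_upwards [ae_prod_fst (ae_rayDen_ne_zero (m := m))] with r hr
  have hq : |boolSign r.1.2 * exp r.2| = exp r.2 := by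
    cases r.1.2 <;> simp [abs_exp]
  have e1 : exp ((m + 1 : ℕ) * -r.2 / 2) = exp ((m + 1 : ℕ) * r.2 / 2) * (exp r.2 ^ (m + 1))⁻¹ := by
    rw [← exp_nat_mul, ← exp_neg, ← exp_add]; ring_nf
  have e2 : rayPoint (r.1, -r.2) = ((rayPoint r).1, ((boolSign r.1.2 * exp r.2) ^ 2)⁻¹ • (rayPoint r).2) := by
    simp only [rayPoint, smul_smul]
    congr 2
    rw [← sq_abs, hq, exp_neg]
    field_simp
  rw [h, rayInvert, inner_rayPoint hr, hq, ← e2, e1]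
  push_cast; ring

/-- The test functions on the set where `⟨ζ, z⟩ ≠ 0`. -/
abbrev ConeTest (m : ℕ) : Type := {F : Chart m → ℂ //
    (HasCompactSupport F ∧ ContDiff ℝ ∞ F) ∧ tsupport F ⊆ {p | ⟪p.1, p.2⟫ ≠ 0}}

/-- The Schwartz function of which `F` is the symplectic Fourier transform. -/
def ConeTest.vec (F : ConeTest m) : 𝓢(Chart m, ℂ) := unsymp (F.2.1.1.toSchwartzMap F.2.1.2)

lemma ConeTest.total : TotalFam fun F : ConeTest m => (F.vec.toLp 2 : L2Sigma (m + 1)) := fun G h => by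
  rw [← (sympF (m + 1)).map_eq_zero_iff, Lp.eq_zero_iff_ae_eq_zero]
  have := (isOpen_inner_ne_zero (m + 1)).ae_eq_zero_of_integral_contDiff_smul_eq_zero (μ := volume)
    (f := sympF (m + 1) G) (((Lp.memLp _).locallyIntegrable (by norm_num)).locallyIntegrableOn _)
    fun g hg hs hgU => ?_
  · filter_upwards [this, ae_inner_ne_zero] with p h1 h2
    exact h1 h2
  · have hs' : HasCompactSupport fun p => (g p : ℂ) := hs.comp_left ofReal_zero
    have hg' : ContDiff ℝ ∞ fun p => (g p : ℂ) := ofRealCLM.contDiff.comp hg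
    have h := h ⟨_, ⟨hs', hg'⟩, (tsupport_comp_subset ofReal_zero g).trans hgU⟩
    change inner ℂ ((unsymp _).toLp 2) G = 0 at h
    rw [← (sympF (m + 1)).inner_map_map, sympF_unsymp,
      inner_eq_integral ((hs'.toSchwartzMap hg').coeFn_toLp 2 volume) (.refl _ _)] at h
    refine .trans (integral_ext fun p => ?_) h
    change _ = _ * conj (g p : ℂ)
    rw [conj_ofReal, real_smul, mul_comm]

end Inversion

/-! ### Invariance under `ℝˣ` -/

section Scale
variable {m : ℕ} {u : Chart m → ℂ}

lemma enorm_truncKer_exp_sub_le (a b : ℝ) {L c : ℝ} (hc : 0 ≤ c) (hL : c ≤ L) :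
    ‖truncKer L (exp c * a) ((exp c)⁻¹ * b) - truncKer L a b‖ₑ ≤
      ofReal (exp (-((L - c) / 16))) * kerBound a b := by
  have e0 : truncKer L (exp c * a) ((exp c)⁻¹ * b) = ∫ s in (-(L + c))..(L - c), oscPair a b s := by
    rw [neg_add', ← intervalIntegral.integral_comp_sub_right]
    refine intervalIntegral.integral_congr fun s _ => ?_
    simp only [oscPair, osc_eq_chr, ← exp_neg]
    have h1 : exp (-(s - c)) = exp c * exp (-s) := by rw [← exp_add]; ring_nf
    have h2 : exp (s - c) = exp (-c) * exp s := by rw [← exp_add]; ring_nf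
    rw [h1, h2]; ring_nf
  rw [e0]
  exact enorm_integral_osc_sub_le a b (sub_nonneg.2 hL) (by linarith) le_rfl (by linarith)
    (by linarith)

lemma argA_scaleAct (t : ℝ) (p : Phase m) (q : Chart m) :
    argA (scaleAct t p) q = t * argA p q := by simp [argA, scaleAct, inner_smul_left]

lemma argB_scaleAct (t : ℝ) (p : Phase m) (q : Chart m) :
    argB (scaleAct t p) q = t⁻¹ * argB p q := by simp [argB, scaleAct, inner_smul_right]

lemma scaleAct_mem_regularSet {t : ℝ} (ht : t ≠ 0) {p : Phase m}
    (hp : p ∈ regularSet (m + 1)) : scaleAct t p ∈ regularSet (m + 1) :=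
  ⟨smul_ne_zero ht hp.1, smul_ne_zero (inv_ne_zero ht) hp.2⟩

lemma thetaLim_scaleAct_exp (hu : IsChartDecaying u) {c : ℝ} (hc : 0 ≤ c) {p : Phase m}
    (hp : p ∈ regularSet (m + 1)) : thetaLim u (scaleAct (exp c) p) = thetaLim u p := by
  have hp' := scaleAct_mem_regularSet (exp_ne_zero c) hp
  have h := (tendsto_truncTheta hu.integrable hu.measurable (kerIntegral_ne_top hu hp')).sub
    (tendsto_truncTheta hu.integrable hu.measurable (kerIntegral_ne_top hu hp))
  refine sub_eq_zero.1 (tendsto_nhds_unique h (tendsto_zero_iff_enorm_tendsto_zero.2 ?_))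
  have hb : Tendsto (fun L : ℕ => ofReal (exp (-((L - c) / 16))) * kerIntegral u p) atTop (𝓝 0) := by
    have : Tendsto (fun L : ℕ => ofReal (exp (-((L - c) / 16)))) atTop (𝓝 0) := by
      rw [← ENNReal.ofReal_zero]
      refine tendsto_ofReal (Real.tendsto_exp_neg_atTop_nhds_zero.comp ?_)
      exact (tendsto_atTop_add_const_right _ (-c) tendsto_natCast_atTop_atTop).atTop_div_const (by norm_num)
    simpa using ENNReal.Tendsto.mul_const this (Or.inr (kerIntegral_ne_top hu hp))
  refine tendsto_of_tendsto_of_tendsto_of_le_of_le' tendsto_const_nhds hb (.of_forall fun _ => zero_le) ?_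
  filter_upwards [tendsto_natCast_atTop_atTop.eventually_ge_atTop c] with L hL
  rw [truncTheta, truncTheta, ← integral_sub (integrable_mul_truncKer hu.integrable L _)
    (integrable_mul_truncKer hu.integrable L p)]
  refine (enorm_integral_le_lintegral_enorm _).trans ?_
  rw [kerIntegral, ← lintegral_const_mul' _ _ ofReal_ne_top]
  refine lintegral_mono fun q => ?_
  simp only [argA_scaleAct, argB_scaleAct]
  rw [← mul_sub, enorm_mul, mul_left_comm]
  exact mul_le_mul_right (enorm_truncKer_exp_sub_le _ _ hc hL) _

/-- The functions `𝓕_symp (Φ̃ dm)` are invariant under the action of `ℝˣ`. -/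
theorem thetaLim_scaleAct (hu : IsChartDecaying u) {t : ℝ} (ht : t ≠ 0) {p : Phase m}
    (hp : p ∈ regularSet (m + 1)) : thetaLim u (scaleAct t p) = thetaLim u p := by
  have hpos : ∀ {t : ℝ}, 0 < t → ∀ {p}, p ∈ regularSet (m + 1) → thetaLim u (scaleAct t p) = thetaLim u p := by
    intro t ht p hp
    rcases le_total 0 (log t) with h | h
    · have := thetaLim_scaleAct_exp hu h hp
      rwa [exp_log ht] at this
    · have := thetaLim_scaleAct_exp hu (neg_nonneg.2 h) (scaleAct_mem_regularSet ht.ne' hp)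
      rwa [exp_neg, exp_log ht, scaleAct_scaleAct, inv_mul_cancel₀ ht.ne',
        show scaleAct 1 p = p by simp [scaleAct], eq_comm] at this
  rcases lt_or_gt_of_ne ht with h | h
  · rw [← hpos (neg_pos.2 h) hp]
    simp only [thetaLim, truncTheta, argA_scaleAct, argB_scaleAct, inv_neg, neg_mul]
    congr 1
    funext L
    refine integral_ext fun q => ?_
    simp only [truncKer, neg_neg, add_comm]
  · exact hpos h hp

end Scale

/-! ### The reflection and the slices -/

section InvLink
variable {m : ℕ} {f F : Chart m → ℂ}

lemma integrable_oscPair_mul_scaledF (hf : IsWeightedL2 f) (hF : IsWeightedL2 F) (h : ℝ) :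
    Integrable (fun r : ℝ × Chart m =>
      oscPair (h * ⟪r.2.1, r.2.2⟫) 1 r.1 * (f r.2 * scaledF F r.1 r.2)) (volume.prod volume) :=
  (integrable_mul_scaledF hf hF).bdd_mul (c := 2) (Measurable.aestronglyMeasurable (by fun_prop))
    (.of_forall fun _ => norm_oscPair_le _ _ _)

lemma oscPair_eq (a b s : ℝ) : oscPair a b s =
    chr (a * exp (-s) - b * exp s) + chr (-(a * exp (-s) - b * exp s)) := by
  rw [oscPair, osc_eq_chr, osc_eq_chr]; ring_nf

lemma chr_pair_congr {x y : ℝ} (h : |x| = |y|) : chr x + chr (-x) = chr y + chr (-y) := by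
  rcases abs_eq_abs.1 h with rfl | rfl
  · rfl
  · rw [neg_neg, add_comm]

lemma exp_neg_nat_mul (k : ℕ) (t : ℝ) : exp (-(k * t)) = (exp t ^ k)⁻¹ := by rw [exp_neg, exp_nat_mul]

lemma exp_neg_two_mul (t : ℝ) : exp (-(2 * t)) = (exp t ^ 2)⁻¹ := by
  rw [← exp_neg_nat_mul]; norm_num

lemma linkIntegrand_rayInvert (h s : ℝ) {p : Chart m} (hp : ⟪p.1, p.2⟫ ≠ 0) :
    linkIntegrand h f (rayInvert F) (log |⟪p.1, p.2⟫| - s, p) =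
      oscPair (h * ⟪p.1, p.2⟫) 1 s * (f p * scaledF F s p) := by
  set η := ⟪p.1, p.2⟫ with hη
  have e1 : exp (log |η| - s) = |η| / exp s := by rw [Real.exp_sub, exp_log (abs_pos.2 hp)]
  have hs := exp_ne_zero s
  have ho : oscPair η h (log |η| - s) = oscPair (h * η) 1 s := by
    rw [oscPair_eq, oscPair_eq, exp_neg, exp_neg, e1]
    refine chr_pair_congr ?_
    rcases abs_choice η with h' | h' <;> rw [h'] <;> field_simp
    · rw [← abs_neg]; congr 1; ring
    · congr 1; ring
  have hi : ⟪p.1, -((|η| / exp s) ^ 2)⁻¹ • p.2⟫ = -(η⁻¹ * exp s ^ 2) := by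
    rw [inner_smul_right, ← hη, div_pow, sq_abs]; field_simp
  simp only [linkIntegrand, ← hη, ho, mul_assoc]
  congr 2
  simp only [scaledF, rayInvert, exp_neg_nat_mul, exp_neg_two_mul, e1, hi, smul_smul]
  rw [← mul_assoc, ← Complex.ofReal_mul]
  congr 3
  · rw [abs_neg, abs_mul, abs_inv, abs_pow, abs_exp]
    have := abs_pos.2 hp
    field_simp
    rw [← mul_pow]; congr 1; field_simp
  · congr 1
    rw [div_pow, sq_abs]; field_simp

lemma integral_linkIntegrand_rayInvert (hf : IsWeightedL2 f) (hF : IsWeightedL2 F)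
    (hF' : IsWeightedL2 (rayInvert F)) (h : ℝ) :
    ∫ r, linkIntegrand h f (rayInvert F) r ∂(volume.prod volume) =
      ∫ r, oscPair (h * ⟪r.2.1, r.2.2⟫) 1 r.1 * (f r.2 * scaledF F r.1 r.2) ∂(volume.prod volume) := by
  rw [integral_prod_symm _ (integrable_linkIntegrand hf hF' h),
    integral_prod_symm _ (integrable_oscPair_mul_scaledF hf hF h)]
  refine integral_ext_ae ae_inner_ne_zero fun p hp => ?_
  rw [← integral_sub_left_eq_self _ _ (log |⟪p.1, p.2⟫|)]
  exact integral_congr_ae (.of_forall fun s => linkIntegrand_rayInvert h s hp)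

lemma integral_linkIntegrand_dilate (hf : IsWeightedL2 f) (hF : IsWeightedL2 F) {h : ℝ} (hh : h ≠ 0)
    (hf' : IsWeightedL2 fun p : Chart m => f (p.1, (h ^ 2)⁻¹ • p.2)) :
    ∫ r, linkIntegrand h⁻¹ (fun p => f (p.1, (h ^ 2)⁻¹ • p.2)) F r ∂(volume.prod volume) =
      ((|h| ^ (m + 1) : ℝ) : ℂ) * ∫ r, oscPair (h * ⟪r.2.1, r.2.2⟫) 1 r.1 *
        (f r.2 * scaledF F r.1 r.2) ∂(volume.prod volume) := by
  have i1 := integrable_linkIntegrand hf' hF h⁻¹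
  have h0 : 0 < |h| := abs_pos.2 hh
  rw [integral_prod _ i1, integral_prod _ (integrable_oscPair_mul_scaledF hf hF h), ← integral_const_mul,
    ← integral_add_right_eq_self _ (log |h|)]
  refine integral_ext fun s => ?_
  have hm : Measurable fun p => linkIntegrand h⁻¹ (fun p => f (p.1, (h ^ 2)⁻¹ • p.2)) F (s + log |h|, p) := by
    have := hf'.measurable
    have := (measurable_scaledF hF.measurable).comp (measurable_prodMk_left (x := s + log |h|))
    exact (Measurable.mul (by fun_prop) hf'.measurable).mul this
  simp only
  rw [integral_comp_dilate (pow_ne_zero 2 hh) hm.aestronglyMeasurable, ← integral_const_mul]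
  refine integral_ext fun p => ?_
  have e1 : exp (s + log |h|) = |h| * exp s := by rw [exp_add, exp_log h0, mul_comm]
  have hs := exp_ne_zero s
  have ho : oscPair (h ^ 2 * ⟪p.1, p.2⟫) h⁻¹ (s + log |h|) = oscPair (h * ⟪p.1, p.2⟫) 1 s := by
    rw [oscPair_eq, oscPair_eq, exp_neg, exp_neg, e1]
    refine chr_pair_congr ?_
    rcases abs_choice h with h' | h' <;> rw [h'] <;> field_simp
    rw [← abs_neg]
    congr 1; ring
  simp only [linkIntegrand, scaledF, inner_smul_right, ho, exp_neg_nat_mul, exp_neg_two_mul, e1, smul_smul]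
  rw [inv_mul_cancel₀ (pow_ne_zero 2 hh), one_smul, show -((|h| * exp s) ^ 2)⁻¹ * h ^ 2 =
    -(exp s ^ 2)⁻¹ by rw [mul_pow, sq_abs]; field_simp, abs_pow]
  have hp : ((|h| : ℝ) : ℂ) ≠ 0 := ofReal_ne_zero.2 h0.ne'
  push_cast
  field_simp
  ring

end InvLink

/-! ### The reflection becomes the inversion -/

section InvTheta
variable {m : ℕ} {u : Chart m → ℂ}

lemma offCone_mem_regularSet {h : ℝ} (hh : h ≠ 0) (p : Chart m) :
    offCone h p ∈ regularSet (m + 1) := by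
  have hi : ⟪(offCone h p).1, (offCone h p).2⟫ = h := by rw [offCone, inner_joinLast]; ring
  constructor <;> intro h0 <;> simp [h0] at hi <;> exact hh hi.symm

lemma continuous_thetaLim_offCone (hu : IsChartDecaying u) {h : ℝ} (hh : h ≠ 0) :
    Continuous fun p => thetaLim u (offCone h p) :=
  (continuousOn_thetaLim hu).comp_continuous (continuous_offCone h) (offCone_mem_regularSet hh)

/-- The dilated function `v ↦ b (c • v)`. -/
def schwartzDilate {n : ℕ} {c : ℝ} (hc : c ≠ 0) (b : 𝓢(Eu n, ℂ)) : 𝓢(Eu n, ℂ) :=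
  SchwartzMap.compCLMOfContinuousLinearEquiv ℂ (ContinuousLinearEquiv.smulLeft (Units.mk0 c hc)) b

lemma fourier_schwartzDilate {n : ℕ} {c : ℝ} (hc : c ≠ 0) (b : 𝓢(Eu n, ℂ)) (z : Eu n) :
    𝓕 (schwartzDilate hc b) z = (((|c| ^ n)⁻¹ : ℝ) : ℂ) * 𝓕 b (c⁻¹ • z) := by
  rw [SchwartzMap.fourier_coe, SchwartzMap.fourier_coe, fourier_eq', fourier_eq']
  have h := Measure.integral_comp_smul (volume : Measure (Eu n))
    (fun v => cexp (↑(-2 * π * ⟪v, c⁻¹ • z⟫) * I) • b v) c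
  rw [finrank_euclideanSpace_fin, abs_inv, abs_pow, real_smul] at h
  rw [← h]
  refine integral_ext fun v => ?_
  simp only [inner_smul_left, inner_smul_right, conj_trivial]
  rw [inv_mul_cancel_left₀ hc]
  rfl

lemma ConeTest.sympI_vec (F : ConeTest m) : sympI F.vec = F.1 := sympI_unsymp _

lemma ConeTest.isWeightedL2 (F : ConeTest m) : IsWeightedL2 F.1 :=
  isWeightedL2_of_hasCompactSupport F.2.1.2.continuous F.2.1.1 F.2.2

lemma integral_thetaLim_dilate (F : ConeTest m) {h : ℝ} (hh : h ≠ 0) (a b : 𝓢(Eu (m + 1), ℂ)) :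
    ∫ p : Chart m, thetaLim F.vec (offCone h⁻¹ (p.1, (h ^ 2)⁻¹ • p.2)) * (a p.1 * b p.2) =
      ((|h| ^ (m + 1) : ℝ) : ℂ) * ∫ r, oscPair (h * ⟪r.2.1, r.2.2⟫) 1 r.1 *
        (𝓕⁻ a r.2.1 * 𝓕 b r.2.2 * scaledF F.1 r.1 r.2) ∂(volume.prod volume) := by
  have h2 := pow_ne_zero 2 hh
  have hu := (isRapid_schwartz F.vec).isChartDecaying
  have hc := continuous_thetaLim_offCone hu (inv_ne_zero hh)
  have hc' : Continuous fun p : Chart m => thetaLim F.vec (offCone h⁻¹ (p.1, (h ^ 2)⁻¹ • p.2)) :=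
    hc.comp (f := fun p : Chart m => (p.1, (h ^ 2)⁻¹ • p.2)) (by fun_prop)
  rw [integral_comp_dilate h2 (Continuous.aestronglyMeasurable (by fun_prop))]
  have e := integral_thetaLim_offCone (isRapid_schwartz F.vec) (F.sympI_vec ▸ F.isWeightedL2) a
    (schwartzDilate h2 b) h⁻¹
  rw [F.sympI_vec] at e
  have e' := integral_linkIntegrand_dilate (isWeightedL2_tensor (𝓕⁻ a) (𝓕 b)) F.isWeightedL2 hh
    (isWeightedL2_tensor (𝓕⁻ a) (schwartzDilate (inv_ne_zero h2) (𝓕 b)))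
  rw [← e', integral_const_mul]
  simp only [inv_smul_smul₀ h2]
  refine (congrArg _ e).trans ?_
  rw [← integral_const_mul]
  refine integral_ext fun r => ?_
  simp only [linkIntegrand, fourier_schwartzDilate]
  have hp : (((|h ^ 2| ^ (m + 1) : ℝ)) : ℂ) ≠ 0 := ofReal_ne_zero.2 (by positivity)
  rw [Complex.ofReal_inv]
  field_simp

lemma thetaLim_offCone_eq {F F' : ConeTest m} (hF : F'.1 = rayInvert F.1) {h : ℝ} (hh : h ≠ 0)
    (p : Chart m) : thetaLim F'.vec (offCone h p) =
      (((|h| ^ (m + 1))⁻¹ : ℝ) : ℂ) * thetaLim F.vec (offCone h⁻¹ (p.1, (h ^ 2)⁻¹ • p.2)) := by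
  have hu := (isRapid_schwartz F.vec).isChartDecaying
  have hu' := (isRapid_schwartz F'.vec).isChartDecaying
  have c1 := continuous_thetaLim_offCone hu' hh
  set G : Chart m → ℂ := fun p => (((|h| ^ (m + 1))⁻¹ : ℝ) : ℂ) *
    thetaLim F.vec (offCone h⁻¹ (p.1, (h ^ 2)⁻¹ • p.2)) with hG
  have c2 : Continuous G := continuous_const.mul ((continuous_thetaLim_offCone hu (inv_ne_zero hh)).comp
    (f := fun p : Chart m => (p.1, (h ^ 2)⁻¹ • p.2)) (by fun_prop))
  have key := ae_eq_zero_of_tensor_test (E := Eu (m + 1)) (E' := Eu (m + 1))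
    (R := fun p => thetaLim F'.vec (offCone h p) - G p) (fun K => memLp_restrict_of_continuous (c1.sub c2)) fun c d hc hcs hd hds => ?_
  · have := ((c1.sub c2).ae_eq_iff_eq volume continuous_const).1 key
    exact sub_eq_zero.1 (congrFun this p)
  · have hi {T : Chart m → ℂ} (hT : Continuous T) := integrable_mul_tensor
      (fun K => memLp_restrict_of_continuous hT) hc.continuous hd.continuous hcs hds
    simp only [sub_mul]
    rw [integral_sub (hi c1) (hi c2), sub_eq_zero]
    simp only [hG, mul_assoc]
    rw [integral_const_mul]
    have e1 := integral_thetaLim_dilate F hh (schwartzOfReal hc hcs) (schwartzOfReal hd hds)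
    have e2 := integral_thetaLim_offCone (isRapid_schwartz F'.vec) (F'.sympI_vec ▸ F'.isWeightedL2)
      (schwartzOfReal hc hcs) (schwartzOfReal hd hds) h
    have hw := F'.isWeightedL2
    rw [hF] at hw
    rw [F'.sympI_vec, hF, integral_linkIntegrand_rayInvert (isWeightedL2_tensor (𝓕⁻ _) (𝓕 _))
      F.isWeightedL2 hw] at e2
    refine e2.trans (.trans ?_ (congrArg _ e1.symm))
    have hp : ((|h| ^ (m + 1) : ℝ) : ℂ) ≠ 0 := ofReal_ne_zero.2 (by positivity)
    rw [Complex.ofReal_inv, inv_mul_cancel_left₀ hp]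

/-- On the spectral side, `𝓚` is a reflection; on the functions `𝓕_symp (Φ̃ dm)`, it is the inversion. -/
theorem thetaLim_rayInvert {F F' : ConeTest m} (hF : F'.1 = rayInvert F.1) {z : Phase m}
    (hQ : ⟪z.1, z.2⟫ ≠ 0) (hz : lastCoord z.1 ≠ 0) :
    thetaLim F'.vec z = inversion (thetaLim F.vec) z := by
  have hu := (isRapid_schwartz F.vec).isChartDecaying
  have hu' := (isRapid_schwartz F'.vec).isChartDecaying
  set Q := ⟪z.1, z.2⟫ with hQd
  have e1 : thetaLim F'.vec z = thetaLim F'.vec (offCone Q (coneProj z)) := by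
    conv_lhs => rw [eq_scaleAct_offCone hz]
    exact thetaLim_scaleAct hu' hz (offCone_mem_regularSet hQ _)
  have hl : lastCoord (Q⁻¹ • z.1) = Q⁻¹ * lastCoord z.1 := rfl
  have hs : ∀ v : Eu (m + 2), starPart (Q⁻¹ • v) = Q⁻¹ • starPart v := fun _ => rfl
  have hz' : lastCoord (Q⁻¹ • z.1, Q⁻¹ • z.2).1 ≠ 0 := by
    rw [hl]; exact mul_ne_zero (inv_ne_zero hQ) hz
  have hi : ⟪Q⁻¹ • z.1, Q⁻¹ • z.2⟫ = Q⁻¹ := by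
    rw [inner_smul_left, inner_smul_right, ← hQd, conj_trivial, inv_mul_cancel₀ hQ, mul_one]
  have hp : coneProj (Q⁻¹ • z.1, Q⁻¹ • z.2) = ((coneProj z).1, (Q ^ 2)⁻¹ • (coneProj z).2) := by
    simp only [coneProj, hl, hs, smul_smul]
    congr 2 <;> field_simp
  have e2 : thetaLim F.vec (Q⁻¹ • z.1, Q⁻¹ • z.2) =
      thetaLim F.vec (offCone Q⁻¹ ((coneProj z).1, (Q ^ 2)⁻¹ • (coneProj z).2)) := by
    conv_lhs => rw [eq_scaleAct_offCone hz', hi, hp]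
    exact thetaLim_scaleAct hu hz' (offCone_mem_regularSet (inv_ne_zero hQ) _)
  rw [e1, thetaLim_offCone_eq hF hQ, inversion, ← hQd, e2]

end InvTheta

/-! ### The inversion of distributions -/

section Jacobian
variable {k : ℕ}

/-- The involution `z ↦ z / ⟨x, ξ⟩`. -/
def invMap (z : Eu² k) : Eu² k := (⟪z.1, z.2⟫)⁻¹ • z

lemma inner_invMap (z : Eu² k) : ⟪(invMap z).1, (invMap z).2⟫ = (⟪z.1, z.2⟫)⁻¹ := by
  simp only [invMap, Prod.smul_fst, Prod.smul_snd, inner_smul_left, inner_smul_right, conj_trivial]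
  rcases eq_or_ne ⟪z.1, z.2⟫ 0 with h | h
  · simp [h]
  · rw [inv_mul_cancel₀ h, mul_one]

lemma invMap_invMap {z : Eu² k} (hz : ⟪z.1, z.2⟫ ≠ 0) : invMap (invMap z) = z := by
  rw [invMap, inner_invMap, inv_inv, invMap, smul_inv_smul₀ hz]

/-- The derivative is `⟨x, ξ⟩⁻¹` times a reflection. -/
lemma exists_hasFDerivAt_invMap {z : Eu² k} (hz : ⟪z.1, z.2⟫ ≠ 0) :
    ∃ D : (Eu² k) →L[ℝ] (Eu² k), HasFDerivAt invMap D z ∧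
      |D.det| = (|⟪z.1, z.2⟫| ^ (2 * k))⁻¹ := by
  have hq : HasFDerivAt (fun z : Eu² k => ⟪z.1, z.2⟫) _ z :=
    (hasFDerivAt_fst (𝕜 := ℝ) (p := z)).inner ℝ hasFDerivAt_snd
  set l := (fderivInnerCLM ℝ (z.1, z.2)).comp ((ContinuousLinearMap.fst ℝ (Eu k) (Eu k)).prod
    (ContinuousLinearMap.snd ℝ (Eu k) (Eu k))) with hl
  have hlz : l z = 2 * ⟪z.1, z.2⟫ := by simp [hl, fderivInnerCLM_apply]; ring
  refine ⟨_, ((hasDerivAt_inv hz).comp_hasFDerivAt z hq).smul (hasFDerivAt_id z), ?_⟩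
  rw [ContinuousLinearMap.det, show ((_ : (Eu² k) →L[ℝ] (Eu² k)) : (Eu² k) →ₗ[ℝ] (Eu² k)) =
    (⟪z.1, z.2⟫)⁻¹ • LinearMap.transvection (l : (Eu² k) →ₗ[ℝ] ℝ) (-(⟪z.1, z.2⟫)⁻¹ • z) from ?_,
    LinearMap.det_smul, LinearMap.transvection.det]
  · rw [map_smul, ContinuousLinearMap.coe_coe, hlz, Module.finrank_prod, finrank_euclideanSpace_fin, smul_eq_mul,
      show 1 + -(⟪z.1, z.2⟫)⁻¹ * (2 * ⟪z.1, z.2⟫) = -1 by field_simp; norm_num, abs_mul, abs_neg, abs_one,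
      mul_one, abs_pow, abs_inv, inv_pow, two_mul]
  · refine LinearMap.ext fun w => ?_
    simp [LinearMap.transvection, smul_smul, smul_add, sq]
    ring_nf

lemma integral_comp_invMap (f : Eu² k → ℂ) (hf : ∀ z, ⟪z.1, z.2⟫ = 0 → f z = 0) :
    ∫ z, f z = ∫ z, (((|⟪z.1, z.2⟫| ^ (2 * k))⁻¹ : ℝ) : ℂ) * f (invMap z) := by
  set U := {p : Eu² k | ⟪p.1, p.2⟫ ≠ 0}
  choose! D hD hdet using fun (z : Eu² k) (hz : ⟪z.1, z.2⟫ ≠ 0) => exists_hasFDerivAt_invMap hz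
  have himg : invMap '' U = U := by
    ext z
    constructor
    · rintro ⟨w, hw, rfl⟩
      change _ ≠ _
      rw [inner_invMap]
      exact inv_ne_zero hw
    · intro hz
      exact ⟨invMap z, by change _ ≠ _; rw [inner_invMap]; exact inv_ne_zero hz, invMap_invMap hz⟩
  have h := integral_image_eq_integral_abs_det_fderiv_smul (volume : Measure (Eu² k))
    (isOpen_inner_ne_zero k).measurableSet (fun z hz => (hD z hz).hasFDerivWithinAt)
    (fun z hz w hw e => by rw [← invMap_invMap hz, e, invMap_invMap hw]) f
  change ∫ z in invMap '' U, f z = _ at h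
  rw [himg, setIntegral_eq_integral_of_forall_compl_eq_zero (s := U) fun z hz => hf z (not_not.1 hz)] at h
  rw [h]
  refine Eq.trans (setIntegral_congr_fun (isOpen_inner_ne_zero k).measurableSet fun z hz => ?_)
    (setIntegral_eq_integral_of_forall_compl_eq_zero (s := U) fun z hz => ?_)
  · rw [hdet z hz, real_smul]
  · rw [hf (invMap z), mul_zero]
    rw [inner_invMap, not_not.1 hz, inv_zero]

end Jacobian

section InvDist
variable {m : ℕ} {ψ : 𝓢(Phase m, ℂ)}

/-- The transpose of the inversion. -/
def invTest (ψ : Phase m → ℂ) (z : Phase m) : ℂ :=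
  (((|⟪z.1, z.2⟫| ^ (m + 3))⁻¹ : ℝ) : ℂ) * ψ (invMap z)

lemma invTest_test {ψ : Phase m → ℂ} (hψ : ContDiff ℝ ∞ ψ) (hs : HasCompactSupport ψ)
    (hU : tsupport ψ ⊆ {p | ⟪p.1, p.2⟫ ≠ 0}) : ContDiff ℝ ∞ (invTest ψ) ∧
      HasCompactSupport (invTest ψ) ∧ tsupport (invTest ψ) ⊆ {p | ⟪p.1, p.2⟫ ≠ 0} := by
  refine contDiff_mul_comp_involution (isOpen_inner_ne_zero _) (σ := invMap) ?_ (fun p => ?_)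
    (fun p hp => invMap_invMap hp) (contDiffOn_abs_inner_pow _ _) hψ hs hU
  · exact ((contDiff_fst.inner ℝ contDiff_snd).contDiffOn.inv fun p hp => hp).smul contDiff_id.contDiffOn
  · change _ ≠ _ ↔ _ ≠ _
    rw [inner_invMap, ne_eq, inv_eq_zero]

lemma integral_inversion (g ψ : Phase m → ℂ) (hU : ∀ z, ⟪z.1, z.2⟫ = 0 → ψ z = 0) :
    ∫ z, inversion g z * ψ z = ∫ z, g z * invTest ψ z := by
  rw [integral_comp_invMap (fun z => g z * invTest ψ z) fun z hz => by
    rw [invTest, hU, mul_zero, mul_zero]; rw [inner_invMap, hz, inv_zero]]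
  refine integral_ext fun z => ?_
  simp only [invTest, inner_invMap, inversion]
  rcases eq_or_ne ⟪z.1, z.2⟫ 0 with h | h
  · rw [hU z h, hU (invMap (invMap z)), mul_zero, mul_zero, mul_zero, mul_zero]
    rw [inner_invMap, inner_invMap, h, inv_zero, inv_zero]
  · rw [invMap_invMap h]
    have h0 : ((|⟪z.1, z.2⟫| : ℝ) : ℂ) ≠ 0 := ofReal_ne_zero.2 (abs_ne_zero.2 h)
    have key : ∀ x a b : ℂ, x ≠ 0 → (x ^ (m + 1))⁻¹ * a * b =
        (x ^ (2 * (m + 1 + 1)))⁻¹ * (a * (x ^ (m + 3) * b)) := fun x a b hx => by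
      field_simp; ring
    rw [show ((⟪z.1, z.2⟫)⁻¹ • z.1, (⟪z.1, z.2⟫)⁻¹ • z.2) = invMap z from rfl, abs_inv, inv_pow, inv_inv]
    push_cast
    exact key _ _ _ h0

lemma ae_lastCoord_ne_zero : ∀ᵐ z : Phase m, lastCoord z.1 ≠ 0 := by
  refine ae_prod_fst (p := fun y : Eu (m + 2) => lastCoord y ≠ 0) ?_
  have := Measure.addHaar_submodule (volume : Measure (Eu (m + 2)))
    (LinearMap.ker (EuclideanSpace.proj (Fin.last (m + 1)) : Eu (m + 2) →L[ℝ] ℝ).toLinearMap) fun h => ?_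
  · rw [ae_iff]
    simp only [not_not]
    exact this
  · have h1 : joinLast (0 : Eu (m + 1)) 1 ∈ (⊤ : Submodule ℝ (Eu (m + 2))) := trivial
    rw [← h] at h1
    simp at h1

lemma inner_ne_zero_subset_regularSet (n : ℕ) :
    {p : Eu (n + 1) × Eu (n + 1) | ⟪p.1, p.2⟫ ≠ 0} ⊆ regularSet n :=
  fun z hz => ⟨fun h => hz (by simp [h]), fun h => hz (by simp [h])⟩

lemma exists_invTest (hs : HasCompactSupport ψ) (hU : tsupport ψ ⊆ {p | ⟪p.1, p.2⟫ ≠ 0}) :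
    ∃ ψ' : 𝓢(Phase m, ℂ), (∀ z, ψ' z = invTest ψ z) ∧ HasCompactSupport ψ' ∧
      tsupport ψ' ⊆ regularSet (m + 1) := by
  obtain ⟨h1, h2, h3⟩ := invTest_test (ψ.smooth ⊤) hs hU
  exact ⟨h2.toSchwartzMap h1, fun _ => rfl, h2, h3.trans (inner_ne_zero_subset_regularSet _)⟩

lemma thetaDist_rayInvert {F F' : ConeTest m} (hF : F'.1 = rayInvert F.1) (hs : HasCompactSupport ψ)
    (hU : tsupport ψ ⊆ {p | ⟪p.1, p.2⟫ ≠ 0})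
    {ψ' : 𝓢(Phase m, ℂ)} (hψ' : ∀ z, ψ' z = invTest ψ z) (hs' : HasCompactSupport ψ')
    (hU' : tsupport ψ' ⊆ regularSet (m + 1)) : thetaDist F'.vec ψ = thetaDist F.vec ψ' := by
  have hu := isRapid_schwartz F.vec
  have hu' := isRapid_schwartz F'.vec
  have h0 : ∀ z, ⟪z.1, z.2⟫ = 0 → ψ z = 0 := fun z hz =>
    image_eq_zero_of_notMem_tsupport fun h => hU h hz
  rw [thetaEqOn_thetaLim hu'.isChartDecaying hu'.memLp ψ hs (hU.trans (inner_ne_zero_subset_regularSet _)),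
    thetaEqOn_thetaLim hu.isChartDecaying hu.memLp ψ' hs' hU']
  simp only [hψ']
  rw [← integral_inversion _ _ h0]
  refine integral_ext_ae ae_lastCoord_ne_zero fun z hz => ?_
  rcases eq_or_ne ⟪z.1, z.2⟫ 0 with h | h
  · rw [h0 z h, mul_zero, mul_zero]
  · rw [thetaLim_rayInvert hF h hz]

lemma thetaDist_kOp (hs : HasCompactSupport ψ) (hU : tsupport ψ ⊆ {p | ⟪p.1, p.2⟫ ≠ 0})
    {ψ' : 𝓢(Phase m, ℂ)} (hψ' : ∀ z, ψ' z = invTest ψ z) (hs' : HasCompactSupport ψ')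
    (hU' : tsupport ψ' ⊆ regularSet (m + 1)) (u : L2Sigma (m + 1)) :
    thetaDist (kOp m u) ψ = thetaDist u ψ' := by
  obtain ⟨T, hT⟩ := exists_thetaCLM ψ
  obtain ⟨T', hT'⟩ := exists_thetaCLM ψ'
  rw [← hT, ← hT']
  refine ConeTest.total.clm_ext (A := T.comp ((kOp m).toContinuousLinearEquiv : L2Sigma (m + 1) →L[ℂ] _))
    (B := T') (fun F => ?_) u
  obtain ⟨h1, h2, h3⟩ := rayInvert_test F.2.1.2 F.2.1.1 F.2.2
  have hk : kOp m (F.vec.toLp 2) = (ConeTest.vec ⟨rayInvert F.1, ⟨h2, h1⟩, h3⟩).toLp 2 := kOp_unsymp fun _ => rfl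
  change T (kOp m _) = _
  rw [hk, hT, hT', thetaDist_congr (SchwartzMap.coeFn_toLp _ 2 volume), thetaDist_congr (F.vec.coeFn_toLp 2 volume)]
  exact thetaDist_rayInvert rfl hs hU hψ' hs' hU'

theorem thetaEqOn_inversion {Φ : Phase m → ℂ} (hΦ : IsTestFunction Φ) {u : L2Sigma (m + 1)}
    (hu : u =ᵐ[volume] inCoords Φ) :
    ThetaEqOn (kOp m u) {z | ⟪z.1, z.2⟫ ≠ 0} (inversion (thetaFun (inCoords Φ))) := by
  intro ψ hs hU
  obtain ⟨ψ', h1, h2, h3⟩ := exists_invTest hs hU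
  rw [thetaDist_kOp hs hU h1 h2 h3, thetaDist_congr hu, hΦ.isThetaFun.2 ψ' h2 h3,
    integral_inversion _ _ fun z hz => image_eq_zero_of_notMem_tsupport fun h => hU h hz]
  simp only [h1]

end InvDist

theorem theorem3p1 (n : ℕ) (hn : 1 ≤ n) :
    -- for `Φ ∈ L²(Σ_n^•)`, the tempered distribution `Φ̃ dm` is well defined
    (∀ Φ : L2Sigma n, ∃ T : 𝓢(Eu (n + 1) × Eu (n + 1), ℂ) →L[ℂ] ℂ, ∀ φ,
      Integrable (fun z => tilde Φ z * φ z) (coneMeasure n) ∧ T φ = conePairing Φ φ) ∧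
    -- for a test function, `Φ ∈ L²` and `𝓕_symp (Φ̃ dm)` is a continuous function on
    -- `x ≠ 0, ξ ≠ 0`, so that it has a restriction to `Σ_n`
    (∀ Φ : Eu (n + 1) × Eu (n + 1) → ℂ, IsTestFunction Φ →
      MemLp (inCoords Φ) 2 volume ∧ IsThetaFun (inCoords Φ) (thetaFun (inCoords Φ))) ∧
    -- the test functions `Φ` with `𝓗 Φ ∈ L²` are dense
    Dense {u : L2Sigma n | ∃ Φ : Eu (n + 1) × Eu (n + 1) → ℂ, IsTestFunction Φ ∧
      u =ᵐ[volume] inCoords Φ ∧ MemLp (hFun (inCoords Φ)) 2 volume} ∧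
    -- `r` is self-adjoint
    IsSelfAdjoint (eulerOp n) ∧
    -- `𝓗` extends as an unbounded self-adjoint operator
    ∃ H : L2Sigma n →ₗ.[ℂ] L2Sigma n, IsSelfAdjoint H ∧ H.domain ≠ ⊤ ∧
      (∀ Φ : Eu (n + 1) × Eu (n + 1) → ℂ, IsTestFunction Φ →
        ∀ u : L2Sigma n, u =ᵐ[volume] inCoords Φ →
          (u ∈ H.domain ↔ MemLp (hFun (inCoords Φ)) 2 volume) ∧
          ∀ v : L2Sigma n, (u, v) ∈ H.graph → v =ᵐ[volume] hFun (inCoords Φ)) ∧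
      -- the formula for `𝓗² = 𝓗* 𝓗`
      opComp H H = opComp H.adjoint H ∧
      IsFunctionOf (eulerOp n) squareSymbol (opComp H H) ∧
      -- the operator `𝓚`, a unitary involution
      ∃ G : L2Sigma n →ₗ.[ℂ] L2Sigma n, IsFunctionOf (eulerOp n) normalizingSymbol G ∧
      ∃ K : L2Sigma n ≃ₗᵢ[ℂ] L2Sigma n,
        (∀ (δ : Fin 2) (u v : L2Sigma n), HasParity δ u → (u, v) ∈ H.graph →
          ∃ w : L2Sigma n, (v, w) ∈ G.graph ∧ K u = (-1 : ℂ) ^ (δ : ℕ) • w) ∧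
        (∀ u, K (K u) = u) ∧
        -- `𝓕_symp ((𝓚 Φ)~ dm) = Inv (𝓕_symp (Φ̃ dm))`
        (∀ Φ : Eu (n + 1) × Eu (n + 1) → ℂ, IsTestFunction Φ →
          ∀ u : L2Sigma n, u =ᵐ[volume] inCoords Φ →
            ThetaEqOn (K u) {z | ⟪z.1, z.2⟫ ≠ 0} (inversion (thetaFun (inCoords Φ)))) := by
  obtain ⟨m, rfl⟩ : ∃ m, n = m + 1 := ⟨n - 1, by omega⟩
  exact ⟨exists_tempered, fun Φ hΦ => ⟨hΦ.memLp, hΦ.isThetaFun⟩, dense_testFunctions, isSelfAdjoint_eulerOp,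
    hOp m, isSelfAdjoint_hOp, hOp_domain_ne_top, fun Φ hΦ u hu => hΦ.mem_hOp_domain_iff hu, opComp_hOp,
    isFunctionOf_hOp_sq, normOp m, isFunctionOf_normOp, kOp m, exists_normOp_of_parity, kOp_kOp,
    fun Φ hΦ u hu => thetaEqOn_inversion hΦ hu⟩

end
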